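/- Work in real projective 3-space $\mathbb{RP}^3$, and let $m\ge 2$. A *planar quadrilateral* is a quadruple of coplanar points, no three of them collinear. **SC-patches.** An SC-patch is a parametrized surface $f:[0,1]^2\to\mathbb{RP}^3$ (isolated singular points, lying on finitely many exceptional interior parameter lines, are allowed) that is the restriction of a smooth conjugate parametrization of a supercyclide by its characteristic conics: the parameter lines of each family are arcs of nondegenerate conics, and along each of them the tangents of the conjugate parameter lines are concurrent (they generate the cone enveloped by the tangent planes), the cone being nondegenerate along the boundary curves. Supercyclides are assumed to be generic: of degree four (not contained in a surface of smaller degree), with skew characteristic lines, where the characteristic lines are the axes of the two pencils of planes that carry the conics; opposite boundary curves lie in different planes. Two patches with a common boundary curve have the TCC-property if their tangency cones along that curve coincide. **SC-nets.** An $m$-dimensional SC-net $s=(x,f)$ consists of a map $x:\mathbb Z^m\to\mathbb{RP}^3$ for which all quadrilaterals $(x,x_i,x_{ij},x_j)$, $i\neq j$, are planar quadrilaterals, where indices denote unit shifts in the lattice, and of an SC-patch with these vertices for every elementary quadrilateral, such that all patches around an edge have the same boundary curve along this edge, and patches on edge-adjacent quadrilaterals of the same coordinate plane have the TCC-property. The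 tangents of the patches at a vertex $x(z)$ are then well-defined lines $t^i(z)$, $i=1,\dots,m$. **F-transforms.** Two SC-nets $s=(x,f)$, $s^+=(x^+,f^+)$ are F-transforms of each other if all $(x,x_i,x_i^+,x^+)$ are planar quadrilaterals and corresponding patches form classical F-pairs, i.e. for each parameter direction the tangents to the parameter lines in corresponding points are coplanar. **General position.** A pair $s,s^+$ of F-transforms is in general position if for all $i\ne j$, all $k$ and at all lattice points: $x^+\notin x\vee x_i\vee x_j$; none of the lines $t^i,t^i_k,t^{+i},t^{+i}_k$ lies in the plane of $(x,x_k,x_k^+,x^+)$; and $t^i,t^{+i}_k$ as well as $t^i_k,t^{+i}$ are skew. A net $s$ and two F-transforms $s^{(1)},s^{(2)}$ are in general position if both pairs $s,s^{(1)}$ and $s,s^{(2)}$ are, $x,x^{(1)},x^{(2)}$ span a plane $E^{12}(z)$ at each $z$, for every $i$ the points $x_i(z)=x(z+e_i)$ and $x(z)$ do not lie in $E^{12}(z)$ and $E^{12}(z+e_i)$ respectively, and no tangent $t^{(1)i}(z)$, $t^{(2)i}(z)$ lies in $E^{12}(z)$ (the planes $E^{ij}$ for other pairs of F-transforms are defined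 likewise). A net $s$ and three F-transforms are in general position if $s$ and any two of them are, and corresponding vertices of the four nets always span $\mathbb{RP}^3$. *Generic* points of a plane (or generic triples of points of three planes) are those at which none of countably many suitable polynomials in the homogeneous coordinates vanishes, no polynomial vanishing identically on the plane (on the product of the planes). **Theorem (Permutability properties of F-transformations of supercyclidic nets).** (i) Let $s=(x,f)$ be an $m$-dimensional SC-net and let $s^{(1)},s^{(2)}$ be two of its F-transforms, in general position. Then there is a 2-parameter family of SC-nets $s^{(12)}$ that are F-transforms of both $s^{(1)}$ and $s^{(2)}$, such that the corresponding vertices of $s,s^{(1)},s^{(12)},s^{(2)}$ form planar quadrilaterals: for every $z_0\in\mathbb Z^m$ and every generic point $p$ of the plane $E^{12}(z_0)$ there is such a net with $x^{(12)}(z_0)=p$ for which the pairs $s^{(1)},s^{(12)}$ and $s^{(2)},s^{(12)}$ are in general position. Such a net $s^{(12)}$ is uniquely determined by any one of its vertices: every common F-transform of $s^{(1)}$ and $s^{(2)}$ that satisfies the coplanarity condition and shares one vertex $x^{(12)}(z)$ with it, for some $z$, coincides with it, in its vertices and its (parametrized) patches. (ii) Let $s$ be an $m$-dimensional SC-net,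 and let $s^{(1)},s^{(2)},s^{(3)}$ be three of its F-transforms, in general position. Let $z_0\in\mathbb Z^m$. Let $s^{(12)},s^{(13)},s^{(23)}$ be SC-nets such that $s^{(ij)}$ is an F-transform of both $s^{(i)}$ and $s^{(j)}$, with corresponding vertices of $s,s^{(i)},s^{(ij)},s^{(j)}$ forming planar quadrilaterals. Then generically, i.e. if $(x^{(12)}(z_0),x^{(13)}(z_0),x^{(23)}(z_0))$ is a generic triple of points of $E^{12}(z_0)\times E^{13}(z_0)\times E^{23}(z_0)$, there is a unique SC-net $s^{(123)}$ that is an F-transform of $s^{(12)}$, $s^{(13)}$ and $s^{(23)}$ and for which, for every permutation $(ijk)$ of $(123)$, the corresponding vertices of $s^{(i)},s^{(ij)},s^{(123)},s^{(ik)}$ form planar quadrilaterals. Its vertices are fixed by the coplanarity conditions: at every $z\in\mathbb Z^m$ the point $x^{(123)}$ is the only common point of the planes $x^{(i)}\vee x^{(ij)}\vee x^{(ik)}$. -/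

import Mathlib

open scoped ContDiff

noncomputable section

namespace SCNet

/-! ### Real projective 3-space -/

/-- Homogeneous coordinates of real projective 3-space. -/
abbrev V : Type := Fin 4 → ℝ

/-- Points of real projective 3-space. Lines and planes are the submodules of `V` of rank 2 and 3;
the join of subspaces is `⊔`, their intersection is `⊓`. -/
abbrev RP3 : Type := Projectivization ℝ V

/-- `w` is a vector of homogeneous coordinates of the point `p`. -/
def Represents (p : RP3) (w : V) : Prop := p.submodule = Submodule.span ℝ {w}

/-- The subspace spanned by three points. -/
def join3 (a b c : RP3) : Submodule ℝ V := a.submodule ⊔ b.submodule ⊔ c.submodule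

/-- The four points are coplanar, and no three of them are collinear: a (nondegenerate) planar
quadrilateral. -/
structure PlanarQuad (a b c d : RP3) : Prop where
  planar : Module.finrank ℝ ↥(join3 a b c ⊔ d.submodule) = 3
  abc : Module.finrank ℝ ↥(join3 a b c) = 3
  abd : Module.finrank ℝ ↥(join3 a b d) = 3
  acd : Module.finrank ℝ ↥(join3 a c d) = 3
  bcd : Module.finrank ℝ ↥(join3 b c d) = 3

/-- Linear dependence of a finite list of vectors. -/
def Dep {n : ℕ} (w : Fin n → V) : Prop := ¬ LinearIndependent ℝ w

/-! ### Supercyclidic patches -/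

/-- Homogeneous coordinates of a parametrized surface `(u, v) ↦ [F u v]`. -/
abbrev Lift : Type := ℝ → ℝ → V

namespace Lift

/-- Partial derivative in the first parameter. -/
def du (F : Lift) : Lift := fun u v => deriv (fun s => F s v) u

/-- Partial derivative in the second parameter. -/
def dv (F : Lift) : Lift := fun u v => deriv (fun s => F u s) v

/-- The same surface with the two parameters exchanged. -/
def swap (F : Lift) : Lift := fun u v => F v u

/-- The span of the parameter line `u ↦ F u v`, `0 ≤ u ≤ 1`. -/
def lineSpan (F : Lift) (v : ℝ) : Submodule ℝ V :=
  Submodule.span ℝ ((fun u => F u v) '' Set.Icc 0 1)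

/-- The parameter line `u ↦ [F u v]`, `0 ≤ u ≤ 1`, as a set of points. -/
def arc (F : Lift) (v : ℝ) : Set RP3 := {p | ∃ u ∈ Set.Icc (0 : ℝ) 1, Represents p (F u v)}

/-- The tangent to the parameter line `u ↦ [F u 0]` at the vertex `[F 0 0]`. -/
def vertexTangent (F : Lift) : Submodule ℝ V := Submodule.span ℝ {F 0 0, F.du 0 0}

/-- Along the parameter line `u ↦ [F u v]`, `0 ≤ u ≤ 1`, all tangents of the conjugate parameter
lines (that is, the lines through `F u v` and `F.dv u v`) pass through the point `[a]`. -/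
def IsApex (F : Lift) (v : ℝ) (a : V) : Prop :=
  a ≠ 0 ∧ ∀ u ∈ Set.Icc (0 : ℝ) 1, Dep ![a, F u v, F.dv u v]

end Lift

/-- `u ↦ [c u]`, `0 ≤ u ≤ 1`, is an injective and immersed parametrization of an arc of a
nondegenerate conic. -/
structure IsConicArc (c : ℝ → V) : Prop where
  immersed : ∀ u ∈ Set.Icc (0 : ℝ) 1, LinearIndependent ℝ ![c u, deriv c u]
  injective : ∀ u ∈ Set.Icc (0 : ℝ) 1, ∀ u' ∈ Set.Icc (0 : ℝ) 1, u ≠ u' →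
    LinearIndependent ℝ ![c u, c u']
  conic : ∃ (E : Submodule ℝ V) (q : QuadraticForm ℝ V), Module.finrank ℝ E = 3 ∧
    (∀ w ∈ E, (∀ w' ∈ E, QuadraticMap.polar q w w' = 0) → w = 0) ∧
    ∀ u ∈ Set.Icc (0 : ℝ) 1, c u ∈ E ∧ q (c u) = 0

/-- The parameter lines `u ↦ [F u v]` are characteristic conics whose planes belong to the pencil
with axis `A`: the axis is contained in the planes, the lines are arcs of conics, and along each of
them the conjugate tangents are the generators of a cone, i.e. they are concurrent.

Isolated singular points of the surface are allowed: they show up as finitely many exceptional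
interior parameter lines, on which nothing is required. Along an interior conic the cone of tangent
planes may degenerate to a plane (as it does along the top circle of a torus); along the two
boundary curves it is a proper quadratic cone, i.e. its apex is not in the plane of the conic. The planes of the two boundary curves are distinct. -/
structure IsConicFamily (F : Lift) (A : Submodule ℝ V) : Prop where
  axis : Module.finrank ℝ A = 2
  lines : ∃ S : Set ℝ, S.Finite ∧ S ⊆ Set.Ioo 0 1 ∧ ∀ v ∈ Set.Icc (0 : ℝ) 1, v ∉ S →
    IsConicArc (fun u => F u v) ∧ A ≤ F.lineSpan v ∧ ∃ a, F.IsApex v a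
  boundary : ∀ v ∈ ({0, 1} : Set ℝ), ∃ a, F.IsApex v a ∧ a ∉ F.lineSpan v
  planes_ne : F.lineSpan 0 ≠ F.lineSpan 1

/-- `F` is a lift of an SC-patch: of the restriction to the square `[0,1] × [0,1]` of a smooth
conjugate parametrization of a generic supercyclide (skew characteristic lines, and degree four,
i.e. not contained in a surface of smaller degree) by its characteristic conics. -/
structure IsSCPatch (F : Lift) : Prop where
  smooth : ContDiff ℝ ∞ (fun p : ℝ × ℝ => F p.1 p.2)
  conjugate : ∀ u ∈ Set.Icc (0 : ℝ) 1, ∀ v ∈ Set.Icc (0 : ℝ) 1,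
    Dep ![F u v, F.du u v, F.dv u v, F.dv.du u v]
  conics : ∃ A₁ A₂ : Submodule ℝ V,
    IsConicFamily F A₁ ∧ IsConicFamily F.swap A₂ ∧ A₁ ⊓ A₂ = ⊥
  degree_four : ∀ p : MvPolynomial (Fin 4) ℝ, p.IsHomogeneous 3 →
    (∀ u ∈ Set.Icc (0 : ℝ) 1, ∀ v ∈ Set.Icc (0 : ℝ) 1, MvPolynomial.eval (F u v) p = 0) → p = 0

/-- Two lifts describe the same parametrized patch. -/
def SamePatch (F G : Lift) : Prop :=
  ∀ u ∈ Set.Icc (0 : ℝ) 1, ∀ v ∈ Set.Icc (0 : ℝ) 1, Dep ![F u v, G u v]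

/-- Two patches have the same tangency cone along the common boundary curve that is the line
`u = 1` of `F` and the line `u = 0` of `G`: the cones over the curve have the same apex. -/
def TCCJoin (F G : Lift) : Prop := ∃ a, F.swap.IsApex 1 a ∧ G.swap.IsApex 0 a

/-- Two conjugate parametrizations are classical fundamental transforms with respect to the first
parameter: in corresponding points the tangents to the first parameter lines are coplanar. -/
def ClassicalFPair (F G : Lift) : Prop :=
  ∀ u ∈ Set.Icc (0 : ℝ) 1, ∀ v ∈ Set.Icc (0 : ℝ) 1, Dep ![F u v, F.du u v, G u v, G.du u v]

/-! ### Supercyclidic nets -/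

/-- Vertices of the `m`-dimensional lattice. -/
abbrev Lattice (m : ℕ) : Type := Fin m → ℤ

/-- The `i`-th unit vector of the lattice. -/
def e {m : ℕ} (i : Fin m) : Lattice m := Pi.single i 1

end SCNet

/-- An `m`-dimensional supercyclidic net in real projective 3-space: a Q-net `vertex` together
with SC-patches adapted to its elementary quadrilaterals. For `i ≠ j`, `patch i j z` is the patch on
the 2-cell at `z` spanned by `e i` and `e j`, its first parameter running in direction `i`; hence
`patch i j z` and `patch j i z` are the same patch with the parameters exchanged (and `patch i i z`
has no meaning). -/
structure SCNet (m : ℕ) where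
  vertex : SCNet.Lattice m → SCNet.RP3
  patch : Fin m → Fin m → SCNet.Lattice m → SCNet.Lift
  /-- elementary quadrilaterals are planar -/
  planar : ∀ i j, i ≠ j → ∀ z, SCNet.PlanarQuad (vertex z) (vertex (z + SCNet.e i))
    (vertex (z + SCNet.e i + SCNet.e j)) (vertex (z + SCNet.e j))
  isSCPatch : ∀ i j, i ≠ j → ∀ z, SCNet.IsSCPatch (patch i j z)
  patch_swap : ∀ i j, i ≠ j → ∀ z, patch j i z = (patch i j z).swap
  /-- the patches are adapted to the quadrilaterals -/
  adapted : ∀ i j, i ≠ j → ∀ z, SCNet.Represents (vertex z) (patch i j z 0 0) ∧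
    SCNet.Represents (vertex (z + SCNet.e i)) (patch i j z 1 0) ∧
    SCNet.Represents (vertex (z + SCNet.e j)) (patch i j z 0 1) ∧
    SCNet.Represents (vertex (z + SCNet.e i + SCNet.e j)) (patch i j z 1 1)
  /-- common boundary condition: all patches around the edge from `z` to `z + e i` have the same
  boundary curve along this edge -/
  common_start : ∀ i j k, i ≠ j → i ≠ k → ∀ z, (patch i j z).arc 0 = (patch i k z).arc 0
  common_end : ∀ i j k, i ≠ j → i ≠ k → ∀ z,
    (patch i j z).arc 1 = (patch i k (z + SCNet.e j)).arc 0
  /-- tangent cone continuity in the coordinate planes -/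
  tcc : ∀ i j, i ≠ j → ∀ z, SCNet.TCCJoin (patch i j z) (patch i j (z + SCNet.e i))

namespace SCNet

variable {m : ℕ}

/-- Equality of supercyclidic nets: same vertices and same (parametrized) patches. -/
structure Same (s s' : SCNet m) : Prop where
  vertex : ∀ z, s.vertex z = s'.vertex z
  patch : ∀ i j, i ≠ j → ∀ z, SamePatch (s.patch i j z) (s'.patch i j z)

/-- `s` and `s'` are fundamental transforms of each other: the supporting Q-nets form a discrete
fundamental pair, and corresponding patches form classical fundamental pairs. -/
structure IsFTransform (s s' : SCNet m) : Prop where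
  qnet : ∀ i z, PlanarQuad (s.vertex z) (s.vertex (z + e i)) (s'.vertex (z + e i)) (s'.vertex z)
  patch : ∀ i j, i ≠ j → ∀ z, ClassicalFPair (s.patch i j z) (s'.patch i j z)

/-- `s₁₂` is a common F-transform of `s₁` and `s₂` such that the corresponding vertices of `s`, `s₁`,
`s₂`, `s₁₂` are coplanar (forming a planar quadrilateral). -/
structure IsCommonFTransform (s s₁ s₂ s₁₂ : SCNet m) : Prop where
  left : IsFTransform s₁ s₁₂
  right : IsFTransform s₂ s₁₂
  coplanar : ∀ z, PlanarQuad (s.vertex z) (s₁.vertex z) (s₁₂.vertex z) (s₂.vertex z)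

/-- `s₁₂₃` is a common F-transform of `s₁₂`, `s₁₃`, `s₂₃` such that for every permutation `(i j k)`
of `(1 2 3)` the corresponding vertices of `sᵢ`, `sᵢⱼ`, `sᵢₖ`, `s₁₂₃` are coplanar. -/
structure IsTripleFTransform (s₁ s₂ s₃ s₁₂ s₁₃ s₂₃ s₁₂₃ : SCNet m) : Prop where
  ftransform₁₂ : IsFTransform s₁₂ s₁₂₃
  ftransform₁₃ : IsFTransform s₁₃ s₁₂₃
  ftransform₂₃ : IsFTransform s₂₃ s₁₂₃
  coplanar₁ : ∀ z, PlanarQuad (s₁.vertex z) (s₁₂.vertex z) (s₁₂₃.vertex z) (s₁₃.vertex z)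
  coplanar₂ : ∀ z, PlanarQuad (s₂.vertex z) (s₁₂.vertex z) (s₁₂₃.vertex z) (s₂₃.vertex z)
  coplanar₃ : ∀ z, PlanarQuad (s₃.vertex z) (s₁₃.vertex z) (s₁₂₃.vertex z) (s₂₃.vertex z)

/-! ### General position -/

/-- The tangent of direction `i` at the vertex `z`, read off from the patch `patch i j z`, `j ≠ i`
(the tangent does not depend on `j`). -/
def tangent (s : SCNet m) (i j : Fin m) (z : Lattice m) : Submodule ℝ V :=
  (s.patch i j z).vertexTangent

/-- General position of a pair of F-transforms, seen as two layers of an `(m+1)`-dimensional net: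
elementary cubes between the layers are not flat; no tangent lies in the plane of an adjacent
quadrilateral between the layers; corresponding tangents at opposite vertices of such a
quadrilateral are skew. -/
structure GeneralPair (s s' : SCNet m) : Prop where
  cube : ∀ i j, i ≠ j → ∀ z, ¬ (s'.vertex z).submodule ≤
    join3 (s.vertex z) (s.vertex (z + e i)) (s.vertex (z + e j))
  tangent : ∀ i j k, i ≠ j → ∀ z, ∀ t ∈ ({s.tangent i j z, s.tangent i j (z + e k),
      s'.tangent i j z, s'.tangent i j (z + e k)} : Set (Submodule ℝ V)),
    ¬ t ≤ join3 (s.vertex z) (s.vertex (z + e k)) (s'.vertex z)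
  skew : ∀ i j k, i ≠ j → ∀ z, s.tangent i j z ⊓ s'.tangent i j (z + e k) = ⊥ ∧
    s.tangent i j (z + e k) ⊓ s'.tangent i j z = ⊥

/-- The plane (in general position) spanned by corresponding vertices of three nets. -/
def vertexPlane (s s₁ s₂ : SCNet m) (z : Lattice m) : Submodule ℝ V :=
  join3 (s.vertex z) (s₁.vertex z) (s₂.vertex z)

/-- General position of a net and two of its F-transforms: corresponding vertices span a plane which
contains neither an adjacent vertex of `s` nor a tangent of `s₁` or `s₂` at its corresponding
vertex. -/
structure GeneralTriple (s s₁ s₂ : SCNet m) : Prop where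
  pair₁ : GeneralPair s s₁
  pair₂ : GeneralPair s s₂
  plane : ∀ z, Module.finrank ℝ (vertexPlane s s₁ s₂ z) = 3
  next : ∀ i z, ¬ (s.vertex (z + e i)).submodule ≤ vertexPlane s s₁ s₂ z
  prev : ∀ i z, ¬ (s.vertex z).submodule ≤ vertexPlane s s₁ s₂ (z + e i)
  tangent₁ : ∀ i j, i ≠ j → ∀ z, ¬ s₁.tangent i j z ≤ vertexPlane s s₁ s₂ z
  tangent₂ : ∀ i j, i ≠ j → ∀ z, ¬ s₂.tangent i j z ≤ vertexPlane s s₁ s₂ z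

/-- General position of a net and three of its F-transforms. -/
structure GeneralQuadruple (s s₁ s₂ s₃ : SCNet m) : Prop where
  triple₁₂ : GeneralTriple s s₁ s₂
  triple₁₃ : GeneralTriple s s₁ s₃
  triple₂₃ : GeneralTriple s s₂ s₃
  span : ∀ z, vertexPlane s s₁ s₂ z ⊔ (s₃.vertex z).submodule = ⊤

/-- `Q w` holds for generic `w` in the (irreducible) set `E`: for all `w ∈ E` outside the zero sets of
countably many polynomials, none of which vanishes identically on `E`. -/
def Generically {ι : Type} (E : Set (ι → ℝ)) (Q : (ι → ℝ) → Prop) : Prop :=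
  ∃ p : ℕ → MvPolynomial ι ℝ, (∀ n, ∃ w ∈ E, MvPolynomial.eval w (p n) ≠ 0) ∧
    ∀ w ∈ E, (∀ n, MvPolynomial.eval w (p n) ≠ 0) → Q w

end SCNet

end

noncomputable section

namespace SCNet

open Set Filter Topology
open Module (finrank)
open Submodule (span subset_span mem_span_pair span_le mem_span_singleton mem_span_singleton_self
  span_mono smul_mem_iff mem_span_range_iff_exists_fun)

set_option linter.unusedSectionVars false

/-- Linear independence over `ℝ`. -/
local notation "LI" => LinearIndependent ℝ

/-- The unit interval. -/
local notation "I01" => Icc (0 : ℝ) 1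

/-- The endpoints of the unit interval. -/
local notation "B01" => ({0, 1} : Set ℝ)

/-! ### Smooth functions with vanishing Wronskian -/

lemma eventually_ne_of_iteratedDeriv_ne {n : ℕ} : ∀ {f : ℝ → ℝ}, ContDiff ℝ ∞ f → ∀ {x : ℝ},
    iteratedDeriv n f x ≠ 0 → ∀ᶠ y in 𝓝[≠] x, f y ≠ 0 := by
  induction n with
  | zero =>
    intro f hf x h; rw [iteratedDeriv_zero] at h
    exact (hf.continuous.continuousAt.eventually_ne h).filter_mono nhdsWithin_le_nhds
  | succ n ih =>
    intro f hf x h; rw [iteratedDeriv_succ'] at h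
    have hf' : ContDiff ℝ ∞ (deriv f) := (contDiff_infty_iff_deriv.1 hf).2
    have h1 := ih hf' h; by_cases hx : f x = 0
    · rw [eventually_nhdsWithin_iff, Metric.eventually_nhds_iff] at h1 ⊢
      obtain ⟨δ, hδ, h2⟩ := h1; refine ⟨δ, hδ, fun y hy hne hfy => ?_⟩
      have hd := hf.differentiable (by simp)
      rw [Real.dist_eq] at hy
      rcases lt_or_gt_of_ne hne with hlt | hlt
      · obtain ⟨c, hc, hc'⟩ := exists_deriv_eq_zero hlt hd.continuous.continuousOn (hfy.trans hx.symm)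
        refine h2 ?_ hc.2.ne hc'
        rw [Real.dist_eq, abs_lt] at *; constructor <;> linarith [hc.1, hc.2]
      · obtain ⟨c, hc, hc'⟩ := exists_deriv_eq_zero hlt hd.continuous.continuousOn (hx.trans hfy.symm)
        refine h2 ?_ hc.1.ne' hc'
        rw [Real.dist_eq, abs_lt] at *; constructor <;> linarith [hc.1, hc.2]
    · exact (hf.continuous.continuousAt.eventually_ne hx).filter_mono nhdsWithin_le_nhds

lemma exists_iteratedDeriv_mul_ne {f g : ℝ → ℝ} (hf : ContDiff ℝ ∞ f) (hg : ContDiff ℝ ∞ g) {x : ℝ}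
    (h1 : ∃ n, iteratedDeriv n f x ≠ 0) (h2 : ∃ n, iteratedDeriv n g x ≠ 0) :
    ∃ n, iteratedDeriv n (fun y => f y * g y) x ≠ 0 := by
  classical
  refine ⟨Nat.find h1 + Nat.find h2, ?_⟩
  rw [iteratedDeriv_fun_mul (hf.of_le (by exact_mod_cast le_top)).contDiffAt
    (hg.of_le (by exact_mod_cast le_top)).contDiffAt]
  rw [Finset.sum_eq_single (Nat.find h1)]
  · have := Nat.find_spec h1; have := Nat.find_spec h2; simp only [Nat.add_sub_cancel_left]
    have h3 : ((Nat.find h1 + Nat.find h2).choose (Nat.find h1) : ℝ) ≠ 0 := by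
      exact_mod_cast (Nat.choose_pos (Nat.le_add_right _ _)).ne'
    positivity
  · intro b hb hne; rw [Finset.mem_range] at hb
    rcases lt_or_gt_of_ne hne with hlt | hlt
    · have := not_not.1 (Nat.find_min h1 hlt); simp [this]
    · have : Nat.find h1 + Nat.find h2 - b < Nat.find h2 := by omega
      have := not_not.1 (Nat.find_min h2 this); simp [this]
  · intro h; simp at h

lemma eq_const_mul_on_of_wronskian {f g : ℝ → ℝ} (hf : ContDiff ℝ ∞ f) (hg : ContDiff ℝ ∞ g)
    {s : Set ℝ} (hs : IsOpen s) (hs' : IsPreconnected s) (h0 : ∀ x ∈ s, f x ≠ 0)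
    (hW : ∀ x ∈ s, f x * deriv g x = deriv f x * g x) : ∃ c, ∀ x ∈ s, g x = c * f x := by
  have hfd := hf.differentiable (by simp)
  have hgd := hg.differentiable (by simp)
  obtain ⟨c, hc⟩ := hs.exists_is_const_of_deriv_eq_zero hs' (f := fun x => g x / f x)
    (fun x hx => ((hgd x).div (hfd x) (h0 x hx)).differentiableWithinAt) (by
      intro x hx; have := deriv_div (hgd x) (hfd x) (h0 x hx); simp only [Pi.div_def] at this
      rw [this]; have := hW x hx; simp only [Pi.zero_apply, div_eq_zero_iff]
      left; linarith)
  refine ⟨c, fun x hx => ?_⟩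
  have := hc x hx; have h := h0 x hx; exact (div_eq_iff h).1 this

lemma eventually_eq_const_mul_of_wronskian {f g : ℝ → ℝ} (hf : ContDiff ℝ ∞ f)
    (hg : ContDiff ℝ ∞ g) {x : ℝ} (hx : x ∈ Ioo (0 : ℝ) 1)
    (hW : ∀ x ∈ I01, f x * deriv g x = deriv f x * g x)
    (hnf : ∃ n, iteratedDeriv n f x ≠ 0) : ∃ c, ∀ᶠ y in 𝓝 x, g y = c * f y := by
  obtain ⟨n, hn⟩ := hnf; have h1 := (eventually_ne_of_iteratedDeriv_ne hf hn).and
    ((isOpen_Ioo.eventually_mem hx).filter_mono nhdsWithin_le_nhds)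
  rw [eventually_nhdsWithin_iff, Metric.eventually_nhds_iff] at h1
  obtain ⟨δ, hδ, h2⟩ := h1
  have hR : ∀ y ∈ Ioo x (x + δ), f y ≠ 0 ∧ y ∈ Ioo (0 : ℝ) 1 := fun y hy => h2 (by
    rw [Real.dist_eq, abs_lt]; constructor <;> linarith [hy.1, hy.2]) hy.1.ne'
  have hL : ∀ y ∈ Ioo (x - δ) x, f y ≠ 0 ∧ y ∈ Ioo (0 : ℝ) 1 := fun y hy => h2 (by
    rw [Real.dist_eq, abs_lt]; constructor <;> linarith [hy.1, hy.2]) hy.2.ne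
  obtain ⟨c, hc⟩ := eq_const_mul_on_of_wronskian hf hg isOpen_Ioo isPreconnected_Ioo
    (fun y hy => (hR y hy).1) (fun y hy => hW y (Ioo_subset_Icc_self (hR y hy).2))
  obtain ⟨c', hc'⟩ := eq_const_mul_on_of_wronskian hf hg isOpen_Ioo isPreconnected_Ioo
    (fun y hy => (hL y hy).1) (fun y hy => hW y (Ioo_subset_Icc_self (hL y hy).2))
  have key : ∀ (c : ℝ) (s : Set ℝ), IsOpen s → x ∈ closure s → (∀ y ∈ s, g y = c * f y) → ∀ k,
      iteratedDeriv k g x = c * iteratedDeriv k f x := by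
    intro c s hs hxs h k; have hcl : IsClosed {y | iteratedDeriv k g y = c * iteratedDeriv k f y} :=
      isClosed_eq (hg.continuous_iteratedDeriv k (by exact_mod_cast le_top))
        (continuous_const.mul (hf.continuous_iteratedDeriv k (by exact_mod_cast le_top)))
    refine hcl.closure_subset_iff.2 ?_ hxs
    intro y hy; have he : g =ᶠ[𝓝 y] fun y => c * f y := by
      filter_upwards [hs.mem_nhds hy] with z hz using h z hz
    show iteratedDeriv k g y = _
    rw [he.iteratedDeriv_eq, iteratedDeriv_const_mul_field]
  have hxR : x ∈ closure (Ioo x (x + δ)) := by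
    rw [closure_Ioo (by linarith)]; exact ⟨le_rfl, by linarith⟩
  have hxL : x ∈ closure (Ioo (x - δ) x) := by
    rw [closure_Ioo (by linarith)]; exact ⟨by linarith, le_rfl⟩
  have h3 := key c _ isOpen_Ioo hxR hc n; have h4 := key c' _ isOpen_Ioo hxL hc' n
  have hcc : c = c' := mul_right_cancel₀ hn (h3.symm.trans h4)
  have h5 := key c _ isOpen_Ioo hxR hc 0; rw [iteratedDeriv_zero, iteratedDeriv_zero] at h5
  refine ⟨c, ?_⟩
  rw [Metric.eventually_nhds_iff]; refine ⟨δ, hδ, fun y hy => ?_⟩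
  rw [Real.dist_eq, abs_lt] at hy
  rcases lt_trichotomy y x with h | h | h
  · rw [hcc]; exact hc' y ⟨by linarith, h⟩
  · rw [h]; exact h5
  · exact hc y ⟨h, by linarith⟩

lemma exists_eq_const_mul_of_wronskian {f g : ℝ → ℝ} (hf : ContDiff ℝ ∞ f)
    (hg : ContDiff ℝ ∞ g) (hW : ∀ x ∈ I01, f x * deriv g x = deriv f x * g x)
    (hnf : ∀ x ∈ I01, ∃ n, iteratedDeriv n f x ≠ 0) :
    ∃ c, ∀ x ∈ I01, g x = c * f x := by
  have hnear : ∀ x ∈ Ioo (0 : ℝ) 1, ∀ᶠ y in 𝓝[≠] x, f y ≠ 0 := fun x hx =>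
    let ⟨_, hn⟩ := hnf x (Ioo_subset_Icc_self hx)
    eventually_ne_of_iteratedDeriv_ne hf hn
  have hhalf : (1 / 2 : ℝ) ∈ Ioo (0 : ℝ) 1 := by norm_num
  obtain ⟨c, hc⟩ := eventually_eq_const_mul_of_wronskian hf hg hhalf hW
    (hnf _ (Ioo_subset_Icc_self hhalf))
  have hsub : Ioo (0 : ℝ) 1 ⊆ {x | ∀ᶠ y in 𝓝 x, g y = c * f y} := by
    refine isPreconnected_Ioo.subset_of_closure_inter_subset isOpen_setOfPred_eventually_nhds
      ⟨_, hhalf, hc⟩ ?_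
    rintro x ⟨hxc, hx⟩; obtain ⟨c', hc'⟩ := eventually_eq_const_mul_of_wronskian hf hg hx hW
      (hnf _ (Ioo_subset_Icc_self hx))
    have hfr : ∃ y, (∀ᶠ z in 𝓝 y, g z = c * f z) ∧ y ∈ Ioo (0:ℝ) 1 ∧
        ∀ᶠ z in 𝓝 y, g z = c' * f z := by
      have h1 : {y | ∀ᶠ z in 𝓝 y, g z = c' * f z} ∩ Ioo (0:ℝ) 1 ∈ 𝓝 x :=
        inter_mem (isOpen_setOfPred_eventually_nhds.mem_nhds hc') (isOpen_Ioo.mem_nhds hx)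
      obtain ⟨y, hy1, hy2⟩ := mem_closure_iff_nhds.1 hxc _ h1; exact ⟨y, hy2, hy1.2, hy1.1⟩
    obtain ⟨y, h1, hy, h2⟩ := hfr; have h3 : ∀ᶠ z in 𝓝[≠] y, False ∨ c = c' := by
      filter_upwards [hnear y hy, h1.filter_mono nhdsWithin_le_nhds,
        h2.filter_mono nhdsWithin_le_nhds] with z hz1 hz2 hz3
      exact Or.inr (mul_right_cancel₀ hz1 (hz2.symm.trans hz3))
    obtain ⟨z, hz⟩ := h3.exists; have : c = c' := by simpa using hz
    show ∀ᶠ y in 𝓝 x, g y = c * f y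
    rw [this]; exact hc'
  have hcl : IsClosed {x | g x = c * f x} :=
    isClosed_eq hg.continuous (continuous_const.mul hf.continuous)
  refine ⟨c, fun x hx => ?_⟩
  rw [← closure_Ioo (zero_ne_one' ℝ)] at hx
  exact (hcl.closure_subset_iff.2 fun y hy => (hsub hy).self_of_nhds) hx

/-! ### Closed conditions that hold outside of finite sets -/

lemma subset_of_isClosed_of_finite {P : Set ℝ} (hP : IsClosed P) {S : Set ℝ} (hS : S.Finite)
    (h : ∀ x ∈ I01, x ∉ S → x ∈ P) : ∀ x ∈ I01, x ∈ P := by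
  intro x hx; have hd : Dense Sᶜ := hS.countable.dense_compl ℝ
  rw [← closure_Ioo (zero_ne_one' ℝ)] at hx
  have h2 := closure_minimal (hd.open_subset_closure_inter isOpen_Ioo) isClosed_closure hx
  exact (hP.closure_subset_iff.2 fun y hy => h y (Ioo_subset_Icc_self hy.1) hy.2) h2

/-! ### Linear algebra -/

section LinearAlgebra

variable {W W' : Type*} [AddCommGroup W] [Module ℝ W] [AddCommGroup W'] [Module ℝ W']

lemma span_range_eq_of_mem [FiniteDimensional ℝ W] {n : ℕ} {v : Fin n → W} (hv : LI v) {E : Submodule ℝ W}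
    (hE : finrank ℝ E = n) (h : ∀ i, v i ∈ E) : span ℝ (range v) = E := by
  refine Submodule.eq_of_le_of_finrank_eq (span_le.2 ?_) ?_
  · rintro _ ⟨i, rfl⟩; exact h i
  · rw [finrank_span_eq_card hv, hE, Fintype.card_fin]

lemma mem_span_triple {a b c x : W} : x ∈ span ℝ (range ![a, b, c]) ↔
    ∃ r s t : ℝ, x = r • a + s • b + t • c := by
  rw [mem_span_range_iff_exists_fun]; constructor
  · rintro ⟨f, rfl⟩; exact ⟨f 0, f 1, f 2, by simp [Fin.sum_univ_three]⟩
  · rintro ⟨r, s, t, rfl⟩; exact ⟨![r, s, t], by simp [Fin.sum_univ_three]⟩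

lemma mem_span_pair_range {a b x : W} : x ∈ span ℝ (range ![a, b]) ↔
    ∃ r s : ℝ, x = r • a + s • b := by
  rw [mem_span_range_iff_exists_fun]; constructor
  · rintro ⟨f, rfl⟩; exact ⟨f 0, f 1, by simp [Fin.sum_univ_two]⟩
  · rintro ⟨r, s, rfl⟩; exact ⟨![r, s], by simp [Fin.sum_univ_two]⟩

lemma li_two {a b : W} : LI ![a, b] ↔
    ∀ r s : ℝ, r • a + s • b = 0 → r = 0 ∧ s = 0 := LinearIndependent.pair_iff

lemma li_three {a b c : W} : LI ![a, b, c] ↔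
    ∀ r s t : ℝ, r • a + s • b + t • c = 0 → r = 0 ∧ s = 0 ∧ t = 0 := by
  rw [Fintype.linearIndependent_iff]; constructor
  · intro h r s t hr; have := h ![r, s, t] (by simpa [Fin.sum_univ_three] using hr)
    exact ⟨this 0, this 1, this 2⟩
  · intro h g hg; rw [Fin.sum_univ_three] at hg; obtain ⟨h0, h1, h2⟩ := h _ _ _ hg
    intro i; fin_cases i <;> assumption

lemma li_four {a b c d : W} : LI ![a, b, c, d] ↔
    ∀ r s t k : ℝ, r • a + s • b + t • c + k • d = 0 → r = 0 ∧ s = 0 ∧ t = 0 ∧ k = 0 := by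
  rw [Fintype.linearIndependent_iff]; constructor
  · intro h r s t k hr; have := h ![r, s, t, k] (by simpa [Fin.sum_univ_four] using hr)
    exact ⟨this 0, this 1, this 2, this 3⟩
  · intro h g hg; rw [Fin.sum_univ_four] at hg; obtain ⟨h0, h1, h2, h3⟩ := h _ _ _ _ hg
    intro i; fin_cases i <;> assumption

lemma not_li_two {a b : W} : ¬ LI ![a, b] ↔
    ∃ r s : ℝ, r • a + s • b = 0 ∧ (r ≠ 0 ∨ s ≠ 0) := by
  rw [li_two]; push Not
  refine exists_congr fun r => exists_congr fun s => and_congr_right fun _ => ?_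
  tauto

lemma not_li_three {a b c : W} : ¬ LI ![a, b, c] ↔
    ∃ r s t : ℝ, r • a + s • b + t • c = 0 ∧ (r ≠ 0 ∨ s ≠ 0 ∨ t ≠ 0) := by
  rw [li_three]; push Not
  refine exists_congr fun r => exists_congr fun s => exists_congr fun t => and_congr_right fun _ => ?_
  tauto

lemma not_li_four {a b c d : W} : ¬ LI ![a, b, c, d] ↔
    ∃ r s t k : ℝ, r • a + s • b + t • c + k • d = 0 ∧ (r ≠ 0 ∨ s ≠ 0 ∨ t ≠ 0 ∨ k ≠ 0) := by
  rw [li_four]; push Not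
  refine exists_congr fun r => exists_congr fun s => exists_congr fun t => exists_congr fun k =>
    and_congr_right fun _ => ?_
  tauto

lemma exists_smul_of_not_li {a b : W} (ha : a ≠ 0) (h : ¬ LI ![a, b]) :
    ∃ r : ℝ, b = r • a := by
  by_contra! hc
  exact h ((LinearIndependent.pair_iff' ha).2 fun r hr => hc r hr.symm)

lemma exists_comb_of_not_li {a b x : W} (hab : LI ![a, b])
    (h : ¬ LI ![x, a, b]) : ∃ r s : ℝ, x = r • a + s • b := by
  by_contra hc; exact h (linearIndependent_finCons.2 ⟨hab, fun hx => hc (mem_span_pair_range.1 hx)⟩)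

lemma li_left_ne {a b : W} (h : LI ![a, b]) : a ≠ 0 := h.ne_zero 0

lemma not_li_of_finrank_lt [FiniteDimensional ℝ W] {n : ℕ} {v : Fin n → W} {E : Submodule ℝ W}
    (h : ∀ i, v i ∈ E) (hE : finrank ℝ E < n) : ¬ LI v := fun hv => by
  have h1 := finrank_span_eq_card hv
  have h2 : span ℝ (range v) ≤ E := span_le.2 (by rintro _ ⟨i, rfl⟩; exact h i)
  have := Submodule.finrank_mono h2; rw [Fintype.card_fin] at h1
  omega

lemma exists_dual_ne {E : Submodule ℝ W} {x : W} (hx : x ∉ E) :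
    ∃ f : W →ₗ[ℝ] ℝ, f x ≠ 0 ∧ ∀ e ∈ E, f e = 0 := by
  obtain ⟨f, hf, hE⟩ := E.exists_dual_map_eq_bot_of_notMem hx inferInstance
  refine ⟨f, hf, fun e he => ?_⟩
  have : f e ∈ E.map f := Submodule.mem_map_of_mem he; rw [hE] at this
  simpa using this

end LinearAlgebra

/-! ### Derivatives of (bi)linear expressions -/

section Deriv

variable {W W' W'' : Type*} [NormedAddCommGroup W] [NormedSpace ℝ W] [FiniteDimensional ℝ W]
  [NormedAddCommGroup W'] [NormedSpace ℝ W'] [FiniteDimensional ℝ W']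
  [NormedAddCommGroup W''] [NormedSpace ℝ W'']

lemma contDiff_linear_comp (l : W →ₗ[ℝ] W'') {c : ℝ → W} (hc : ContDiff ℝ ∞ c) :
    ContDiff ℝ ∞ (fun u => l (c u)) := l.toContinuousLinearMap.contDiff.comp hc

lemma deriv_linear_comp (l : W →ₗ[ℝ] W'') {c : ℝ → W} (hc : ContDiff ℝ ∞ c) (u : ℝ) :
    deriv (fun u => l (c u)) u = l (deriv c u) :=
  (l.toContinuousLinearMap.hasFDerivAt.comp_hasDerivAt u
    (hc.differentiable (by simp) u).hasDerivAt).deriv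

lemma contDiff_deriv {c : ℝ → W''} (hc : ContDiff ℝ ∞ c) : ContDiff ℝ ∞ (deriv c) :=
  (contDiff_infty_iff_deriv.1 hc).2

lemma deriv_eq_zero_of_eqOn {c : ℝ → W''} (hc : ContDiff ℝ ∞ c) (h : ∀ u ∈ I01, c u = 0) :
    ∀ u ∈ I01, deriv c u = 0 := by
  intro u hu
  have hcl : IsClosed {u | deriv c u = 0} := isClosed_eq (contDiff_deriv hc).continuous continuous_const
  rw [← closure_Ioo (zero_ne_one' ℝ)] at hu; refine (hcl.closure_subset_iff.2 fun y hy => ?_) hu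
  have : c =ᶠ[𝓝 y] fun _ => 0 := by
    filter_upwards [isOpen_Ioo.mem_nhds hy] with z hz using h z (Ioo_subset_Icc_self hz)
  show deriv c y = 0
  rw [this.deriv_eq, deriv_const]

lemma deriv_mem_of_mem {c : ℝ → W} (hc : ContDiff ℝ ∞ c) {E : Submodule ℝ W}
    (h : ∀ u ∈ I01, c u ∈ E) : ∀ u ∈ I01, deriv c u ∈ E := by
  intro u hu; by_contra hn; obtain ⟨f, hf, hE⟩ := exists_dual_ne hn
  refine hf ?_
  rw [← deriv_linear_comp f hc]
  exact deriv_eq_zero_of_eqOn (contDiff_linear_comp f hc) (fun u hu => hE _ (h u hu)) u hu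

lemma hasDerivAt_bilin (B : W →ₗ[ℝ] W' →ₗ[ℝ] W'') {c : ℝ → W} {d : ℝ → W'} {c' : W} {d' : W'}
    {u : ℝ} (hc : HasDerivAt c c' u) (hd : HasDerivAt d d' u) :
    HasDerivAt (fun u => B (c u) (d u)) (B c' (d u) + B (c u) d') u := by
  have := ((LinearMap.toContinuousLinearMap
    ((LinearMap.toContinuousLinearMap : (W' →ₗ[ℝ] W'') ≃ₗ[ℝ] (W' →L[ℝ] W'')).toLinearMap.comp
      B)).hasFDerivAt.comp_hasDerivAt u hc).clm_apply hd
  exact this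

lemma contDiff_bilin {X : Type*} [NormedAddCommGroup X] [NormedSpace ℝ X]
    (B : W →ₗ[ℝ] W' →ₗ[ℝ] W'') {c : X → W} {d : X → W'}
    (hc : ContDiff ℝ ∞ c) (hd : ContDiff ℝ ∞ d) : ContDiff ℝ ∞ (fun u => B (c u) (d u)) := by
  exact ((LinearMap.toContinuousLinearMap
    ((LinearMap.toContinuousLinearMap : (W' →ₗ[ℝ] W'') ≃ₗ[ℝ] (W' →L[ℝ] W'')).toLinearMap.comp
      B)).contDiff.comp hc).clm_apply hd

lemma deriv_bilin (B : W →ₗ[ℝ] W' →ₗ[ℝ] W'') {c : ℝ → W} {d : ℝ → W'}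
    (hc : ContDiff ℝ ∞ c) (hd : ContDiff ℝ ∞ d) (u : ℝ) :
    deriv (fun u => B (c u) (d u)) u = B (deriv c u) (d u) + B (c u) (deriv d u) :=
  (hasDerivAt_bilin B (hc.differentiable (by simp) u).hasDerivAt
    (hd.differentiable (by simp) u).hasDerivAt).deriv

lemma tangent_eq_of_dep {c d : ℝ → W} (hc : ContDiff ℝ ∞ c) (hd : ContDiff ℝ ∞ d)
    (h : ∀ u ∈ I01, ¬ LI ![c u, d u]) {u : ℝ} (hu : u ∈ I01)
    (hcu : c u ≠ 0) : ∃ r s : ℝ, d u = r • c u ∧ deriv d u = s • c u + r • deriv c u := by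
  obtain ⟨f, hf⟩ : ∃ f : W →ₗ[ℝ] ℝ, f (c u) ≠ 0 := by
    obtain ⟨f, hf, -⟩ := exists_dual_ne (E := ⊥) (x := c u) (by simpa using hcu)
    exact ⟨f, hf⟩
  have key : ∀ v ∈ I01, f (c v) • d v - f (d v) • c v = 0 := by
    intro v hv; obtain ⟨r, s, hrs, hne⟩ := not_li_two.1 (h v hv)
    have e2 : r * f (c v) + s * f (d v) = 0 := by simpa using congrArg f hrs
    by_cases hs : s = 0
    · subst hs; have hr : r ≠ 0 := by simpa using hne
      have : c v = 0 := by simpa [hr] using hrs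
      simp [this]
    · have e1 : d v = (-r / s) • c v := by
        have h1 : s • d v = (-r) • c v := by
          rw [neg_smul]; exact eq_neg_of_add_eq_zero_right hrs
        rw [div_eq_inv_mul, mul_smul, ← h1, smul_smul, inv_mul_cancel₀ hs, one_smul]
      rw [e1]; simp only [map_smul, smul_eq_mul]; module
  have hfc := contDiff_linear_comp f hc; have hfd := contDiff_linear_comp f hd
  have h1 := key u hu; have h2 := deriv_eq_zero_of_eqOn ((hfc.smul hd).sub (hfd.smul hc)) key u hu
  have d1 := (hc.differentiable (by simp) u).hasDerivAt
  have d2 := (hd.differentiable (by simp) u).hasDerivAt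
  have d3 := (hfc.differentiable (by simp) u).hasDerivAt
  have d4 := (hfd.differentiable (by simp) u).hasDerivAt
  have h3 := ((d3.smul d2).sub (d4.smul d1)).deriv; have h2' := h3.symm.trans h2
  rw [deriv_linear_comp f hc, deriv_linear_comp f hd] at h2'
  refine ⟨f (d u) / f (c u), (f (c u))⁻¹ * (f (deriv d u) - f (deriv c u) * (f (d u) / f (c u))), ?_, ?_⟩
  · rw [div_eq_inv_mul, mul_smul, ← sub_eq_zero.1 h1, smul_smul, inv_mul_cancel₀ hf, one_smul]
  · have e1 : d u = (f (d u) / f (c u)) • c u := by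
      rw [div_eq_inv_mul, mul_smul, ← sub_eq_zero.1 h1, smul_smul, inv_mul_cancel₀ hf, one_smul]
    have e2 : f (c u) • deriv d u = f (d u) • deriv c u + f (deriv d u) • c u
        - f (deriv c u) • d u := by
      rw [← sub_eq_zero, ← h2']; module
    have e3 : deriv d u = (f (c u))⁻¹ • (f (c u) • deriv d u) := by
      rw [smul_smul, inv_mul_cancel₀ hf, one_smul]
    obtain ⟨r, hr⟩ : ∃ r, f (d u) / f (c u) = r := ⟨_, rfl⟩; rw [hr] at e1 ⊢
    have hr' : f (d u) = r * f (c u) := by rw [← hr, div_mul_cancel₀ _ hf]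
    refine e3.trans ?_
    rw [e2, hr', e1]; simp only [smul_sub, smul_add, smul_smul, ← mul_assoc]
    rw [mul_comm _ r, mul_assoc r, inv_mul_cancel₀ hf]; module

end Deriv

section Conics

variable {W W' : Type*} [NormedAddCommGroup W] [NormedSpace ℝ W] [FiniteDimensional ℝ W]
  [NormedAddCommGroup W'] [NormedSpace ℝ W'] [FiniteDimensional ℝ W']

lemma isClosed_dep {n : ℕ} {c : ℝ → Fin n → W} (hc : ∀ i, Continuous fun u => c u i) :
    IsClosed {u | ¬ LI (c u)} := by
  have h : IsOpen {u | LI (c u)} :=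
    isOpen_setOfPred_linearIndependent.preimage (continuous_pi hc)
  exact h.isClosed_compl

lemma isClosed_dep_two {c d : ℝ → W} (hc : Continuous c) (hd : Continuous d) :
    IsClosed {u | ¬ LI ![c u, d u]} :=
  isClosed_dep (c := fun u => ![c u, d u]) fun i => by fin_cases i <;> assumption

/-! ### Arcs of conics in vector spaces -/

/-- A smooth, injective and immersed parametrization of an arc of a nondegenerate conic in the plane
`E`, given by the symmetric bilinear form `B`. -/
structure ConicData (c : ℝ → W) (E : Submodule ℝ W) (B : W →ₗ[ℝ] W →ₗ[ℝ] ℝ) : Prop where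
  smooth : ContDiff ℝ ∞ c
  immersed : ∀ u ∈ I01, LI ![c u, deriv c u]
  injective : ∀ u ∈ I01, ∀ u' ∈ I01, u ≠ u' →
    LI ![c u, c u']
  finrank : finrank ℝ E = 3
  symm : ∀ x y, B x y = B y x
  nondeg : ∀ w ∈ E, (∀ w' ∈ E, B w w' = 0) → w = 0
  mem : ∀ u ∈ I01, c u ∈ E
  zero : ∀ u ∈ I01, B (c u) (c u) = 0

lemma IsConicArc.exists_data {c : ℝ → V} (h : IsConicArc c) (hc : ContDiff ℝ ∞ c) :
    ∃ E B, ConicData c E B := by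
  obtain ⟨E, q, hE, hq, hm⟩ := h.conic
  refine ⟨E, q.polarBilin, hc, h.immersed, h.injective, hE, fun x y => ?_, hq, fun u hu => (hm u hu).1,
    fun u hu => ?_⟩
  · simp [QuadraticMap.polar_comm]
  · simp [(hm u hu).2]

lemma ConicData.isConicArc {c : ℝ → V} {E : Submodule ℝ V} {B : V →ₗ[ℝ] V →ₗ[ℝ] ℝ}
    (h : ConicData c E B) : IsConicArc c := by
  refine ⟨h.immersed, h.injective, E, LinearMap.BilinMap.toQuadraticMap B, h.finrank, fun w hw hw' => ?_,
    fun u hu => ⟨h.mem u hu, h.zero u hu⟩⟩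
  refine h.nondeg w hw fun w' hw2 => ?_
  have := hw' w' hw2; rw [LinearMap.BilinMap.polar_toQuadraticMap, h.symm w' w] at this
  linarith

namespace ConicData

variable {c : ℝ → W} {E : Submodule ℝ W} {B : W →ₗ[ℝ] W →ₗ[ℝ] ℝ}

lemma isotropic (h : ConicData c E B) {x y : W} (hx : x ∈ E) (hy : y ∈ E) (hxx : B x x = 0)
    (hyy : B y y = 0) (hxy : B x y = 0) : ¬ LI ![x, y] := by
  intro hli; have hlt : span ℝ (range ![x, y]) < E := by
    refine lt_of_le_of_ne (span_le.2 ?_) fun he => ?_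
    · rintro _ ⟨i, rfl⟩; fin_cases i <;> assumption
    · have := finrank_span_eq_card hli; rw [he, h.finrank] at this
      simp at this
  obtain ⟨e, heE, he⟩ := SetLike.exists_of_lt hlt
  have h3 : LI ![e, x, y] := linearIndependent_finCons.2 ⟨hli, he⟩
  have hspan := span_range_eq_of_mem h3 h.finrank (by
    intro i; fin_cases i <;> assumption)
  have hyx : B y x = 0 := by rw [h.symm, hxy]
  have key : B y e • x - B x e • y = 0 := by
    refine h.nondeg _ (E.sub_mem (E.smul_mem _ hx) (E.smul_mem _ hy)) fun w hw => ?_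
    rw [← hspan, mem_span_triple] at hw; obtain ⟨r, s, t, rfl⟩ := hw
    simp only [map_sub, map_smul, map_add, LinearMap.sub_apply, LinearMap.smul_apply, smul_eq_mul,
      hxx, hyy, hxy, hyx]
    ring
  obtain ⟨h1, h2⟩ := li_two.1 hli (B y e) (-B x e) (by rw [neg_smul, ← sub_eq_add_neg, key])
  refine hli.ne_zero 0 (h.nondeg x hx fun w hw => ?_)
  rw [← hspan, mem_span_triple] at hw; obtain ⟨r, s, t, rfl⟩ := hw
  have h2' : B x e = 0 := by linarith
  simp [hxx, hxy, h2']

lemma li_points (h : ConicData c E B) {u v w : ℝ} (hu : u ∈ I01) (hv : v ∈ I01)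
    (hw : w ∈ I01) (huv : u ≠ v) (huw : u ≠ w) (hvw : v ≠ w) :
    LI ![c u, c v, c w] := by
  by_contra hcon; have hvw' := h.injective v hv w hw hvw
  obtain ⟨r, s, hrs⟩ := exists_comb_of_not_li hvw' hcon; have hr : r ≠ 0 := by
    rintro rfl
    exact not_li_two.2 ⟨1, -s, by rw [hrs]; module, Or.inl one_ne_zero⟩ (h.injective u hu w hw huw)
  have hs : s ≠ 0 := by
    rintro rfl
    exact not_li_two.2 ⟨1, -r, by rw [hrs]; module, Or.inl one_ne_zero⟩ (h.injective u hu v hv huv)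
  have h0 := h.zero u hu; rw [hrs] at h0
  simp only [map_add, map_smul, LinearMap.add_apply, LinearMap.smul_apply, smul_eq_mul, h.zero v hv,
    h.zero w hw, h.symm (c w) (c v)] at h0
  have h1 : (2 * r * s) * B (c v) (c w) = 0 := by linarith
  have h2 : B (c v) (c w) = 0 := by
    rcases mul_eq_zero.1 h1 with h3 | h3
    · simp [hr, hs] at h3
    · exact h3
  exact h.isotropic (h.mem v hv) (h.mem w hw) (h.zero v hv) (h.zero w hw) h2 hvw'

lemma deriv_mem (h : ConicData c E B) {u : ℝ} (hu : u ∈ I01) : deriv c u ∈ E :=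
  deriv_mem_of_mem h.smooth h.mem u hu

lemma bilin_deriv (h : ConicData c E B) {u : ℝ} (hu : u ∈ I01) :
    B (c u) (deriv c u) = 0 := by
  have := deriv_eq_zero_of_eqOn (contDiff_bilin B h.smooth h.smooth) h.zero u hu
  rw [deriv_bilin B h.smooth h.smooth, h.symm (deriv c u)] at this
  linarith

lemma bilin_deriv_two (h : ConicData c E B) {u : ℝ} (hu : u ∈ I01) :
    B (c u) (deriv (deriv c) u) = - B (deriv c u) (deriv c u) := by
  have := deriv_eq_zero_of_eqOn (contDiff_bilin B h.smooth (contDiff_deriv h.smooth))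
    (fun v hv => h.bilin_deriv hv) u hu
  rw [deriv_bilin B h.smooth (contDiff_deriv h.smooth)] at this
  linarith

lemma li_deriv_two (h : ConicData c E B) {u : ℝ} (hu : u ∈ I01) :
    LI ![deriv (deriv c) u, c u, deriv c u] := by
  by_contra hcon; obtain ⟨r, s, hrs⟩ := exists_comb_of_not_li (h.immersed u hu) hcon
  have h1 := h.bilin_deriv_two hu; rw [hrs] at h1
  simp only [map_add, map_smul, smul_eq_mul, h.zero u hu, h.bilin_deriv hu] at h1
  exact h.isotropic (h.mem u hu) (h.deriv_mem hu) (h.zero u hu) (by linarith) (h.bilin_deriv hu)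
    (h.immersed u hu)

lemma eq_span_points (h : ConicData c E B) {u v w : ℝ} (hu : u ∈ I01)
    (hv : v ∈ I01) (hw : w ∈ I01) (huv : u ≠ v) (huw : u ≠ w) (hvw : v ≠ w) :
    span ℝ (range ![c u, c v, c w]) = E :=
  span_range_eq_of_mem (h.li_points hu hv hw huv huw hvw) h.finrank (by
    intro i; fin_cases i
    exacts [h.mem u hu, h.mem v hv, h.mem w hw])

lemma eq_span_deriv (h : ConicData c E B) {u : ℝ} (hu : u ∈ I01) :
    span ℝ (range ![deriv (deriv c) u, c u, deriv c u]) = E :=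
  span_range_eq_of_mem (h.li_deriv_two hu) h.finrank (by
    intro i; fin_cases i
    exacts [deriv_mem_of_mem (contDiff_deriv h.smooth) (fun v hv => h.deriv_mem hv) u hu, h.mem u hu,
      h.deriv_mem hu])

lemma span_eq (h : ConicData c E B) : span ℝ (c '' Icc 0 1) = E := by
  refine le_antisymm (span_le.2 ?_) ?_
  · rintro _ ⟨u, hu, rfl⟩; exact h.mem u hu
  · rw [← h.eq_span_points (u := 0) (v := 1 / 2) (w := 1) (by norm_num) (by norm_num) (by norm_num)
      (by norm_num) (by norm_num) (by norm_num)]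
    refine span_mono ?_
    rintro _ ⟨i, rfl⟩
    fin_cases i
    exacts [⟨0, by norm_num, rfl⟩, ⟨1 / 2, by norm_num, rfl⟩, ⟨1, by norm_num, rfl⟩]

lemma exists_iteratedDeriv_ne (h : ConicData c E B) {l : W →ₗ[ℝ] ℝ} (hl : ∃ e ∈ E, l e ≠ 0)
    {u : ℝ} (hu : u ∈ I01) : ∃ n, iteratedDeriv n (fun u => l (c u)) u ≠ 0 := by
  by_contra! hcon
  have e1 : deriv (fun u => l (c u)) = fun u => l (deriv c u) := by
    ext v; exact deriv_linear_comp l h.smooth v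
  have e2 : deriv (fun u => l (deriv c u)) = fun u => l (deriv (deriv c) u) := by
    ext v; exact deriv_linear_comp l (contDiff_deriv h.smooth) v
  have h0 := hcon 0; have h1 := hcon 1; have h2 := hcon 2; rw [iteratedDeriv_zero] at h0
  rw [iteratedDeriv_one, e1] at h1; rw [iteratedDeriv_succ', e1, iteratedDeriv_one, e2] at h2
  obtain ⟨e, he, hle⟩ := hl; rw [← h.eq_span_deriv hu, mem_span_triple] at he
  obtain ⟨r, s, t, rfl⟩ := he; simp [h0, h1, h2] at hle

lemma finite_zeros (h : ConicData c E B) {l : W →ₗ[ℝ] ℝ} (hl : ∃ e ∈ E, l e ≠ 0) :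
    {u | u ∈ I01 ∧ l (c u) = 0}.Finite := by
  by_contra hcon; obtain ⟨t, hts, ht⟩ := (show Set.Infinite _ from hcon).exists_subset_card_eq 3
  obtain ⟨u, v, w, huv, huw, hvw, rfl⟩ := Finset.card_eq_three.1 ht
  have hu := hts (show u ∈ _ by simp)
  have hv := hts (show v ∈ _ by simp)
  have hw := hts (show w ∈ _ by simp)
  obtain ⟨e, he, hle⟩ := hl
  rw [← h.eq_span_points hu.1 hv.1 hw.1 huv huw hvw, mem_span_triple] at he
  obtain ⟨r, s, t, rfl⟩ := he; simp [hu.2, hv.2, hw.2] at hle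

lemma finite_tangents (h : ConicData c E B) {o : W} (ho : o ≠ 0) (hoE : o ∈ E) :
    {u | u ∈ I01 ∧ ¬ LI ![o, c u, deriv c u]}.Finite := by
  have hl : ∃ e ∈ E, B o e ≠ 0 := by
    by_contra! hcon
    exact ho (h.nondeg o hoE hcon)
  refine (h.finite_zeros hl).subset ?_
  rintro u ⟨hu, hli⟩; refine ⟨hu, ?_⟩
  obtain ⟨r, s, rfl⟩ := exists_comb_of_not_li (h.immersed u hu) hli
  simp [h.zero u hu, h.symm (deriv c u), h.bilin_deriv hu]

lemma ne_zero (h : ConicData c E B) {u : ℝ} (hu : u ∈ I01) : c u ≠ 0 :=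
  (h.immersed u hu).ne_zero 0

lemma map (h : ConicData c E B) (L : W →ₗ[ℝ] W') (hL : ∀ e ∈ E, L e = 0 → e = 0) :
    ∃ B', ConicData (fun u => L (c u)) (E.map L) B' := by
  have hinj : Function.Injective (L.domRestrict E) := by
    rw [injective_iff_map_eq_zero]; intro a ha; exact Subtype.ext (hL a a.2 ha)
  obtain ⟨R, hR⟩ := (L.domRestrict E).exists_leftInverse_of_injective (LinearMap.ker_eq_bot.2 hinj)
  have hR' : ∀ e ∈ E, (R (L e) : W) = e := fun e he => by
    have := LinearMap.congr_fun hR ⟨e, he⟩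
    simp only [LinearMap.comp_apply, LinearMap.id_apply, LinearMap.domRestrict_apply] at this
    rw [this]
  let T : W' →ₗ[ℝ] W := E.subtype ∘ₗ R
  have hT : ∀ e ∈ E, T (L e) = e := hR'
  have hli : ∀ x ∈ E, ∀ y ∈ E, LI ![x, y] → LI ![L x, L y] := by
    intro x hx y hy hxy; rw [li_two] at *; intro r s hrs
    refine hxy r s (hL _ (E.add_mem (E.smul_mem _ hx) (E.smul_mem _ hy)) ?_)
    simpa using hrs
  refine ⟨B.compl₁₂ T T, ?_⟩
  refine ⟨contDiff_linear_comp L h.smooth, fun u hu => ?_, fun u hu v hv huv => ?_, ?_, fun x y => ?_,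
    ?_, fun u hu => Submodule.mem_map_of_mem (h.mem u hu), fun u hu => ?_⟩
  · rw [deriv_linear_comp L h.smooth]; exact hli _ (h.mem u hu) _ (h.deriv_mem hu) (h.immersed u hu)
  · exact hli _ (h.mem u hu) _ (h.mem v hv) (h.injective u hu v hv huv)
  · rw [← h.finrank]; have : E.map L = LinearMap.range (L.domRestrict E) := by
      rw [LinearMap.range_domRestrict]
    rw [this]; exact LinearMap.finrank_range_of_inj hinj
  · simp [h.symm (T x)]
  · rintro _ ⟨e, he, rfl⟩ hw; rw [h.nondeg e he fun e' he' => ?_, map_zero]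
    have := hw (L e') (Submodule.mem_map_of_mem he'); simpa [hT e he, hT e' he'] using this
  · simp [hT _ (h.mem u hu), h.zero u hu]

end ConicData

/-! ### Homologies between conics -/

lemma exists_coordinates (hW : finrank ℝ W = 3) {o : W} (ho : o ≠ 0) :
    ∃ (x y z : W →ₗ[ℝ] ℝ) (e f : W), x o = 1 ∧ y o = 0 ∧ z o = 0 ∧
      (∀ w, w = x w • o + y w • e + z w • f) ∧ y e ≠ 0 := by
  have h1 : LI ![o] := by
    rw [linearIndependent_unique_iff]; simpa using ho
  have hex : ∀ {n : ℕ} {v : Fin n → W}, LI v → n < 3 →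
      ∃ e, LI (Fin.cons e v : Fin (n + 1) → W) := by
    intro n v hv hn; have : span ℝ (range v) < ⊤ := by
      refine lt_top_iff_ne_top.2 fun he => ?_
      have := finrank_span_eq_card hv; rw [he, finrank_top, hW, Fintype.card_fin] at this
      omega
    obtain ⟨e, -, he⟩ := SetLike.exists_of_lt this; exact ⟨e, linearIndependent_finCons.2 ⟨hv, he⟩⟩
  obtain ⟨e, he⟩ := hex h1 (by norm_num)
  obtain ⟨f, hf⟩ := hex he (by norm_num)
  let b := basisOfLinearIndependentOfCardEqFinrank hf (by simp [hW])
  have hb : ∀ i, b i = (Fin.cons f (Fin.cons e ![o]) : Fin 3 → W) i := fun i => by simp [b]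
  have hb0 : b 0 = f := hb 0; have hb1 : b 1 = e := hb 1; have hb2 : b 2 = o := hb 2
  refine ⟨b.coord 2, b.coord 1, b.coord 0, e, f, ?_, ?_, ?_, fun w => ?_, ?_⟩
  · rw [← hb2]; simp
  · rw [← hb2]; simp
  · rw [← hb2]; simp
  · have := b.sum_repr w; rw [Fin.sum_univ_three, hb0, hb1, hb2] at this
    simp only [Module.Basis.coord_apply]; exact this.symm.trans (by module)
  · rw [← hb1]; simp

omit [FiniteDimensional ℝ W] in
lemma det_ne_zero_of_li {x y z : W →ₗ[ℝ] ℝ} {o e f a b : W}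
    (hw : ∀ w, w = x w • o + y w • e + z w • f) (hli : LI ![o, a, b]) :
    y a * z b - z a * y b ≠ 0 := by
  intro h0; have ha := hw a; have hb := hw b
  generalize x a = x1, y a = y1, z a = z1, x b = x2, y b = y2, z b = z2 at *
  obtain ⟨-, h1, h2⟩ := li_three.1 hli (-(z2 * x1 - z1 * x2)) z2 (-z1) (by
    rw [ha, hb]; linear_combination (norm := module) h0 • e)
  obtain ⟨-, h3, h4⟩ := li_three.1 hli (-(y2 * x1 - y1 * x2)) y2 (-y1) (by
    rw [ha, hb]; linear_combination (norm := module) -h0 • f)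
  obtain ⟨-, h5, -⟩ := li_three.1 hli x1 (-1) 0 (by
    rw [ha, neg_eq_zero.1 h2, neg_eq_zero.1 h4]; module)
  norm_num at h5

lemma wronskian_scalar {c0 c1 c2 c0' c1' c2' d0 d1 d2 d0' d1' d2' l l' s t : ℝ}
    (h1 : c1 * d2 = c2 * d1) (h2 : c1' * d2 + c1 * d2' = c2' * d1 + c2 * d1')
    (hne : c1 * c2' - c2 * c1' ≠ 0)
    (t0 : l' * c0 - l * c0' = s * d0 + t * d0') (t1 : l' * c1 - l * c1' = s * d1 + t * d1')
    (t2 : l' * c2 - l * c2' = s * d2 + t * d2') :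
    (l * d1) * (d0' * c1 + d0 * c1' - (c0' * d1 + c0 * d1')) =
      (l' * d1 + l * d1') * (d0 * c1 - c0 * d1) := by
  obtain ⟨a, ha1, ha2⟩ : ∃ a, d1 = a * c1 ∧ d2 = a * c2 := by
    by_cases hc1 : c1 = 0
    · have hc2 : c2 ≠ 0 := by rintro rfl; simp [hc1] at hne
      refine ⟨d2 / c2, ?_, by field_simp⟩
      subst hc1; have : d1 = 0 := by simpa [hc2] using h1
      simp [this]
    · exact ⟨d1 / c1, by field_simp, by field_simp; linarith⟩
  subst ha1 ha2; obtain ⟨g, hg1, hg2⟩ : ∃ g, d1' = a * c1' + g * c1 ∧ d2' = a * c2' + g * c2 := by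
    have h3 : c1 * (d2' - a * c2') = c2 * (d1' - a * c1') := by linarith
    by_cases hc1 : c1 = 0
    · have hc2 : c2 ≠ 0 := by rintro rfl; simp [hc1] at hne
      refine ⟨(d2' - a * c2') / c2, ?_, by field_simp; ring⟩
      subst hc1; have : d1' - a * c1' = 0 := by
        rw [zero_mul, eq_comm] at h3; exact (mul_eq_zero.1 h3).resolve_left hc2
      linarith
    · exact ⟨(d1' - a * c1') / c1, by field_simp; ring, by field_simp; linarith⟩
  subst hg1 hg2; have q1 : l' - s * a - t * g = 0 := by
    have : (l' - s * a - t * g) * (c1 * c2' - c2 * c1') = 0 := by linear_combination c2' * t1 - c1' * t2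
    exact (mul_eq_zero.1 this).resolve_right hne
  have q2 : l + t * a = 0 := by
    have : (l + t * a) * (c1 * c2' - c2 * c1') = 0 := by linear_combination c2 * t1 - c1 * t2
    exact (mul_eq_zero.1 this).resolve_right hne
  have hl : l = - (t * a) := by linarith
  have hl' : l' = s * a + t * g := by linarith
  subst hl hl'; linear_combination (-a ^ 2 * c1 ^ 2) * (-t0)

lemma exists_homology (hW : finrank ℝ W = 3) {c d : ℝ → W} {E E' : Submodule ℝ W}
    {B B' : W →ₗ[ℝ] W →ₗ[ℝ] ℝ} (hc : ConicData c E B) (hd : ConicData d E' B') {o : W} (ho : o ≠ 0)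
    {l : W →ₗ[ℝ] ℝ} (hl : l ≠ 0)
    (h1 : ∀ u ∈ I01, ¬ LI ![o, c u, d u]) {S : Set ℝ} (hS : S.Finite)
    (h2 : ∀ u ∈ I01, u ∉ S → ∃ s t : ℝ,
      l (deriv c u) • c u - l (c u) • deriv c u = s • d u + t • deriv d u) :
    ∃ k : ℝ, ∀ u ∈ I01, ¬ LI ![d u, c u + (k * l (c u)) • o] := by
  have hE : E = ⊤ := Submodule.eq_top_of_finrank_eq (by rw [hc.finrank, hW])
  have hE' : E' = ⊤ := Submodule.eq_top_of_finrank_eq (by rw [hd.finrank, hW])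
  obtain ⟨x, y, z, e, f, hxo, hyo, hzo, hw, hye⟩ := exists_coordinates hW ho
  have hle : ∃ e ∈ E, l e ≠ 0 := by
    by_contra! hcon
    exact hl (LinearMap.ext fun w => hcon w (hE ▸ Submodule.mem_top))
  have cs := hc.smooth; have ds := hd.smooth; have lc := contDiff_linear_comp l cs
  have xc := contDiff_linear_comp x cs; have yc := contDiff_linear_comp y cs
  have zc := contDiff_linear_comp z cs; have xd := contDiff_linear_comp x ds
  have yd := contDiff_linear_comp y ds; have zd := contDiff_linear_comp z ds
  have hD : ∀ {g : ℝ → ℝ}, ContDiff ℝ ∞ g → ∀ u, HasDerivAt g (deriv g u) u := fun hg u =>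
    (hg.differentiable (by simp) u).hasDerivAt
  have hpar : ∀ u ∈ I01, y (c u) * z (d u) - z (c u) * y (d u) = 0 := by
    intro u hu; obtain ⟨r, s, t, hr, hne⟩ := not_li_three.1 (h1 u hu)
    have e1 := congrArg y hr; have e2 := congrArg z hr
    simp only [map_add, map_smul, hyo, hzo, smul_eq_mul, mul_zero, zero_add, map_zero] at e1 e2
    by_cases hs : s = 0
    · have ht : t ≠ 0 := by
        rintro rfl; have : r ≠ 0 := by simpa [hs] using hne
        simp [hs, this, ho] at hr
      have e1' : y (d u) = 0 := by simpa [hs, ht] using e1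
      have e2' : z (d u) = 0 := by simpa [hs, ht] using e2
      rw [e1', e2']; ring
    · have : s * (y (c u) * z (d u) - z (c u) * y (d u)) = 0 := by
        linear_combination z (d u) * e1 - y (d u) * e2
      exact (mul_eq_zero.1 this).resolve_left hs
  have hpar' := deriv_eq_zero_of_eqOn ((yc.mul zd).sub (zc.mul yd)) hpar
  have hfin := hc.finite_tangents ho (hE ▸ Submodule.mem_top)
  have fs : ContDiff ℝ ∞ (fun u => l (c u) * y (d u)) := lc.mul yd
  have gs : ContDiff ℝ ∞ (fun u => x (d u) * y (c u) - x (c u) * y (d u)) :=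
    (xd.mul yc).sub (xc.mul yd)
  have fd : ∀ u, deriv (fun u => l (c u) * y (d u)) u =
      l (deriv c u) * y (d u) + l (c u) * y (deriv d u) := fun u => by
    rw [((hD lc u).fun_mul (hD yd u)).deriv, deriv_linear_comp l cs, deriv_linear_comp y ds]
  have gd : ∀ u, deriv (fun u => x (d u) * y (c u) - x (c u) * y (d u)) u =
      x (deriv d u) * y (c u) + x (d u) * y (deriv c u) -
        (x (deriv c u) * y (d u) + x (c u) * y (deriv d u)) := fun u => by
    rw [(((hD xd u).fun_mul (hD yc u)).fun_sub ((hD xc u).fun_mul (hD yd u))).deriv, deriv_linear_comp x ds,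
      deriv_linear_comp y cs, deriv_linear_comp x cs, deriv_linear_comp y ds]
  have hWr : ∀ u ∈ I01, u ∈ {u | (l (c u) * y (d u)) *
      deriv (fun u => x (d u) * y (c u) - x (c u) * y (d u)) u =
      deriv (fun u => l (c u) * y (d u)) u * (x (d u) * y (c u) - x (c u) * y (d u))} := by
    refine subset_of_isClosed_of_finite (isClosed_eq
      (fs.continuous.mul (contDiff_deriv gs).continuous)
      ((contDiff_deriv fs).continuous.mul gs.continuous)) (hS.union hfin) ?_
    intro u hu hnot; rw [mem_union, not_or] at hnot; have hli : LI ![o, c u, deriv c u] := by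
      by_contra hcon; exact hnot.2 ⟨hu, hcon⟩
    obtain ⟨s, t, hst⟩ := h2 u hu hnot.1
    have hp' : y (deriv c u) * z (d u) + y (c u) * z (deriv d u) -
        (z (deriv c u) * y (d u) + z (c u) * y (deriv d u)) = 0 := by
      have := (((hD yc u).mul (hD zd u)).sub ((hD zc u).mul (hD yd u))).deriv.symm.trans (hpar' u hu)
      rwa [deriv_linear_comp y cs, deriv_linear_comp z ds, deriv_linear_comp z cs,
        deriv_linear_comp y ds] at this
    show _ = _
    rw [fd, gd]; refine wronskian_scalar (c2 := z (c u)) (c2' := z (deriv c u)) (d2 := z (d u))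
      (d2' := z (deriv d u)) (s := s) (t := t) (by linarith [hpar u hu]) (by linarith) ?_ ?_ ?_ ?_
    · exact det_ne_zero_of_li hw hli
    · have := congrArg x hst; simpa using this
    · have := congrArg y hst; simpa using this
    · have := congrArg z hst; simpa using this
  obtain ⟨k, hk⟩ := exists_eq_const_mul_of_wronskian fs gs hWr fun u hu =>
    exists_iteratedDeriv_mul_ne lc yd (hc.exists_iteratedDeriv_ne hle hu)
      (hd.exists_iteratedDeriv_ne ⟨e, hE' ▸ Submodule.mem_top, hye⟩ hu)
  refine ⟨k, subset_of_isClosed_of_finite (isClosed_dep_two ds.continuous (cs.continuous.add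
    ((continuous_const.mul lc.continuous).smul continuous_const)))
    (hc.finite_zeros (l := y) ⟨e, hE ▸ Submodule.mem_top, hye⟩) ?_⟩
  intro u hu hnot; have hy : y (c u) ≠ 0 := fun h => hnot ⟨hu, h⟩
  have hoc : LI ![o, c u] := by
    rw [LinearIndependent.pair_iff' ho]; intro r hr; rw [← hr] at hy
    simp [hyo] at hy
  have h3 : ¬ LI ![d u, o, c u] := by
    obtain ⟨r, s, t, hr, hne⟩ := not_li_three.1 (h1 u hu)
    exact not_li_three.2 ⟨t, r, s, by rw [← hr]; module, by tauto⟩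
  obtain ⟨b, a, hab⟩ := exists_comb_of_not_li hoc h3; have hku := hk u hu
  simp only [hab, map_add, map_smul, hyo, hxo, smul_eq_mul, mul_zero, zero_add, mul_one] at hku
  have hb : b = k * l (c u) * a := by
    have : (b - k * l (c u) * a) * y (c u) = 0 := by linarith
    linarith [(mul_eq_zero.1 this).resolve_right hy]
  refine not_li_two.2 ⟨1, -a, ?_, Or.inl one_ne_zero⟩
  show (1:ℝ) • d u + _ = 0
  rw [hab, hb]; module

end Conics

/-! ### Smoothness of lifts -/

section Smooth

variable {F : Lift}

/-- Smoothness of a lift as a function of both parameters. -/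
def Lift.Smooth (F : Lift) : Prop := ContDiff ℝ ∞ (fun p : ℝ × ℝ => F p.1 p.2)

lemma Lift.Smooth.left (h : F.Smooth) (v : ℝ) : ContDiff ℝ ∞ (fun u => F u v) :=
  ContDiff.comp (g := fun p : ℝ × ℝ => F p.1 p.2) h (contDiff_id.prodMk contDiff_const)

lemma Lift.Smooth.right (h : F.Smooth) (u : ℝ) : ContDiff ℝ ∞ (fun v => F u v) :=
  ContDiff.comp (g := fun p : ℝ × ℝ => F p.1 p.2) h (contDiff_const.prodMk contDiff_id)

lemma Lift.Smooth.swap (h : F.Smooth) : F.swap.Smooth :=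
  ContDiff.comp (g := fun p : ℝ × ℝ => F p.1 p.2) h (contDiff_snd.prodMk contDiff_fst)

lemma Lift.Smooth.du (h : F.Smooth) : F.du.Smooth := by
  have h1 : ContDiff ℝ ∞ (fun p : ℝ × ℝ => fderiv ℝ (fun p : ℝ × ℝ => F p.1 p.2) p (1, 0)) :=
    (h.fderiv_right (m := ∞) (by simp)).clm_apply contDiff_const
  have h2 : (fun p : ℝ × ℝ => F.du p.1 p.2) =
      fun p : ℝ × ℝ => fderiv ℝ (fun p : ℝ × ℝ => F p.1 p.2) p (1, 0) := by
    ext1 p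
    have := (h.differentiable (by simp) p).hasFDerivAt.comp_hasDerivAt p.1
      ((hasDerivAt_id p.1).prodMk (hasDerivAt_const p.1 p.2))
    exact this.deriv
  rw [Lift.Smooth, h2]; exact h1

lemma Lift.Smooth.dv (h : F.Smooth) : F.dv.Smooth := (h.swap.du).swap

lemma isClosed_dep_three {W : Type*} [NormedAddCommGroup W] [NormedSpace ℝ W]
    [FiniteDimensional ℝ W] {c d e : ℝ → W}
    (hc : Continuous c) (hd : Continuous d) (he : Continuous e) :
    IsClosed {u | ¬ LI ![c u, d u, e u]} :=
  isClosed_dep (c := fun u => ![c u, d u, e u]) fun i => by fin_cases i <;> assumption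

lemma isClosed_dep_four {W : Type*} [NormedAddCommGroup W] [NormedSpace ℝ W]
    [FiniteDimensional ℝ W] {c d e f : ℝ → W}
    (hc : Continuous c) (hd : Continuous d) (he : Continuous e) (hf : Continuous f) :
    IsClosed {u | ¬ LI ![c u, d u, e u, f u]} :=
  isClosed_dep (c := fun u => ![c u, d u, e u, f u]) fun i => by fin_cases i <;> assumption

end Smooth

lemma dep_two_comm {W : Type*} [AddCommGroup W] [Module ℝ W] {a b : W}
    (h : ¬ LI ![a, b]) : ¬ LI ![b, a] := by
  obtain ⟨r, s, hrs, hne⟩ := not_li_two.1 h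
  exact not_li_two.2 ⟨s, r, by rw [add_comm]; exact hrs, hne.symm⟩

/-! ### Conic families -/

section Families

variable {F : Lift} {A : Submodule ℝ V}

lemma zero_mem_Icc : (0 : ℝ) ∈ I01 := by norm_num

lemma one_mem_Icc : (1 : ℝ) ∈ I01 := by norm_num

lemma Lift.mem_lineSpan (F : Lift) {u : ℝ} (v : ℝ) (hu : u ∈ I01) :
    F u v ∈ F.lineSpan v := subset_span ⟨u, hu, rfl⟩

lemma IsConicFamily.exists_data (h : IsConicFamily F A) (hF : F.Smooth) :
    ∃ S : Set ℝ, S.Finite ∧ 0 ∉ S ∧ 1 ∉ S ∧ ∀ v ∈ I01, v ∉ S →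
      (∃ B, ConicData (fun u => F u v) (F.lineSpan v) B) ∧ A ≤ F.lineSpan v ∧ ∃ a, F.IsApex v a := by
  obtain ⟨S, hS, hS', h1⟩ := h.lines; refine ⟨S, hS, fun h0 => by have := (hS' h0).1; simp at this,
    fun h0 => by have := (hS' h0).2; simp at this, fun v hv hvS => ?_⟩
  obtain ⟨h2, h3, h4⟩ := h1 v hv hvS; obtain ⟨E, B, h5⟩ := h2.exists_data (hF.left v)
  exact ⟨⟨B, by have := h5.span_eq; rw [show F.lineSpan v = E from this]; exact h5⟩, h3, h4⟩

lemma finrank_V : finrank ℝ V = 4 := by simp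

lemma IsConicFamily.inf_planes (h : IsConicFamily F A) (hF : F.Smooth) :
    F.lineSpan 0 ⊓ F.lineSpan 1 = A := by
  obtain ⟨S, hS, h0, h1, h2⟩ := h.exists_data hF; obtain ⟨⟨B, hB⟩, hA, -⟩ := h2 0 zero_mem_Icc h0
  obtain ⟨⟨B', hB'⟩, hA', -⟩ := h2 1 one_mem_Icc h1; symm
  refine Submodule.eq_of_le_of_finrank_eq (le_inf hA hA') ?_
  rw [h.axis]; have hlt : F.lineSpan 0 < F.lineSpan 0 ⊔ F.lineSpan 1 := by
    refine lt_of_le_of_ne le_sup_left fun he => h.planes_ne ?_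
    have : F.lineSpan 1 ≤ F.lineSpan 0 := le_sup_right.trans he.ge
    exact (Submodule.eq_of_le_of_finrank_eq this (by rw [hB.finrank, hB'.finrank])).symm
  have h3 := Submodule.finrank_lt_finrank_of_lt hlt
  have h4 := Submodule.finrank_le (F.lineSpan 0 ⊔ F.lineSpan 1)
  have h5 := Submodule.finrank_sup_add_finrank_inf_eq (F.lineSpan 0) (F.lineSpan 1)
  rw [hB.finrank] at h3 h5; rw [hB'.finrank] at h5; rw [finrank_V] at h4
  omega

end Families

/-! ### Projections along the axes -/

/-- `p` and `q` are the projections belonging to the decomposition `V = A ⊕ A'`. -/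
structure IsSplitting (A A' : Submodule ℝ V) (p q : V →ₗ[ℝ] V) : Prop where
  add : ∀ x, p x + q x = x
  mem_left : ∀ x, p x ∈ A
  mem_right : ∀ x, q x ∈ A'
  left_eq : ∀ x ∈ A, p x = x
  right_eq : ∀ x ∈ A', q x = x

namespace IsSplitting

variable {A A' : Submodule ℝ V} {p q : V →ₗ[ℝ] V}

lemma symm (h : IsSplitting A A' p q) : IsSplitting A' A q p :=
  ⟨fun x => by rw [add_comm, h.add], h.mem_right, h.mem_left, h.right_eq, h.left_eq⟩

lemma right_zero (h : IsSplitting A A' p q) {x : V} (hx : x ∈ A) : q x = 0 := by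
  have := h.add x; rwa [h.left_eq x hx, add_eq_left] at this

lemma left_zero (h : IsSplitting A A' p q) {x : V} (hx : x ∈ A') : p x = 0 := h.symm.right_zero hx

lemma mem_of_right_zero (h : IsSplitting A A' p q) {x : V} (hx : q x = 0) : x ∈ A := by
  have := h.add x; rw [hx, add_zero] at this; rw [← this]; exact h.mem_left x

end IsSplitting

lemma exists_isSplitting {A A' : Submodule ℝ V} (hA : finrank ℝ A = 2)
    (hA' : finrank ℝ A' = 2) (h : A ⊓ A' = ⊥) : ∃ p q, IsSplitting A A' p q := by
  have hs := Submodule.finrank_sup_add_finrank_inf_eq A A'; rw [h, finrank_bot, hA, hA'] at hs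
  have hc : IsCompl A A' := by
    refine ⟨disjoint_iff.2 h, codisjoint_iff.2 (Submodule.eq_top_of_finrank_eq ?_)⟩
    rw [finrank_V]; omega
  have h1 : ∀ x ∈ A, A.subtype (A.projectionOnto A' hc x) = x := fun x hx => by
    rw [Submodule.projectionOnto_apply_left hc ⟨x, hx⟩]; rfl
  have h2 : ∀ x ∈ A', A.subtype (A.projectionOnto A' hc x) = 0 := fun x hx => by
    rw [Submodule.projectionOnto_apply_right hc ⟨x, hx⟩]; rfl
  have hpA : ∀ x, A.subtype (A.projectionOnto A' hc x) ∈ A := fun x => (A.projectionOnto A' hc x).2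
  refine ⟨A.subtype ∘ₗ A.projectionOnto A' hc,
    LinearMap.id - A.subtype ∘ₗ A.projectionOnto A' hc, fun x => ?_, hpA, fun x => ?_,
    h1, fun x hx => ?_⟩
  · simp
  · obtain ⟨a, ha, b, hb, rfl⟩ := Submodule.mem_sup.1
      (show x ∈ A ⊔ A' by rw [hc.sup_eq_top]; trivial)
    simp only [LinearMap.sub_apply, LinearMap.id_apply, LinearMap.comp_apply, map_add]
    rw [h1 a ha, h2 b hb]; simpa using hb
  · simp only [LinearMap.sub_apply, LinearMap.id_apply, LinearMap.comp_apply]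
    rw [h2 x hx, sub_zero]

lemma exists_form_of_plane {A A' : Submodule ℝ V} {p q : V →ₗ[ℝ] V} (h : IsSplitting A A' p q)
    (hA : finrank ℝ A = 2) {P : Submodule ℝ V} (hP : finrank ℝ P = 3) (hAP : A ≤ P)
    {b : V} (hb : b ≠ 0) (hbA : b ∈ A') (hbP : b ∈ P) :
    ∃ w : V →ₗ[ℝ] ℝ, w b = 1 ∧ (∀ a ∈ A, w a = 0) ∧ ∀ x ∈ P, q x = w x • b := by
  have hbA' : b ∉ A := fun hbA2 => hb (by rw [← h.right_eq b hbA, h.right_zero hbA2])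
  obtain ⟨f, hf, hfA⟩ := exists_dual_ne hbA'
  refine ⟨(f b)⁻¹ • f, by simp [hf], fun a ha => by simp [hfA a ha], fun x hx => ?_⟩
  have hPe : A ⊔ span ℝ {b} = P := by
    refine Submodule.eq_of_le_of_finrank_le (sup_le hAP (by simpa using hbP)) ?_
    have hlt : A < A ⊔ span ℝ {b} := by
      refine lt_of_le_of_ne le_sup_left fun he => hbA' ?_
      rw [he]; exact Submodule.mem_sup_right (mem_span_singleton_self b)
    have := Submodule.finrank_lt_finrank_of_lt hlt; omega
  rw [← hPe, Submodule.mem_sup] at hx; obtain ⟨a, ha, y, hy, rfl⟩ := hx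
  obtain ⟨r, rfl⟩ := mem_span_singleton.1 hy
  rw [map_add, h.right_zero ha, map_smul, h.right_eq b hbA]
  simp only [LinearMap.smul_apply, map_add, hfA a ha, map_smul, smul_eq_mul, zero_add]
  congr 1
  field_simp
  ring

lemma exists_mem_of_plane {A A' : Submodule ℝ V} {p q : V →ₗ[ℝ] V} (h : IsSplitting A A' p q)
    (hA : finrank ℝ A = 2) {P : Submodule ℝ V} (hP : finrank ℝ P = 3) (hAP : A ≤ P) :
    ∃ b, b ≠ 0 ∧ b ∈ A' ∧ b ∈ P := by
  have : ¬ P ≤ A := fun hle => by have := Submodule.finrank_mono hle; omega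
  obtain ⟨x, hx, hxA⟩ := SetLike.not_le_iff_exists.1 this
  refine ⟨q x, fun h0 => hxA (h.mem_of_right_zero h0), h.mem_right x, ?_⟩
  have : q x = x - p x := eq_sub_of_add_eq' (h.add x); rw [this]
  exact P.sub_mem hx (hAP (h.mem_left x))

/-! ### The normal form of a supercyclidic patch -/

/-- The normal form of a supercyclidic patch with respect to its axes `A1`, `A2`. -/
structure NormalForm (F : Lift) (A1 A2 : Submodule ℝ V) (p1 p2 : V →ₗ[ℝ] V)
    (w1 w2 : V →ₗ[ℝ] ℝ) : Prop where
  family1 : IsConicFamily F A1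
  family2 : IsConicFamily F.swap A2
  splitting : IsSplitting A1 A2 p1 p2
  left_ne : p1 (F 0 0) ≠ 0
  right_ne : p2 (F 0 0) ≠ 0
  form1 : ∀ x ∈ F.lineSpan 0, p2 x = w1 x • p2 (F 0 0)
  form2 : ∀ x ∈ F.swap.lineSpan 0, p1 x = w2 x • p1 (F 0 0)
  zero1 : ∀ x ∈ A1, w1 x = 0
  zero2 : ∀ x ∈ A2, w2 x = 0
  dep : ∀ u ∈ I01, ∀ v ∈ I01,
    Dep ![F u v, w1 (F u 0) • p2 (F 0 v) + w2 (F 0 v) • p1 (F u 0)]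

lemma apex_mem_axis {F : Lift} {A2 : Submodule ℝ V} (hF : F.Smooth)
    (h2 : IsConicFamily F.swap A2) {v : ℝ} (hv : v ∈ I01) {a : V} (ha : F.IsApex v a) :
    a ∈ A2 := by
  obtain ⟨S, hS, h0, h1, h3⟩ := h2.exists_data hF.swap; rw [← h2.inf_planes hF.swap]
  have key : ∀ u ∈ I01, u ∉ S → a ∈ F.swap.lineSpan u := by
    intro u hu huS; obtain ⟨⟨B, hB⟩, -, -⟩ := h3 u hu huS
    obtain ⟨r, s, hrs⟩ := exists_comb_of_not_li (hB.immersed v hv) (ha.2 u hu)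
    rw [hrs]; exact Submodule.add_mem _ (Submodule.smul_mem _ _ (hB.mem v hv))
      (Submodule.smul_mem _ _ (hB.deriv_mem hv))
  exact ⟨key 0 zero_mem_Icc h0, key 1 one_mem_Icc h1⟩

lemma exists_homology_of_patch {F : Lift} (hF : F.Smooth) {A1 A2 : Submodule ℝ V}
    {p1 p2 : V →ₗ[ℝ] V} (hs : IsSplitting A1 A2 p1 p2) (h1 : IsConicFamily F A1)
    (h2 : IsConicFamily F.swap A2) {w2 : V →ₗ[ℝ] ℝ} {a0 : V} (ha0 : a0 ≠ 0)
    (hw2 : ∀ x ∈ F.swap.lineSpan 0, p1 x = w2 x • a0) (hw2' : ∀ x ∈ A2, w2 x = 0)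
    {S : Set ℝ} (hS0 : 0 ∉ S) (hS : ∀ u ∈ I01, u ∉ S →
      (∃ B, ConicData (fun v => F.swap v u) (F.swap.lineSpan u) B) ∧ A2 ≤ F.swap.lineSpan u)
    {u : ℝ} (hu : u ∈ I01) (huS : u ∉ S) :
    ∃ (α : V), α ∈ A1 ∧ ∀ v ∈ I01,
      Dep ![F u v, p2 (F 0 v) + w2 (F 0 v) • α] := by
  obtain ⟨⟨B, hB⟩, hA0⟩ := hS 0 zero_mem_Icc hS0; obtain ⟨⟨B', hB'⟩, hAu⟩ := hS u hu huS
  obtain ⟨α, hα, hα1, hα2⟩ := exists_mem_of_plane hs.symm h2.axis hB'.finrank hAu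
  obtain ⟨w, hwα, hwA, hw⟩ := exists_form_of_plane hs.symm h2.axis hB'.finrank hAu hα hα1 hα2
  let P : V →ₗ[ℝ] A2 := p2.codRestrict A2 hs.mem_right
  have hP : ∀ x, (P x : V) = p2 x := fun x => rfl
  let κ : V →ₗ[ℝ] A2 × ℝ := P.prod w2
  let κ' : V →ₗ[ℝ] A2 × ℝ := P.prod w
  have hκ : ∀ x ∈ F.swap.lineSpan 0, κ x = 0 → x = 0 := by
    intro x hx h0; have h3 : p2 x = 0 := by rw [← hP, show P x = 0 from congrArg Prod.fst h0]; rfl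
    have h4 : w2 x = 0 := congrArg Prod.snd h0; rw [← hs.add x, h3, hw2 x hx, h4]; simp
  have hκ' : ∀ x ∈ F.swap.lineSpan u, κ' x = 0 → x = 0 := by
    intro x hx h0; have h3 : p2 x = 0 := by rw [← hP, show P x = 0 from congrArg Prod.fst h0]; rfl
    have h4 : w x = 0 := congrArg Prod.snd h0; rw [← hs.add x, h3, hw x hx, h4]; simp
  obtain ⟨B1, hc⟩ := hB.map κ hκ; obtain ⟨B2, hd⟩ := hB'.map κ' hκ'
  obtain ⟨S1, hS1, -, -, h3⟩ := h1.exists_data hF; have hfr : finrank ℝ (A2 × ℝ) = 3 := by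
    rw [Module.finrank_prod, h2.axis]; simp
  have hA : ∀ v ∈ I01, ¬ LI
      ![((0 : A2), (1 : ℝ)), κ (F 0 v), κ' (F u v)] := by
    refine subset_of_isClosed_of_finite (isClosed_dep_three continuous_const hc.smooth.continuous
      hd.smooth.continuous) hS1 ?_
    intro v hv hvS; obtain ⟨⟨B3, hB3⟩, hA, -⟩ := h3 v hv hvS
    obtain ⟨β, hβ, hβ1, hβ2⟩ := exists_mem_of_plane hs h1.axis hB3.finrank hA
    obtain ⟨w', -, -, hw'⟩ := exists_form_of_plane hs h1.axis hB3.finrank hA hβ hβ1 hβ2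
    have e1 := hw' _ (F.mem_lineSpan v zero_mem_Icc); have e2 := hw' _ (F.mem_lineSpan v hu)
    have e1' : P (F 0 v) = w' (F 0 v) • ⟨β, hβ1⟩ := Subtype.ext e1
    have e2' : P (F u v) = w' (F u v) • ⟨β, hβ1⟩ := Subtype.ext e2
    show ¬ LI ![_, κ (F 0 v), κ' (F u v)]
    have e3 : κ (F 0 v) = (w' (F 0 v) • ⟨β, hβ1⟩, w2 (F 0 v)) := by rw [← e1']; rfl
    have e4 : κ' (F u v) = (w' (F u v) • ⟨β, hβ1⟩, w (F u v)) := by rw [← e2']; rfl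
    rw [e3, e4]; by_cases h0 : w' (F 0 v) = 0
    · exact not_li_three.2 ⟨w2 (F 0 v), -1, 0, by rw [h0]; ext <;> simp, by simp⟩
    · refine not_li_three.2 ⟨w' (F u v) * w2 (F 0 v) - w' (F 0 v) * w (F u v), -w' (F u v), w' (F 0 v), ?_, by simp [h0]⟩
      refine Prod.ext ?_ ?_
      · simp [smul_smul, mul_comm]
      · simp
        ring
  have hB0 : ∀ v ∈ I01, v ∉ S1 → ∃ s t : ℝ,
      w2 (deriv (fun v => F 0 v) v) • κ (F 0 v) - w2 (F 0 v) • κ (deriv (fun v => F 0 v) v) =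
        s • κ' (F u v) + t • κ' (deriv (fun v => F u v) v) := by
    intro v hv hvS; obtain ⟨-, -, a, ha⟩ := h3 v hv hvS; have haA := apex_mem_axis hF h2 hv ha
    obtain ⟨s, t, hst⟩ := exists_comb_of_not_li (hB.immersed v hv) (ha.2 0 zero_mem_Icc)
    obtain ⟨s', t', hst'⟩ := exists_comb_of_not_li (hB'.immersed v hv) (ha.2 u hu)
    have hκa : κ a = κ' a := by
      refine Prod.ext rfl ?_
      show w2 a = w a
      rw [hw2' a haA, hwA a haA]
    have e1 : κ a = s • κ (F 0 v) + t • κ (deriv (fun v => F 0 v) v) := by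
      conv_lhs => rw [hst]
      rw [map_add, map_smul, map_smul]; rfl
    have e2 : κ a = s' • κ' (F u v) + t' • κ' (deriv (fun v => F u v) v) := by
      rw [hκa]
      conv_lhs => rw [hst']
      rw [map_add, map_smul, map_smul]; rfl
    have e3 : s * w2 (F 0 v) + t * w2 (deriv (fun v => F 0 v) v) = 0 := by
      have h5 : (κ a).2 = 0 := hw2' a haA; rw [e1] at h5; exact h5
    have hst0 : s ≠ 0 ∨ t ≠ 0 := by
      by_contra! hcon
      refine ha.1 ?_
      rw [hst, hcon.1, hcon.2]; simp
    obtain ⟨m, hm1, hm2⟩ : ∃ m, w2 (deriv (fun v => F 0 v) v) = m * s ∧ - w2 (F 0 v) = m * t := by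
      rcases hst0 with h0 | h0
      · refine ⟨w2 (deriv (fun v => F 0 v) v) / s, by field_simp, ?_⟩
        field_simp; linarith
      · refine ⟨- w2 (F 0 v) / t, ?_, by field_simp⟩
        field_simp; linarith
    refine ⟨m * s', m * t', ?_⟩
    have : m • κ a = m • κ a := rfl
    conv_lhs at this => rw [e1]
    conv_rhs at this => rw [e2]
    linear_combination (norm := module) this + hm1 • κ (F 0 v) +
      hm2 • κ (deriv (fun v => F 0 v) v)
  obtain ⟨k, hk⟩ := exists_homology hfr hc hd (o := ((0 : A2), (1 : ℝ))) (by simp)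
    (l := LinearMap.snd ℝ A2 ℝ) (fun h0 => by
      have := LinearMap.congr_fun h0 (0, 1); simp at this) hA hS1 (fun v hv hvS => by
        have d1 : deriv (fun v => κ (F.swap v 0)) v = κ (deriv (fun v => F 0 v) v) :=
          deriv_linear_comp κ hB.smooth v
        have d2 : deriv (fun v => κ' (F.swap v u)) v = κ' (deriv (fun v => F u v) v) :=
          deriv_linear_comp κ' hB'.smooth v
        rw [d1, d2]; exact hB0 v hv hvS)
  refine ⟨(1 + k) • α, A1.smul_mem _ hα1, fun v hv => ?_⟩
  obtain ⟨r, s, hrs, hne⟩ := not_li_two.1 (hk v hv)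
  have e1 : r • p2 (F u v) + s • p2 (F 0 v) = 0 := by
    have := congrArg (fun z => ((Prod.fst z : A2) : V)) hrs
    simpa [κ, κ', hP, Lift.swap] using this
  have e2 : r * w (F u v) + s * (w2 (F 0 v) + k * w2 (F 0 v)) = 0 := by
    have := congrArg Prod.snd hrs; simpa [κ, κ', Lift.swap] using this
  refine not_li_two.2 ⟨r, s, ?_, hne⟩
  show r • F u v + s • (p2 (F 0 v) + w2 (F 0 v) • (1 + k) • α) = 0
  rw [← hs.add (F u v), hw (F u v) (F.swap.mem_lineSpan u hv)]
  linear_combination (norm := module) e1 + e2 • α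

lemma left_ne_of_homology {F : Lift} (hF : F.Smooth) {A1 A2 : Submodule ℝ V}
    {p1 p2 : V →ₗ[ℝ] V} (hs : IsSplitting A1 A2 p1 p2) (h1 : IsConicFamily F A1)
    (h2 : IsConicFamily F.swap A2) : p1 (F 0 0) ≠ 0 := by
  intro h0; obtain ⟨S, hS, hS0, hS1, hS2⟩ := h2.exists_data hF.swap
  obtain ⟨T, hT, hT0, hT1, hT2⟩ := h1.exists_data hF
  obtain ⟨⟨B, hB⟩, hA, -⟩ := hS2 0 zero_mem_Icc hS0
  obtain ⟨⟨B', hB'⟩, -, -⟩ := hT2 0 zero_mem_Icc hT0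
  obtain ⟨a, ha, ha1, ha2⟩ := exists_mem_of_plane hs.symm h2.axis hB.finrank hA
  obtain ⟨w, hwa, hwA, hw⟩ := exists_form_of_plane hs.symm h2.axis hB.finrank hA ha ha1 ha2
  have hw0 : w (F 0 0) = 0 := by
    have := hw _ (F.swap.mem_lineSpan 0 zero_mem_Icc)
    rw [show F.swap 0 0 = F 0 0 from rfl, h0] at this
    exact (smul_eq_zero.1 this.symm).resolve_right ha
  have hp : p2 (F 0 0) = F 0 0 := by
    have := hs.add (F 0 0); rwa [h0, zero_add] at this
  obtain ⟨α, hα, h3⟩ := exists_homology_of_patch hF hs h1 h2 ha hw hwA hS0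
    (fun u hu huS => ⟨(hS2 u hu huS).1, (hS2 u hu huS).2.1⟩) one_mem_Icc hS1
  have h4 := h3 0 zero_mem_Icc; rw [hw0, zero_smul, add_zero, hp] at h4
  exact h4 (hB'.injective 1 one_mem_Icc 0 zero_mem_Icc one_ne_zero)

lemma IsSCPatch.exists_normalForm {F : Lift} (h : IsSCPatch F) :
    ∃ A1 A2 p1 p2 w1 w2, NormalForm F A1 A2 p1 p2 w1 w2 := by
  obtain ⟨A1, A2, h1, h2, h3⟩ := h.conics; have hF : F.Smooth := h.smooth
  obtain ⟨p1, p2, hs⟩ := exists_isSplitting h1.axis h2.axis h3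
  have ha0 := left_ne_of_homology hF hs h1 h2
  have hb0 : p2 (F 0 0) ≠ 0 := left_ne_of_homology hF.swap hs.symm h2 h1
  obtain ⟨S, hS, hS0, hS1, hS2⟩ := h2.exists_data hF.swap
  obtain ⟨T, hT, hT0, hT1, hT2⟩ := h1.exists_data hF
  obtain ⟨⟨B, hB⟩, hA, -⟩ := hS2 0 zero_mem_Icc hS0
  obtain ⟨⟨B', hB'⟩, hA', -⟩ := hT2 0 zero_mem_Icc hT0
  have ha0' : p1 (F 0 0) ∈ F.swap.lineSpan 0 := by
    rw [eq_sub_of_add_eq (hs.add (F 0 0))]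
    exact Submodule.sub_mem _ (F.swap.mem_lineSpan 0 zero_mem_Icc) (hA (hs.mem_right _))
  have hb0' : p2 (F 0 0) ∈ F.lineSpan 0 := by
    rw [eq_sub_of_add_eq' (hs.add (F 0 0))]
    exact Submodule.sub_mem _ (F.mem_lineSpan 0 zero_mem_Icc) (hA' (hs.mem_left _))
  obtain ⟨w2, hw2a, hw2A, hw2⟩ := exists_form_of_plane hs.symm h2.axis hB.finrank hA ha0
    (hs.mem_left _) ha0'
  obtain ⟨w1, hw1b, hw1A, hw1⟩ := exists_form_of_plane hs h1.axis hB'.finrank hA' hb0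
    (hs.mem_right _) hb0'
  have hw20 : w2 (F 0 0) = 1 := by
    conv_lhs => rw [← hs.add (F 0 0)]
    rw [map_add, hw2a, hw2A _ (hs.mem_right _), add_zero]
  refine ⟨A1, A2, p1, p2, w1, w2, h1, h2, hs, ha0, hb0, hw1, hw2, hw1A, hw2A, ?_⟩
  intro u hu v hv; refine subset_of_isClosed_of_finite (P := {u | Dep ![F u v,
    w1 (F u 0) • p2 (F 0 v) + w2 (F 0 v) • p1 (F u 0)]}) ?_ hS ?_ u hu
  · refine isClosed_dep_two (hF.left v).continuous ?_
    have e1 := (hF.left 0).continuous; have e2 := w1.continuous_of_finiteDimensional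
    have e3 := p1.continuous_of_finiteDimensional; fun_prop
  · intro u hu huS; obtain ⟨α, hα, h4⟩ := exists_homology_of_patch hF hs h1 h2 ha0 hw2 hw2A hS0
      (fun u hu huS => ⟨(hS2 u hu huS).1, (hS2 u hu huS).2.1⟩) hu huS
    have h5 := h4 0 zero_mem_Icc; rw [hw20, one_smul] at h5; have hne : p2 (F 0 0) + α ≠ 0 := by
      intro h0; refine hb0 ?_; have := congrArg p2 h0
      rwa [map_add, hs.right_eq _ (hs.mem_right _), hs.right_zero hα, add_zero, map_zero] at this
    obtain ⟨r, hr⟩ := exists_smul_of_not_li hne (dep_two_comm h5)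
    have e1 : p1 (F u 0) = r • α := by
      rw [hr, map_smul, map_add, hs.left_zero (hs.mem_right _), hs.left_eq _ hα, zero_add]
    have e2 : w1 (F u 0) = r := by
      rw [hr, map_smul, map_add, hw1b, hw1A _ hα, smul_eq_mul, add_zero, mul_one]
    obtain ⟨s, t, hst, hne'⟩ := not_li_two.1 (h4 v hv); have hr0 : r ≠ 0 := by
      rintro rfl; rw [zero_smul] at hr; exact hB'.ne_zero hu hr
    refine not_li_two.2 ⟨r * s, t, ?_, by simpa [hr0] using hne'⟩
    rw [e1, e2]; linear_combination (norm := module) r • hst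

/-! ### Corresponding boundary curves of fundamental transforms -/

lemma exists_comb_of_mem_planes {P P' : Submodule ℝ V} (hP : finrank ℝ P = 3)
    (hP' : finrank ℝ P' = 3) (hne : P ≠ P') {x y z : V} (hxy : LI ![x, y])
    (hx : x ∈ P) (hx' : x ∈ P') (hy : y ∈ P) (hy' : y ∈ P') (hz : z ∈ P) (hz' : z ∈ P') :
    ∃ r s : ℝ, z = r • x + s • y := by
  refine exists_comb_of_not_li hxy fun hli => hne ?_
  rw [← span_range_eq_of_mem hli hP (by intro i; fin_cases i <;> assumption),
    ← span_range_eq_of_mem hli hP' (by intro i; fin_cases i <;> assumption)]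

lemma exists_projection {o : V} (ho : o ≠ 0) : ∃ π : V →ₗ[ℝ] (Fin 3 → ℝ),
    (∀ x, π x = 0 ↔ ∃ r : ℝ, x = r • o) ∧
    ∀ f : V →ₗ[ℝ] ℝ, f o = 0 → ∃ l : (Fin 3 → ℝ) →ₗ[ℝ] ℝ, ∀ x, l (π x) = f x := by
  have h1 : finrank ℝ (V ⧸ span ℝ {o}) = finrank ℝ (Fin 3 → ℝ) := by
    have := (span ℝ {o}).finrank_quotient_add_finrank
    rw [finrank_span_singleton ho, finrank_V] at this; simp; omega
  let φ := LinearEquiv.ofFinrankEq _ _ h1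
  refine ⟨φ.toLinearMap ∘ₗ (span ℝ {o}).mkQ, fun x => ?_, fun f hf => ?_⟩
  · rw [LinearMap.comp_apply, LinearEquiv.coe_coe, LinearEquiv.map_eq_zero_iff,
      Submodule.mkQ_apply, Submodule.Quotient.mk_eq_zero, mem_span_singleton]
    simp only [eq_comm]
  · refine ⟨((span ℝ {o}).liftQ f ?_) ∘ₗ φ.symm.toLinearMap, fun x => ?_⟩
    · rw [Submodule.span_singleton_le_iff_mem]; exact hf
    · simp

section Edge

variable {c d : ℝ → V} {P P' Q : Submodule ℝ V} {B B' : V →ₗ[ℝ] V →ₗ[ℝ] ℝ} {a a' : V}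

lemma exists_center (hc : ConicData c P B) (hd : ConicData d P' B')
    (h1 : ∀ u ∈ I01, Dep ![c u, a, d u, a'])
    (h2 : ∀ u ∈ I01, Dep ![c u, deriv c u, d u, deriv d u])
    (hQ : finrank ℝ Q = 3) (hc0 : c 0 ∈ Q) (hc1 : c 1 ∈ Q) (hd0 : d 0 ∈ Q) (hd1 : d 1 ∈ Q)
    (l1 : LI ![c 0, c 1, d 0]) (l2 : LI ![c 0, c 1, d 1])
    (l3 : LI ![c 0, d 0, d 1]) (l4 : LI ![c 1, d 0, d 1])
    (hPQ : P ≠ Q) (hPQ' : P' ≠ Q) (ha : a ∉ Q) (haa : LI ![a, a']) :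
    ∃ O : V, (∃ r s : ℝ, O = r • c 0 + s • d 0) ∧ (∃ r s : ℝ, O = r • c 1 + s • d 1) ∧
      O ∉ P ∧ O ∉ P' ∧ ∀ u ∈ I01, ∃ r s : ℝ, d u = r • c u + s • O := by
  have m0 := zero_mem_Icc; have m1 := one_mem_Icc; rw [li_three] at l1 l2 l3 l4
  have key : ∀ u ∈ B01, ∃ O : V, O ≠ 0 ∧ (∃ r s : ℝ, O = r • c u + s • d u) ∧
      ∃ r s : ℝ, O = r • a + s • a' := by
    intro u hu; have hu' : u ∈ I01 := by rcases hu with rfl | rfl <;> assumption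
    obtain ⟨r, s, t, k, hrs, hne⟩ := not_li_four.1 (h1 u hu')
    refine ⟨r • c u + t • d u, fun h0 => ?_, ⟨r, t, rfl⟩, -s, -k, by
      linear_combination (norm := module) hrs⟩
    have hli : LI ![c u, d u] := by
      rw [li_two]; intro r s hrs
      rcases hu with rfl | rfl
      · have := l1 r 0 s (by linear_combination (norm := module) hrs); tauto
      · have := l2 0 r s (by linear_combination (norm := module) hrs); tauto
    have e1 := (li_two.1 hli) _ _ h0
    have e2 := (li_two.1 haa) s k (by linear_combination (norm := module) hrs - h0)
    rw [e1.1, e1.2, e2.1, e2.2] at hne; simp at hne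
  obtain ⟨O, hO, ⟨r0, s0, hO0⟩, α, α', hOa⟩ := key 0 (by simp)
  obtain ⟨O', hO', ⟨r1, s1, hO1⟩, β, β', hOa'⟩ := key 1 (by simp)
  have hOQ : O ∈ Q := hO0 ▸ Q.add_mem (Q.smul_mem _ hc0) (Q.smul_mem _ hd0)
  have hOQ' : O' ∈ Q := hO1 ▸ Q.add_mem (Q.smul_mem _ hc1) (Q.smul_mem _ hd1)
  have hα' : α' ≠ 0 := by
    rintro rfl; rw [zero_smul, add_zero] at hOa; have : α ≠ 0 := by rintro rfl; simp [hOa] at hO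
    rw [hOa] at hOQ; exact ha ((Q.smul_mem_iff this).1 hOQ)
  have hβ' : β' ≠ 0 := by
    rintro rfl; rw [zero_smul, add_zero] at hOa'; have : β ≠ 0 := by rintro rfl; simp [hOa'] at hO'
    rw [hOa'] at hOQ'; exact ha ((Q.smul_mem_iff this).1 hOQ')
  have hdet : β' * α = α' * β := by
    by_contra hne; have : β' • O - α' • O' = (β' * α - α' * β) • a := by rw [hOa, hOa']; module
    refine ha ((Q.smul_mem_iff (sub_ne_zero.2 hne)).1 ?_)
    rw [← this]; exact Q.sub_mem (Q.smul_mem _ hOQ) (Q.smul_mem _ hOQ')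
  have hOO' : O = (α' / β') • O' := by
    have : β' • O = α' • O' := by
      rw [hOa, hOa']; linear_combination (norm := module) hdet • a
    rw [div_eq_inv_mul, mul_smul, ← this, smul_smul, inv_mul_cancel₀ hβ', one_smul]
  obtain ⟨r1', s1', hO1'⟩ : ∃ r s : ℝ, O = r • c 1 + s • d 1 :=
    ⟨α' / β' * r1, α' / β' * s1, by rw [hOO', hO1]; module⟩
  have hOP : O ∉ P := by
    intro hOP; obtain ⟨r, s, hrs⟩ := exists_comb_of_mem_planes hc.finrank hQ hPQ
      (hc.injective 0 m0 1 m1 zero_ne_one) (hc.mem 0 m0) hc0 (hc.mem 1 m1) hc1 hOP hOQ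
    have e1 := l1 (r - r0) s (-s0) (by linear_combination (norm := module) hO0 - hrs)
    have e2 := l2 r (s - r1') (-s1') (by linear_combination (norm := module) hO1' - hrs)
    rw [e1.2.1, e2.1] at hrs; exact hO (by rw [hrs]; simp)
  have hOP' : O ∉ P' := by
    intro hOP; obtain ⟨r, s, hrs⟩ := exists_comb_of_mem_planes hd.finrank hQ hPQ'
      (hd.injective 0 m0 1 m1 zero_ne_one) (hd.mem 0 m0) hd0 (hd.mem 1 m1) hd1 hOP hOQ
    have e1 := l3 r0 (s0 - r) (-s) (by linear_combination (norm := module) hrs - hO0)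
    rw [e1.1] at hO0
    have e2 := l4 r1' (-s0) s1' (by linear_combination (norm := module) hO0 - hO1')
    exact hO (by rw [hO0, neg_eq_zero.1 e2.2.1]; simp)
  refine ⟨O, ⟨r0, s0, hO0⟩, ⟨r1', s1', hO1'⟩, hOP, hOP', ?_⟩
  obtain ⟨π, hπ, hπl⟩ := exists_projection hO; have hπO : π O = 0 := (hπ O).2 ⟨1, by simp⟩
  have hr0 : r0 ≠ 0 := by
    rintro rfl; exact hOP' (by rw [hO0]; simpa using P'.smul_mem s0 (hd.mem 0 m0))
  have hs0 : s0 ≠ 0 := by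
    rintro rfl; exact hOP (by rw [hO0]; simpa using P.smul_mem r0 (hc.mem 0 m0))
  have hx : c 0 ∉ (P ⊓ P') ⊔ span ℝ {O} := by
    intro hx; obtain ⟨z, hz, y, hy, hzy⟩ := Submodule.mem_sup.1 hx
    obtain ⟨r, rfl⟩ := mem_span_singleton.1 hy; have hr : r = 0 := by
      by_contra hr; refine hOP ((P.smul_mem_iff hr).1 ?_); rw [← add_sub_cancel_left z (r • O), hzy]
      exact P.sub_mem (hc.mem 0 m0) hz.1
    have hx' : c 0 ∈ P' := by rw [← hzy, hr, zero_smul, add_zero]; exact hz.2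
    obtain ⟨r, s, hrs⟩ := exists_comb_of_mem_planes hd.finrank hQ hPQ'
      (hd.injective 0 m0 1 m1 zero_ne_one) (hd.mem 0 m0) hd0 (hd.mem 1 m1) hd1 hx' hc0
    have := l3 1 (-r) (-s) (by rw [hrs]; module)
    exact one_ne_zero this.1
  obtain ⟨f, hf, hfE⟩ := exists_dual_ne hx
  have hfO : f O = 0 := hfE _ (Submodule.mem_sup_right (mem_span_singleton_self O))
  have hfP : ∀ z ∈ P, z ∈ P' → f z = 0 := fun z hz hz' => hfE _ (Submodule.mem_sup_left ⟨hz, hz'⟩)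
  obtain ⟨l, hl⟩ := hπl f hfO
  have hinj : ∀ {E : Submodule ℝ V}, O ∉ E → ∀ e ∈ E, π e = 0 → e = 0 := by
    intro E hE e he h0; obtain ⟨r, hr⟩ := (hπ e).1 h0; by_cases hr0 : r = 0
    · rw [hr, hr0, zero_smul]
    · exact absurd ((E.smul_mem_iff hr0).1 (hr ▸ he)) hE
  obtain ⟨B1, hc'⟩ := hc.map π (hinj hOP); obtain ⟨B2, hd'⟩ := hd.map π (hinj hOP')
  have hπa : π a' = (-α / α') • π a := by
    have : α • π a + α' • π a' = 0 := by rw [← map_smul, ← map_smul, ← map_add, ← hOa, hπO]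
    rw [div_eq_inv_mul, mul_smul, eq_inv_smul_iff₀ hα']; linear_combination (norm := module) this
  have hπa0 : π a ≠ 0 := by
    intro h0; obtain ⟨r, hr⟩ := (hπ a).1 h0; exact ha (hr ▸ Q.smul_mem r hOQ)
  obtain ⟨k, hk⟩ := exists_homology (by simp) hc' hd' (o := π a) hπa0 (l := l)
    (by rintro rfl; exact hf (by rw [← hl]; simp)) (fun u hu => by
      obtain ⟨r, s, t, k, hrs, hne⟩ := not_li_four.1 (h1 u hu); have := congrArg π hrs
      simp only [map_add, map_smul, hπa, map_zero] at this
      refine not_li_three.2 ⟨s + k * (-α / α'), r, t, by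
        linear_combination (norm := module) this, ?_⟩
      by_contra! hcon
      obtain ⟨hs, rfl, rfl⟩ := hcon
      have := (li_two.1 haa) s k (by linear_combination (norm := module) hrs)
      simp [this.1, this.2] at hne) (Set.finite_empty) (fun u hu _ => by
      rw [deriv_linear_comp π hc.smooth, deriv_linear_comp π hd.smooth, hl, hl]
      obtain ⟨r, s, t, k, hrs, hne⟩ := not_li_four.1 (h2 u hu)
      have hz1 : r • c u + s • deriv c u ∈ P :=
        P.add_mem (P.smul_mem _ (hc.mem u hu)) (P.smul_mem _ (hc.deriv_mem hu))
      have hz2 : r • c u + s • deriv c u ∈ P' := by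
        rw [show r • c u + s • deriv c u = (-t) • d u + (-k) • deriv d u by
          linear_combination (norm := module) hrs]
        exact P'.add_mem (P'.smul_mem _ (hd.mem u hu)) (P'.smul_mem _ (hd.deriv_mem hu))
      have e1 := hfP _ hz1 hz2; rw [map_add, map_smul, map_smul, smul_eq_mul, smul_eq_mul] at e1
      have hrs0 : r ≠ 0 ∨ s ≠ 0 := by
        by_contra! hcon
        have := (li_two.1 (hd.immersed u hu)) t k (by
          rw [hcon.1, hcon.2] at hrs; linear_combination (norm := module) hrs)
        simp [hcon.1, hcon.2, this.1, this.2] at hne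
      obtain ⟨m, hm1, hm2⟩ : ∃ m, f (deriv c u) = m * r ∧ - f (c u) = m * s := by
        rcases hrs0 with h0 | h0
        · refine ⟨f (deriv c u) / r, by field_simp, ?_⟩
          field_simp; linarith
        · refine ⟨- f (c u) / s, ?_, by field_simp⟩
          field_simp; linarith
      refine ⟨-(m * t), -(m * k), ?_⟩
      have e2 := congrArg π hrs; simp only [map_add, map_smul, map_zero] at e2
      linear_combination (norm := module) m • e2 + hm1 • π (c u) + hm2 • π (deriv c u))
  have hk0 : k = 0 := by
    obtain ⟨r, s, hrs, hne⟩ := not_li_two.1 (hk 0 m0)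
    have e1 : r0 • π (c 0) + s0 • π (d 0) = 0 := by
      rw [← map_smul, ← map_smul, ← map_add, ← hO0, hπO]
    have e3 : (s0 * s - r * r0) • π (c 0) + (s0 * s * (k * l (π (c 0)))) • π a = 0 := by
      linear_combination (norm := module) s0 • hrs - r • e1
    have e4 : LI ![π (c 0), π a] := by
      rw [li_two]; intro x y hxy; rw [← map_smul, ← map_smul, ← map_add] at hxy
      obtain ⟨t, ht⟩ := (hπ _).1 hxy; have hy : y = 0 := by
        by_contra hy; refine ha ((Q.smul_mem_iff hy).1 ?_)
        rw [← add_sub_cancel_left (x • c 0) (y • a), ht]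
        exact Q.sub_mem (Q.smul_mem _ hOQ) (Q.smul_mem _ hc0)
      refine ⟨?_, hy⟩
      have := (li_two.1 (show LI ![c 0, d 0] from by
        rw [li_two]; intro r s hrs
        have := l1 r 0 s (by linear_combination (norm := module) hrs); tauto))
        (x - t * r0) (-t * s0) (by
          rw [hy, hO0] at ht; linear_combination (norm := module) ht)
      have ht0 : t = 0 := by
        have := this.2; simpa [hs0] using this
      have := this.1; rw [ht0] at this; simpa using this
    obtain ⟨e5, e6⟩ := (li_two.1 e4) _ _ e3; rw [hl] at e6; by_contra hk0
    have hs' : s = 0 := by simpa [hs0, hk0, hf] using e6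
    rw [hs'] at e5 hne; have hr' : r = 0 := by simpa [hr0] using e5
    simp [hr'] at hne
  intro u hu; obtain ⟨r, s, hrs, hne⟩ := not_li_two.1 (hk u hu)
  rw [hk0, zero_mul, zero_smul, add_zero, ← map_smul, ← map_smul, ← map_add] at hrs
  obtain ⟨t, ht⟩ := (hπ _).1 hrs; have hr : r ≠ 0 := by
    rintro rfl; rw [zero_smul, zero_add] at hrs; have := hinj hOP _ (P.smul_mem s (hc.mem u hu)) hrs
    have := (smul_eq_zero.1 this).resolve_right (hc.ne_zero hu); simp [this] at hne
  refine ⟨-(r⁻¹ * s), r⁻¹ * t, ?_⟩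
  have : d u = r⁻¹ • (r • d u) := by rw [smul_smul, inv_mul_cancel₀ hr, one_smul]
  rw [this, ← add_sub_cancel_right (r • d u) (s • c u), ht]; module

end Edge

/-! ### Intersections of lines in a four-dimensional space with a hyperplane -/

/-- Homogeneous coordinates of a four-dimensional projective space that contains the projective
space of `V` as the hyperplane `x.2 = 0`. -/
abbrev Hat : Type := V × ℝ

/-- The intersection of the line through `x` and `y` with the hyperplane `V`. -/
def meet : Hat →ₗ[ℝ] Hat →ₗ[ℝ] V :=
  LinearMap.mk₂ ℝ (fun x y => x.2 • y.1 - y.2 • x.1)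
    (fun x x' y => by simp only [Prod.snd_add, Prod.fst_add]; module)
    (fun r x y => by simp only [Prod.smul_snd, Prod.smul_fst, smul_eq_mul]; module)
    (fun x y y' => by simp only [Prod.snd_add, Prod.fst_add]; module)
    (fun r x y => by simp only [Prod.smul_snd, Prod.smul_fst, smul_eq_mul]; module)

lemma meet_apply (x y : Hat) : meet x y = x.2 • y.1 - y.2 • x.1 := rfl

lemma meet_self (x : Hat) : meet x x = 0 := by rw [meet_apply, sub_self]

lemma meet_comm (x y : Hat) : meet x y = - meet y x := by simp only [meet_apply]; module

lemma plucker (x y z : Hat) : x.2 • meet y z + y.2 • meet z x + z.2 • meet x y = 0 := by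
  simp only [meet_apply]; module

lemma inl_meet (x y : Hat) : ((meet x y, 0) : Hat) = x.2 • y - y.2 • x := by
  ext1
  · rfl
  · simp [mul_comm]

/-- The points of a subspace in the hyperplane `V`. -/
def trace (K : Submodule ℝ Hat) : Submodule ℝ V := K.comap (LinearMap.inl ℝ V ℝ)

lemma mem_trace {K : Submodule ℝ Hat} {x : V} : x ∈ trace K ↔ ((x, 0) : Hat) ∈ K := Iff.rfl

lemma meet_mem_trace {K : Submodule ℝ Hat} {x y : Hat} (hx : x ∈ K) (hy : y ∈ K) :
    meet x y ∈ trace K := by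
  rw [mem_trace, inl_meet]; exact K.sub_mem (K.smul_mem _ hy) (K.smul_mem _ hx)

lemma finrank_trace_lt {K : Submodule ℝ Hat} {x : Hat} (hx : x ∈ K) (h : x.2 ≠ 0) :
    finrank ℝ (trace K) < finrank ℝ K := by
  have hinj : Function.Injective (LinearMap.inl ℝ V ℝ) := LinearMap.inl_injective
  have h1 : finrank ℝ ((trace K).map (LinearMap.inl ℝ V ℝ)) = finrank ℝ (trace K) :=
    (Submodule.equivMapOfInjective _ hinj _).finrank_eq.symm
  rw [← h1]
  refine Submodule.finrank_lt_finrank_of_lt (lt_of_le_of_ne (Submodule.map_comap_le _ _) fun he => ?_)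
  rw [← he] at hx; obtain ⟨y, -, rfl⟩ := hx; exact h rfl

lemma not_li_of_meet {n : ℕ} {K : Submodule ℝ Hat} (hK : finrank ℝ K ≤ n + 1)
    {x y : Fin (n + 1) → Hat} (hx : ∀ i, x i ∈ K) (hy : ∀ i, y i ∈ K) :
    ¬ LI (fun i => meet (x i) (y i)) := by
  by_cases h : ∃ z ∈ K, z.2 ≠ 0
  · obtain ⟨z, hz, hz2⟩ := h; have := finrank_trace_lt hz hz2
    exact not_li_of_finrank_lt (E := trace K) (fun i => meet_mem_trace (hx i) (hy i)) (by omega)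
  · push Not at h; intro hli; refine hli.ne_zero 0 ?_
    rw [meet_apply, h _ (hx 0), h _ (hy 0), zero_smul, zero_smul, sub_zero]

lemma finrank_span_four_le (a b c d : Hat) :
    finrank ℝ (span ℝ (range ![a, b, c, d])) ≤ 4 := by
  exact (finrank_range_le_card (R := ℝ) ![a, b, c, d]).trans (by simp)

lemma not_li_meet_four {K : Submodule ℝ Hat} (hK : finrank ℝ K ≤ 4)
    {a b c d a' b' c' d' : Hat} (ha : a ∈ K) (hb : b ∈ K) (hc : c ∈ K) (hd : d ∈ K)
    (ha' : a' ∈ K) (hb' : b' ∈ K) (hc' : c' ∈ K) (hd' : d' ∈ K) :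
    Dep ![meet a a', meet b b', meet c c', meet d d'] := by
  have := not_li_of_meet (n := 3) hK (x := ![a, b, c, d]) (y := ![a', b', c', d'])
    (by intro i; fin_cases i <;> assumption) (by intro i; fin_cases i <;> assumption)
  convert this using 2
  ext i; fin_cases i <;> rfl

lemma trace_eq_span {K : Submodule ℝ Hat} {a b c : Hat}
    (hK : span ℝ (range ![a, b, c]) = K) (ha : a.2 ≠ 0) :
    trace K = span ℝ (range ![meet a b, meet a c]) := by
  have hm : a ∈ K ∧ b ∈ K ∧ c ∈ K := by
    subst hK; exact ⟨subset_span ⟨0, rfl⟩, subset_span ⟨1, rfl⟩, subset_span ⟨2, rfl⟩⟩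
  apply le_antisymm
  · intro x hx; rw [mem_trace, ← hK, mem_span_triple] at hx; obtain ⟨r, s, t, h⟩ := hx
    have h1 : a.2 • x = s • meet a b + t • meet a c := by
      have : meet a (x, 0) = a.2 • x := by simp [meet_apply]
      rw [← this, h]; simp [meet_self]
    rw [mem_span_pair_range]; refine ⟨a.2⁻¹ * s, a.2⁻¹ * t, ?_⟩
    rw [mul_smul, mul_smul, ← smul_add, ← h1, smul_smul, inv_mul_cancel₀ ha, one_smul]
  · rw [span_le]; rintro _ ⟨i, rfl⟩
    fin_cases i
    · exact meet_mem_trace hm.1 hm.2.1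
    · exact meet_mem_trace hm.1 hm.2.2

lemma li_meet {a b c : Hat} (h : LI ![a, b, c]) (ha : a.2 ≠ 0) :
    LI ![meet a b, meet a c] := by
  rw [li_two]; intro r s hrs
  have : (-(r * b.2 + s * c.2)) • a + (a.2 * r) • b + (a.2 * s) • c = 0 := by
    have h1 : ((r • meet a b + s • meet a c, 0) : Hat) = r • (meet a b, 0) + s • (meet a c, 0) := by
      ext1 <;> simp
    rw [hrs, inl_meet, inl_meet] at h1; rw [show ((0 : V), (0 : ℝ)) = 0 from rfl] at h1
    linear_combination (norm := module) -h1
  obtain ⟨-, h2, h3⟩ := li_three.1 h _ _ _ this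
  exact ⟨by simpa [ha] using h2, by simpa [ha] using h3⟩

lemma finrank_trace {K : Submodule ℝ Hat} {a b c : Hat}
    (hK : span ℝ (range ![a, b, c]) = K) (h : LI ![a, b, c])
    (ha : a.2 ≠ 0) : finrank ℝ (trace K) = 2 := by
  rw [trace_eq_span hK ha]; simpa using finrank_span_eq_card (li_meet h ha)

lemma eq_zero_of_meet {K : Submodule ℝ Hat} {y : Hat} (hy : y.2 ≠ 0) (hyK : y ∉ K) {x : Hat}
    (hx : x ∈ K) (h : meet x y = 0) : x = 0 := by
  have h1 : x.2 • y - y.2 • x = 0 := by rw [← inl_meet, h]; rfl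
  have h2 : x.2 = 0 := by
    by_contra h2; refine hyK ((K.smul_mem_iff h2).1 ?_); rw [sub_eq_zero.1 h1]
    exact K.smul_mem _ hx
  rw [h2, zero_smul, zero_sub, neg_eq_zero] at h1; exact (smul_eq_zero.1 h1).resolve_left hy

/-! ### Supercyclides generated by two conics -/

/-- The position of the conic `B` with respect to the plane of the conic `A` that makes the curves
`u ↦ meet (A u) (B v)` a family of characteristic conics. -/
structure Transversal (A B : ℝ → Hat) : Prop where
  ne : ∀ j ∈ B01, (B j).2 ≠ 0
  li : ∀ j ∈ B01, LI ![A 0, A (1 / 2), A 1, B j, deriv B j]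
  li_ends : LI ![A 0, A (1 / 2), A 1, B 0, B 1]

lemma li_five {W : Type*} [AddCommGroup W] [Module ℝ W] {a b c d e : W} :
    LI ![a, b, c, d, e] ↔
    ∀ r s t k l : ℝ, r • a + s • b + t • c + k • d + l • e = 0 →
      r = 0 ∧ s = 0 ∧ t = 0 ∧ k = 0 ∧ l = 0 := by
  rw [Fintype.linearIndependent_iff]; constructor
  · intro h r s t k l hr; have := h ![r, s, t, k, l] (by simpa [Fin.sum_univ_five] using hr)
    exact ⟨this 0, this 1, this 2, this 3, this 4⟩
  · intro h g hg; rw [Fin.sum_univ_five] at hg; obtain ⟨h0, h1, h2, h3, h4⟩ := h _ _ _ _ _ hg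
    intro i; fin_cases i <;> assumption

lemma li_five_iff {W : Type*} [AddCommGroup W] [Module ℝ W] {a b c d e : W} {K : Submodule ℝ W}
    (hK : span ℝ (range ![a, b, c]) = K) (habc : LI ![a, b, c]) :
    LI ![a, b, c, d, e] ↔
      ∀ r s : ℝ, r • d + s • e ∈ K → r = 0 ∧ s = 0 := by
  subst hK; rw [li_five]; constructor
  · intro h r s hrs; obtain ⟨x, y, z, hxyz⟩ := mem_span_triple.1 hrs
    have := h (-x) (-y) (-z) r s (by linear_combination (norm := module) hxyz)
    exact this.2.2.2
  · intro h r s t k l hr; obtain ⟨rfl, rfl⟩ := h k l (mem_span_triple.2 ⟨-r, -s, -t, by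
      linear_combination (norm := module) hr⟩)
    have := li_three.1 habc r s t (by linear_combination (norm := module) hr)
    tauto

section Meet

variable {A B : ℝ → Hat} {K K' : Submodule ℝ Hat} {β β' : Hat →ₗ[ℝ] Hat →ₗ[ℝ] ℝ} {G : Lift} {κ : ℝ}

lemma ConicData.span_three {W : Type*} [NormedAddCommGroup W] [NormedSpace ℝ W]
    [FiniteDimensional ℝ W] {c : ℝ → W} {K : Submodule ℝ W} {β : W →ₗ[ℝ] W →ₗ[ℝ] ℝ}
    (h : ConicData c K β) : span ℝ (range ![c 0, c (1 / 2), c 1]) = K :=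
  h.eq_span_points (by norm_num) (by norm_num) (by norm_num) (by norm_num) (by norm_num) (by norm_num)

lemma ConicData.li_three {W : Type*} [NormedAddCommGroup W] [NormedSpace ℝ W]
    [FiniteDimensional ℝ W] {c : ℝ → W} {K : Submodule ℝ W} {β : W →ₗ[ℝ] W →ₗ[ℝ] ℝ}
    (h : ConicData c K β) : LI ![c 0, c (1 / 2), c 1] :=
  h.li_points (by norm_num) (by norm_num) (by norm_num) (by norm_num) (by norm_num) (by norm_num)

lemma du_meet (hA : ContDiff ℝ ∞ A) (hG : ∀ u v, G u v = κ • meet (A u) (B v)) (u v : ℝ) :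
    G.du u v = κ • meet (deriv A u) (B v) := by
  have h1 : (fun s => G s v) = fun s => (κ • meet.flip (B v)) (A s) := by ext1 s; rw [hG]; rfl
  rw [Lift.du, h1, deriv_linear_comp _ hA]; rfl

lemma dv_meet (hB : ContDiff ℝ ∞ B) (hG : ∀ u v, G u v = κ • meet (A u) (B v)) (u v : ℝ) :
    G.dv u v = κ • meet (A u) (deriv B v) := by
  have h1 : (fun s => G u s) = fun s => (κ • meet (A u)) (B s) := by ext1 s; rw [hG]; rfl
  rw [Lift.dv, h1, deriv_linear_comp _ hB]; rfl

lemma isConicFamily_of_meet (hκ : κ ≠ 0) (hG : ∀ u v, G u v = κ • meet (A u) (B v))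
    (hA : ConicData A K β) (hB : ConicData B K' β') (hA0 : (A 0).2 ≠ 0) (hT : Transversal A B) :
    IsConicFamily G (trace K) := by
  have hK := hA.span_three; have hli := hA.li_three
  have hBK : ∀ j ∈ B01, B j ∉ K := fun j hj hBj => by
    have := (li_five_iff hK hli).1 (hT.li j hj) 1 0 (by simpa using hBj)
    exact one_ne_zero this.1
  have m01 : ∀ j ∈ B01, j ∈ I01 := by
    rintro j (rfl | rfl); exacts [zero_mem_Icc, one_mem_Icc]
  have hconic : ∀ v, (B v).2 ≠ 0 → B v ∉ K →
      ∃ β'', ConicData (fun u => G u v) (K.map (κ • meet.flip (B v))) β'' := by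
    intro v h2 hK; have := hA.map (κ • meet.flip (B v)) (fun x hx h0 => by
      have h0' : meet x (B v) = 0 := (smul_eq_zero.1 h0).resolve_left hκ
      exact eq_zero_of_meet h2 hK hx h0')
    rwa [show (fun u => G u v) = fun u => (κ • meet.flip (B v)) (A u) from funext fun u => hG u v]
  have hspan : ∀ v, (B v).2 ≠ 0 → B v ∉ K → G.lineSpan v = K.map (κ • meet.flip (B v)) := by
    intro v h2 hK; obtain ⟨β'', h⟩ := hconic v h2 hK; exact h.span_eq
  have hapex : ∀ v ∈ I01, (B v).2 ≠ 0 → G.IsApex v (meet (B v) (deriv B v)) := by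
    intro v hv h2; refine ⟨fun h0 => ?_, fun u _ => ?_⟩
    · have h1 : (B v).2 • deriv B v - (deriv B v).2 • B v = 0 := by rw [← inl_meet, h0]; rfl
      have := li_two.1 (hB.immersed v hv) (-(deriv B v).2) ((B v).2) (by
        linear_combination (norm := module) h1)
      exact h2 this.2
    · rw [hG, dv_meet hB.smooth hG]
      refine not_li_three.2 ⟨κ * (A u).2, (deriv B v).2, -(B v).2, ?_, Or.inr (Or.inr (neg_ne_zero.2 h2))⟩
      have := plucker (A u) (B v) (deriv B v); rw [meet_comm (deriv B v) (A u)] at this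
      linear_combination (norm := module) κ • this
  refine ⟨finrank_trace hK hli hA0, ?_, ?_, ?_⟩
  · obtain ⟨φ, hφ, hφK⟩ := exists_dual_ne (hBK 0 (by simp))
    have hB0 : B 0 ∈ K' := hB.mem 0 zero_mem_Icc
    have f1 := hB.finite_zeros (l := LinearMap.snd ℝ V ℝ) ⟨B 0, hB0, hT.ne 0 (by simp)⟩
    have f2 := hB.finite_zeros (l := φ) ⟨B 0, hB0, hφ⟩
    refine ⟨({v | v ∈ I01 ∧ LinearMap.snd ℝ V ℝ (B v) = 0} ∪
      {v | v ∈ I01 ∧ φ (B v) = 0}) ∩ Ioo 0 1, (f1.union f2).inter_of_left _,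
      inter_subset_right, fun v hv hvS => ?_⟩
    have hgood : (B v).2 ≠ 0 ∧ B v ∉ K := by
      by_cases hv01 : v ∈ B01
      · exact ⟨hT.ne v hv01, hBK v hv01⟩
      · have hvo : v ∈ Ioo (0 : ℝ) 1 := by
          simp only [mem_insert_iff, mem_singleton_iff, not_or] at hv01
          exact ⟨lt_of_le_of_ne hv.1 (Ne.symm hv01.1), lt_of_le_of_ne hv.2 hv01.2⟩
        have : ¬ ((v ∈ I01 ∧ LinearMap.snd ℝ V ℝ (B v) = 0) ∨
            (v ∈ I01 ∧ φ (B v) = 0)) := fun h => hvS ⟨h, hvo⟩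
        push Not at this; exact ⟨this.1 hv, fun hK => this.2 hv (hφK _ hK)⟩
    obtain ⟨β'', hc⟩ := hconic v hgood.1 hgood.2; refine ⟨hc.isConicArc, ?_, _, hapex v hv hgood.1⟩
    rw [hspan v hgood.1 hgood.2]; intro x hx
    refine ⟨(-(κ * (B v).2)⁻¹) • (x, 0), K.smul_mem _ hx, ?_⟩
    have h3 := hgood.1; rw [map_smul]
    show -(κ * (B v).2)⁻¹ • κ • ((0 : ℝ) • (B v).1 - (B v).2 • x) = x
    rw [zero_smul, zero_sub, smul_neg, smul_neg, neg_smul, neg_neg, smul_smul, smul_smul,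
      show (κ * (B v).2)⁻¹ * κ * (B v).2 = 1 by field_simp, one_smul]
  · intro j hj; refine ⟨_, hapex j (m01 j hj) (hT.ne j hj), ?_⟩
    rw [hspan j (hT.ne j hj) (hBK j hj)]; rintro ⟨x, hx, hxe⟩
    have hxe' : meet (κ • x + deriv B j) (B j) = 0 := by
      have : κ • meet x (B j) = meet (B j) (deriv B j) := hxe
      rw [map_add, LinearMap.add_apply, map_smul, LinearMap.smul_apply, this, meet_comm]
      simp
    have h1 : (κ • x + deriv B j).2 • B j - (B j).2 • (κ • x + deriv B j) = 0 := by
      rw [← inl_meet, hxe']; rfl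
    have := (li_five_iff hK hli).1 (hT.li j hj) ((κ • x + deriv B j).2) (-(B j).2) (by
      rw [show (κ • x + deriv B j).2 • B j + (-(B j).2) • deriv B j = ((B j).2 * κ) • x by
        linear_combination (norm := module) h1]
      exact K.smul_mem _ hx)
    exact hT.ne j hj (neg_eq_zero.1 this.2)
  · intro he; have h1 : κ • meet (A 0) (B 1) ∈ G.lineSpan 0 := by
      rw [he, hspan 1 (hT.ne 1 (by simp)) (hBK 1 (by simp))]
      exact ⟨A 0, hA.mem 0 zero_mem_Icc, rfl⟩
    rw [hspan 0 (hT.ne 0 (by simp)) (hBK 0 (by simp))] at h1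
    obtain ⟨x, hx, hxe⟩ := h1; have hxe' : meet x (B 0) = meet (A 0) (B 1) := by
      have : κ • meet x (B 0) = κ • meet (A 0) (B 1) := hxe; exact smul_right_injective _ hκ this
    have h2 : x.2 • B 0 - (B 0).2 • x = (A 0).2 • B 1 - (B 1).2 • A 0 := by
      rw [← inl_meet, ← inl_meet, hxe']
    have := (li_five_iff hK hli).1 hT.li_ends (x.2) (-(A 0).2) (by
      rw [show x.2 • B 0 + (-(A 0).2) • B 1 = (B 0).2 • x - (B 1).2 • A 0 by
        linear_combination (norm := module) h2]
      exact K.sub_mem (K.smul_mem _ hx) (K.smul_mem _ (hA.mem 0 zero_mem_Icc)))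
    exact hA0 (neg_eq_zero.1 this.2)

end Meet

/-! ### Cubic surfaces -/

/-- The monomials of degree three in four variables. -/
abbrev Cubic : Type := ↥((Finset.univ : Finset (Fin 4)).finsuppAntidiag 3)

/-- The values of the cubic monomials. -/
def veronese (x : V) : Cubic → ℝ := fun s => ∏ i, x i ^ (s : Fin 4 →₀ ℕ) i

lemma veronese_smul (r : ℝ) (x : V) : veronese (r • x) = r ^ 3 • veronese x := by
  ext s; have hs : ∑ i, (s : Fin 4 →₀ ℕ) i = 3 := (Finset.mem_finsuppAntidiag.1 s.2).1
  simp only [veronese, Pi.smul_apply, smul_eq_mul, mul_pow, Finset.prod_mul_distrib,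
    Finset.prod_pow_eq_pow_sum, hs]

lemma eval_cubic {p : MvPolynomial (Fin 4) ℝ} (hp : p.IsHomogeneous 3) (x : V) :
    MvPolynomial.eval x p = ∑ s : Cubic, p.coeff s * veronese x s := by
  rw [MvPolynomial.eval_eq']
  have h1 : p.support ⊆ (Finset.univ : Finset (Fin 4)).finsuppAntidiag 3 := by
    intro s hs; rw [Finset.mem_finsuppAntidiag]; have := hp (MvPolynomial.mem_support_iff.1 hs)
    refine ⟨?_, fun _ _ => Finset.mem_univ _⟩
    rw [← this, Finsupp.weight_apply, Finsupp.sum_fintype] <;> simp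
  rw [Finset.sum_subset h1 (fun s _ hs => by
    rw [MvPolynomial.notMem_support_iff.1 hs, zero_mul])]
  rw [← Finset.sum_coe_sort]; rfl

lemma degree_four_iff (F : Lift) : (∀ p : MvPolynomial (Fin 4) ℝ, p.IsHomogeneous 3 →
    (∀ u ∈ I01, ∀ v ∈ I01, MvPolynomial.eval (F u v) p = 0) → p = 0) ↔
    ∃ q : Fin (Fintype.card Cubic) → ℝ × ℝ, (∀ k, (q k).1 ∈ I01 ∧ (q k).2 ∈ I01) ∧
      LI fun k => veronese (F (q k).1 (q k).2) := by
  constructor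
  · intro h
    set X : Set (Cubic → ℝ) := (fun q : ℝ × ℝ => veronese (F q.1 q.2)) '' (Icc 0 1 ×ˢ Icc 0 1)
    have hX : span ℝ X = ⊤ := by
      by_contra hne; obtain ⟨x, -, hx⟩ := SetLike.exists_of_lt (lt_top_iff_ne_top.2 hne)
      obtain ⟨f, hf, hfX⟩ := exists_dual_ne hx; let p : MvPolynomial (Fin 4) ℝ :=
        ∑ s : Cubic, MvPolynomial.monomial (s : Fin 4 →₀ ℕ) (f (Pi.single s 1))
      have hcoeff : ∀ s : Cubic, p.coeff s = f (Pi.single s 1) := by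
        intro s; simp only [p, MvPolynomial.coeff_sum, MvPolynomial.coeff_monomial]
        rw [Finset.sum_eq_single s]
        · simp
        · intro t _ hts; rw [if_neg (fun h => hts (Subtype.ext h))]
        · simp
      have hhom : p.IsHomogeneous 3 := by
        refine MvPolynomial.IsHomogeneous.sum _ _ _ fun s _ => ?_
        refine MvPolynomial.isHomogeneous_monomial _ ?_
        have hs : ∑ i, (s : Fin 4 →₀ ℕ) i = 3 := (Finset.mem_finsuppAntidiag.1 s.2).1
        rw [Finsupp.degree_eq_sum]; exact hs
      have hf' : ∀ y : Cubic → ℝ, f y = ∑ s : Cubic, p.coeff s * y s := by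
        intro y
        conv_lhs => rw [pi_eq_sum_univ' y, map_sum]
        refine Finset.sum_congr rfl fun s _ => ?_
        rw [map_smul, hcoeff, smul_eq_mul, mul_comm]
      have hp0 := h p hhom (fun u hu v hv => by
        rw [eval_cubic hhom, ← hf']; exact hfX _ (subset_span ⟨(u, v), ⟨hu, hv⟩, rfl⟩))
      refine hf ?_
      rw [hf', hp0]; simp
    obtain ⟨b, hbX, hbs, hb⟩ := exists_linearIndependent ℝ X; rw [hX] at hbs
    let bas := Module.Basis.mk hb (by rw [Subtype.range_coe, hbs])
    have : Fintype b := FiniteDimensional.fintypeBasisIndex bas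
    have hcard : Fintype.card (Fin (Fintype.card Cubic)) = Fintype.card b := by
      rw [← Module.finrank_eq_card_basis bas]; simp
    let σ := Fintype.equivOfCardEq hcard
    choose q hq hq' using fun k => hbX (σ k).2
    refine ⟨q, fun k => ⟨(hq k).1, (hq k).2⟩, ?_⟩
    have := hb.comp σ σ.injective
    rwa [show (fun k => veronese (F (q k).1 (q k).2)) = (fun x : b => (x : Cubic → ℝ)) ∘ σ from
      funext hq']
  · rintro ⟨q, hq, hli⟩ p hp h
    have hspan : span ℝ (range fun k => veronese (F (q k).1 (q k).2)) = ⊤ :=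
      hli.span_eq_top_of_card_eq_finrank' (by simp)
    let f : (Cubic → ℝ) →ₗ[ℝ] ℝ := ∑ s : Cubic, p.coeff s • LinearMap.proj s
    have hf : ∀ y, f y = ∑ s : Cubic, p.coeff s * y s := by intro y; simp [f]
    have hf0 : f = 0 := by
      refine LinearMap.ext_on_range hspan fun k => ?_
      rw [hf, ← eval_cubic hp, h _ (hq k).1 _ (hq k).2]; rfl
    ext s; by_cases hs : s ∈ (Finset.univ : Finset (Fin 4)).finsuppAntidiag 3
    · have := hf (Pi.single ⟨s, hs⟩ 1); rw [hf0] at this; simpa [Pi.single_apply] using this.symm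
    · by_contra hne; refine hs ?_; have := hp hne; rw [Finset.mem_finsuppAntidiag]
      refine ⟨?_, fun _ _ => Finset.mem_univ _⟩
      rw [← this, Finsupp.weight_apply, Finsupp.sum_fintype] <;> simp

/-! ### Patches generated by pairs of conics in a four-dimensional space -/

/-- Two conics `A`, `B` in a four-dimensional space in such a position that the points of the lines
`A u`, `B v` in the hyperplane `V` form a supercyclidic patch. -/
structure MeetData (A B : ℝ → Hat) : Prop where
  left : ∃ K β, ConicData A K β
  right : ∃ K β, ConicData B K β
  transversal : Transversal A B
  transversal' : Transversal B A
  skew : LI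
    ![meet (A 0) (A (1 / 2)), meet (A 0) (A 1), meet (B 0) (B (1 / 2)), meet (B 0) (B 1)]
  cubic : ∃ q : Fin (Fintype.card Cubic) → ℝ × ℝ,
    (∀ k, (q k).1 ∈ I01 ∧ (q k).2 ∈ I01) ∧
      LI fun k => veronese (meet (A (q k).1) (B (q k).2))

/-- The patch generated by two conics. -/
def meetLift (A B : ℝ → Hat) : Lift := fun u v => meet (A u) (B v)

lemma smooth_meetLift {A B : ℝ → Hat} (hA : ContDiff ℝ ∞ A) (hB : ContDiff ℝ ∞ B) :
    (meetLift A B).Smooth :=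
  contDiff_bilin meet (c := fun p : ℝ × ℝ => A p.1) (d := fun p : ℝ × ℝ => B p.2)
    (hA.comp contDiff_fst) (hB.comp contDiff_snd)

lemma du_meetLift {A : ℝ → Hat} (hA : ContDiff ℝ ∞ A) (B : ℝ → Hat) :
    (meetLift A B).du = meetLift (deriv A) B := by
  ext1 u; ext1 v
  have := du_meet (B := B) (κ := 1) hA (G := meetLift A B) (fun u v => (one_smul _ _).symm) u v
  rwa [one_smul] at this

lemma dv_meetLift (A : ℝ → Hat) {B : ℝ → Hat} (hB : ContDiff ℝ ∞ B) :
    (meetLift A B).dv = meetLift A (deriv B) := by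
  ext1 u; ext1 v
  have := dv_meet (A := A) (κ := 1) hB (G := meetLift A B) (fun u v => (one_smul _ _).symm) u v
  rwa [one_smul] at this

lemma swap_meetLift (A B : ℝ → Hat) : (meetLift A B).swap = meetLift (-B) A := by
  ext1 u; ext1 v
  show meet (A v) (B u) = meet (-(B u)) (A v)
  rw [map_neg, meet_comm]; rfl

lemma li_pairs_inf {W : Type*} [AddCommGroup W] [Module ℝ W] {a b c d : W} :
    LI ![a, b, c, d] ↔ LI ![a, b] ∧ LI ![c, d] ∧
      span ℝ (range ![a, b]) ⊓ span ℝ (range ![c, d]) = ⊥ := by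
  rw [li_four, li_two, li_two]; constructor
  · intro h; refine ⟨fun r s hrs => ?_, fun r s hrs => ?_, ?_⟩
    · have := h r s 0 0 (by linear_combination (norm := module) hrs); tauto
    · have := h 0 0 r s (by linear_combination (norm := module) hrs); tauto
    · rw [eq_bot_iff]; rintro x ⟨hx1, hx2⟩; obtain ⟨r, s, rfl⟩ := mem_span_pair_range.1 hx1
      obtain ⟨t, k, hx⟩ := mem_span_pair_range.1 hx2; have := h r s (-t) (-k) (by rw [hx]; module)
      rw [this.1, this.2.1]; simp
  · rintro ⟨h1, h2, h3⟩ r s t k h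
    have hx : r • a + s • b ∈ span ℝ (range ![a, b]) ⊓ span ℝ (range ![c, d]) :=
      ⟨mem_span_pair_range.2 ⟨r, s, rfl⟩, mem_span_pair_range.2 ⟨-t, -k, by
        linear_combination (norm := module) h⟩⟩
    rw [h3, Submodule.mem_bot] at hx; have e1 := h1 r s hx
    have e2 := h2 t k (by linear_combination (norm := module) h - hx)
    tauto

lemma MeetData.isSCPatch {A B : ℝ → Hat} (h : MeetData A B) : IsSCPatch (meetLift A B) := by
  obtain ⟨K, β, hA⟩ := h.left; obtain ⟨K', β', hB⟩ := h.right
  refine ⟨smooth_meetLift hA.smooth hB.smooth, fun u _ v _ => ?_, ⟨trace K, trace K', ?_, ?_, ?_⟩,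
    (degree_four_iff _).2 h.cubic⟩
  · rw [dv_meetLift A hB.smooth, du_meetLift hA.smooth, du_meetLift hA.smooth]
    refine not_li_meet_four (finrank_span_four_le (A u) (deriv A u) (B v) (deriv B v)) ?_ ?_ ?_ ?_ ?_ ?_
      ?_ ?_
    exacts [subset_span ⟨0, rfl⟩, subset_span ⟨1, rfl⟩,
      subset_span ⟨0, rfl⟩, subset_span ⟨1, rfl⟩, subset_span ⟨2, rfl⟩,
      subset_span ⟨2, rfl⟩, subset_span ⟨3, rfl⟩, subset_span ⟨3, rfl⟩]
  · exact isConicFamily_of_meet (κ := 1) one_ne_zero (fun u v => (one_smul _ _).symm) hA hB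
      (h.transversal'.ne 0 (by simp)) h.transversal
  · refine isConicFamily_of_meet (κ := -1) (by norm_num) (fun u v => ?_) hB hA
      (h.transversal.ne 0 (by simp)) h.transversal'
    show meet (A v) (B u) = _
    rw [meet_comm]; simp
  · rw [trace_eq_span hA.span_three (h.transversal'.ne 0 (by simp)),
      trace_eq_span hB.span_three (h.transversal.ne 0 (by simp))]
    exact (li_pairs_inf.1 h.skew).2.2

/-! ### The conics of a patch in normal form -/

lemma NormalForm.swap {F : Lift} {A1 A2 : Submodule ℝ V} {p1 p2 : V →ₗ[ℝ] V} {w1 w2 : V →ₗ[ℝ] ℝ}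
    (h : NormalForm F A1 A2 p1 p2 w1 w2) : NormalForm F.swap A2 A1 p2 p1 w2 w1 where
  family1 := h.family2
  family2 := h.family1
  splitting := h.splitting.symm
  left_ne := h.right_ne
  right_ne := h.left_ne
  form1 := h.form2
  form2 := h.form1
  zero1 := h.zero2
  zero2 := h.zero1
  dep := fun u hu v hv => by rw [add_comm]; exact h.dep v hv u hu

section NormalForm

variable {F : Lift} {A1 A2 : Submodule ℝ V} {p1 p2 : V →ₗ[ℝ] V} {w1 w2 : V →ₗ[ℝ] ℝ}

lemma NormalForm.w_zero (h : NormalForm F A1 A2 p1 p2 w1 w2) : w1 (F 0 0) = 1 := by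
  have := h.form1 _ (F.mem_lineSpan 0 zero_mem_Icc); by_contra hne
  refine hne (sub_eq_zero.1 ((smul_eq_zero.1 (?_ : (w1 (F 0 0) - 1) • p2 (F 0 0) = 0)).resolve_right
    h.right_ne))
  linear_combination (norm := module) -this

lemma NormalForm.ne_one (hF : F.Smooth) (h : NormalForm F A1 A2 p1 p2 w1 w2) : w1 (F 1 0) ≠ 0 := by
  obtain ⟨S, hS, hS0, hS1, hS2⟩ := h.family2.exists_data hF.swap
  obtain ⟨T, hT, hT0, hT1, hT2⟩ := h.family1.exists_data hF
  obtain ⟨⟨B', hB'⟩, -, -⟩ := hT2 0 zero_mem_Icc hT0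
  obtain ⟨α, hα, h4⟩ := exists_homology_of_patch hF h.splitting h.family1 h.family2 h.left_ne h.form2
    h.zero2 hS0 (fun u hu huS => ⟨(hS2 u hu huS).1, (hS2 u hu huS).2.1⟩) one_mem_Icc hS1
  have h5 := h4 0 zero_mem_Icc; rw [show w2 (F 0 0) = 1 from h.swap.w_zero, one_smul] at h5
  have hs := h.splitting; have hne : p2 (F 0 0) + α ≠ 0 := by
    intro h0; refine h.right_ne ?_; have := congrArg p2 h0
    rwa [map_add, hs.right_eq _ (hs.mem_right _), hs.right_zero hα, add_zero, map_zero] at this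
  obtain ⟨r, hr⟩ := exists_smul_of_not_li hne (dep_two_comm h5)
  have e2 : w1 (p2 (F 0 0)) = 1 := by
    have := h.w_zero; rwa [← hs.add (F 0 0), map_add, h.zero1 _ (hs.mem_left _), zero_add] at this
  rw [hr, map_smul, map_add, e2, h.zero1 _ hα, add_zero, smul_eq_mul, mul_one]
  rintro rfl; rw [zero_smul] at hr; exact hB'.ne_zero one_mem_Icc hr

lemma infinite_Icc : (I01).Infinite := Set.Icc_infinite one_pos

lemma NormalForm.right_ne_one (hF : F.Smooth) (h : NormalForm F A1 A2 p1 p2 w1 w2) :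
    p2 (F 0 1) ≠ 0 := by
  intro h0; have hs := h.splitting; obtain ⟨S, hS, hS0, hS1, hS2⟩ := h.family1.exists_data hF
  obtain ⟨⟨B, hB⟩, -, -⟩ := hS2 0 zero_mem_Icc hS0
  obtain ⟨⟨B', hB'⟩, hA, -⟩ := hS2 1 one_mem_Icc hS1
  obtain ⟨α, hα, h4⟩ := exists_homology_of_patch (F := F.swap) hF.swap hs.symm h.family2 h.family1
    h.right_ne h.form1 h.zero1 hS0 (fun u hu huS => ⟨(hS2 u hu huS).1, (hS2 u hu huS).2.1⟩)
    one_mem_Icc hS1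
  have key : ∀ u ∈ I01, Dep ![F u 1, p1 (F u 0)] := by
    have h5 := h4 0 zero_mem_Icc; rw [show w1 (F.swap 0 0) = 1 from h.w_zero, one_smul] at h5
    have hne : p1 (F 0 0) + α ≠ 0 := by
      intro h0; refine h.left_ne ?_; have := congrArg p1 h0
      rwa [map_add, hs.left_eq _ (hs.mem_left _), hs.left_zero hα, add_zero, map_zero] at this
    obtain ⟨r, hr⟩ := exists_smul_of_not_li hne (dep_two_comm h5)
    have hα0 : α = 0 := by
      have := congrArg p2 hr
      rw [map_smul, map_add, hs.right_zero (hs.mem_left _), hs.right_eq _ hα, zero_add] at this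
      rw [show p2 (F.swap 1 0) = 0 from h0] at this
      refine (smul_eq_zero.1 this.symm).resolve_left ?_
      rintro rfl; rw [zero_smul] at hr; exact hB'.ne_zero zero_mem_Icc hr
    intro u hu; have := h4 u hu; rwa [hα0, smul_zero, add_zero] at this
  have hA1 : ∃ x ∈ F.lineSpan 1, x ∉ A1 := by
    refine SetLike.not_le_iff_exists.1 fun hle => ?_
    have := Submodule.finrank_mono hle; rw [hB'.finrank, h.family1.axis] at this
    omega
  obtain ⟨x, hx, hxA⟩ := hA1; obtain ⟨f, hf, hfA⟩ := exists_dual_ne hxA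
  obtain ⟨g, hg, -⟩ := exists_dual_ne (E := ⊥) (x := p1 (F 0 0)) (by simpa using h.left_ne)
  have f1 := hB'.finite_zeros (l := f) ⟨x, hx, hf⟩
  have f2 := hB.finite_zeros (l := g ∘ₗ p1) ⟨_, F.mem_lineSpan 0 zero_mem_Icc, hg⟩
  obtain ⟨u, hu, huS⟩ := infinite_Icc.exists_notMem_finite (f1.union f2)
  simp only [mem_union, mem_ofPred_eq, not_or, not_and] at huS
  have h6 : p1 (F u 0) ≠ 0 := fun h0 => huS.2 hu (by simp [h0])
  obtain ⟨r, hr⟩ := exists_smul_of_not_li h6 (dep_two_comm (key u hu))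
  refine huS.1 hu ?_
  rw [hr, map_smul, hfA _ (hs.mem_left _), smul_zero]

/-- Lifts of the boundary curve `v = 0` to the four-dimensional space. -/
def lift1 (p1 : V →ₗ[ℝ] V) (w1 : V →ₗ[ℝ] ℝ) : V →ₗ[ℝ] Hat := p1.prod w1

/-- Lifts of the boundary curve `u = 0` to the four-dimensional space. -/
def lift2 (p2 : V →ₗ[ℝ] V) (w2 : V →ₗ[ℝ] ℝ) : V →ₗ[ℝ] Hat := p2.prod (-w2)

lemma meet_lift (p1 p2 : V →ₗ[ℝ] V) (w1 w2 : V →ₗ[ℝ] ℝ) (x y : V) :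
    meet (lift1 p1 w1 x) (lift2 p2 w2 y) = w1 x • p2 y + w2 y • p1 x := by
  rw [meet_apply]
  show w1 x • p2 y - (-w2 y) • p1 x = _
  module

lemma NormalForm.lift1_inj (h : NormalForm F A1 A2 p1 p2 w1 w2) :
    ∀ x ∈ F.lineSpan 0, lift1 p1 w1 x = 0 → x = 0 := by
  intro x hx h0; have h1 : p1 x = 0 := congrArg Prod.fst h0
  have h2 : w1 x = 0 := congrArg Prod.snd h0; rw [← h.splitting.add x, h1, h.form1 x hx, h2]; simp

lemma NormalForm.conic (hF : F.Smooth) (h : NormalForm F A1 A2 p1 p2 w1 w2) :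
    (∃ B, ConicData (fun u => F u 0) (F.lineSpan 0) B) ∧
    (∃ B, ConicData (fun u => F u 1) (F.lineSpan 1) B) ∧ A1 ≤ F.lineSpan 0 ∧ A1 ≤ F.lineSpan 1 := by
  obtain ⟨S, hS, hS0, hS1, hS2⟩ := h.family1.exists_data hF
  obtain ⟨h1, h2, -⟩ := hS2 0 zero_mem_Icc hS0; obtain ⟨h3, h4, -⟩ := hS2 1 one_mem_Icc hS1
  exact ⟨h1, h3, h2, h4⟩

lemma NormalForm.left (hF : F.Smooth) (h : NormalForm F A1 A2 p1 p2 w1 w2) :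
    ∃ β, ConicData (fun u => lift1 p1 w1 (F u 0)) ((F.lineSpan 0).map (lift1 p1 w1)) β := by
  obtain ⟨⟨B, hB⟩, -⟩ := h.conic hF; exact hB.map _ h.lift1_inj

lemma NormalForm.lift2_inj (h : NormalForm F A1 A2 p1 p2 w1 w2) :
    ∀ x ∈ F.swap.lineSpan 0, lift2 p2 w2 x = 0 → x = 0 := by
  intro x hx h0; have h1 : p2 x = 0 := congrArg Prod.fst h0
  have h2 : -(w2 x) = 0 := congrArg Prod.snd h0
  rw [← h.splitting.add x, h1, h.form2 x hx, neg_eq_zero.1 h2]; simp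

lemma NormalForm.right (hF : F.Smooth) (h : NormalForm F A1 A2 p1 p2 w1 w2) :
    ∃ β, ConicData (fun v => lift2 p2 w2 (F 0 v)) ((F.swap.lineSpan 0).map (lift2 p2 w2)) β := by
  obtain ⟨⟨B, hB⟩, -⟩ := h.swap.conic hF.swap; exact hB.map _ h.lift2_inj

lemma NormalForm.transversal (hF : F.Smooth) (h : NormalForm F A1 A2 p1 p2 w1 w2) :
    Transversal (fun u => lift1 p1 w1 (F u 0)) (fun v => lift2 p2 w2 (F 0 v)) := by
  obtain ⟨β, hA⟩ := h.left hF; obtain ⟨β', hB⟩ := h.right hF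
  obtain ⟨-, ⟨B1, hc1⟩, hA0, hA1⟩ := h.conic hF; obtain ⟨⟨B2, hd⟩, -, -⟩ := h.swap.conic hF.swap
  have hs := h.splitting; have hj : ∀ j ∈ B01, j ∈ I01 ∧ A1 ≤ F.lineSpan j ∧ p2 (F 0 j) ≠ 0 ∧
      w2 (F 0 j) ≠ 0 := by
    rintro j (rfl | rfl)
    · exact ⟨zero_mem_Icc, hA0, h.right_ne, by
        rw [show w2 (F 0 0) = 1 from h.swap.w_zero]; exact one_ne_zero⟩
    · exact ⟨one_mem_Icc, hA1, h.right_ne_one hF, h.swap.ne_one hF.swap⟩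
  have key : ∀ z ∈ F.swap.lineSpan 0, lift2 p2 w2 z ∈ (F.lineSpan 0).map (lift1 p1 w1) → z ∈ A1 := by
    rintro z hz ⟨x, hx, hxz⟩; have h1 : p1 x = p2 z := congrArg Prod.fst hxz
    have h2 : p2 z = 0 := by
      rw [← hs.right_eq _ (hs.mem_right z), ← h1, hs.right_zero (hs.mem_left x)]
    exact hs.mem_of_right_zero h2
  refine ⟨fun j hj' => ?_, fun j hj' => ?_, ?_⟩
  · exact neg_ne_zero.2 (hj j hj').2.2.2
  · obtain ⟨hjm, hAj, hpj, -⟩ := hj j hj'; rw [li_five_iff hA.span_three hA.li_three]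
    intro r s hrs; rw [deriv_linear_comp _ (hF.right 0), ← map_smul, ← map_smul, ← map_add] at hrs
    have hz := key _ (Submodule.add_mem _ (Submodule.smul_mem _ _ (hd.mem j hjm))
      (Submodule.smul_mem _ _ (hd.deriv_mem hjm))) hrs
    by_cases hs0 : s = 0
    · subst hs0; rw [zero_smul, add_zero] at hz; refine ⟨?_, rfl⟩
      by_contra hr; exact hpj (hs.right_zero ((A1.smul_mem_iff hr).1 hz))
    · exfalso
      have hd' : deriv (fun v => F 0 v) j ∈ F.lineSpan j := by
        refine ((F.lineSpan j).smul_mem_iff hs0).1 ?_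
        rw [← add_sub_cancel_left (r • F 0 j) (s • deriv (fun v => F 0 v) j)]
        exact Submodule.sub_mem _ (hAj hz) (Submodule.smul_mem _ _ (F.mem_lineSpan j zero_mem_Icc))
      obtain ⟨a, ha, haP⟩ := h.family1.boundary j hj'
      obtain ⟨x, y, hxy⟩ := exists_comb_of_not_li (hd.immersed j hjm) (ha.2 0 zero_mem_Icc)
      refine haP (hxy ▸ Submodule.add_mem _ (Submodule.smul_mem _ _ (F.mem_lineSpan j zero_mem_Icc))
        (Submodule.smul_mem _ _ hd'))
  · rw [li_five_iff hA.span_three hA.li_three]; intro r s hrs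
    rw [← map_smul, ← map_smul, ← map_add] at hrs
    have hz := key _ (Submodule.add_mem _ (Submodule.smul_mem _ _ (hd.mem 0 zero_mem_Icc))
      (Submodule.smul_mem _ _ (hd.mem 1 one_mem_Icc))) hrs
    have hs0 : s = 0 := by
      by_contra hs0; have h1 : F 0 1 ∈ F.lineSpan 0 := by
        refine ((F.lineSpan 0).smul_mem_iff hs0).1 ?_
        rw [← add_sub_cancel_left (r • F 0 0) (s • F 0 1)]
        exact Submodule.sub_mem _ (hA0 hz) (Submodule.smul_mem _ _ (F.mem_lineSpan 0 zero_mem_Icc))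
      have h2 : F 0 1 ∈ A1 := by
        rw [← h.family1.inf_planes hF]; exact ⟨h1, F.mem_lineSpan 1 zero_mem_Icc⟩
      exact h.right_ne_one hF (hs.right_zero h2)
    subst hs0; rw [zero_smul, add_zero] at hz; refine ⟨?_, rfl⟩; by_contra hr
    exact h.right_ne (hs.right_zero ((A1.smul_mem_iff hr).1 hz))

/-- Reflection in the hyperplane `V`. -/
def reflect : Hat →ₗ[ℝ] Hat := (LinearMap.fst ℝ V ℝ).prod (-LinearMap.snd ℝ V ℝ)

lemma reflect_reflect (x : Hat) : reflect (reflect x) = x := by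
  ext1
  · rfl
  · exact neg_neg _

lemma ker_reflect : LinearMap.ker reflect = ⊥ :=
  LinearMap.ker_eq_bot_of_inverse (g := reflect) (LinearMap.ext reflect_reflect)

lemma li_five_reflect {a b c d e : Hat} (h : LI ![a, b, c, d, e]) :
    LI ![reflect a, reflect b, reflect c, reflect d, reflect e] := by
  have := h.map' reflect ker_reflect; rwa [show reflect ∘ ![a, b, c, d, e] =
    ![reflect a, reflect b, reflect c, reflect d, reflect e] from
    funext fun i => by fin_cases i <;> rfl] at this

lemma Transversal.reflect {A B : ℝ → Hat} (h : Transversal A B) (hB : ContDiff ℝ ∞ B) :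
    Transversal (fun u => SCNet.reflect (A u)) (fun u => SCNet.reflect (B u)) := by
  refine ⟨fun j hj => neg_ne_zero.2 (h.ne j hj), fun j hj => ?_, ?_⟩
  · rw [deriv_linear_comp _ hB]; exact li_five_reflect (h.li j hj)
  · exact li_five_reflect h.li_ends

lemma NormalForm.transversal' (hF : F.Smooth) (h : NormalForm F A1 A2 p1 p2 w1 w2) :
    Transversal (fun v => lift2 p2 w2 (F 0 v)) (fun u => lift1 p1 w1 (F u 0)) := by
  have := (h.swap.transversal hF.swap).reflect (contDiff_linear_comp _ (hF.left 0))
  convert this using 2 with u u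
  · rfl
  · rw [← reflect_reflect (lift1 p1 w1 (F u 0))]; rfl

lemma NormalForm.trace_left (h : NormalForm F A1 A2 p1 p2 w1 w2) (x y : V) :
    meet (lift1 p1 w1 x) (lift1 p1 w1 y) ∈ A1 := by
  rw [meet_apply]
  exact A1.sub_mem (A1.smul_mem _ (h.splitting.mem_left _)) (A1.smul_mem _ (h.splitting.mem_left _))

lemma NormalForm.trace_right (h : NormalForm F A1 A2 p1 p2 w1 w2) (x y : V) :
    meet (lift2 p2 w2 x) (lift2 p2 w2 y) ∈ A2 := by
  rw [meet_apply]
  exact A2.sub_mem (A2.smul_mem _ (h.splitting.mem_right _)) (A2.smul_mem _ (h.splitting.mem_right _))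

lemma IsSplitting.inf_eq {A A' : Submodule ℝ V} {p q : V →ₗ[ℝ] V} (h : IsSplitting A A' p q) :
    A ⊓ A' = ⊥ := by
  rw [eq_bot_iff]; rintro x ⟨hx, hx'⟩; rw [Submodule.mem_bot, ← h.left_eq x hx, h.left_zero hx']

lemma NormalForm.cubic (hF : IsSCPatch F) (h : NormalForm F A1 A2 p1 p2 w1 w2) :
    ∀ p : MvPolynomial (Fin 4) ℝ, p.IsHomogeneous 3 →
    (∀ u ∈ I01, ∀ v ∈ I01,
      MvPolynomial.eval (w1 (F u 0) • p2 (F 0 v) + w2 (F 0 v) • p1 (F u 0)) p = 0) → p = 0 := by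
  intro p hp h0; have hs := h.splitting; have hFs : F.Smooth := hF.smooth
  obtain ⟨⟨B, hB⟩, -⟩ := h.conic hFs; obtain ⟨⟨B', hB'⟩, -⟩ := h.swap.conic hFs.swap
  obtain ⟨f, hf, -⟩ := exists_dual_ne (E := ⊥) (x := p2 (F 0 0)) (by simpa using h.right_ne)
  have f1 := hB.finite_zeros (l := w1) ⟨_, F.mem_lineSpan 0 zero_mem_Icc, by
    rw [h.w_zero]; exact one_ne_zero⟩
  have f2 := hB'.finite_zeros (l := f ∘ₗ p2) ⟨_, F.swap.mem_lineSpan 0 zero_mem_Icc, hf⟩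
  have hcont : ∀ {c : ℝ → V}, Continuous c → IsClosed {u | MvPolynomial.eval (c u) p = 0} :=
    fun hc => isClosed_eq (p.continuous_eval.comp hc) continuous_const
  refine hF.degree_four p hp fun u hu v hv => ?_
  refine subset_of_isClosed_of_finite (hcont (hFs.left v).continuous) f1 (fun u hu huS => ?_) u hu
  refine subset_of_isClosed_of_finite (hcont (hFs.right u).continuous) f2 (fun v hv hvS => ?_) v hv
  simp only [mem_ofPred_eq, not_and] at huS hvS
  have hne : w1 (F u 0) • p2 (F 0 v) + w2 (F 0 v) • p1 (F u 0) ≠ 0 := by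
    intro h1; have := congrArg p2 h1
    rw [map_add, map_smul, map_smul, hs.right_eq _ (hs.mem_right _), hs.right_zero (hs.mem_left _),
      smul_zero, add_zero, map_zero] at this
    rcases smul_eq_zero.1 this with h2 | h2
    · exact huS hu h2
    · exact hvS hv (by show f (p2 (F 0 v)) = 0; rw [h2, map_zero])
  obtain ⟨r, hr⟩ := exists_smul_of_not_li hne (dep_two_comm (h.dep u hu v hv))
  show MvPolynomial.eval (F u v) p = 0
  have h2 := h0 u hu v hv; rw [eval_cubic hp] at h2 ⊢; rw [hr, veronese_smul]
  simp only [Pi.smul_apply, smul_eq_mul]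
  have : ∀ s : Cubic, ∀ y, p.coeff s * (r ^ 3 * y) = r ^ 3 * (p.coeff s * y) := fun s y => by ring
  simp only [this, ← Finset.mul_sum, h2, mul_zero]

lemma NormalForm.meetData (hF : IsSCPatch F) (h : NormalForm F A1 A2 p1 p2 w1 w2) :
    MeetData (fun u => lift1 p1 w1 (F u 0)) (fun v => lift2 p2 w2 (F 0 v)) := by
  have hFs : F.Smooth := hF.smooth; obtain ⟨β, hA⟩ := h.left hFs
  obtain ⟨β', hB⟩ := h.right hFs
  refine ⟨⟨_, β, hA⟩, ⟨_, β', hB⟩, h.transversal hFs, h.transversal' hFs, ?_, ?_⟩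
  · refine li_pairs_inf.2 ⟨li_meet hA.li_three ((h.transversal' hFs).ne 0 (by simp)),
      li_meet hB.li_three ((h.transversal hFs).ne 0 (by simp)), ?_⟩
    rw [eq_bot_iff, ← h.splitting.inf_eq]; refine inf_le_inf (span_le.2 ?_) (span_le.2 ?_)
    · rintro _ ⟨i, rfl⟩; fin_cases i <;> exact h.trace_left _ _
    · rintro _ ⟨i, rfl⟩; fin_cases i <;> exact h.trace_right _ _
  · simp only [meet_lift]
    exact (degree_four_iff (fun u v => w1 (F u 0) • p2 (F 0 v) + w2 (F 0 v) • p1 (F u 0))).1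
      (h.cubic hF)

end NormalForm

/-! ### Fundamental pairs of patches in general position -/

/-- Homogeneous coordinates of the vertices of a planar quadrilateral. -/
structure Quad (a b c d : V) : Prop where
  dep : Dep ![a, b, c, d]
  abc : LI ![a, b, c]
  abd : LI ![a, b, d]
  acd : LI ![a, c, d]
  bcd : LI ![b, c, d]

/-- General position of a fundamental pair of patches along the edge `v = j`. -/
structure EdgePosition (F G : Lift) (j : ℝ) : Prop where
  quad : Quad (F 0 j) (F 1 j) (G 1 j) (G 0 j)
  du_left : LI ![F.du 0 j, F 0 j, F 1 j, G 0 j]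
  du_right : LI ![G.du 0 j, F 0 j, F 1 j, G 0 j]
  dv_left : LI ![F.dv 0 j, F 0 j, F 1 j, G 0 j]
  dv_left' : LI ![F.dv 1 j, F 0 j, F 1 j, G 0 j]
  skew : LI ![F 0 j, F.dv 0 j, G 1 j, G.dv 1 j]
  skew' : LI ![G 0 j, G.dv 0 j, F 1 j, F.dv 1 j]

lemma li_three_swap {W : Type*} [AddCommGroup W] [Module ℝ W] {a b c : W}
    (h : LI ![a, b, c]) : LI ![a, c, b] := by
  rw [li_three] at h ⊢; intro r s t hr; have := h r t s (by linear_combination (norm := module) hr)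
  tauto

lemma li_three_rotate {W : Type*} [AddCommGroup W] [Module ℝ W] {a b c : W}
    (h : LI ![a, b, c]) : LI ![b, c, a] := by
  rw [li_three] at h ⊢; intro r s t hr; have := h t r s (by linear_combination (norm := module) hr)
  tauto

lemma notMem_span_of_li {a b c x : V} (h : LI ![x, a, b, c]) :
    x ∉ span ℝ (range ![a, b, c]) := (linearIndependent_finCons.1 h).2

lemma mem_span_of_not_li {a b c x : V} (h : LI ![a, b, c])
    (hx : Dep ![x, a, b, c]) : x ∈ span ℝ (range ![a, b, c]) := by
  by_contra hn; exact hx (linearIndependent_finCons.2 ⟨h, hn⟩)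

lemma mem_span_triple_left {W : Type*} [AddCommGroup W] [Module ℝ W] (a b c : W) :
    a ∈ span ℝ (range ![a, b, c]) ∧ b ∈ span ℝ (range ![a, b, c]) ∧
      c ∈ span ℝ (range ![a, b, c]) :=
  ⟨subset_span ⟨0, rfl⟩, subset_span ⟨1, rfl⟩, subset_span ⟨2, rfl⟩⟩

lemma Quad.mem {a b c d : V} (h : Quad a b c d) : c ∈ span ℝ (range ![a, b, d]) := by
  refine mem_span_of_not_li h.abd ?_
  obtain ⟨r, s, t, k, hr, hne⟩ := not_li_four.1 h.dep
  exact not_li_four.2 ⟨t, r, s, k, by linear_combination (norm := module) hr, by tauto⟩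

lemma finrank_span_three {a b c : V} (h : LI ![a, b, c]) :
    finrank ℝ (span ℝ (range ![a, b, c])) = 3 := by
  simpa using finrank_span_eq_card h

lemma IsSCPatch.boundary {F : Lift} (h : IsSCPatch F) {j : ℝ} (hj : j ∈ B01) :
    (∃ B, ConicData (fun u => F u j) (F.lineSpan j) B) ∧
    ∃ a, F.IsApex j a ∧ a ∉ F.lineSpan j ∧ ∃ S : Set ℝ, S.Finite ∧ 0 ∉ S ∧ 1 ∉ S ∧
      ∀ u ∈ I01, u ∉ S → LI ![F u j, F.dv u j] ∧
        ∃ r s : ℝ, s ≠ 0 ∧ a = r • F u j + s • F.dv u j := by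
  obtain ⟨A1, A2, h1, h2, -⟩ := h.conics; have hF : F.Smooth := h.smooth
  have hjm : j ∈ I01 := by
    rcases hj with rfl | rfl
    exacts [zero_mem_Icc, one_mem_Icc]
  obtain ⟨S, hS, hS0, hS1, hS2⟩ := h2.exists_data hF.swap
  obtain ⟨T, hT, hT0, hT1, hT2⟩ := h1.exists_data hF; obtain ⟨a, ha, haP⟩ := h1.boundary j hj
  refine ⟨(hT2 j hjm (by rcases hj with rfl | rfl <;> assumption)).1, a, ha, haP, S, hS, hS0, hS1,
    fun u hu huS => ?_⟩
  obtain ⟨⟨B, hB⟩, -⟩ := hS2 u hu huS; have hi : LI ![F u j, F.dv u j] := hB.immersed j hjm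
  obtain ⟨r, s, hrs⟩ := exists_comb_of_not_li hi (ha.2 u hu); refine ⟨hi, r, s, ?_, hrs⟩
  rintro rfl; refine haP ?_; rw [hrs, zero_smul, add_zero]
  exact Submodule.smul_mem _ _ (F.mem_lineSpan j hu)

lemma dep_apexes {F G : Lift} (hF : F.Smooth) (hG : G.Smooth) {j : ℝ} {a a' : V} {S S' : Set ℝ}
    (hj : j ∈ I01) (hS : S.Finite) (hS' : S'.Finite)
    (ha : ∀ u ∈ I01, u ∉ S → ∃ r s : ℝ, s ≠ 0 ∧ a = r • F u j + s • F.dv u j)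
    (ha' : ∀ u ∈ I01, u ∉ S' → ∃ r s : ℝ, s ≠ 0 ∧ a' = r • G u j + s • G.dv u j)
    (h : ClassicalFPair F.swap G.swap) : ∀ u ∈ I01, Dep ![F u j, a, G u j, a'] := by
  refine subset_of_isClosed_of_finite (isClosed_dep_four (hF.left j).continuous continuous_const
    (hG.left j).continuous continuous_const) (hS.union hS') fun u hu huS => ?_
  simp only [mem_union, not_or] at huS; obtain ⟨α, β, hβ, e1⟩ := ha u hu huS.1
  obtain ⟨α', β', hβ', e2⟩ := ha' u hu huS.2
  obtain ⟨r, s, t, k, hr, hne⟩ := not_li_four.1 (h j hj u hu)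
  have hr' : r • F u j + s • F.dv u j + t • G u j + k • G.dv u j = 0 := hr
  refine not_li_four.2 ⟨β * β' * r - β' * s * α, β' * s, β * β' * t - β * k * α', β * k, ?_, ?_⟩
  · rw [e1, e2]; linear_combination (norm := module) (β * β') • hr'
  · by_contra! hcon
    obtain ⟨h1, h2, h3, h4⟩ := hcon; have hs : s = 0 := by simpa [hβ'] using h2
    have hk : k = 0 := by simpa [hβ] using h4
    subst hs hk; have hr0 : r = 0 := by simpa [hβ, hβ'] using h1
    have ht0 : t = 0 := by simpa [hβ, hβ'] using h3
    simp [hr0, ht0] at hne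

lemma exists_edge_center {F G : Lift} (hF : IsSCPatch F) (hG : IsSCPatch G) {j : ℝ}
    (hj : j ∈ B01) (hpos : EdgePosition F G j)
    (h : ClassicalFPair F G) (h' : ClassicalFPair F.swap G.swap) :
    ∃ O : V, (∃ r s : ℝ, O = r • F 0 j + s • G 0 j) ∧ (∃ r s : ℝ, O = r • F 1 j + s • G 1 j) ∧
      O ∉ F.lineSpan j ∧ O ∉ G.lineSpan j ∧
      ∀ u ∈ I01, ∃ r s : ℝ, G u j = r • F u j + s • O := by
  have hFs : F.Smooth := hF.smooth; have hGs : G.Smooth := hG.smooth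
  have hjm : j ∈ I01 := by
    rcases hj with rfl | rfl
    exacts [zero_mem_Icc, one_mem_Icc]
  obtain ⟨⟨B, hc⟩, a, ha, haP, S, hS, hS0, hS1, hS2⟩ := hF.boundary hj
  obtain ⟨⟨B', hd⟩, a', ha', haP', S', hS', hS0', hS1', hS2'⟩ := hG.boundary hj
  have hdep := dep_apexes hFs hGs hjm hS hS' (fun u hu huS => (hS2 u hu huS).2)
    (fun u hu huS => (hS2' u hu huS).2) h'
  have hq := hpos.quad; obtain ⟨m1, m2, m3⟩ := mem_span_triple_left (F 0 j) (F 1 j) (G 0 j)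
  set Q := span ℝ (range ![F 0 j, F 1 j, G 0 j]) with hQ
  have hPQ : F.lineSpan j ≠ Q := fun he =>
    notMem_span_of_li hpos.du_left (by rw [← hQ, ← he]; exact hc.deriv_mem zero_mem_Icc)
  have hPQ' : G.lineSpan j ≠ Q := fun he =>
    notMem_span_of_li hpos.du_right (by rw [← hQ, ← he]; exact hd.deriv_mem zero_mem_Icc)
  obtain ⟨-, α, β, hβ, e1⟩ := hS2 0 zero_mem_Icc hS0
  obtain ⟨-, α', β', hβ', e2⟩ := hS2' 1 one_mem_Icc hS1'; have haQ : a ∉ Q := by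
    intro haQ; refine notMem_span_of_li hpos.dv_left ((smul_mem_iff _ hβ).1 ?_)
    rw [← hQ, ← add_sub_cancel_left (α • F 0 j) (β • F.dv 0 j), ← e1]
    exact Q.sub_mem haQ (Q.smul_mem _ m1)
  have haa : LI ![a, a'] := by
    rw [li_two]; intro r s hrs; have := li_four.1 hpos.skew (r * α) (r * β) (s * α') (s * β') (by
      rw [e1, e2] at hrs; linear_combination (norm := module) hrs)
    simpa [hβ, hβ'] using And.intro this.2.1 this.2.2.2
  exact exists_center hc hd hdep (fun u hu => h u hu j hjm)
    (finrank_span_three hq.abd) m1 m2 m3 hq.mem hq.abd hq.abc (li_three_swap hq.acd)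
    (li_three_swap hq.bcd) hPQ hPQ' haQ haa

lemma exists_edge_form {F G : Lift} (hF : IsSCPatch F) (hG : IsSCPatch G) (hpos : EdgePosition F G 0)
    (h : ClassicalFPair F G) (h' : ClassicalFPair F.swap G.swap) :
    ∃ (k : ℝ) (l : V →ₗ[ℝ] ℝ), k ≠ 0 ∧ l (F 0 0) = 1 ∧
      (∃ r s : ℝ, k • G 0 0 - F 0 0 = r • F 1 0 + s • G 1 0) ∧
      k • G 0 0 - F 0 0 ∉ F.lineSpan 0 ∧
      ∀ u ∈ I01, Dep ![G u 0, F u 0 + l (F u 0) • (k • G 0 0 - F 0 0)] := by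
  obtain ⟨⟨B', hd⟩, -⟩ := hG.boundary (j := 0) (by simp)
  obtain ⟨O, ⟨r, s, hO⟩, hO1, hOP, hOP', hcd⟩ := exists_edge_center hF hG (j := 0) (by simp) hpos h h'
  have hr : r ≠ 0 := by
    rintro rfl
    exact hOP' (by rw [hO]; simpa using Submodule.smul_mem _ s (G.mem_lineSpan 0 zero_mem_Icc))
  have hs : s ≠ 0 := by
    rintro rfl
    exact hOP (by rw [hO]; simpa using Submodule.smul_mem _ r (F.mem_lineSpan 0 zero_mem_Icc))
  obtain ⟨f, hf, hfP⟩ := exists_dual_ne hOP'; have hfO : f O = r * f (F 0 0) := by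
    rw [hO, map_add, map_smul, map_smul, hfP _ (G.mem_lineSpan 0 zero_mem_Icc)]; simp
  have hfx : f (F 0 0) ≠ 0 := by
    intro h0; rw [h0, mul_zero] at hfO; exact hf hfO
  have hO' : (-s / r) • G 0 0 - F 0 0 = (-r⁻¹) • O := by
    rw [hO, smul_add, smul_smul, smul_smul, show -r⁻¹ * r = -1 by field_simp,
      show -s / r = -r⁻¹ * s by field_simp]
    module
  have hr' : -r⁻¹ ≠ 0 := neg_ne_zero.2 (inv_ne_zero hr)
  refine ⟨-s / r, (f (F 0 0))⁻¹ • f, div_ne_zero (neg_ne_zero.2 hs) hr, ?_, ?_, ?_, ?_⟩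
  · simp [hfx]
  · obtain ⟨x, y, hxy⟩ := hO1; exact ⟨-r⁻¹ * x, -r⁻¹ * y, by rw [hO', hxy]; module⟩
  · rw [hO', smul_mem_iff _ hr']; exact hOP
  · intro u hu; rw [hO']; obtain ⟨x, y, hxy⟩ := hcd u hu; have hx : x ≠ 0 := by
      rintro rfl; rw [zero_smul, zero_add] at hxy; have hy : y ≠ 0 := by
        rintro rfl; exact hd.ne_zero hu (by simpa using hxy)
      exact hOP' ((smul_mem_iff _ hy).1 (hxy ▸ hd.mem u hu))
    have e3 : x * f (F u 0) + y * f O = 0 := by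
      have := hfP _ (hd.mem u hu); rw [hxy] at this; simpa using this
    refine not_li_two.2 ⟨1, -x, ?_, Or.inl one_ne_zero⟩
    have e4 : y = -(x * f (F u 0) / (r * f (F 0 0))) := by
      rw [hfO] at e3; field_simp; linarith
    show (1 : ℝ) • G u 0 + (-x) • (F u 0 + ((f (F 0 0))⁻¹ * f (F u 0)) • (-r⁻¹) • O) = 0
    rw [hxy, e4]
    have e5 : x * f (F u 0) / (r * f (F 0 0)) = x * ((f (F 0 0))⁻¹ * f (F u 0)) * r⁻¹ := by
      field_simp
    rw [e5]; module

/-! ### The normal form of a fundamental pair -/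

lemma Quad.reverse {a b c d : V} (h : Quad a b c d) : Quad a d c b := by
  refine ⟨?_, li_three_swap h.acd, li_three_swap h.abd, li_three_swap h.abc,
    li_three_swap (li_three_rotate (li_three_rotate h.bcd))⟩
  obtain ⟨r, s, t, k, hr, hne⟩ := not_li_four.1 h.dep
  exact not_li_four.2 ⟨r, k, t, s, by linear_combination (norm := module) hr, by tauto⟩

/-- General position of a fundamental pair of patches. -/
structure CellPosition (F G : Lift) : Prop where
  edge1 : EdgePosition F G 0
  edge2 : EdgePosition F.swap G.swap 0
  quad1 : Quad (F 0 1) (F 1 1) (G 1 1) (G 0 1)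
  quad2 : Quad (F 1 0) (F 1 1) (G 1 1) (G 1 0)
  quad_left : Quad (F 0 0) (F 1 0) (F 1 1) (F 0 1)
  quad_right : Quad (G 0 0) (G 1 0) (G 1 1) (G 0 1)
  cube : LI ![G 0 0, F 0 0, F 1 0, F 0 1]

lemma CellPosition.swap {F G : Lift} (h : CellPosition F G) : CellPosition F.swap G.swap where
  edge1 := h.edge2
  edge2 := h.edge1
  quad1 := h.quad2
  quad2 := h.quad1
  quad_left := h.quad_left.reverse
  quad_right := h.quad_right.reverse
  cube := by
    have := h.cube; rw [li_four] at this ⊢; intro r s t k hr; have := this r s k t (by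
      have hr' : r • G 0 0 + s • F 0 0 + t • F 0 1 + k • F 1 0 = 0 := hr
      linear_combination (norm := module) hr')
    tauto

/-- The fundamental transform of a point of the four-dimensional space in direction `X`. -/
def shift (T : V →ₗ[ℝ] Hat) (P : V →ₗ[ℝ] ℝ) (X : Hat) : V →ₗ[ℝ] Hat := T + P.smulRight X

lemma shift_apply (T : V →ₗ[ℝ] Hat) (P : V →ₗ[ℝ] ℝ) (X : Hat) (z : V) :
    shift T P X z = T z + P z • X := rfl

/-- The patch `F` is generated by the conics `T (F u 0)` and `S (F 0 v)`, and the boundary curves of the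
patch `G` are generated by the conics that arise by adding multiples of `X`. -/
structure PairForm (F G : Lift) (T S : V →ₗ[ℝ] Hat) (X : Hat) (P Q : V →ₗ[ℝ] ℝ) : Prop where
  base : ∀ u ∈ I01, ∀ v ∈ I01, Dep ![F u v, meet (T (F u 0)) (S (F 0 v))]
  corner : ∀ j ∈ B01, ∀ k ∈ B01, meet (T (F j 0)) (S (F 0 k)) ≠ 0
  left : ∀ u ∈ I01, ∃ r : ℝ, r ≠ 0 ∧
    meet (shift T P X (F u 0)) (shift S Q X (F 0 0)) = r • G u 0
  right : ∀ v ∈ I01, ∃ r : ℝ, r ≠ 0 ∧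
    meet (shift T P X (F 0 0)) (shift S Q X (F 0 v)) = r • G 0 v
  left_ne : (shift T P X (F 0 0)).2 ≠ 0
  right_ne : (shift S Q X (F 0 0)).2 ≠ 0

namespace PairForm

variable {F G : Lift} {T S : V →ₗ[ℝ] Hat} {X : Hat} {P Q : V →ₗ[ℝ] ℝ}

lemma swap (h : PairForm F G T S X P Q) : PairForm F.swap G.swap S T X Q P where
  base u hu v hv := by
    obtain ⟨r, s, hr, hne⟩ := not_li_two.1 (h.base v hv u hu)
    refine not_li_two.2 ⟨r, -s, ?_, by simpa using hne⟩
    show r • F v u + (-s) • meet (S (F 0 u)) (T (F v 0)) = 0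
    rw [meet_comm, smul_neg, neg_smul, neg_neg]; exact hr
  corner j hj k hk := by
    show meet (S (F 0 j)) (T (F k 0)) ≠ 0
    rw [meet_comm, neg_ne_zero]; exact h.corner k hk j hj
  left u hu := by
    obtain ⟨r, hr, h1⟩ := h.right u hu
    exact ⟨-r, neg_ne_zero.2 hr, by rw [meet_comm, neg_smul]; exact congrArg _ h1⟩
  right u hu := by
    obtain ⟨r, hr, h1⟩ := h.left u hu
    exact ⟨-r, neg_ne_zero.2 hr, by rw [meet_comm, neg_smul]; exact congrArg _ h1⟩
  left_ne := h.right_ne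
  right_ne := h.left_ne

lemma exists_base (h : PairForm F G T S X P Q) {j k : ℝ} (hj : j ∈ B01)
    (hk : k ∈ B01) : ∃ r : ℝ, F j k = r • meet (T (F j 0)) (S (F 0 k)) := by
  have h01 : ∀ j ∈ B01, j ∈ I01 := by
    rintro j (rfl | rfl); exacts [zero_mem_Icc, one_mem_Icc]
  exact exists_smul_of_not_li (h.corner j hj k hk) (dep_two_comm (h.base j (h01 j hj) k (h01 k hk)))

lemma corner_mem (h : PairForm F G T S X P Q) (hpos : CellPosition F G) :
    meet (shift T P X (F 1 0)) (shift S Q X (F 0 1)) ∈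
      span ℝ (range ![F 0 1, F 1 1, G 0 1]) := by
  refine mem_span_of_not_li hpos.quad1.abd ?_
  obtain ⟨r1, e1⟩ := h.exists_base (j := 0) (k := 1) (by simp) (by simp)
  obtain ⟨r2, e2⟩ := h.exists_base (j := 1) (k := 1) (by simp) (by simp)
  obtain ⟨r3, hr3, e3⟩ := h.right 1 one_mem_Icc; intro hli
  obtain ⟨m0, m1, m2, m3⟩ : T (F 0 0) ∈ span ℝ (range ![T (F 0 0), T (F 1 0), S (F 0 1), X]) ∧
    T (F 1 0) ∈ span ℝ (range ![T (F 0 0), T (F 1 0), S (F 0 1), X]) ∧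
    S (F 0 1) ∈ span ℝ (range ![T (F 0 0), T (F 1 0), S (F 0 1), X]) ∧
    X ∈ span ℝ (range ![T (F 0 0), T (F 1 0), S (F 0 1), X]) :=
    ⟨subset_span ⟨0, rfl⟩, subset_span ⟨1, rfl⟩, subset_span ⟨2, rfl⟩,
      subset_span ⟨3, rfl⟩⟩
  have hdep := not_li_meet_four
    (finrank_span_four_le (T (F 0 0)) (T (F 1 0)) (S (F 0 1)) X)
    (a := shift T P X (F 1 0)) (a' := shift S Q X (F 0 1)) (b := T (F 0 0)) (b' := S (F 0 1))
    (c := T (F 1 0)) (c' := S (F 0 1)) (d := shift T P X (F 0 0)) (d' := shift S Q X (F 0 1))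
    (Submodule.add_mem _ m1 (Submodule.smul_mem _ _ m3)) m0 m1
    (Submodule.add_mem _ m0 (Submodule.smul_mem _ _ m3))
    (Submodule.add_mem _ m2 (Submodule.smul_mem _ _ m3)) m2 m2
    (Submodule.add_mem _ m2 (Submodule.smul_mem _ _ m3))
  rw [e3] at hdep; obtain ⟨r, s, t, k, hr, hne⟩ := not_li_four.1 hdep
  have hr1 : r1 ≠ 0 := by rintro rfl; exact hli.ne_zero 1 (by simpa using e1)
  have hr2 : r2 ≠ 0 := by rintro rfl; exact hli.ne_zero 2 (by simpa using e2)
  rw [(eq_inv_smul_iff₀ hr1).2 e1.symm, (eq_inv_smul_iff₀ hr2).2 e2.symm] at hr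
  have := li_four.1 hli r (s * r1⁻¹) (t * r2⁻¹) (k * r3) (by
    linear_combination (norm := module) hr)
  simp only [mul_eq_zero, inv_eq_zero, hr1, hr2, hr3, or_false] at this
  tauto

lemma exists_corner (h : PairForm F G T S X P Q) (hpos : CellPosition F G) :
    (∃ r : ℝ, r ≠ 0 ∧ meet (shift T P X (F 1 0)) (shift S Q X (F 0 1)) = r • G 1 1) ∧
      (shift T P X (F 1 0)).2 ≠ 0 ∧ (shift S Q X (F 0 1)).2 ≠ 0 := by
  set A0 := shift T P X (F 0 0) with hA0
  set A1 := shift T P X (F 1 0) with hA₁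
  set B0 := shift S Q X (F 0 0) with hB0
  set B1 := shift S Q X (F 0 1) with hB₁
  have hq1 := hpos.quad1; have hq2 : Quad (F 1 0) (F 1 1) (G 1 1) (G 1 0) := hpos.quad2
  have hq3 : Quad (F 0 0) (F 0 1) (G 0 1) (G 0 0) := hpos.edge2.quad
  have hx := hpos.quad_left; have hy := hpos.quad_right
  obtain ⟨r0, hr0, e0⟩ := h.left 0 zero_mem_Icc; obtain ⟨r1, hr1, e1⟩ := h.left 1 one_mem_Icc
  obtain ⟨r2, hr2, e2⟩ := h.right 1 one_mem_Icc; rw [← hA0, ← hB0] at e0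
  rw [← hA₁, ← hB0] at e1; rw [← hA0, ← hB₁] at e2; have hli1 := hq1.abd
  have hli2 := hq2.abd; have hli3 := hy.abd
  have n1 : meet A1 B1 ∈ span ℝ (range ![F 0 1, F 1 1, G 0 1]) := h.corner_mem hpos
  have n2 : meet A1 B1 ∈ span ℝ (range ![F 1 0, F 1 1, G 1 0]) := by
    rw [meet_comm, Submodule.neg_mem_iff]; exact h.swap.corner_mem hpos.swap
  have n3 : meet A1 B1 ∈ span ℝ (range ![G 0 0, G 1 0, G 0 1]) := by
    refine mem_span_of_not_li hli3 fun hli => ?_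
    obtain ⟨m0, m1, m2, m3⟩ : A0 ∈ span ℝ (range ![A0, A1, B0, B1]) ∧
      A1 ∈ span ℝ (range ![A0, A1, B0, B1]) ∧
      B0 ∈ span ℝ (range ![A0, A1, B0, B1]) ∧
      B1 ∈ span ℝ (range ![A0, A1, B0, B1]) :=
      ⟨subset_span ⟨0, rfl⟩, subset_span ⟨1, rfl⟩, subset_span ⟨2, rfl⟩,
        subset_span ⟨3, rfl⟩⟩
    have hdep := not_li_meet_four (finrank_span_four_le A0 A1 B0 B1) m1 m0 m1 m0 m3 m2 m2 m3
    rw [e0, e1, e2] at hdep; obtain ⟨r, s, t, k, hr, hne⟩ := not_li_four.1 hdep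
    have := li_four.1 hli r (s * r0) (t * r1) (k * r2) (by linear_combination (norm := module) hr)
    simp only [mul_eq_zero, hr1, hr2, hr0, or_false] at this; tauto
  obtain ⟨x1, x2, x3⟩ := mem_span_triple_left (F 0 1) (F 1 1) (G 0 1)
  obtain ⟨y1, y2, y3⟩ := mem_span_triple_left (F 1 0) (F 1 1) (G 1 0)
  obtain ⟨z1, z2, z3⟩ := mem_span_triple_left (G 0 0) (G 1 0) (G 0 1)
  have g1 : G 1 1 ∈ span ℝ (range ![F 0 1, F 1 1, G 0 1]) := hq1.mem
  have g2 : G 1 1 ∈ span ℝ (range ![F 1 0, F 1 1, G 1 0]) := hq2.mem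
  have g3 : G 1 1 ∈ span ℝ (range ![G 0 0, G 1 0, G 0 1]) := hy.mem
  have d1 := finrank_span_three hli1; have d2 := finrank_span_three hli2
  have d3 := finrank_span_three hli3; set R1 := span ℝ (range ![F 0 1, F 1 1, G 0 1])
  set R2 := span ℝ (range ![F 1 0, F 1 1, G 1 0]); set Y := span ℝ (range ![G 0 0, G 1 0, G 0 1])
  have hne : R1 ≠ R2 := by
    intro he; have f1 : F 1 0 ∈ R1 := he ▸ y1
    have e3 : span ℝ (range ![F 1 0, F 1 1, F 0 1]) = R1 :=
      span_range_eq_of_mem hx.bcd d1 (by intro i; fin_cases i <;> assumption)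
    have f2 : F 0 0 ∈ R1 := by
      rw [← e3]; exact mem_span_of_not_li hx.bcd hx.dep
    have e4 : span ℝ (range ![F 0 0, F 0 1, G 0 1]) = R1 :=
      span_range_eq_of_mem hq3.abc d1 (by intro i; fin_cases i <;> assumption)
    have f3 : G 0 0 ∈ R1 := by
      rw [← e4]; refine mem_span_of_not_li hq3.abc ?_
      obtain ⟨r, s, t, k, hr, hne⟩ := not_li_four.1 hq3.dep
      exact not_li_four.2 ⟨k, r, s, t, by linear_combination (norm := module) hr, by tauto⟩
    exact not_li_of_finrank_lt (E := R1) (by intro i; fin_cases i <;> assumption) (by omega) hpos.cube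
  have hFY : F 1 1 ∉ Y := by
    intro hF; refine hne ?_
    rw [← span_range_eq_of_mem hq1.bcd d1 (by intro i; fin_cases i <;> assumption),
      span_range_eq_of_mem hq1.bcd d3 (by intro i; fin_cases i <;> assumption),
      ← span_range_eq_of_mem hq2.bcd d2 (by intro i; fin_cases i <;> assumption),
      span_range_eq_of_mem hq2.bcd d3 (by intro i; fin_cases i <;> assumption)]
  have hFG : LI ![F 1 1, G 1 1] := by
    rw [li_two]; intro r s hr
    have := li_three.1 hq1.bcd r s 0 (by linear_combination (norm := module) hr)
    tauto
  obtain ⟨s, hs⟩ : ∃ s : ℝ, meet A1 B1 = s • G 1 1 := by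
    obtain ⟨r, s, hrs⟩ := exists_comb_of_mem_planes d1 d2 hne hFG x2 y2 g1 g2 n1 n2
    by_cases hr : r = 0
    · exact ⟨s, by rw [hrs, hr]; simp⟩
    · refine absurd ((Y.smul_mem_iff hr).1 ?_) hFY
      rw [← add_sub_cancel_right (r • F 1 1) (s • G 1 1), ← hrs]
      exact Y.sub_mem n3 (Y.smul_mem _ g3)
  have hA : A1.2 = 0 → B1.2 = 0 := by
    intro h0; have e3 : meet A1 B0 = -B0.2 • A1.1 := by rw [meet_apply, h0]; module
    have e4 : meet A1 B1 = -B1.2 • A1.1 := by rw [meet_apply, h0]; module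
    have := li_three.1 hy.bcd (-B1.2 * r1) (B0.2 * s) 0 (by
      have e5 : (-B1.2) • meet A1 B0 + B0.2 • meet A1 B1 = 0 := by rw [e3, e4]; module
      rw [e1, hs] at e5; linear_combination (norm := module) e5)
    simpa [hr1] using this.1
  have hB : B1.2 = 0 → A1.2 = 0 := by
    intro h0; have e3 : meet A0 B1 = A0.2 • B1.1 := by rw [meet_apply, h0]; module
    have e4 : meet A1 B1 = A1.2 • B1.1 := by rw [meet_apply, h0]; module
    have := li_three.1 hy.bcd 0 (-A0.2 * s) (A1.2 * r2) (by
      have e5 : A1.2 • meet A0 B1 + (-A0.2) • meet A1 B1 = 0 := by rw [e3, e4]; module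
      rw [e2, hs] at e5; linear_combination (norm := module) e5)
    simpa [hr2] using this.2.2
  have hA1 : A1.2 ≠ 0 := by
    intro h0; have h0' := hA h0; refine hFY ?_
    obtain ⟨r, e3⟩ := h.exists_base (j := 1) (k := 1) (by simp) (by simp)
    have hT : T (F 1 0) = A1 - P (F 1 0) • X := by rw [hA₁, shift_apply]; module
    have hS : S (F 0 1) = B1 - Q (F 0 1) • X := by rw [hB₁, shift_apply]; module
    have e4 : meet (T (F 1 0)) (S (F 0 1)) = (Q (F 0 1) * X.2) • A1.1 - (P (F 1 0) * X.2) • B1.1 := by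
      rw [hT, hS, map_sub, map_sub, LinearMap.sub_apply, LinearMap.sub_apply, map_smul, map_smul,
        LinearMap.smul_apply, map_smul, LinearMap.smul_apply, meet_self]
      simp only [meet_apply, h0, h0']; module
    have e5 : A1.1 ∈ Y := by
      have e6 : meet A1 B0 = -B0.2 • A1.1 := by rw [meet_apply, h0]; module
      refine (Y.smul_mem_iff (neg_ne_zero.2 h.right_ne)).1 ?_
      rw [← hB0, ← e6, e1]; exact Y.smul_mem _ z2
    have e7 : B1.1 ∈ Y := by
      have e6 : meet A0 B1 = A0.2 • B1.1 := by rw [meet_apply, h0']; module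
      refine (Y.smul_mem_iff h.left_ne).1 ?_
      rw [← hA0, ← e6, e2]; exact Y.smul_mem _ z3
    rw [e3, e4]; exact Y.smul_mem _ (Y.sub_mem (Y.smul_mem _ e5) (Y.smul_mem _ e7))
  have hB1 : B1.2 ≠ 0 := fun h0 => hA1 (hB h0)
  refine ⟨⟨s, ?_, hs⟩, hA1, hB1⟩
  rintro rfl; rw [zero_smul] at hs
  have e3 : A1.2 • B1 - B1.2 • A1 = 0 := by rw [← inl_meet, hs]; rfl
  have e4 : A1.2 • meet A0 B1 = B1.2 • meet A0 A1 := by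
    have := congrArg (meet A0) (sub_eq_zero.1 e3); rwa [map_smul, map_smul] at this
  have e5 := plucker A0 A1 B0; rw [meet_comm B0 A0] at e5
  have := li_three.1 hli3 (-(A1.2 * B1.2 * r0)) (B1.2 * A0.2 * r1) (B0.2 * A1.2 * r2) (by
    rw [e0, e1] at e5; rw [e2] at e4; linear_combination (norm := module) B1.2 • e5 + B0.2 • e4)
  exact (mul_ne_zero (mul_ne_zero h.right_ne hA1) hr2) this.2.2

end PairForm

lemma Lift.Smooth.du_eq {F : Lift} (h : F.Smooth) (p : ℝ × ℝ) :
    F.du p.1 p.2 = fderiv ℝ (fun p : ℝ × ℝ => F p.1 p.2) p (1, 0) := by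
  have := (h.differentiable (by simp) p).hasFDerivAt.comp_hasDerivAt p.1
    ((hasDerivAt_id p.1).prodMk (hasDerivAt_const p.1 p.2))
  exact this.deriv

lemma Lift.Smooth.dv_eq {F : Lift} (h : F.Smooth) (p : ℝ × ℝ) :
    F.dv p.1 p.2 = fderiv ℝ (fun p : ℝ × ℝ => F p.1 p.2) p (0, 1) := by
  have := (h.differentiable (by simp) p).hasFDerivAt.comp_hasDerivAt p.2
    ((hasDerivAt_const p.2 p.1).prodMk (hasDerivAt_id p.2))
  exact this.deriv

lemma Lift.Smooth.dv_du {F : Lift} (h : F.Smooth) (u v : ℝ) : F.dv.du u v = F.du.dv u v := by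
  have hd : Differentiable ℝ (fderiv ℝ (fun p : ℝ × ℝ => F p.1 p.2)) :=
    (h.fderiv_right (m := ∞) (by simp)).differentiable (by simp)
  have h1 := h.dv.du_eq (u, v); have h2 := h.du.dv_eq (u, v)
  rw [show (fun p : ℝ × ℝ => F.dv p.1 p.2) = fun p => fderiv ℝ (fun p : ℝ × ℝ => F p.1 p.2) p (0, 1)
    from funext h.dv_eq] at h1
  rw [show (fun p : ℝ × ℝ => F.du p.1 p.2) = fun p => fderiv ℝ (fun p : ℝ × ℝ => F p.1 p.2) p (1, 0)
    from funext h.du_eq] at h2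
  rw [fderiv_clm_apply (hd _) (differentiableAt_const _)] at h1 h2
  simp only [fderiv_fun_const, Pi.zero_apply, ContinuousLinearMap.comp_zero, zero_add,
    ContinuousLinearMap.flip_apply] at h1 h2
  rw [h1, h2]
  exact (h.contDiffAt.isSymmSndFDerivAt (by simp; exact WithTop.coe_le_coe.2 le_top)).eq _ _

lemma IsSCPatch.swap {F : Lift} (h : IsSCPatch F) : IsSCPatch F.swap := by
  obtain ⟨A1, A2, h1, h2, h3⟩ := h.conics; have hF : F.Smooth := h.smooth
  refine ⟨hF.swap, fun u hu v hv => ?_, ⟨A2, A1, h2, h1, by rwa [inf_comm]⟩, fun p hp h0 =>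
    h.degree_four p hp fun u hu v hv => h0 v hv u hu⟩
  obtain ⟨r, s, t, k, hr, hne⟩ := not_li_four.1 (h.conjugate v hv u hu)
  refine not_li_four.2 ⟨r, t, s, k, ?_, by tauto⟩
  show r • F v u + t • F.dv v u + s • F.du v u + k • F.du.dv v u = 0
  rw [← hF.dv_du]; linear_combination (norm := module) hr

namespace PairForm

variable {F G : Lift} {T S : V →ₗ[ℝ] Hat} {X : Hat} {P Q : V →ₗ[ℝ] ℝ}

lemma li_tangent (hG : IsSCPatch G) {j k : ℝ} (hj : j ∈ B01) (hk : k ∈ B01) :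
    LI ![G j k, G.du j k] := by
  obtain ⟨⟨B, hB⟩, -⟩ := hG.boundary hk; refine hB.immersed j ?_
  rcases hj with rfl | rfl
  exacts [zero_mem_Icc, one_mem_Icc]

lemma tangent_left (h : PairForm F G T S X P Q) (hF : F.Smooth) (hG : G.Smooth) (hne : G 0 0 ≠ 0) :
    ∃ r s : ℝ, r ≠ 0 ∧ meet (shift T P X (F.du 0 0)) (shift S Q X (F 0 0)) = s • G 0 0 + r • G.du 0 0 := by
  have hd : ContDiff ℝ ∞ (fun u => (meet.flip (shift S Q X (F 0 0)) ∘ₗ shift T P X) (F u 0)) :=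
    contDiff_linear_comp _ (hF.left 0)
  obtain ⟨r, s, h1, h2⟩ := tangent_eq_of_dep (hG.left 0) hd (fun u hu => by
    obtain ⟨r, hr, e⟩ := h.left u hu; exact not_li_two.2 ⟨r, -1, by
      show r • G u 0 + (-1 : ℝ) • meet (shift T P X (F u 0)) (shift S Q X (F 0 0)) = 0
      rw [e]; module, Or.inl hr⟩) zero_mem_Icc hne
  rw [deriv_linear_comp _ (hF.left 0)] at h2; refine ⟨r, s, ?_, h2⟩
  rintro rfl; obtain ⟨r, hr, e⟩ := h.left 0 zero_mem_Icc; rw [zero_smul] at h1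
  have h1' : meet (shift T P X (F 0 0)) (shift S Q X (F 0 0)) = 0 := h1
  rw [h1'] at e
  rcases smul_eq_zero.1 e.symm with h0 | h0
  exacts [hr h0, hne h0]

lemma tangent_base (h : PairForm F G T S X P Q) (hF : F.Smooth) (hne : F 0 1 ≠ 0) :
    ∃ r s : ℝ, r ≠ 0 ∧ meet (T (F 0 0)) (S (F 0 1)) = r • F 0 1 ∧
      meet (T (F.du 0 0)) (S (F 0 1)) = s • F 0 1 + r • F.du 0 1 := by
  have hd : ContDiff ℝ ∞ (fun u => (meet.flip (S (F 0 1)) ∘ₗ T) (F u 0)) :=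
    contDiff_linear_comp _ (hF.left 0)
  obtain ⟨r, s, h1, h2⟩ := tangent_eq_of_dep (hF.left 1) hd (fun u hu => h.base u hu 1 one_mem_Icc)
    zero_mem_Icc hne
  rw [deriv_linear_comp _ (hF.left 0)] at h2; refine ⟨r, s, ?_, h1, h2⟩
  rintro rfl; exact h.corner 0 (by simp) 1 (by simp) (by rw [zero_smul] at h1; exact h1)

lemma apex_mem (h : PairForm F G T S X P Q) (hF : IsSCPatch F) (hG : IsSCPatch G)
    (hFG : ClassicalFPair F G) (hpos : CellPosition F G) :
    meet (shift T P X (F 0 0)) (shift T P X (F.du 0 0)) ∈ G.lineSpan 1 := by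
  have hFs : F.Smooth := hF.smooth; have hGs : G.Smooth := hG.smooth
  set γ := meet (shift T P X (F 0 0)) (shift T P X (F.du 0 0)) with hγ
  have t00 := li_tangent hG (j := 0) (k := 0) (by simp) (by simp)
  obtain ⟨r0, hr0, e0⟩ := h.left 0 zero_mem_Icc
  obtain ⟨r1, s1, hr1, e1⟩ := h.tangent_left hFs hGs (li_left_ne t00)
  have hn := h.right_ne; have hn' := h.left_ne
  have m1 : ∃ r s : ℝ, γ = r • G 0 0 + s • G.du 0 0 := by
    have := plucker (shift T P X (F 0 0)) (shift T P X (F.du 0 0)) (shift S Q X (F 0 0))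
    rw [meet_comm (shift S Q X (F 0 0)), e0, e1, ← hγ] at this; set b := (shift S Q X (F 0 0)).2
    refine ⟨-(b⁻¹ * ((shift T P X (F 0 0)).2 * s1 - (shift T P X (F.du 0 0)).2 * r0)),
      -(b⁻¹ * ((shift T P X (F 0 0)).2 * r1)), ?_⟩
    have e2 : γ = b⁻¹ • (b • γ) := by rw [smul_smul, inv_mul_cancel₀ hn, one_smul]
    rw [e2]; linear_combination (norm := module) b⁻¹ • this
  have hγ0 : γ ≠ 0 := by
    intro h0; have e2 : (shift T P X (F 0 0)).2 • shift T P X (F.du 0 0) -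
      (shift T P X (F.du 0 0)).2 • shift T P X (F 0 0) = 0 := by rw [← inl_meet, ← hγ, h0]; rfl
    have e3 := congrArg (fun z => meet z (shift S Q X (F 0 0))) (sub_eq_zero.1 e2)
    simp only [map_smul, LinearMap.smul_apply] at e3; rw [e0, e1] at e3
    have := li_two.1 t00 ((shift T P X (F 0 0)).2 * s1 - (shift T P X (F.du 0 0)).2 * r0)
      ((shift T P X (F 0 0)).2 * r1) (by linear_combination (norm := module) e3)
    exact mul_ne_zero hn' hr1 this.2
  have lF : LI ![F 0 1, F.du 0 1, G 0 1] := by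
    have hq : Quad (F 0 0) (F 0 1) (G 0 1) (G 0 0) := hpos.edge2.quad
    have hd : LI ![F.du 0 1, F 0 0, F 0 1, G 0 0] := hpos.edge2.dv_left'
    rw [li_three]; intro r s t hr; have hs : s = 0 := by
      by_contra hs; obtain ⟨m1, m2, m3⟩ := mem_span_triple_left (F 0 0) (F 0 1) (G 0 0)
      refine notMem_span_of_li hd ((smul_mem_iff _ hs).1 ?_)
      rw [show s • F.du 0 1 = (-r) • F 0 1 + (-t) • G 0 1 by linear_combination (norm := module) hr]
      exact Submodule.add_mem _ (Submodule.smul_mem _ _ m2) (Submodule.smul_mem _ _ hq.mem)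
    subst hs; have := li_three.1 hq.bcd r t 0 (by linear_combination (norm := module) hr)
    tauto
  have hF01 : F 0 1 ≠ 0 := lF.ne_zero 0; obtain ⟨r2, s2, hr2, e2, e3⟩ := h.tangent_base hFs hF01
  obtain ⟨r3, hr3, e4⟩ := h.right 1 one_mem_Icc
  have m2 : γ ∈ span ℝ (range ![F 0 1, F.du 0 1, G 0 1]) := by
    refine mem_span_of_not_li lF fun hli => ?_
    set K := span ℝ (range ![T (F 0 0), T (F.du 0 0), S (F 0 1), X]) with hK
    have n0 : T (F 0 0) ∈ K := subset_span ⟨0, rfl⟩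
    have n1 : T (F.du 0 0) ∈ K := subset_span ⟨1, rfl⟩
    have n2 : S (F 0 1) ∈ K := subset_span ⟨2, rfl⟩; have n3 : X ∈ K := subset_span ⟨3, rfl⟩
    have hdep := not_li_meet_four
      (finrank_span_four_le (T (F 0 0)) (T (F.du 0 0)) (S (F 0 1)) X)
      (a := shift T P X (F 0 0)) (a' := shift T P X (F.du 0 0)) (b := T (F 0 0)) (b' := S (F 0 1))
      (c := T (F.du 0 0)) (c' := S (F 0 1)) (d := shift T P X (F 0 0)) (d' := shift S Q X (F 0 1))
      (K.add_mem n0 (K.smul_mem _ n3)) n0 n1 (K.add_mem n0 (K.smul_mem _ n3))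
      (K.add_mem n1 (K.smul_mem _ n3)) n2 n2 (K.add_mem n2 (K.smul_mem _ n3))
    rw [e2, e3, e4] at hdep; obtain ⟨r, s, t, k, hr, hne⟩ := not_li_four.1 hdep
    have := li_four.1 hli r (s * r2 + t * s2) (t * r2) (k * r3) (by
      linear_combination (norm := module) hr)
    obtain ⟨h1, h2, h3, h4⟩ := this; have ht : t = 0 := by simpa [hr2] using h3
    subst ht; have hs : s = 0 := by simpa [hr2] using h2
    have hk : k = 0 := by simpa [hr3] using h4
    simp [h1, hs, hk] at hne
  obtain ⟨-, g, hg, hgP, Sg, hSg, h0Sg, h1Sg, hg'⟩ := IsSCPatch.boundary (F := G.swap)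
    (by exact hG.swap) (j := 0) (by simp)
  obtain ⟨-, α, β, hβ, g0⟩ := hg' 0 zero_mem_Icc h0Sg
  obtain ⟨-, α', β', hβ', g1⟩ := hg' 1 one_mem_Icc h1Sg
  replace g0 : g = α • G 0 0 + β • G.du 0 0 := g0
  replace g1 : g = α' • G 0 1 + β' • G.du 0 1 := g1
  obtain ⟨n1, n2, n3⟩ := mem_span_triple_left (F 0 1) (F.du 0 1) (G 0 1)
  have hR := finrank_span_three lF; set R := span ℝ (range ![F 0 1, F.du 0 1, G 0 1])
  have gR : g ∈ R := by
    have hGu : G.du 0 1 ∈ R := by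
      refine mem_span_of_not_li lF ?_
      obtain ⟨r, s, t, k, hr, hne⟩ := not_li_four.1 (hFG 0 zero_mem_Icc 1 one_mem_Icc)
      exact not_li_four.2 ⟨k, r, s, t, by linear_combination (norm := module) hr, by tauto⟩
    rw [g1]; exact R.add_mem (R.smul_mem _ n3) (R.smul_mem _ hGu)
  obtain ⟨x, y, hxy⟩ := m1; have hgγ : ¬ LI ![γ, g] := by
    intro hli; have hsk : LI ![G 0 0, G.du 0 0, F 0 1, F.du 0 1] := hpos.edge2.skew'
    have e5 : span ℝ (range ![γ, g]) = span ℝ (range ![G 0 0, G.du 0 0]) :=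
      span_range_eq_of_mem hli (by simpa using finrank_span_eq_card t00) (by
        intro i; fin_cases i
        · exact mem_span_pair_range.2 ⟨x, y, hxy⟩
        · exact mem_span_pair_range.2 ⟨α, β, g0⟩)
    have e6 : span ℝ (range ![γ, g]) ≤ R := span_le.2 (by
      rintro _ ⟨i, rfl⟩; fin_cases i
      exacts [m2, gR])
    rw [e5] at e6; have k0 : G 0 0 ∈ R := e6 (subset_span ⟨0, rfl⟩)
    have k1 : G.du 0 0 ∈ R := e6 (subset_span ⟨1, rfl⟩)
    exact not_li_of_finrank_lt (E := R) (by intro i; fin_cases i <;> assumption) (by omega) hsk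
  obtain ⟨m, hm⟩ := exists_smul_of_not_li hg.1 (dep_two_comm hgγ)
  rw [hm]; refine Submodule.smul_mem _ _ ?_; obtain ⟨⟨B, hB⟩, -⟩ := hG.boundary (j := 1) (by simp)
  rw [g1]; exact Submodule.add_mem _ (Submodule.smul_mem _ _ (hB.mem 0 zero_mem_Icc))
    (Submodule.smul_mem _ _ (hB.deriv_mem zero_mem_Icc))

lemma lineSpan_eq (hF : IsSCPatch F) (h : LI ![F.du 0 0, F 0 0, F 1 0]) :
    span ℝ (range ![F.du 0 0, F 0 0, F 1 0]) = F.lineSpan 0 := by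
  obtain ⟨⟨B, hB⟩, -⟩ := hF.boundary (j := 0) (by simp)
  refine span_range_eq_of_mem h hB.finrank ?_
  intro i; fin_cases i
  exacts [hB.deriv_mem zero_mem_Icc, hB.mem 0 zero_mem_Icc, hB.mem 1 one_mem_Icc]

lemma axis_mem (h : PairForm F G T S X P Q) (hF : IsSCPatch F) (hG : IsSCPatch G)
    (hFG : ClassicalFPair F G) (hpos : CellPosition F G) {z : V} (hz : z ∈ F.lineSpan 0) :
    meet (shift T P X z) (shift T P X (F 0 0)) ∈ G.lineSpan 0 ⊓ G.lineSpan 1 := by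
  have hn := h.right_ne; have hn' := h.left_ne
  obtain ⟨⟨r1, hr1, e1⟩, hA1, hB1⟩ := h.exists_corner hpos
  obtain ⟨r2, hr2, e2⟩ := h.right 1 one_mem_Icc; have hapex := h.apex_mem hF hG hFG hpos
  have hli : LI ![F.du 0 0, F 0 0, F 1 0] := by
    have := hpos.edge1.du_left; rw [li_four] at this; rw [li_three]
    intro r s t hr; have := this r s t 0 (by linear_combination (norm := module) hr)
    tauto
  have k0 : ∀ z ∈ F.lineSpan 0, meet (shift T P X z) (shift S Q X (F 0 0)) ∈ G.lineSpan 0 := by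
    have : F.lineSpan 0 ≤ (G.lineSpan 0).comap (meet.flip (shift S Q X (F 0 0)) ∘ₗ shift T P X) := by
      refine span_le.2 ?_
      rintro _ ⟨u, hu, rfl⟩; obtain ⟨r, -, e⟩ := h.left u hu
      show meet (shift T P X (F u 0)) (shift S Q X (F 0 0)) ∈ G.lineSpan 0
      rw [e]; exact Submodule.smul_mem _ _ (G.mem_lineSpan 0 hu)
    exact fun z hz => this hz
  have k1 : ∀ z ∈ F.lineSpan 0, meet (shift T P X z) (shift S Q X (F 0 1)) ∈ G.lineSpan 1 := by
    have : F.lineSpan 0 ≤ (G.lineSpan 1).comap (meet.flip (shift S Q X (F 0 1)) ∘ₗ shift T P X) := by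
      rw [← lineSpan_eq hF hli]; refine span_le.2 ?_; rintro _ ⟨i, rfl⟩
      have i0 : meet (shift T P X (F 0 0)) (shift S Q X (F 0 1)) ∈ G.lineSpan 1 := by
        rw [e2]; exact Submodule.smul_mem _ _ (G.mem_lineSpan 1 zero_mem_Icc)
      fin_cases i
      · show meet (shift T P X (F.du 0 0)) (shift S Q X (F 0 1)) ∈ G.lineSpan 1
        have := plucker (shift T P X (F 0 0)) (shift T P X (F.du 0 0)) (shift S Q X (F 0 1))
        rw [meet_comm (shift S Q X (F 0 1))] at this; refine (smul_mem_iff _ hn').1 ?_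
        rw [show (shift T P X (F 0 0)).2 • meet (shift T P X (F.du 0 0)) (shift S Q X (F 0 1)) =
          (shift T P X (F.du 0 0)).2 • meet (shift T P X (F 0 0)) (shift S Q X (F 0 1)) -
          (shift S Q X (F 0 1)).2 • meet (shift T P X (F 0 0)) (shift T P X (F.du 0 0)) by
          linear_combination (norm := module) this]
        exact Submodule.sub_mem _ (Submodule.smul_mem _ _ i0) (Submodule.smul_mem _ _ hapex)
      · exact i0
      · show meet (shift T P X (F 1 0)) (shift S Q X (F 0 1)) ∈ G.lineSpan 1
        rw [e1]; exact Submodule.smul_mem _ _ (G.mem_lineSpan 1 one_mem_Icc)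
    exact fun z hz => this hz
  have hx : F 0 0 ∈ F.lineSpan 0 := F.mem_lineSpan 0 zero_mem_Icc
  have key : ∀ (E : Submodule ℝ V) (b : Hat), b.2 ≠ 0 → (∀ z ∈ F.lineSpan 0, meet (shift T P X z) b ∈ E) →
      meet (shift T P X z) (shift T P X (F 0 0)) ∈ E := by
    intro E b hb hE; have := plucker (shift T P X z) (shift T P X (F 0 0)) b
    rw [meet_comm b] at this; refine (smul_mem_iff _ hb).1 ?_
    rw [show b.2 • meet (shift T P X z) (shift T P X (F 0 0)) =
      (shift T P X (F 0 0)).2 • meet (shift T P X z) b - (shift T P X z).2 • meet (shift T P X (F 0 0)) b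
      by linear_combination (norm := module) this]
    exact Submodule.sub_mem _ (Submodule.smul_mem _ _ (hE z hz)) (Submodule.smul_mem _ _ (hE _ hx))
  exact ⟨key _ _ hn k0, key _ _ hB1 k1⟩

lemma dep (h : PairForm F G T S X P Q) (hF : IsSCPatch F) (hG : IsSCPatch G)
    (hFG : ClassicalFPair F G) (hFG' : ClassicalFPair F.swap G.swap) (hpos : CellPosition F G) :
    ∀ u ∈ I01, ∀ v ∈ I01,
      Dep ![G u v, meet (shift T P X (F u 0)) (shift S Q X (F 0 v))] := by
  intro u hu v hv; have hGs : G.Smooth := hG.smooth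
  obtain ⟨A1, A2, p1, p2, w1, w2, hN⟩ := hG.exists_normalForm
  have a1 := h.axis_mem hF hG hFG hpos (F.mem_lineSpan 0 hu)
  have a2 := h.swap.axis_mem hF.swap hG.swap hFG' hpos.swap (F.swap.mem_lineSpan 0 hv)
  rw [hN.family1.inf_planes hGs] at a1; rw [hN.family2.inf_planes hGs.swap] at a2
  change meet (shift S Q X (F 0 v)) (shift S Q X (F 0 0)) ∈ A2 at a2
  have hs := hN.splitting; obtain ⟨r0, hr0, e0⟩ := h.left 0 zero_mem_Icc
  obtain ⟨r1, hr1, e1⟩ := h.left u hu; obtain ⟨r2, hr2, e2⟩ := h.right v hv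
  have hn := h.right_ne; have hn' := h.left_ne; set α := shift T P X (F u 0)
  set A := shift T P X (F 0 0); set β := shift S Q X (F 0 v); set B := shift S Q X (F 0 0)
  have c1 : A.2 • p2 (meet α B) = α.2 • p2 (meet A B) := by
    have := congrArg p2 (plucker α A B)
    simp only [map_add, map_smul, hs.right_zero a1, meet_comm B α, map_neg, map_zero] at this
    linear_combination (norm := module) -this
  have c2 : B.2 • p1 (meet A β) = β.2 • p1 (meet A B) := by
    have := congrArg p1 (plucker A B β)
    have h0 : p1 (meet B β) = 0 := by rw [meet_comm, map_neg, hs.left_zero a2, neg_zero]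
    simp only [map_add, map_smul, h0, meet_comm β A, map_neg, map_zero] at this
    linear_combination (norm := module) -this
  have c3 : A.2 • p2 (meet α β) = α.2 • p2 (meet A β) := by
    have := congrArg p2 (plucker α A β)
    simp only [map_add, map_smul, hs.right_zero a1, meet_comm β α, map_neg, map_zero] at this
    linear_combination (norm := module) -this
  have c4 : B.2 • p1 (meet α β) = β.2 • p1 (meet α B) := by
    have := congrArg p1 (plucker α B β)
    have h0 : p1 (meet B β) = 0 := by rw [meet_comm, map_neg, hs.left_zero a2, neg_zero]
    simp only [map_add, map_smul, h0, meet_comm β α, map_neg, map_zero] at this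
    linear_combination (norm := module) -this
  rw [e0, e1, map_smul, map_smul, hN.form1 _ (G.mem_lineSpan 0 hu)] at c1
  rw [e0, e2, map_smul, map_smul, show p1 (G 0 v) = w2 (G 0 v) • p1 (G 0 0) from
    hN.form2 _ (G.swap.mem_lineSpan 0 hv)] at c2
  rw [e2, map_smul] at c3; rw [e1, map_smul] at c4; have d1 : A.2 * r1 * w1 (G u 0) = α.2 * r0 := by
    refine sub_eq_zero.1 ((smul_eq_zero.1 (?_ : (A.2 * r1 * w1 (G u 0) - α.2 * r0) •
      p2 (G 0 0) = 0)).resolve_right hN.right_ne)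
    linear_combination (norm := module) c1
  have d2 : B.2 * r2 * w2 (G 0 v) = β.2 * r0 := by
    refine sub_eq_zero.1 ((smul_eq_zero.1 (?_ : (B.2 * r2 * w2 (G 0 v) - β.2 * r0) •
      p1 (G 0 0) = 0)).resolve_right hN.left_ne)
    linear_combination (norm := module) c2
  have key : (A.2 * B.2 * r0) • meet α β = (A.2 * B.2 * r1 * r2) •
      (w1 (G u 0) • p2 (G 0 v) + w2 (G 0 v) • p1 (G u 0)) := by
    have := hs.add (meet α β)
    linear_combination (norm := module) (-(A.2 * B.2 * r0)) • this + (B.2 * r0) • c3 +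
      (A.2 * r0) • c4 - (B.2 * r2) • (d1 • p2 (G 0 v)) - (A.2 * r1) • (d2 • p1 (G u 0))
  obtain ⟨r, s, hr, hne⟩ := not_li_two.1 (hN.dep u hu v hv)
  refine not_li_two.2 ⟨r * (A.2 * B.2 * r1 * r2), s * (A.2 * B.2 * r0), ?_, ?_⟩
  · rw [mul_smul s, key]; linear_combination (norm := module) (A.2 * B.2 * r1 * r2) • hr
  · simp only [ne_eq, mul_eq_zero, hn, hn', hr0, hr1, hr2, or_false]
    exact hne

end PairForm

lemma exists_ne_smul_of_not_li {W : Type*} [AddCommGroup W] [Module ℝ W] {a b : W} (ha : a ≠ 0)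
    (hb : b ≠ 0) (h : ¬ LI ![a, b]) : ∃ r : ℝ, r ≠ 0 ∧ b = r • a := by
  obtain ⟨r, hr⟩ := exists_smul_of_not_li ha h
  exact ⟨r, by rintro rfl; exact hb (by rw [hr, zero_smul]), hr⟩

lemma IsSCPatch.ne_zero_left {F : Lift} (hF : IsSCPatch F) {j : ℝ} (hj : j ∈ B01) {u : ℝ}
    (hu : u ∈ I01) : F u j ≠ 0 := by
  obtain ⟨⟨B, hB⟩, -⟩ := hF.boundary hj; exact hB.ne_zero hu

lemma lift1_apply (p : V →ₗ[ℝ] V) (w : V →ₗ[ℝ] ℝ) (z : V) : lift1 p w z = (p z, w z) := rfl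

lemma lift2_apply (p : V →ₗ[ℝ] V) (w : V →ₗ[ℝ] ℝ) (z : V) : lift2 p w z = (p z, -w z) := rfl

lemma exists_pairForm {F G : Lift} (hF : IsSCPatch F) (hG : IsSCPatch G) (hFG : ClassicalFPair F G)
    (hFG' : ClassicalFPair F.swap G.swap) (hpos : CellPosition F G) {A1 A2 : Submodule ℝ V}
    {p1 p2 : V →ₗ[ℝ] V} {w1 w2 : V →ₗ[ℝ] ℝ} (hN : NormalForm F A1 A2 p1 p2 w1 w2) :
    ∃ X P Q, PairForm F G (lift1 p1 w1) (lift2 p2 w2) X P Q ∧ P (F 0 0) = 0 ∧ Q (F 0 0) = 1 := by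
  obtain ⟨k, l, hk, hl, -, hkl, hD⟩ := exists_edge_form hF hG hpos.edge1 hFG hFG'
  obtain ⟨k', l', hk', hl', -, hkl', hD'⟩ := exists_edge_form hF.swap hG.swap hpos.edge2 hFG' hFG
  change l' (F 0 0) = 1 at hl'
  change k' • G 0 0 - F 0 0 ∉ F.swap.lineSpan 0 at hkl'
  change ∀ u ∈ I01, Dep ![G 0 u, F 0 u + l' (F 0 u) • (k' • G 0 0 - F 0 0)] at hD'
  have hFs : F.Smooth := hF.smooth; have hs := hN.splitting; have hw := hN.w_zero
  have hw' : w2 (F 0 0) = 1 := hN.swap.w_zero; set x := F 0 0 with hx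
  obtain ⟨ρ, hρ0, hρk⟩ : ∃ ρ : ℝ, ρ ≠ 0 ∧ ρ * k = k' :=
    ⟨k' / k, div_ne_zero hk' hk, div_mul_cancel₀ _ hk⟩
  set X : Hat := (k' • G 0 0 - x + (1 - ρ) • p1 x, 1 - ρ) with hX
  have hadd := hs.add x
  have e1 : ∀ z ∈ F.lineSpan 0, meet (shift (lift1 p1 w1) (l - w1) X z) (shift (lift2 p2 w2) l' X x) =
      ρ • (z + l z • (k • G 0 0 - x)) := by
    intro z hz; have h1 := hs.add z; rw [hN.form1 z hz] at h1
    simp only [shift_apply, meet_apply, lift1_apply, lift2_apply, hX, hl', hw', LinearMap.sub_apply, Prod.fst_add, Prod.snd_add, Prod.smul_fst, Prod.smul_snd,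
      smul_eq_mul]
    linear_combination (norm := module) ρ • h1 + (l z * (1 - ρ)) • hadd - l z • (hρk • G 0 0)
  have e2 : ∀ z ∈ F.swap.lineSpan 0, meet (shift (lift1 p1 w1) (l - w1) X x)
      (shift (lift2 p2 w2) l' X z) = z + l' z • (k' • G 0 0 - x) := by
    intro z hz; have h1 := hs.add z; rw [show p1 z = w2 z • p1 x from hN.form2 z hz] at h1
    simp only [shift_apply, meet_apply, lift1_apply, lift2_apply, hX, hl, hw, LinearMap.sub_apply, Prod.fst_add, Prod.snd_add, Prod.smul_fst, Prod.smul_snd,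
      smul_eq_mul]
    linear_combination (norm := module) h1
  have hne : ∀ {E : Submodule ℝ V} {z w : V} {r : ℝ}, z ∈ E → z ≠ 0 → w ∉ E → z + r • w ≠ 0 := by
    intro E z w r hz hz0 hw h0; have hr : r ≠ 0 := by rintro rfl; exact hz0 (by simpa using h0)
    refine hw ((E.smul_mem_iff hr).1 ?_)
    rw [← neg_eq_of_add_eq_zero_right h0]; exact E.neg_mem hz
  refine ⟨X, l - w1, l', ⟨fun u hu v hv => ?_, fun j hj i hi => ?_, fun u hu => ?_, fun v hv => ?_, ?_, ?_⟩,
    by simp [hl, hw], hl'⟩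
  · rw [meet_lift]; exact hN.dep u hu v hv
  · rw [meet_lift]; intro h0; have h1 := congrArg p2 h0
    rw [map_add, map_smul, map_smul, hs.right_eq _ (hs.mem_right _), hs.right_zero (hs.mem_left _),
      smul_zero, add_zero, map_zero] at h1
    have h2 : w1 (F j 0) ≠ 0 := by
      rcases hj with rfl | rfl
      · rw [← hx, hw]; exact one_ne_zero
      · exact hN.ne_one hFs
    have h3 : p2 (F 0 i) ≠ 0 := by
      rcases hi with rfl | rfl
      · exact hN.right_ne
      · exact hN.right_ne_one hFs
    exact (smul_ne_zero h2 h3) h1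
  · have h1 := hne (r := l (F u 0)) (F.mem_lineSpan 0 hu) (hF.ne_zero_left (by simp) hu) hkl
    obtain ⟨r, hr, h2⟩ := exists_ne_smul_of_not_li (hG.ne_zero_left (by simp) hu) h1 (hD u hu)
    exact ⟨ρ * r, mul_ne_zero hρ0 hr, by rw [e1 _ (F.mem_lineSpan 0 hu), h2, smul_smul]⟩
  · have h1 := hne (r := l' (F 0 v)) (F.swap.mem_lineSpan 0 hv) (hF.swap.ne_zero_left (by simp) hv) hkl'
    obtain ⟨r, hr, h2⟩ := exists_ne_smul_of_not_li (hG.swap.ne_zero_left (by simp) hv) h1 (hD' v hv)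
    exact ⟨r, hr, (e2 _ (F.swap.mem_lineSpan 0 hv)).trans h2⟩
  · have h1 : (l - w1) x = 0 := by simp [hl, hw]
    show (lift1 p1 w1 x + (l - w1) x • X).2 ≠ 0
    rw [h1, zero_smul, add_zero]
    show w1 x ≠ 0
    rw [hw]; exact one_ne_zero
  · show (lift2 p2 w2 x + l' x • X).2 ≠ 0
    rw [hl', one_smul]
    show -w2 x + (1 - ρ) ≠ 0
    rw [hw']; intro h0; exact hρ0 (by linarith)

/-! ### Fundamental pairs of generated patches -/

/-- The patch generated by linear images of the boundary curves `v = 0` and `u = 0` of `F`. -/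
def gen (F : Lift) (T S : V →ₗ[ℝ] Hat) : Lift := meetLift (fun u => T (F u 0)) (fun v => S (F 0 v))

lemma smooth_gen {F : Lift} (hF : F.Smooth) (T S : V →ₗ[ℝ] Hat) : (gen F T S).Smooth :=
  smooth_meetLift (contDiff_linear_comp T (hF.left 0)) (contDiff_linear_comp S (hF.right 0))

lemma du_gen {F : Lift} (hF : F.Smooth) (T S : V →ₗ[ℝ] Hat) (u v : ℝ) :
    (gen F T S).du u v = meet (T (F.du u 0)) (S (F 0 v)) := by
  rw [gen, du_meetLift (contDiff_linear_comp T (hF.left 0)), meetLift, deriv_linear_comp T (hF.left 0)]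
  rfl

lemma swap_gen (F : Lift) (T S : V →ₗ[ℝ] Hat) : (gen F T S).swap = gen F.swap (-S) T :=
  swap_meetLift _ _

lemma ClassicalFPair.symm {F G : Lift} (h : ClassicalFPair F G) : ClassicalFPair G F := by
  intro u hu v hv; obtain ⟨r, s, t, k, hr, hne⟩ := not_li_four.1 (h u hu v hv)
  exact not_li_four.2 ⟨t, k, r, s, by linear_combination (norm := module) hr, by tauto⟩

lemma classicalFPair_gen {F : Lift} (hF : F.Smooth) {T S T' S' : V →ₗ[ℝ] Hat} {P Q : V → ℝ}
    {c d : ℝ} {Y : Hat} (hT : ∀ z, T' z = c • T z + P z • Y) (hS : ∀ z, S' z = d • S z + Q z • Y) :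
    ClassicalFPair (gen F T S) (gen F T' S') := by
  intro u hu v hv; rw [du_gen hF, du_gen hF]
  set K := span ℝ (range ![T (F u 0), T (F.du u 0), S (F 0 v), Y])
  have m0 : T (F u 0) ∈ K := subset_span ⟨0, rfl⟩
  have m1 : T (F.du u 0) ∈ K := subset_span ⟨1, rfl⟩
  have m2 : S (F 0 v) ∈ K := subset_span ⟨2, rfl⟩; have m3 : Y ∈ K := subset_span ⟨3, rfl⟩
  have n2 : S' (F 0 v) ∈ K := by
    rw [hS]; exact K.add_mem (K.smul_mem _ m2) (K.smul_mem _ m3)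
  have n0 : T' (F u 0) ∈ K := by
    rw [hT]; exact K.add_mem (K.smul_mem _ m0) (K.smul_mem _ m3)
  have n1 : T' (F.du u 0) ∈ K := by
    rw [hT]; exact K.add_mem (K.smul_mem _ m1) (K.smul_mem _ m3)
  exact not_li_meet_four (finrank_span_four_le _ _ _ _) m0 m1 n0 n1 m2 m2 n2 n2

lemma ClassicalFPair.congr {F F' G : Lift} (hF : F.Smooth) (hF' : F'.Smooth) (hG : G.Smooth)
    (hd : SamePatch F' F) {S : Set ℝ} (hS : S.Finite)
    (hz : ∀ v ∈ I01, v ∉ S → {u | u ∈ I01 ∧ F u v = 0}.Finite)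
    (h : ClassicalFPair F G) : ClassicalFPair F' G := by
  intro u hu v hv; have hu' : ContDiff ℝ ∞ (fun p : ℝ × ℝ => F'.du p.1 p.2) := hF'.du
  have hGu : ContDiff ℝ ∞ (fun p : ℝ × ℝ => G.du p.1 p.2) := hG.du
  refine subset_of_isClosed_of_finite (P := {v | Dep ![F' u v, F'.du u v, G u v, G.du u v]})
    (isClosed_dep_four (hF'.right u).continuous (Lift.Smooth.right hu' u).continuous
      (hG.right u).continuous (Lift.Smooth.right hGu u).continuous) hS (fun v hv hvS => ?_) v hv
  refine subset_of_isClosed_of_finite (P := {u | Dep ![F' u v, F'.du u v, G u v, G.du u v]})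
    (isClosed_dep_four (hF'.left v).continuous (Lift.Smooth.left hu' v).continuous
      (hG.left v).continuous (Lift.Smooth.left hGu v).continuous) (hz v hv hvS) (fun u hu huS => ?_) u hu
  have hne : F u v ≠ 0 := fun h0 => huS ⟨hu, h0⟩
  obtain ⟨r, s, h1, h2⟩ := tangent_eq_of_dep (c := fun u => F u v) (d := fun u => F' u v) (hF.left v)
    (hF'.left v) (fun u hu => dep_two_comm (hd u hu v hv)) hu hne
  change F'.du u v = s • F u v + r • F.du u v at h2
  intro hli; refine h u hu v hv ?_
  have hr : r ≠ 0 := by rintro rfl; exact hli.ne_zero 0 (by simpa using h1)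
  rw [li_four] at hli ⊢; intro x y k l hx
  have := hli (x * r⁻¹ - y * s * r⁻¹ * r⁻¹) (y * r⁻¹) k l (by
    rw [h1, h2]
    have e1 : (x * r⁻¹ - y * s * r⁻¹ * r⁻¹) * r + y * r⁻¹ * s = x := by field_simp; ring
    have e2 : y * r⁻¹ * r = y := by field_simp
    linear_combination (norm := module) hx + e1 • F u v + e2 • F.du u v)
  obtain ⟨a, b, c, d⟩ := this; have hy : y = 0 := by simpa [hr] using b
  subst hy; exact ⟨by simpa [hr] using a, rfl, c, d⟩

lemma finite_zeros_gen {F : Lift} (hF : IsSCPatch F) {T S : V →ₗ[ℝ] Hat}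
    (h0 : meet (T (F 0 0)) (S (F 0 0)) ≠ 0) : ∃ S' : Set ℝ, S'.Finite ∧ ∀ v ∈ I01, v ∉ S' →
      {u | u ∈ I01 ∧ gen F T S u v = 0}.Finite := by
  obtain ⟨⟨B, hB⟩, -⟩ := hF.boundary (j := 0) (by simp)
  obtain ⟨⟨B', hB'⟩, -⟩ := hF.swap.boundary (j := 0) (by simp)
  obtain ⟨f, hf, -⟩ := exists_dual_ne (E := ⊥) (x := meet (T (F 0 0)) (S (F 0 0))) (by simpa using h0)
  refine ⟨_, hB'.finite_zeros (l := f ∘ₗ meet (T (F 0 0)) ∘ₗ S)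
    ⟨_, F.swap.mem_lineSpan 0 zero_mem_Icc, hf⟩, fun v hv hvS => ?_⟩
  refine (hB.finite_zeros (l := f ∘ₗ meet.flip (S (F 0 v)) ∘ₗ T)
    ⟨_, F.mem_lineSpan 0 zero_mem_Icc, fun h1 => hvS ⟨hv, h1⟩⟩).subset ?_
  rintro u ⟨hu, h1⟩; exact ⟨hu, by
    show f (gen F T S u v) = 0
    rw [h1, map_zero]⟩

lemma classicalFPair_of_gen {F H H' : Lift} (hF : IsSCPatch F) (hH : H.Smooth) (hH' : H'.Smooth)
    {T S T' S' : V →ₗ[ℝ] Hat} {P Q : V → ℝ} {c d : ℝ} {Y : Hat}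
    (hT : ∀ z, T' z = c • T z + P z • Y) (hS : ∀ z, S' z = d • S z + Q z • Y)
    (h0 : meet (T (F 0 0)) (S (F 0 0)) ≠ 0) (h0' : meet (T' (F 0 0)) (S' (F 0 0)) ≠ 0)
    (hd : SamePatch H (gen F T S)) (hd' : SamePatch H' (gen F T' S')) : ClassicalFPair H H' := by
  have hFs : F.Smooth := hF.smooth; obtain ⟨R, hR, h1⟩ := finite_zeros_gen hF h0
  obtain ⟨R', hR', h1'⟩ := finite_zeros_gen hF h0'
  refine ClassicalFPair.congr (smooth_gen hFs T S) hH hH' hd hR h1 (ClassicalFPair.symm ?_)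
  exact ClassicalFPair.congr (smooth_gen hFs T' S') hH' (smooth_gen hFs T S) hd' hR' h1'
    (classicalFPair_gen hFs hT hS).symm

lemma SamePatch.swap {F G : Lift} (h : SamePatch F G) : SamePatch F.swap G.swap :=
  fun u hu v hv => h v hv u hu

/-! ### Superposition of two fundamental transformations -/

/-- Superposition of the fundamental transformations with directions `X1` and `X2`, depending on the
parameters `n / d` and `n' / d'`. -/
def double (T : V →ₗ[ℝ] Hat) (P1 P2 : V →ₗ[ℝ] ℝ) (X1 X2 : Hat) (n d n' d' : ℝ) : V →ₗ[ℝ] Hat :=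
  (d * d' - n * n') • T + P1.smulRight ((d * d') • X1 + (n * d') • X2) +
    P2.smulRight ((n' * d) • X1 + (d * d') • X2)

lemma double_apply (T : V →ₗ[ℝ] Hat) (P1 P2 : V →ₗ[ℝ] ℝ) (X1 X2 : Hat) (n d n' d' : ℝ) (z : V) :
    double T P1 P2 X1 X2 n d n' d' z = (d * d' - n * n') • T z + P1 z • ((d * d') • X1 + (n * d') • X2) +
      P2 z • ((n' * d) • X1 + (d * d') • X2) := rfl

lemma double_swap (T : V →ₗ[ℝ] Hat) (P1 P2 : V →ₗ[ℝ] ℝ) (X1 X2 : Hat) (n d n' d' : ℝ) :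
    double T P1 P2 X1 X2 n d n' d' = double T P2 P1 X2 X1 n' d' n d := by
  refine LinearMap.ext fun z => ?_
  rw [double_apply, double_apply]; module

lemma double_eq (T : V →ₗ[ℝ] Hat) (P1 P2 : V →ₗ[ℝ] ℝ) (X1 X2 : Hat) (n : ℝ) {d : ℝ} (hd : d ≠ 0)
    (n' d' : ℝ) (z : V) : double T P1 P2 X1 X2 n d n' d' z = (d * d' - n * n') • shift T P1 X1 z +
      (n * d⁻¹ * P1 z + P2 z) • ((n' * d) • X1 + (d * d') • X2) := by
  rw [double_apply, shift_apply]; have : n * d⁻¹ * d = n := by field_simp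
  linear_combination (norm := module) -(P1 z * n') • (this • X1) - (P1 z * d') • (this • X2)

section Corner

variable (T S : V →ₗ[ℝ] Hat) (X1 X2 : Hat) (P1 P2 Q1 Q2 : V →ₗ[ℝ] ℝ) (z w : V)

/-- Vanishes if and only if the points `meet (T z) (S w)` and `meet (shift T P X z) (shift S Q X w)`
coincide. -/
def slope (P Q : V →ₗ[ℝ] ℝ) : ℝ := (T z).2 * Q w - (S w).2 * P z

/-- The constant term in the dependence of the superposition on its parameter. -/
def offset : ℝ := slope T S z w P2 Q2 - (P2 z * Q1 w - Q2 w * P1 z) * X1.2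

lemma meet_double (n d n' d' : ℝ) :
    (slope T S z w P1 Q1 * slope T S z w P2 Q2) •
      meet (double T P1 P2 X1 X2 n d n' d' z) (double S Q1 Q2 X1 X2 n d n' d' w) =
    -(d * d' - n * n') •
    (((n * slope T S z w P1 Q1 + d * offset T S X1 P1 P2 Q1 Q2 z w) *
      (n' * slope T S z w P2 Q2 + d' * offset T S X2 P2 P1 Q2 Q1 z w)) • meet (T z) (S w) -
    (d * slope T S z w P2 Q2 * (n' * slope T S z w P2 Q2 + d' * offset T S X2 P2 P1 Q2 Q1 z w)) •
      meet (shift T P1 X1 z) (shift S Q1 X1 w) -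
    (d' * slope T S z w P1 Q1 * (n * slope T S z w P1 Q1 + d * offset T S X1 P1 P2 Q1 Q2 z w)) •
      meet (shift T P2 X2 z) (shift S Q2 X2 w)) := by
  simp only [double_apply, shift_apply, slope, offset]; generalize T z = A
  generalize S w = B
  generalize P1 z = p1
  generalize P2 z = p2
  generalize Q1 w = q1
  generalize Q2 w = q2
  obtain ⟨A, a⟩ := A; obtain ⟨B, b⟩ := B; obtain ⟨X, x⟩ := X1; obtain ⟨Y, y⟩ := X2
  simp only [meet_apply, Prod.fst_add, Prod.snd_add, Prod.smul_fst, Prod.smul_snd, smul_eq_mul]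
  module

variable {T S X1 X2 P1 P2 Q1 Q2 z w}

lemma slope_ne_zero {X : Hat} {P Q : V →ₗ[ℝ] ℝ}
    (h : LI ![meet (T z) (S w), meet (shift T P X z) (shift S Q X w)]) :
    slope T S z w P Q ≠ 0 := by
  intro h0
  have e1 : (shift T P X z).2 • meet (T z) (S w) + (-(T z).2) • meet (shift T P X z) (shift S Q X w) =
      -slope T S z w P Q • meet (T z) X := by
    simp only [shift_apply, slope, meet_apply, Prod.fst_add, Prod.snd_add, Prod.smul_fst,
      Prod.smul_snd, smul_eq_mul]
    module
  have e2 : (shift S Q X w).2 • meet (T z) (S w) + (-(S w).2) • meet (shift T P X z) (shift S Q X w) =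
      -slope T S z w P Q • meet (S w) X := by
    simp only [shift_apply, slope, meet_apply, Prod.fst_add, Prod.snd_add, Prod.smul_fst,
      Prod.smul_snd, smul_eq_mul]
    module
  rw [h0, neg_zero, zero_smul] at e1 e2; have h1 := (li_two.1 h _ _ e1).2
  have h2 := (li_two.1 h _ _ e2).2; refine h.ne_zero 0 ?_
  show meet (T z) (S w) = 0
  rw [meet_apply, neg_eq_zero.1 h1, neg_eq_zero.1 h2, zero_smul, zero_smul, sub_zero]

lemma exists_meet_double {x x1 x2 : V} {μ μ1 μ2 : ℝ} (hμ : μ ≠ 0) (hμ1 : μ1 ≠ 0) (hμ2 : μ2 ≠ 0)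
    (h : meet (T z) (S w) = μ • x) (h1 : meet (shift T P1 X1 z) (shift S Q1 X1 w) = μ1 • x1)
    (h2 : meet (shift T P2 X2 z) (shift S Q2 X2 w) = μ2 • x2) (hli1 : LI ![x, x1])
    (hli2 : LI ![x, x2]) :
    ∃ κ a b a' b' : ℝ, κ ≠ 0 ∧ a ≠ 0 ∧ a' ≠ 0 ∧ ∀ n d n' d' : ℝ,
      meet (double T P1 P2 X1 X2 n d n' d' z) (double S Q1 Q2 X1 X2 n d n' d' w) =
      (κ * (d * d' - n * n')) • (((a * n + b * d) * (a' * n' + b' * d')) • x +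
        (d * (a' * n' + b' * d')) • x1 + (d' * (a * n + b * d)) • x2) := by
  have hs : ∀ {y : V} {ν : ℝ}, ν ≠ 0 → LI ![x, y] →
      LI ![μ • x, ν • y] := by
    intro y ν hν hli; rw [li_two] at hli ⊢; intro r s hrs
    have := hli (r * μ) (s * ν) (by linear_combination (norm := module) hrs)
    simpa [hμ, hν] using this
  have f1 : slope T S z w P1 Q1 ≠ 0 := slope_ne_zero (X := X1) (by rw [h, h1]; exact hs hμ1 hli1)
  have f2 : slope T S z w P2 Q2 ≠ 0 := slope_ne_zero (X := X2) (by rw [h, h2]; exact hs hμ2 hli2)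
  have key := meet_double T S X1 X2 P1 P2 Q1 Q2 z w; rw [h, h1, h2] at key
  generalize slope T S z w P1 Q1 = φ1 at *
  generalize slope T S z w P2 Q2 = φ2 at *
  generalize offset T S X1 P1 P2 Q1 Q2 z w = o1 at *
  generalize offset T S X2 P2 P1 Q2 Q1 z w = o2 at *
  refine ⟨-(μ1 * μ2 / μ), -(μ * φ1 / (μ1 * φ2)), -(μ * o1 / (μ1 * φ2)), -(μ * φ2 / (μ2 * φ1)),
    -(μ * o2 / (μ2 * φ1)), neg_ne_zero.2 (by positivity), neg_ne_zero.2 (by positivity),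
    neg_ne_zero.2 (by positivity), fun n d n' d' => ?_⟩
  refine smul_right_injective _ (mul_ne_zero f1 f2) ?_
  show (φ1 * φ2) • _ = (φ1 * φ2) • _
  rw [key]; have e1 : -(μ * φ1 / (μ1 * φ2)) * n + -(μ * o1 / (μ1 * φ2)) * d =
    -(μ / (μ1 * φ2)) * (n * φ1 + d * o1) := by ring
  have e2 : -(μ * φ2 / (μ2 * φ1)) * n' + -(μ * o2 / (μ2 * φ1)) * d' =
    -(μ / (μ2 * φ1)) * (n' * φ2 + d' * o2) := by ring
  rw [e1, e2]; match_scalars <;> field_simp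

lemma dep_meet {T' S' : V →ₗ[ℝ] Hat} {P Q : V → ℝ} {c d : ℝ} {Y : Hat}
    (hT : ∀ z, T' z = c • T z + P z • Y) (hS : ∀ z, S' z = d • S z + Q z • Y) (z z' w : V) :
    Dep ![meet (T z) (S w), meet (T z') (S w), meet (T' z') (S' w), meet (T' z) (S' w)] := by
  set K := span ℝ (range ![T z, T z', S w, Y]); have m0 : T z ∈ K := subset_span ⟨0, rfl⟩
  have m1 : T z' ∈ K := subset_span ⟨1, rfl⟩; have m2 : S w ∈ K := subset_span ⟨2, rfl⟩
  have m3 : Y ∈ K := subset_span ⟨3, rfl⟩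
  have n0 : T' z ∈ K := by rw [hT]; exact K.add_mem (K.smul_mem _ m0) (K.smul_mem _ m3)
  have n1 : T' z' ∈ K := by rw [hT]; exact K.add_mem (K.smul_mem _ m1) (K.smul_mem _ m3)
  have n2 : S' w ∈ K := by rw [hS]; exact K.add_mem (K.smul_mem _ m2) (K.smul_mem _ m3)
  exact not_li_meet_four (finrank_span_four_le _ _ _ _) m0 m1 n1 n0 m2 m2 n2 n2

end Corner

lemma PairForm.corner_eq {F G : Lift} {T S : V →ₗ[ℝ] Hat} {X : Hat} {P Q : V →ₗ[ℝ] ℝ}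
    (h : PairForm F G T S X P Q) (hpos : CellPosition F G) {j k : ℝ} (hj : j ∈ B01)
    (hk : k ∈ B01) :
    ∃ r : ℝ, r ≠ 0 ∧ meet (shift T P X (F j 0)) (shift S Q X (F 0 k)) = r • G j k := by
  rcases hj with rfl | rfl <;> rcases hk with rfl | rfl
  · exact h.left 0 zero_mem_Icc
  · exact h.right 1 one_mem_Icc
  · exact h.left 1 one_mem_Icc
  · exact (h.exists_corner hpos).1

/-- Linear maps to the four-dimensional space by which the boundary curves of `F` generate `F`. -/
structure Base (F : Lift) (T S : V →ₗ[ℝ] Hat) : Prop where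
  meetData : MeetData (fun u => T (F u 0)) (fun v => S (F 0 v))
  left : ∀ z ∈ F.lineSpan 0, meet (T z) (S (F 0 0)) = z
  right : ∀ z ∈ F.swap.lineSpan 0, meet (T (F 0 0)) (S z) = z
  corner : ∀ j ∈ B01, ∀ k ∈ B01,
    ∃ r : ℝ, r ≠ 0 ∧ meet (T (F j 0)) (S (F 0 k)) = r • F j k
  dep : SamePatch F (gen F T S)
  exists_pairForm : ∀ G, IsSCPatch G → ClassicalFPair F G → ClassicalFPair F.swap G.swap →
    CellPosition F G → ∃ X P Q, PairForm F G T S X P Q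

lemma IsSCPatch.exists_base {F G : Lift} (hF : IsSCPatch F) (hG : IsSCPatch G)
    (h : ClassicalFPair F G) (h' : ClassicalFPair F.swap G.swap) (hpos : CellPosition F G) :
    ∃ T S, Base F T S := by
  obtain ⟨A1, A2, p1, p2, w1, w2, hN⟩ := hF.exists_normalForm
  obtain ⟨X, P, Q, hX, -⟩ := exists_pairForm hF hG h h' hpos hN
  refine ⟨lift1 p1 w1, lift2 p2 w2, hN.meetData hF, fun z hz => ?_, fun z hz => ?_, fun j hj k hk => ?_,
    hX.base, fun G' hG' hFG hFG' hp => ?_⟩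
  · rw [meet_lift, ← hN.form1 z hz, show w2 (F 0 0) = 1 from hN.swap.w_zero, one_smul, add_comm]
    exact hN.splitting.add z
  · rw [meet_lift, hN.w_zero, one_smul, ← show p1 z = w2 z • p1 (F 0 0) from hN.form2 z hz, add_comm]
    exact hN.splitting.add z
  · obtain ⟨r, hr⟩ := hX.exists_base hj hk; have hr0 : r ≠ 0 := by
      rintro rfl; rw [zero_smul] at hr; refine hF.ne_zero_left hk ?_ hr
      rcases hj with rfl | rfl
      exacts [zero_mem_Icc, one_mem_Icc]
    exact ⟨r⁻¹, inv_ne_zero hr0, (eq_inv_smul_iff₀ hr0).2 hr.symm⟩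
  · obtain ⟨X, P, Q, hX, -⟩ := SCNet.exists_pairForm hF hG' hFG hFG' hp hN
    exact ⟨X, P, Q, hX⟩

/-! ### Points and homogeneous coordinates -/

lemma Represents.ne_zero {p : RP3} {w : V} (h : Represents p w) : w ≠ 0 := by
  rintro rfl; have h1 := p.finrank_submodule
  rw [show p.submodule = _ from h, Submodule.span_zero_singleton, finrank_bot] at h1
  exact zero_ne_one h1

lemma rep_spec (p : RP3) : Represents p p.rep := by
  rw [Represents, Projectivization.submodule_eq]

lemma Represents.smul {p : RP3} {w : V} (h : Represents p w) {r : ℝ} (hr : r ≠ 0) :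
    Represents p (r • w) := by
  rw [Represents, Submodule.span_singleton_smul_eq hr.isUnit]; exact h

lemma Represents.exists_smul {p : RP3} {w w' : V} (h : Represents p w) (h' : Represents p w') :
    ∃ r : ℝ, r ≠ 0 ∧ w' = r • w := by
  have h1 : w' ∈ span ℝ {w} := by
    rw [← show p.submodule = _ from h, show p.submodule = _ from h']
    exact mem_span_singleton_self w'
  obtain ⟨r, rfl⟩ := mem_span_singleton.1 h1; refine ⟨r, ?_, rfl⟩
  rintro rfl; exact h'.ne_zero (zero_smul _ _)

lemma Represents.eq {p q : RP3} {w : V} (h : Represents p w) (h' : Represents q w) : p = q :=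
  Projectivization.submodule_injective (by rw [show p.submodule = _ from h, show q.submodule = _ from h'])

lemma exists_represents {w : V} (h : w ≠ 0) : ∃ p : RP3, Represents p w :=
  ⟨Projectivization.mk ℝ w h, Projectivization.submodule_mk w h⟩

lemma Represents.of_dep {p : RP3} {w w' : V} (h : Represents p w) (h0 : w' ≠ 0)
    (hd : ¬ LI ![w, w']) : Represents p w' := by
  obtain ⟨r, hr, rfl⟩ := exists_ne_smul_of_not_li h.ne_zero h0 hd
  exact h.smul hr

lemma Represents.dep {p : RP3} {w w' : V} (h : Represents p w) (h' : Represents p w') :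
    ¬ LI ![w, w'] := by
  obtain ⟨r, hr, rfl⟩ := h.exists_smul h'; exact not_li_two.2 ⟨r, -1, by module, Or.inl hr⟩

lemma range_pair {α : Type*} (a b : α) : range ![a, b] = {a, b} := by
  ext x; simp; tauto

lemma range_triple {α : Type*} (a b c : α) : range ![a, b, c] = {a, b, c} := by
  ext x; simp; tauto

section Points

variable {p q r s : RP3} {a b c d : V}

lemma join3_eq (ha : Represents p a) (hb : Represents q b) (hc : Represents r c) :
    join3 p q r = span ℝ (range ![a, b, c]) := by
  rw [join3, show p.submodule = _ from ha, show q.submodule = _ from hb, show r.submodule = _ from hc,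
    ← Submodule.span_union, ← Submodule.span_union, range_triple]
  congr 1
  ext x; simp; tauto

lemma li_iff_finrank {n : ℕ} (v : Fin n → V) :
    LI v ↔ finrank ℝ (span ℝ (range v)) = n := by
  rw [linearIndependent_iff_card_eq_finrank_span, Fintype.card_fin, Set.finrank, eq_comm]

lemma planarQuad_iff (ha : Represents p a) (hb : Represents q b) (hc : Represents r c)
    (hd : Represents s d) : PlanarQuad p q r s ↔ Quad a b c d := by
  have h4 : join3 p q r ⊔ s.submodule = span ℝ (range ![a, b, c, d]) := by
    rw [join3_eq ha hb hc, show s.submodule = _ from hd, ← Submodule.span_union]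
    congr 1
    ext x; simp
  have hle : finrank ℝ (span ℝ (range ![a, b, c])) ≤
      finrank ℝ (span ℝ (range ![a, b, c, d])) := by
    rw [← h4, ← join3_eq ha hb hc]; exact Submodule.finrank_mono le_sup_left
  have hle4 : finrank ℝ (span ℝ (range ![a, b, c, d])) ≤ 4 :=
    (finrank_range_le_card (R := ℝ) ![a, b, c, d]).trans (by simp)
  constructor
  · rintro ⟨h0, h1, h2, h3, h5⟩; rw [h4] at h0; rw [join3_eq ha hb hc, ← li_iff_finrank] at h1
    rw [join3_eq ha hb hd, ← li_iff_finrank] at h2; rw [join3_eq ha hc hd, ← li_iff_finrank] at h3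
    rw [join3_eq hb hc hd, ← li_iff_finrank] at h5; refine ⟨fun h => ?_, h1, h2, h3, h5⟩
    rw [li_iff_finrank] at h; omega
  · rintro ⟨h0, h1, h2, h3, h5⟩; rw [Dep, li_iff_finrank] at h0
    rw [li_iff_finrank] at h1 h2 h3 h5; refine ⟨?_, ?_, ?_, ?_, ?_⟩
    · rw [h4]; omega
    · rw [join3_eq ha hb hc]; exact h1
    · rw [join3_eq ha hb hd]; exact h2
    · rw [join3_eq ha hc hd]; exact h3
    · rw [join3_eq hb hc hd]; exact h5

lemma Represents.le_iff (ha : Represents p a) (E : Submodule ℝ V) : p.submodule ≤ E ↔ a ∈ E := by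
  rw [show p.submodule = _ from ha, Submodule.span_singleton_le_iff_mem]

end Points

lemma span_pair_eq {a b c d : V} (hab : LI ![a, b])
    (hcd : LI ![c, d]) (hc : c ∈ span ℝ {a, b})
    (hd : d ∈ span ℝ {a, b}) : span ℝ {a, b} = span ℝ {c, d} := by
  rw [← range_pair c d, ← range_pair a b] at *; rw [range_pair a b] at *
  refine (span_range_eq_of_mem hcd ?_ (by intro i; fin_cases i <;> assumption)).symm
  rw [← range_pair a b]; exact (li_iff_finrank _).1 hab

/-! ### Tangents at the vertices of a patch -/

/-- The tangent to the first parameter line at a point. -/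
def Lift.cornerTangent (F : Lift) (u v : ℝ) : Submodule ℝ V := span ℝ {F u v, F.du u v}

lemma IsSCPatch.li_du {F : Lift} (hF : IsSCPatch F) {j : ℝ} (hj : j ∈ B01) {u : ℝ}
    (hu : u ∈ I01) : LI ![F u j, F.du u j] := by
  obtain ⟨⟨B, hB⟩, -⟩ := hF.boundary hj; exact hB.immersed u hu

lemma exists_of_arc_eq {F G : Lift} (hF : IsSCPatch F) {j k : ℝ} (hj : j ∈ B01)
    (h : F.arc j = G.arc k) {u : ℝ} (hu : u ∈ I01) :
    ∃ u' ∈ I01, ∃ r : ℝ, r ≠ 0 ∧ G u' k = r • F u j := by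
  obtain ⟨p, hp⟩ := exists_represents (hF.ne_zero_left hj hu)
  obtain ⟨u', hu', hp'⟩ : p ∈ G.arc k := h ▸ ⟨u, hu, hp⟩; exact ⟨u', hu', hp.exists_smul hp'⟩

lemma cornerTangent_eq_of_arc_eq {F G : Lift} (hF : IsSCPatch F) (hG : IsSCPatch G) {j k : ℝ}
    (hj : j ∈ B01) (hk : k ∈ B01) (h : F.arc j = G.arc k)
    (h0 : ¬ LI ![F 0 j, G 0 k]) : F.cornerTangent 0 j = G.cornerTangent 0 k := by
  obtain ⟨⟨B, hc⟩, -⟩ := hF.boundary hj; have hd := hG.smooth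
  have hG0 := hG.ne_zero_left hk zero_mem_Icc
  have hds : ContDiff ℝ ∞ (fun u => G u k) := Lift.Smooth.left hd k
  have hdE : ∀ u ∈ I01, G u k ∈ F.lineSpan j ∧ B (G u k) (G u k) = 0 := by
    intro u hu; obtain ⟨u', hu', r, hr, e⟩ := exists_of_arc_eq hG hk h.symm hu
    rw [(eq_inv_smul_iff₀ hr).2 e.symm]; refine ⟨Submodule.smul_mem _ _ (F.mem_lineSpan j hu'), ?_⟩
    rw [map_smul, map_smul, LinearMap.smul_apply, hc.zero u' hu', smul_zero, smul_zero]
  have hd' : deriv (fun u => G u k) 0 ∈ F.lineSpan j :=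
    deriv_mem_of_mem hds (fun u hu => (hdE u hu).1) 0 zero_mem_Icc
  have hBd : B (G 0 k) (deriv (fun u => G u k) 0) = 0 := by
    have := deriv_eq_zero_of_eqOn (contDiff_bilin B hds hds) (fun u hu => (hdE u hu).2) 0 zero_mem_Icc
    rw [deriv_bilin B hds hds, hc.symm (deriv _ _)] at this; linarith
  obtain ⟨r, hr, e0⟩ := exists_ne_smul_of_not_li (hF.ne_zero_left hj zero_mem_Icc) hG0 h0
  have hBd' : B (F 0 j) (deriv (fun u => G u k) 0) = 0 := by
    rw [e0, map_smul, LinearMap.smul_apply, smul_eq_mul] at hBd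
    exact (mul_eq_zero.1 hBd).resolve_left hr
  refine span_pair_eq (hF.li_du hj zero_mem_Icc) (hG.li_du hk zero_mem_Icc)
    (mem_span_pair.2 ⟨r, 0, by rw [e0]; module⟩) ?_
  by_contra hn; have hn' : deriv (fun u => G u k) 0 ∉
      span ℝ (range ![F 0 j, deriv (fun u => F u j) 0]) := by rw [range_pair]; exact hn
  have hli := linearIndependent_finCons.2 ⟨hc.immersed 0 zero_mem_Icc, hn'⟩
  have hE := span_range_eq_of_mem hli hc.finrank (by
    intro i; fin_cases i
    exacts [hd', F.mem_lineSpan j zero_mem_Icc, hc.deriv_mem zero_mem_Icc])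
  refine hc.ne_zero zero_mem_Icc (hc.nondeg _ (F.mem_lineSpan j zero_mem_Icc) fun w hw => ?_)
  rw [← hE] at hw; obtain ⟨x, y, z, rfl⟩ := mem_span_triple.1 hw
  have e1 := hc.bilin_deriv zero_mem_Icc; have e2 := hc.zero 0 zero_mem_Icc
  simp only [map_add, map_smul, smul_eq_mul] at *; rw [e1, e2, hBd']; ring

lemma swap_cornerTangent_eq {F : Lift} (hF : IsSCPatch F) {j k : ℝ} (hj : j ∈ B01)
    (hk : k ∈ B01) {a : V} (ha : F.IsApex j a) :
    F.swap.cornerTangent j k = span ℝ {F k j, a} ∧ LI ![F k j, a] := by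
  have h01 : ∀ k ∈ B01, k ∈ I01 := by
    rintro k (rfl | rfl); exacts [zero_mem_Icc, one_mem_Icc]
  obtain ⟨⟨B, hB⟩, a', ha', haP, -⟩ := hF.boundary hj; have key : ∀ k ∈ B01, LI ![F k j, a'] := by
    intro k hk; rw [li_two]; intro r s hrs; have hs : s = 0 := by
      by_contra hs; refine haP ((smul_mem_iff _ hs).1 ?_); rw [← neg_eq_of_add_eq_zero_right hrs]
      exact Submodule.neg_mem _ (Submodule.smul_mem _ _ (F.mem_lineSpan j (h01 k hk)))
    subst hs; rw [zero_smul, add_zero] at hrs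
    exact ⟨(smul_eq_zero.1 hrs).resolve_right (hB.ne_zero (h01 k hk)), rfl⟩
  have hmem : ∀ a, F.IsApex j a → ∀ k ∈ B01, a ∈ F.swap.cornerTangent j k := by
    intro a ha k hk
    obtain ⟨r, s, e⟩ := exists_comb_of_not_li (hF.swap.li_du hk (h01 j hj)) (ha.2 k (h01 k hk))
    exact mem_span_pair.2 ⟨r, s, e.symm⟩
  have htan : ∀ k ∈ B01, F.swap.cornerTangent j k = span ℝ {F k j, a'} :=
    fun k hk => span_pair_eq (hF.swap.li_du hk (h01 j hj)) (key k hk)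
      (subset_span (by left; rfl)) (hmem a' ha' k hk)
  have hprop : ∃ r : ℝ, a = r • a' := by
    obtain ⟨r, s, e⟩ := mem_span_pair.1 (htan 0 (by simp) ▸ hmem a ha 0 (by simp))
    obtain ⟨r', s', e'⟩ := mem_span_pair.1 (htan 1 (by simp) ▸ hmem a ha 1 (by simp))
    have hs : s - s' = 0 := by
      by_contra hs; refine haP ((smul_mem_iff _ hs).1 ?_)
      rw [show (s - s') • a' = r' • F 1 j - r • F 0 j by linear_combination (norm := module) e - e']
      exact Submodule.sub_mem _ (Submodule.smul_mem _ _ (F.mem_lineSpan j one_mem_Icc))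
        (Submodule.smul_mem _ _ (F.mem_lineSpan j zero_mem_Icc))
    have := li_two.1 (hB.injective 0 zero_mem_Icc 1 one_mem_Icc zero_ne_one) r (-r') (by
      linear_combination (norm := module) e - e' - hs • a')
    exact ⟨s, by rw [← e, this.1]; module⟩
  obtain ⟨r, rfl⟩ := hprop; have hr : r ≠ 0 := by rintro rfl; exact ha.1 (zero_smul _ _)
  have hli : LI ![F k j, r • a'] := by
    rw [li_two]; intro x y hxy
    have := li_two.1 (key k hk) x (y * r) (by linear_combination (norm := module) hxy)
    simpa [hr] using this
  refine ⟨?_, hli⟩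
  rw [htan k hk]; exact span_pair_eq (key k hk) hli (subset_span (by left; rfl))
    (mem_span_pair.2 ⟨0, r, by module⟩)

/-! ### Patches adapted to a lattice -/

variable {m : ℕ}

/-- Patches adapted to the elementary quadrilaterals of a lattice with given tangents at the vertices. -/
structure Frame (y : Lattice m → RP3) (H : Fin m → Fin m → Lattice m → Lift)
    (t : Fin m → Fin m → Lattice m → Submodule ℝ V) : Prop where
  sc : ∀ i j, i ≠ j → ∀ z, IsSCPatch (H i j z)
  swap : ∀ i j, i ≠ j → ∀ z, H j i z = (H i j z).swap
  adapted : ∀ i j, i ≠ j → ∀ z, Represents (y z) (H i j z 0 0) ∧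
    Represents (y (z + e i)) (H i j z 1 0) ∧ Represents (y (z + e j)) (H i j z 0 1) ∧
    Represents (y (z + e i + e j)) (H i j z 1 1)
  tangent : ∀ i j, i ≠ j → ∀ z, (H i j z).cornerTangent 0 0 = t i j z ∧
    (H i j z).cornerTangent 1 0 = t i j (z + e i) ∧ (H i j z).cornerTangent 0 1 = t i j (z + e j) ∧
    (H i j z).cornerTangent 1 1 = t i j (z + e i + e j)
  indep : ∀ i j k, i ≠ j → i ≠ k → ∀ z, t i j z = t i k z

lemma frame (s : SCNet m) : Frame s.vertex s.patch s.tangent := by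
  have hsc := s.isSCPatch; have had := s.adapted
  have h01 : ∀ i j, i ≠ j → ∀ z, (s.patch i j z).cornerTangent 0 1 = s.tangent i j (z + e j) :=
    fun i j hij z => cornerTangent_eq_of_arc_eq (hsc i j hij z) (hsc i j hij _) (by simp) (by simp)
      (s.common_end i j j hij hij z) ((had i j hij z).2.2.1.dep (had i j hij _).1)
  have htcc : ∀ i j, i ≠ j → ∀ z, ∀ k ∈ B01,
      ¬ LI ![s.patch i j z 1 k, s.patch i j (z + e i) 0 k] →
      (s.patch i j z).cornerTangent 1 k = (s.patch i j (z + e i)).cornerTangent 0 k := by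
    intro i j hij z k hk hd; obtain ⟨a, ha, ha'⟩ := s.tcc i j hij z
    obtain ⟨e1, l1⟩ := swap_cornerTangent_eq (hsc i j hij z).swap (j := 1) (by simp) hk ha
    obtain ⟨e2, l2⟩ := swap_cornerTangent_eq (hsc i j hij (z + e i)).swap (j := 0) (by simp) hk ha'
    refine (e1.trans ?_).trans e2.symm
    obtain ⟨r, hr⟩ := exists_smul_of_not_li (li_left_ne l1) hd
    exact span_pair_eq l1 l2 (mem_span_pair.2 ⟨r, 0, by rw [zero_smul, add_zero]; exact hr.symm⟩)
      (subset_span (by right; rfl))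
  refine ⟨hsc, s.patch_swap, had, fun i j hij z => ⟨rfl, ?_, h01 i j hij z, ?_⟩,
    fun i j k hij hik z => ?_⟩
  · exact htcc i j hij z 0 (by simp) ((had i j hij z).2.1.dep (had i j hij _).1)
  · rw [htcc i j hij z 1 (by simp) ((had i j hij z).2.2.2.dep (had i j hij (z + e i)).2.2.1)]
    exact h01 i j hij (z + e i)
  · exact cornerTangent_eq_of_arc_eq (hsc i j hij z) (hsc i k hik z) (by simp) (by simp)
      (s.common_start i j k hij hik z) ((had i j hij z).1.dep (had i k hik z).1)

/-! ### Two layers of patches -/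

/-- General position of two layers of vertices and tangents. -/
structure GenPos (x : Lattice m → RP3) (t : Fin m → Fin m → Lattice m → Submodule ℝ V)
    (y : Lattice m → RP3) (t' : Fin m → Fin m → Lattice m → Submodule ℝ V) : Prop where
  cube : ∀ i j, i ≠ j → ∀ z, ¬ (y z).submodule ≤ join3 (x z) (x (z + e i)) (x (z + e j))
  tangent : ∀ i j k, i ≠ j → ∀ z, ∀ τ ∈ ({t i j z, t i j (z + e k), t' i j z, t' i j (z + e k)} :
    Set (Submodule ℝ V)), ¬ τ ≤ join3 (x z) (x (z + e k)) (y z)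
  skew : ∀ i j k, i ≠ j → ∀ z, t i j z ⊓ t' i j (z + e k) = ⊥ ∧ t i j (z + e k) ⊓ t' i j z = ⊥

lemma generalPair_iff {s s' : SCNet m} :
    GeneralPair s s' ↔ GenPos s.vertex s.tangent s'.vertex s'.tangent :=
  ⟨fun h => ⟨h.cube, h.tangent, h.skew⟩, fun h => ⟨h.cube, h.tangent, h.skew⟩⟩

/-- Two layers of patches that form fundamental pairs. -/
structure Layers (x : Lattice m → RP3) (F : Fin m → Fin m → Lattice m → Lift)
    (t : Fin m → Fin m → Lattice m → Submodule ℝ V) (y : Lattice m → RP3)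
    (G : Fin m → Fin m → Lattice m → Lift) (t' : Fin m → Fin m → Lattice m → Submodule ℝ V) :
    Prop where
  left : Frame x F t
  right : Frame y G t'
  quad_left : ∀ i j, i ≠ j → ∀ z,
    PlanarQuad (x z) (x (z + e i)) (x (z + e i + e j)) (x (z + e j))
  quad_right : ∀ i j, i ≠ j → ∀ z,
    PlanarQuad (y z) (y (z + e i)) (y (z + e i + e j)) (y (z + e j))
  quad : ∀ i z, PlanarQuad (x z) (x (z + e i)) (y (z + e i)) (y z)
  pair : ∀ i j, i ≠ j → ∀ z, ClassicalFPair (F i j z) (G i j z)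
  pos : GenPos x t y t'

lemma IsFTransform.layers {s s' : SCNet m} (h : IsFTransform s s') (hp : GeneralPair s s') :
    Layers s.vertex s.patch s.tangent s'.vertex s'.patch s'.tangent where
  left := frame s
  right := frame s'
  quad_left := s.planar
  quad_right := s'.planar
  quad := h.qnet
  pair := h.patch
  pos := generalPair_iff.1 hp

lemma li_of_not_le {p q r : RP3} {a b c w d : V} (ha : Represents p a) (hb : Represents q b)
    (hc : Represents r c) (hli : LI ![a, b, c])
    (hw : w ∈ span ℝ (range ![a, b, c]))
    (h : ¬ span ℝ {w, d} ≤ join3 p q r) : LI ![d, a, b, c] := by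
  rw [join3_eq ha hb hc] at h; refine linearIndependent_finCons.2 ⟨hli, fun hd => h (span_le.2 ?_)⟩
  rintro _ (rfl | rfl) <;> assumption

lemma edgePosition_of {x y : Lattice m → RP3} {t t' : Fin m → Fin m → Lattice m → Submodule ℝ V}
    (hpos : GenPos x t y t') {i j : Fin m} (hij : i ≠ j) {z : Lattice m} {F G : Lift} {k : ℝ}
    (hk : k ∈ B01) (hF : IsSCPatch F) (hG : IsSCPatch G)
    (hq : PlanarQuad (x z) (x (z + e i)) (y (z + e i)) (y z)) (hx : Represents (x z) (F 0 k))
    (hx' : Represents (x (z + e i)) (F 1 k)) (hy : Represents (y z) (G 0 k))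
    (hy' : Represents (y (z + e i)) (G 1 k)) (ht : F.cornerTangent 0 k = t i j z)
    (ht' : G.cornerTangent 0 k = t' i j z) (hs : F.swap.cornerTangent k 0 = t j i z)
    (hs1 : F.swap.cornerTangent k 1 = t j i (z + e i)) (hs' : G.swap.cornerTangent k 0 = t' j i z)
    (hs1' : G.swap.cornerTangent k 1 = t' j i (z + e i)) : EdgePosition F G k := by
  have hkm : k ∈ I01 := by
    rcases hk with rfl | rfl
    exacts [zero_mem_Icc, one_mem_Icc]
  have hQ : Quad (F 0 k) (F 1 k) (G 1 k) (G 0 k) := (planarQuad_iff hx hx' hy' hy).1 hq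
  obtain ⟨m1, m2, m3⟩ := mem_span_triple_left (F 0 k) (F 1 k) (G 0 k)
  have h1 := hpos.tangent i j i hij z; have h2 := hpos.tangent j i i hij.symm z
  obtain ⟨h3, h4⟩ := hpos.skew j i i hij.symm z; rw [← hs, ← hs1'] at h3
  rw [← hs1, ← hs'] at h4; have hl := hF.swap.li_du (j := 0) (by simp) hkm
  have hl1 := hF.swap.li_du (j := 1) (by simp) hkm
  have hl' := hG.swap.li_du (j := 0) (by simp) hkm
  have hl1' := hG.swap.li_du (j := 1) (by simp) hkm
  refine ⟨hQ, ?_, ?_, ?_, ?_, ?_, ?_⟩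
  · exact li_of_not_le hx hx' hy hQ.abd m1 (h1 _ (by left; exact ht))
  · exact li_of_not_le hx hx' hy hQ.abd m3 (h1 _ (by right; right; left; exact ht'))
  · exact li_of_not_le hx hx' hy hQ.abd m1 (h2 _ (by left; exact hs))
  · exact li_of_not_le hx hx' hy hQ.abd m2 (h2 _ (by right; left; exact hs1))
  · exact li_pairs_inf.2 ⟨hl, hl1', by rw [range_pair, range_pair]; exact h3⟩
  · refine li_pairs_inf.2 ⟨hl', hl1, ?_⟩
    rw [range_pair, range_pair, inf_comm]; exact h4

section Layers

variable {x y : Lattice m → RP3} {F G : Fin m → Fin m → Lattice m → Lift}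
  {t t' : Fin m → Fin m → Lattice m → Submodule ℝ V}

lemma Frame.swap_tangent (h : Frame x F t) {i j : Fin m} (hij : i ≠ j) (z : Lattice m) :
    (F i j z).swap.cornerTangent 0 0 = t j i z ∧ (F i j z).swap.cornerTangent 0 1 = t j i (z + e i) ∧
    (F i j z).swap.cornerTangent 1 0 = t j i (z + e j) ∧
    (F i j z).swap.cornerTangent 1 1 = t j i (z + e j + e i) := by
  obtain ⟨h1, h2, h3, h4⟩ := h.tangent j i hij.symm z; rw [h.swap i j hij z] at h1 h2 h3 h4
  exact ⟨h1, h3, h2, h4⟩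

lemma Layers.edge_zero (h : Layers x F t y G t') {i j : Fin m} (hij : i ≠ j) (z : Lattice m) :
    EdgePosition (F i j z) (G i j z) 0 := by
  obtain ⟨a1, a2, a3, a4⟩ := h.left.adapted i j hij z
  obtain ⟨b1, b2, b3, b4⟩ := h.right.adapted i j hij z
  obtain ⟨s1, s2, s3, s4⟩ := h.left.swap_tangent hij z
  obtain ⟨r1, r2, r3, r4⟩ := h.right.swap_tangent hij z
  exact edgePosition_of h.pos hij (by simp) (h.left.sc i j hij z) (h.right.sc i j hij z) (h.quad i z)
    a1 a2 b1 b2 (h.left.tangent i j hij z).1 (h.right.tangent i j hij z).1 s1 s2 r1 r2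

lemma Layers.edge_one (h : Layers x F t y G t') {i j : Fin m} (hij : i ≠ j) (z : Lattice m) :
    EdgePosition (F i j z) (G i j z) 1 := by
  obtain ⟨a1, a2, a3, a4⟩ := h.left.adapted i j hij z
  obtain ⟨b1, b2, b3, b4⟩ := h.right.adapted i j hij z
  obtain ⟨s1, s2, s3, s4⟩ := h.left.swap_tangent hij z
  obtain ⟨r1, r2, r3, r4⟩ := h.right.swap_tangent hij z; rw [add_right_comm] at a4 b4
  exact edgePosition_of h.pos hij (by simp) (h.left.sc i j hij z) (h.right.sc i j hij z)
    (h.quad i (z + e j)) a3 a4 b3 b4 (h.left.tangent i j hij z).2.2.1 (h.right.tangent i j hij z).2.2.1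
    s3 s4 r3 r4

lemma Layers.pair_swap (h : Layers x F t y G t') {i j : Fin m} (hij : i ≠ j) (z : Lattice m) :
    ClassicalFPair (F i j z).swap (G i j z).swap := by
  rw [← h.left.swap i j hij, ← h.right.swap i j hij]; exact h.pair j i hij.symm z

lemma Layers.cell (h : Layers x F t y G t') {i j : Fin m} (hij : i ≠ j) (z : Lattice m) :
    CellPosition (F i j z) (G i j z) := by
  obtain ⟨a1, a2, a3, a4⟩ := h.left.adapted i j hij z
  obtain ⟨b1, b2, b3, b4⟩ := h.right.adapted i j hij z
  have hq := (planarQuad_iff a1 a2 a4 a3).1 (h.quad_left i j hij z)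
  refine ⟨h.edge_zero hij z, ?_, ?_, ?_, hq, (planarQuad_iff b1 b2 b4 b3).1 (h.quad_right i j hij z), ?_⟩
  · rw [← h.left.swap i j hij, ← h.right.swap i j hij]; exact h.edge_zero hij.symm z
  · have a4' := a4; have b4' := b4; rw [add_right_comm] at a4' b4'
    exact (planarQuad_iff a3 a4' b4' b3).1 (h.quad i (z + e j))
  · exact (planarQuad_iff a2 a4 b4 b2).1 (h.quad j (z + e i))
  · have := h.pos.cube i j hij z; rw [b1.le_iff, join3_eq a1 a2 a3] at this
    exact linearIndependent_finCons.2 ⟨hq.abd, this⟩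

end Layers

/-! ### Edges of fundamental transforms -/

lemma lineSpan_eq_sup {G : Lift} (hG : IsSCPatch G) {j : ℝ} (hj : j ∈ B01)
    (hli : LI ![G.du 0 j, G 0 j, G 1 j]) {p : RP3} (hp : Represents p (G 1 j)) :
    G.lineSpan j = G.cornerTangent 0 j ⊔ p.submodule := by
  obtain ⟨⟨B, hB⟩, -⟩ := hG.boundary hj
  rw [Lift.cornerTangent, show p.submodule = _ from hp, ← Submodule.span_union,
    ← span_range_eq_of_mem hli hB.finrank (by
      intro i; fin_cases i
      exacts [hB.deriv_mem zero_mem_Icc, G.mem_lineSpan j zero_mem_Icc, G.mem_lineSpan j one_mem_Icc]),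
    range_triple]
  congr 1
  ext x; simp; tauto

lemma dep_of_edges {F G F' G' : Lift} (hF : IsSCPatch F) (hG : IsSCPatch G) (hF' : IsSCPatch F')
    (hG' : IsSCPatch G') {j k : ℝ} (hj : j ∈ B01) (hk : k ∈ B01)
    (hpos : EdgePosition F G j) (hpos' : EdgePosition F' G' k) (h : ClassicalFPair F G)
    (hs : ClassicalFPair F.swap G.swap) (h' : ClassicalFPair F' G')
    (hs' : ClassicalFPair F'.swap G'.swap) {x x1 y y1 : RP3} (hx : Represents x (F 0 j))
    (hx' : Represents x (F' 0 k)) (hx1 : Represents x1 (F 1 j)) (hx1' : Represents x1 (F' 1 k))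
    (hy : Represents y (G 0 j)) (hy' : Represents y (G' 0 k)) (hy1 : Represents y1 (G 1 j))
    (hy1' : Represents y1 (G' 1 k)) (ht : G.cornerTangent 0 j = G'.cornerTangent 0 k) {u u' : ℝ}
    (hu : u ∈ I01) (hu' : u' ∈ I01) {ρ : ℝ} (hF'F : F' u' k = ρ • F u j) :
    ¬ LI ![G u j, G' u' k] := by
  obtain ⟨O, ⟨a, b, e0⟩, ⟨c, d, e1⟩, hO, hOG, hdep⟩ := exists_edge_center hF hG hj hpos h hs
  obtain ⟨O', ⟨a', b', e0'⟩, ⟨c', d', e1'⟩, hO', hOG', hdep'⟩ :=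
    exists_edge_center hF' hG' hk hpos' h' hs'
  have hq := hpos.quad; have hE : G.lineSpan j = G'.lineSpan k := by
    have l1 : LI ![G.du 0 j, G 0 j, G 1 j] := by
      refine linearIndependent_finCons.2 ⟨?_, fun hm => notMem_span_of_li hpos.du_right
        (span_le.2 ?_ hm)⟩
      · rw [li_two]; intro r s hrs
        have := li_three.1 hq.acd 0 s r (by linear_combination (norm := module) hrs)
        tauto
      · obtain ⟨m1, m2, m3⟩ := mem_span_triple_left (F 0 j) (F 1 j) (G 0 j)
        rintro _ ⟨i, rfl⟩; fin_cases i
        exacts [m3, hq.mem]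
    have l2 : LI ![G'.du 0 k, G' 0 k, G' 1 k] := by
      refine linearIndependent_finCons.2 ⟨?_, fun hm => notMem_span_of_li hpos'.du_right
        (span_le.2 ?_ hm)⟩
      · rw [li_two]; intro r s hrs
        have := li_three.1 hpos'.quad.acd 0 s r (by linear_combination (norm := module) hrs)
        tauto
      · obtain ⟨m1, m2, m3⟩ := mem_span_triple_left (F' 0 k) (F' 1 k) (G' 0 k)
        rintro _ ⟨i, rfl⟩; fin_cases i
        exacts [m3, hpos'.quad.mem]
    rw [lineSpan_eq_sup hG hj l1 hy1, lineSpan_eq_sup hG' hk l2 hy1', ht]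
  obtain ⟨r, hr⟩ : ∃ r : ℝ, O' = r • O := by
    have hO0 : O ≠ 0 := by rintro rfl; exact hO (Submodule.zero_mem _)
    refine exists_smul_of_not_li hO0 fun hli => ?_
    obtain ⟨r0, -, f0⟩ := hx.exists_smul hx'; obtain ⟨r1, -, f1⟩ := hx1.exists_smul hx1'
    obtain ⟨s0, -, g0⟩ := hy.exists_smul hy'; obtain ⟨s1, -, g1⟩ := hy1.exists_smul hy1'
    have l0 : LI ![F 0 j, G 0 j] := by
      rw [li_two]; intro r s hrs
      have := li_three.1 hq.abd r 0 s (by linear_combination (norm := module) hrs)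
      tauto
    have l1 : LI ![F 1 j, G 1 j] := by
      rw [li_two]; intro r s hrs
      have := li_three.1 hq.bcd r s 0 (by linear_combination (norm := module) hrs)
      tauto
    have q0 := span_pair_eq l0 hli (mem_span_pair.2 ⟨a, b, e0.symm⟩)
      (mem_span_pair.2 ⟨a' * r0, b' * s0, by rw [e0', f0, g0]; module⟩)
    have q1 := span_pair_eq l1 hli (mem_span_pair.2 ⟨c, d, e1.symm⟩)
      (mem_span_pair.2 ⟨c' * r1, d' * s1, by rw [e1', f1, g1]; module⟩)
    have : F 1 j ∈ span ℝ {F 0 j, G 0 j} := by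
      rw [q0, ← q1]; exact subset_span (by left; rfl)
    obtain ⟨v, w, e⟩ := mem_span_pair.1 this
    have := li_three.1 hq.abd v (-1) w (by linear_combination (norm := module) e)
    simpa using this.2.1
  obtain ⟨v, w, e⟩ := hdep u hu; obtain ⟨v', w', e'⟩ := hdep' u' hu'
  have hv : v ≠ 0 := by
    rintro rfl; have hw : w ≠ 0 := by
      rintro rfl; exact hG.ne_zero_left hj hu (by rw [e]; simp)
    refine hOG ((smul_mem_iff _ hw).1 ?_)
    rw [← zero_add (w • O), ← zero_smul ℝ (F u j), ← e]; exact G.mem_lineSpan j hu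
  rw [hF'F, hr] at e'; have hz : v' * ρ * w - v * w' * r = 0 := by
    by_contra hz; refine hOG ((smul_mem_iff _ hz).1 ?_)
    rw [show (v' * ρ * w - v * w' * r) • O = (v' * ρ) • G u j - v • G' u' k by rw [e, e']; module]
    refine Submodule.sub_mem _ (Submodule.smul_mem _ _ (G.mem_lineSpan j hu)) (Submodule.smul_mem _ _ ?_)
    rw [hE]; exact G'.mem_lineSpan k hu'
  exact not_li_two.2 ⟨v' * ρ, -v, by rw [e, e']; linear_combination (norm := module) hz • O,
    Or.inr (neg_ne_zero.2 hv)⟩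

/-! ### Common fundamental transforms of two nets -/

/-- The lines `t1` and `t2` span different planes with `p`. -/
structure Trans (t1 t2 : Submodule ℝ V) (p : RP3) : Prop where
  left : finrank ℝ ↥(t1 ⊔ p.submodule) = 3
  right : finrank ℝ ↥(t2 ⊔ p.submodule) = 3
  ne : t1 ⊔ p.submodule ≠ t2 ⊔ p.submodule

lemma mem_sup_of_pair {F G : Lift} {u v : ℝ} (hu : u ∈ I01) (hv : v ∈ I01)
    {p : RP3} (hp : Represents p (G u v)) (h : ClassicalFPair F G)
    (h3 : finrank ℝ ↥(F.cornerTangent u v ⊔ p.submodule) = 3) :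
    G u v ∈ F.cornerTangent u v ⊔ p.submodule ∧ G.du u v ∈ F.cornerTangent u v ⊔ p.submodule := by
  have he : F.cornerTangent u v ⊔ p.submodule =
      span ℝ (range ![F u v, F.du u v, G u v]) := by
    rw [Lift.cornerTangent, show p.submodule = _ from hp, ← Submodule.span_union, range_triple]
    congr 1
    ext x; simp; tauto
  rw [he] at h3 ⊢; have hli := (li_iff_finrank _).2 h3
  refine ⟨subset_span ⟨2, rfl⟩, mem_span_of_not_li hli ?_⟩
  obtain ⟨r, s, t, k, hr, hne⟩ := not_li_four.1 (h u hu v hv)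
  exact not_li_four.2 ⟨k, r, s, t, by linear_combination (norm := module) hr, by tauto⟩

lemma cornerTangent_eq_inf {F1 F2 G : Lift} (hG : IsSCPatch G) {u v : ℝ}
    (hu : u ∈ B01) (hv : v ∈ B01) {p : RP3} (hp : Represents p (G u v))
    (h1 : ClassicalFPair F1 G) (h2 : ClassicalFPair F2 G) {t1 t2 : Submodule ℝ V}
    (ht1 : F1.cornerTangent u v = t1) (ht2 : F2.cornerTangent u v = t2) (h : Trans t1 t2 p) :
    G.cornerTangent u v = (t1 ⊔ p.submodule) ⊓ (t2 ⊔ p.submodule) := by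
  subst ht1 ht2; have h01 : ∀ k ∈ B01, k ∈ I01 := by
    rintro k (rfl | rfl); exacts [zero_mem_Icc, one_mem_Icc]
  obtain ⟨m1, m2⟩ := mem_sup_of_pair (h01 u hu) (h01 v hv) hp h1 h.left
  obtain ⟨n1, n2⟩ := mem_sup_of_pair (h01 u hu) (h01 v hv) hp h2 h.right
  refine le_antisymm (span_le.2 ?_) fun x hx => ?_
  · rintro _ (rfl | rfl); exacts [⟨m1, n1⟩, ⟨m2, n2⟩]
  · obtain ⟨r, s, e⟩ := exists_comb_of_mem_planes h.left h.right h.ne (hG.li_du hv (h01 u hu)) m1 n1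
      m2 n2 hx.1 hx.2
    exact mem_span_pair.2 ⟨r, s, e.symm⟩

/-- Vertices and patches of a common fundamental transform of two nets in general position. -/
structure CommonTransform (σ1 σ2 : SCNet m) (y : Lattice m → RP3)
    (H : Fin m → Fin m → Lattice m → Lift) : Prop where
  sc : ∀ i j, i ≠ j → ∀ z, IsSCPatch (H i j z)
  swap : ∀ i j, i ≠ j → ∀ z, H j i z = (H i j z).swap
  adapted : ∀ i j, i ≠ j → ∀ z, Represents (y z) (H i j z 0 0) ∧
    Represents (y (z + e i)) (H i j z 1 0) ∧ Represents (y (z + e j)) (H i j z 0 1) ∧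
    Represents (y (z + e i + e j)) (H i j z 1 1)
  planar : ∀ i j, i ≠ j → ∀ z,
    PlanarQuad (y z) (y (z + e i)) (y (z + e i + e j)) (y (z + e j))
  quad : ∀ i z, PlanarQuad (σ1.vertex z) (σ1.vertex (z + e i)) (y (z + e i)) (y z)
  pair₁ : ∀ i j, i ≠ j → ∀ z, ClassicalFPair (σ1.patch i j z) (H i j z)
  pair₂ : ∀ i j, i ≠ j → ∀ z, ClassicalFPair (σ2.patch i j z) (H i j z)
  trans : ∀ i j, i ≠ j → ∀ z, Trans (σ1.tangent i j z) (σ2.tangent i j z) (y z)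
  pos : GenPos σ1.vertex σ1.tangent y (fun i j z => (H i j z).vertexTangent)

namespace CommonTransform

variable {σ1 σ2 : SCNet m} {y : Lattice m → RP3} {H : Fin m → Fin m → Lattice m → Lift}

lemma frame (h : CommonTransform σ1 σ2 y H) :
    Frame y H fun i j z => (H i j z).vertexTangent := by
  have key : ∀ i j, i ≠ j → ∀ z, (H i j z).vertexTangent =
      (σ1.tangent i j z ⊔ (y z).submodule) ⊓ (σ2.tangent i j z ⊔ (y z).submodule) := fun i j hij z =>
    cornerTangent_eq_inf (h.sc i j hij z) (by simp) (by simp) (h.adapted i j hij z).1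
      (h.pair₁ i j hij z) (h.pair₂ i j hij z) rfl rfl (h.trans i j hij z)
  refine ⟨h.sc, h.swap, h.adapted, fun i j hij z => ?_, fun i j k hij hik z => ?_⟩
  · obtain ⟨-, a2, a3, a4⟩ := h.adapted i j hij z
    obtain ⟨-, s2, s3, s4⟩ := (SCNet.frame σ1).tangent i j hij z
    obtain ⟨-, r2, r3, r4⟩ := (SCNet.frame σ2).tangent i j hij z; refine ⟨rfl, ?_, ?_, ?_⟩
    · rw [key i j hij]; exact cornerTangent_eq_inf (h.sc i j hij z) (by simp) (by simp) a2
        (h.pair₁ i j hij z) (h.pair₂ i j hij z) s2 r2 (h.trans i j hij _)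
    · rw [key i j hij]; exact cornerTangent_eq_inf (h.sc i j hij z) (by simp) (by simp) a3
        (h.pair₁ i j hij z) (h.pair₂ i j hij z) s3 r3 (h.trans i j hij _)
    · rw [key i j hij]; exact cornerTangent_eq_inf (h.sc i j hij z) (by simp) (by simp) a4
        (h.pair₁ i j hij z) (h.pair₂ i j hij z) s4 r4 (h.trans i j hij _)
  · show (H i j z).vertexTangent = (H i k z).vertexTangent
    rw [key i j hij, key i k hik, (SCNet.frame σ1).indep i j k hij hik,
      (SCNet.frame σ2).indep i j k hij hik]

lemma layers (h : CommonTransform σ1 σ2 y H) : Layers σ1.vertex σ1.patch σ1.tangent y H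
    (fun i j z => (H i j z).vertexTangent) :=
  ⟨SCNet.frame σ1, h.frame, σ1.planar, h.planar, h.quad, h.pair₁, h.pos⟩

lemma arc_subset {F G F' G' : Lift} (hF : IsSCPatch F) (hG : IsSCPatch G) {j k : ℝ}
    (hj : j ∈ B01) (harc : F.arc j = F'.arc k)
    (hG' : ∀ u ∈ I01, G' u k ≠ 0)
    (h : ∀ u ∈ I01, ∀ u' ∈ I01, ∀ ρ : ℝ, F' u' k = ρ • F u j →
      ¬ LI ![G u j, G' u' k]) : G.arc j ⊆ G'.arc k := by
  rintro p ⟨u, hu, hp⟩; obtain ⟨u', hu', r, -, e⟩ := exists_of_arc_eq hF hj harc hu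
  exact ⟨u', hu', hp.of_dep (hG' u' hu') (h u hu u' hu' r e)⟩

lemma arc_eq {F G F' G' : Lift} (hF : IsSCPatch F) (hG : IsSCPatch G) (hF' : IsSCPatch F')
    (hG' : IsSCPatch G') {j k : ℝ} (hj : j ∈ B01) (hk : k ∈ B01)
    (hpos : EdgePosition F G j) (hpos' : EdgePosition F' G' k) (h : ClassicalFPair F G)
    (hs : ClassicalFPair F.swap G.swap) (h' : ClassicalFPair F' G')
    (hs' : ClassicalFPair F'.swap G'.swap) {x x1 y y1 : RP3} (hx : Represents x (F 0 j))
    (hx' : Represents x (F' 0 k)) (hx1 : Represents x1 (F 1 j)) (hx1' : Represents x1 (F' 1 k))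
    (hy : Represents y (G 0 j)) (hy' : Represents y (G' 0 k)) (hy1 : Represents y1 (G 1 j))
    (hy1' : Represents y1 (G' 1 k)) (ht : G.cornerTangent 0 j = G'.cornerTangent 0 k)
    (harc : F.arc j = F'.arc k) : G.arc j = G'.arc k :=
  Subset.antisymm
    (arc_subset hF hG hj harc (fun u hu => hG'.ne_zero_left hk hu) fun u hu u' hu' ρ e =>
      dep_of_edges hF hG hF' hG' hj hk hpos hpos' h hs h' hs' hx hx' hx1 hx1' hy hy' hy1 hy1' ht hu hu' e)
    (arc_subset hF' hG' hk harc.symm (fun u hu => hG.ne_zero_left hj hu) fun u hu u' hu' ρ e =>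
      dep_of_edges hF' hG' hF hG hk hj hpos' hpos h' hs' h hs hx' hx hx1' hx1 hy' hy hy1' hy1 ht.symm
        hu hu' e)

lemma exists_net (h : CommonTransform σ1 σ2 y H) : ∃ τ : SCNet m, τ.vertex = y ∧ τ.patch = H := by
  have hL := h.layers; have hf := h.frame; have hsc := h.sc; have hσ := SCNet.frame σ1
  refine ⟨⟨y, H, h.planar, hsc, h.swap, h.adapted, fun i j k hij hik z => ?_, fun i j k hij hik z => ?_,
    fun i j hij z => ?_⟩, rfl, rfl⟩
  · obtain ⟨a1, a2, -, -⟩ := hσ.adapted i j hij z; obtain ⟨a1', a2', -, -⟩ := hσ.adapted i k hik z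
    obtain ⟨b1, b2, -, -⟩ := hf.adapted i j hij z; obtain ⟨b1', b2', -, -⟩ := hf.adapted i k hik z
    exact arc_eq (hσ.sc i j hij z) (hsc i j hij z) (hσ.sc i k hik z) (hsc i k hik z) (by simp) (by simp)
      (hL.edge_zero hij z) (hL.edge_zero hik z) (hL.pair i j hij z) (hL.pair_swap hij z)
      (hL.pair i k hik z) (hL.pair_swap hik z) a1 a1' a2 a2' b1 b1' b2 b2' (hf.indep i j k hij hik z)
      (σ1.common_start i j k hij hik z)
  · obtain ⟨-, -, a1, a2⟩ := hσ.adapted i j hij z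
    obtain ⟨a1', a2', -, -⟩ := hσ.adapted i k hik (z + e j)
    obtain ⟨-, -, b1, b2⟩ := hf.adapted i j hij z
    obtain ⟨b1', b2', -, -⟩ := hf.adapted i k hik (z + e j); rw [add_right_comm] at a2 b2
    exact arc_eq (hσ.sc i j hij z) (hsc i j hij z) (hσ.sc i k hik _) (hsc i k hik _) (by simp) (by simp)
      (hL.edge_one hij z) (hL.edge_zero hik _) (hL.pair i j hij z) (hL.pair_swap hij z)
      (hL.pair i k hik _) (hL.pair_swap hik _) a1 a1' a2 a2' b1 b1' b2 b2'
      ((hf.tangent i j hij z).2.2.1.trans (hf.indep i j k hij hik _)) (σ1.common_end i j k hij hik z)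
  · -- both apexes are the intersection of the tangents at the ends of the edge
    have hS := (hsc i j hij z).swap; have hS' := (hsc i j hij (z + e i)).swap
    obtain ⟨⟨B, hB⟩, a, ha, haP, -⟩ := hS.boundary (j := 1) (by simp)
    obtain ⟨-, a', ha', -, -⟩ := hS'.boundary (j := 0) (by simp)
    have hm : ∀ k ∈ B01, (H i j z).cornerTangent 1 k =
        (H i j (z + e i)).cornerTangent 0 k → ∃ r s : ℝ, a' = r • H i j z 1 k + s • a := by
      intro k hk he; obtain ⟨t1, -⟩ := swap_cornerTangent_eq hS (j := 1) (by simp) hk ha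
      obtain ⟨t2, -⟩ := swap_cornerTangent_eq hS' (j := 0) (by simp) hk ha'
      have h1 : a' ∈ (H i j (z + e i)).cornerTangent 0 k := by
        rw [show (H i j (z + e i)).cornerTangent 0 k = _ from t2]; exact subset_span (by right; rfl)
      rw [← he, show (H i j z).cornerTangent 1 k = _ from t1] at h1
      obtain ⟨r, s, e⟩ := mem_span_pair.1 h1; exact ⟨r, s, e.symm⟩
    obtain ⟨r, s, e⟩ := hm 0 (by simp) (hf.tangent i j hij z).2.1
    obtain ⟨r', s', e'⟩ := hm 1 (by simp)
      ((hf.tangent i j hij z).2.2.2.trans (hf.tangent i j hij (z + SCNet.e i)).2.2.1.symm)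
    have hs : s - s' = 0 := by
      by_contra hs; refine haP ((smul_mem_iff _ hs).1 ?_)
      rw [show (s - s') • a = r' • H i j z 1 1 - r • H i j z 1 0 by
        linear_combination (norm := module) e' - e]
      exact Submodule.sub_mem _ (Submodule.smul_mem _ _ ((H i j z).swap.mem_lineSpan 1 one_mem_Icc))
        (Submodule.smul_mem _ _ ((H i j z).swap.mem_lineSpan 1 zero_mem_Icc))
    have hr := li_two.1 (hB.injective 0 zero_mem_Icc 1 one_mem_Icc zero_ne_one) r (-r') (by
      show r • H i j z 1 0 + (-r') • H i j z 1 1 = 0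
      linear_combination (norm := module) e' - e - hs • a)
    rw [hr.1, zero_smul, zero_add] at e; refine ⟨a', ⟨ha'.1, fun u hu => ?_⟩, ha'⟩
    obtain ⟨x, y, k, hx, hne⟩ := not_li_three.1 (ha.2 u hu)
    have hs0 : s ≠ 0 := by rintro rfl; exact ha'.1 (by rw [e, zero_smul])
    refine not_li_three.2 ⟨x * s⁻¹, y, k, ?_, by simpa [hs0] using hne⟩
    rw [e, smul_smul, inv_mul_cancel_right₀ hs0]; exact hx

end CommonTransform

lemma samePatch_of_gen {F G G' : Lift} (hF : IsSCPatch F) (hG : G.Smooth) (hG' : G'.Smooth)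
    {T S : V →ₗ[ℝ] Hat} (h0 : meet (T (F 0 0)) (S (F 0 0)) ≠ 0) (h : SamePatch G (gen F T S))
    (h' : SamePatch G' (gen F T S)) : SamePatch G G' := by
  intro u hu v hv; obtain ⟨R, hR, hz⟩ := finite_zeros_gen hF h0
  refine subset_of_isClosed_of_finite (P := {v | Dep ![G u v, G' u v]})
    (isClosed_dep_two (hG.right u).continuous (hG'.right u).continuous) hR (fun v hv hvR => ?_) v hv
  refine subset_of_isClosed_of_finite (P := {u | Dep ![G u v, G' u v]})
    (isClosed_dep_two (hG.left v).continuous (hG'.left v).continuous) (hz v hv hvR)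
    (fun u hu huR => ?_) u hu
  have hne : gen F T S u v ≠ 0 := fun h0 => huR ⟨hu, h0⟩
  obtain ⟨r, e⟩ := exists_smul_of_not_li hne (dep_two_comm (h u hu v hv))
  obtain ⟨r', e'⟩ := exists_smul_of_not_li hne (dep_two_comm (h' u hu v hv))
  show ¬ _
  rw [e, e']; by_cases hr : r = 0
  · subst hr; exact not_li_two.2 ⟨1, 0, by module, by simp⟩
  · exact not_li_two.2 ⟨r', -r, by module, by simp [hr]⟩

lemma same_of_vertex {σ1 σ2 τ τ' : SCNet m} (h1 : IsFTransform σ1 τ) (h2 : IsFTransform σ2 τ)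
    (h1' : IsFTransform σ1 τ') (h2' : IsFTransform σ2 τ') (hp : GeneralPair σ1 τ)
    (hT : ∀ i j, i ≠ j → ∀ z, Trans (σ1.tangent i j z) (σ2.tangent i j z) (τ.vertex z))
    (hv : ∀ z, τ.vertex z = τ'.vertex z) : Same τ τ' := by
  have ht : ∀ i j, i ≠ j → ∀ z, τ'.tangent i j z = τ.tangent i j z := by
    intro i j hij z
    have e1 : τ.tangent i j z = _ := cornerTangent_eq_inf (τ.isSCPatch i j hij z) (by simp) (by simp)
      (τ.adapted i j hij z).1 (h1.patch i j hij z) (h2.patch i j hij z) rfl rfl (hT i j hij z)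
    have e2 : τ'.tangent i j z = _ := cornerTangent_eq_inf (τ'.isSCPatch i j hij z) (by simp) (by simp)
      (τ'.adapted i j hij z).1 (h1'.patch i j hij z) (h2'.patch i j hij z) rfl rfl (by
        rw [← hv z]; exact hT i j hij z)
    rw [e1, e2, hv z]
  have hp' : GeneralPair σ1 τ' := by
    refine ⟨fun i j hij z => ?_, fun i j k hij z => ?_, fun i j k hij z => ?_⟩
    · rw [← hv]; exact hp.cube i j hij z
    · rw [← hv, ht i j hij, ht i j hij]; exact hp.tangent i j k hij z
    · rw [ht i j hij, ht i j hij]; exact hp.skew i j k hij z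
  refine ⟨hv, fun i j hij z => ?_⟩
  have L := h1.layers hp; have L' := h1'.layers hp'; have hF := σ1.isSCPatch i j hij z
  have hG := τ.isSCPatch i j hij z; have hG' := τ'.isSCPatch i j hij z
  obtain ⟨A1, A2, p1, p2, w1, w2, hN⟩ := hF.exists_normalForm
  obtain ⟨X, P, Q, hX, -⟩ := exists_pairForm hF hG (L.pair i j hij z) (L.pair_swap hij z)
    (L.cell hij z) hN
  have edge : ∀ i j, i ≠ j → ∀ z, ∀ u ∈ I01,
      ¬ LI ![τ.patch i j z u 0, τ'.patch i j z u 0] := by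
    intro i j hij z u hu; obtain ⟨a1, a2, -, -⟩ := σ1.adapted i j hij z
    obtain ⟨b1, b2, -, -⟩ := τ.adapted i j hij z; obtain ⟨b1', b2', -, -⟩ := τ'.adapted i j hij z
    rw [← hv] at b1' b2'
    exact dep_of_edges (σ1.isSCPatch i j hij z) (τ.isSCPatch i j hij z) (σ1.isSCPatch i j hij z)
      (τ'.isSCPatch i j hij z) (by simp) (by simp) (L.edge_zero hij z) (L'.edge_zero hij z)
      (L.pair i j hij z) (L.pair_swap hij z) (L'.pair i j hij z) (L'.pair_swap hij z) a1 a1 a2 a2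
      b1 b1' b2 b2' (ht i j hij z).symm hu hu (one_smul ℝ _).symm
  have hX' : PairForm (σ1.patch i j z) (τ'.patch i j z) (lift1 p1 w1) (lift2 p2 w2) X P Q := by
    refine ⟨hX.base, hX.corner, fun u hu => ?_, fun v hv => ?_, hX.left_ne, hX.right_ne⟩
    · obtain ⟨r, hr, e⟩ := hX.left u hu
      obtain ⟨s, hs, e'⟩ := exists_ne_smul_of_not_li (hG'.ne_zero_left (by simp) hu)
        (hG.ne_zero_left (by simp) hu) (dep_two_comm (edge i j hij z u hu))
      exact ⟨r * s, mul_ne_zero hr hs, by rw [e, e', smul_smul]⟩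
    · obtain ⟨r, hr, e⟩ := hX.right v hv; have := edge j i hij.symm z v hv
      rw [τ.patch_swap i j hij, τ'.patch_swap i j hij] at this
      obtain ⟨s, hs, e'⟩ := exists_ne_smul_of_not_li (hG'.swap.ne_zero_left (by simp) hv)
        (hG.swap.ne_zero_left (by simp) hv) (dep_two_comm this)
      exact ⟨r * s, mul_ne_zero hr hs, by
        rw [e, show τ.patch i j z 0 v = s • τ'.patch i j z 0 v from e', smul_smul]⟩
  obtain ⟨r, hr, e⟩ := hX.left 0 zero_mem_Icc
  exact samePatch_of_gen hF hG.smooth hG'.smooth (T := shift (lift1 p1 w1) P X)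
    (S := shift (lift2 p2 w2) Q X)
    (by rw [e]; exact smul_ne_zero hr (hG.ne_zero_left (by simp) zero_mem_Icc))
    (hX.dep hF hG (L.pair i j hij z) (L.pair_swap hij z) (L.cell hij z))
    (hX'.dep hF hG' (L'.pair i j hij z) (L'.pair_swap hij z) (L'.cell hij z))

/-! ### Propagation along the lattice -/

lemma lattice_induction {P : Lattice m → Prop} {z0 : Lattice m} (h0 : P z0)
    (h : ∀ i z, P z ↔ P (z + e i)) (z : Lattice m) : P z := by
  let A : AddSubgroup (Lattice m) :=
    { carrier := {w | ∀ z, P z ↔ P (z + w)}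
      zero_mem' := fun z => by rw [add_zero]
      add_mem' := fun {a b} ha hb z => by rw [ha z, hb (z + a), add_assoc]
      neg_mem' := fun {a} ha z => by rw [ha (z + -a), neg_add_cancel_right] }
  have hA : z - z0 ∈ A := by
    have : z - z0 = ∑ i, (z - z0) i • (e i : Lattice m) := by
      ext k; simp [e, Pi.single_apply]
    rw [this]; exact A.sum_mem fun i _ => A.zsmul_mem (fun z => h i z) _
  have := (hA z0).1 h0; rwa [add_sub_cancel] at this

lemma exists_parallel {G : Type*} [Group G] (φ : Fin m → Lattice m → G)
    (flat : ∀ i j, i ≠ j → ∀ z, φ j (z + e i) * φ i z = φ i (z + e j) * φ j z) (z0 : Lattice m) :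
    ∃ Φ : Lattice m → G, Φ z0 = 1 ∧ ∀ i z, Φ (z + e i) = φ i z * Φ z := by
  let π : Fin m → Equiv.Perm (Lattice m × G) := fun i =>
    { toFun := fun p => (p.1 + e i, φ i p.1 * p.2)
      invFun := fun p => (p.1 - e i, (φ i (p.1 - e i))⁻¹ * p.2)
      left_inv := fun p => by simp
      right_inv := fun p => by simp }
  have hc : Pairwise fun i j => ∀ (x y : Multiplicative ℤ),
      Commute (zpowersHom _ (π i) x) (zpowersHom _ (π j) y) := by
    intro i j hij x y; have : Commute (π i) (π j) := by
      refine Equiv.ext fun p => ?_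
      show (p.1 + e j + e i, φ i (p.1 + e j) * (φ j p.1 * p.2)) =
        (p.1 + e i + e j, φ j (p.1 + e i) * (φ i p.1 * p.2))
      rw [← mul_assoc, ← mul_assoc, flat i j hij, add_right_comm]
    simpa using this.zpow_zpow _ _
  let Ψ := MonoidHom.noncommPiCoprod (fun i => zpowersHom (Equiv.Perm (Lattice m × G)) (π i)) hc
  let A : Lattice m → Equiv.Perm (Lattice m × G) := fun z => Ψ fun i => Multiplicative.ofAdd (z i)
  have hA : ∀ i z, A (z + e i) = π i * A z := by
    intro i z; have h1 : (fun k => Multiplicative.ofAdd ((z + e i) k)) =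
        Pi.mulSingle i (Multiplicative.ofAdd 1) * fun k => Multiplicative.ofAdd (z k) := by
      ext k; by_cases hk : k = i
      · subst hk; simp [e, add_comm]
      · simp [e, hk]
    show Ψ _ = _
    rw [h1, map_mul, MonoidHom.noncommPiCoprod_mulSingle]; simp [A]
  have h0 : A 0 = 1 := map_one Ψ; have hfst : ∀ z, (A z (z0, 1)).1 = z0 + z := by
    refine lattice_induction (z0 := 0) (by rw [h0]; simp) fun i z => ?_
    rw [hA, Equiv.Perm.mul_apply]
    show _ ↔ (A z (z0, 1)).1 + e i = z0 + (z + e i)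
    rw [← add_assoc, add_left_inj]
  refine ⟨fun z => (A (z - z0) (z0, 1)).2, by
    show (A (z0 - z0) (z0, 1)).2 = 1
    rw [sub_self, h0]; rfl, fun i z => ?_⟩
  show (A (z + e i - z0) (z0, 1)).2 = _
  rw [show z + e i - z0 = z - z0 + e i by abel, hA, Equiv.Perm.mul_apply]
  show φ i (A (z - z0) (z0, 1)).1 * _ = _
  rw [hfst, add_sub_cancel]

/-- An affine bijection of the real line. -/
def affine (a b : ℝ) (ha : a ≠ 0) : ℝ ≃ᵃ[ℝ] ℝ :=
  (LinearEquiv.smulOfNeZero ℝ ℝ a ha).toAffineEquiv.trans (AffineEquiv.constVAdd ℝ ℝ b)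

lemma affine_apply {a b : ℝ} (ha : a ≠ 0) (x : ℝ) : affine a b ha x = a * x + b := add_comm b (a * x)

lemma exists_affine (f : ℝ ≃ᵃ[ℝ] ℝ) : ∃ a b : ℝ, a ≠ 0 ∧ ∀ x, f x = a * x + b := by
  refine ⟨f.linear 1, f 0, by simp, fun x => ?_⟩
  have := f.map_vadd 0 x; rw [vadd_eq_add, add_zero] at this; rw [this, vadd_eq_add]
  have h : f.linear x = x • f.linear 1 := by rw [← map_smul]; simp
  rw [h, smul_eq_mul, mul_comm]

/-! ### Vertices of common fundamental transforms -/

lemma Quad.exists_comb {a b c d : V} (h : Quad a b c d) :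
    ∃ r s t : ℝ, r ≠ 0 ∧ s ≠ 0 ∧ t ≠ 0 ∧ c = r • a + s • b + t • d := by
  obtain ⟨r, s, t, e⟩ := mem_span_triple.1 h.mem; refine ⟨r, s, t, ?_, ?_, ?_, e⟩ <;> rintro rfl
  · have := li_three.1 h.bcd s (-1) t (by rw [e]; module)
    simpa using this.2.1
  · have := li_three.1 h.acd r (-1) t (by rw [e]; module)
    simpa using this.2.1
  · have := li_three.1 h.abc r s (-1) (by rw [e]; module)
    simpa using this.2.2

/-- Homogeneous coordinates of the points of a plane. -/
def wpoint (X X1 X2 : V) (ω1 ω2 : ℝ) : V := (ω1 * ω2) • X + ω2 • X1 + ω1 • X2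

lemma edge_relation {X X1 X2 X' X1' X2' : V} (hli : LI ![X, X1, X2, X'])
    {a1 b1 c1 a2 b2 c2 : ℝ} (h1 : X1' = c1 • X + b1 • X' + a1 • X1) (h2 : X2' = c2 • X + b2 • X' + a2 • X2)
    (hc1 : c1 ≠ 0) {ω1 ω2 ω1' ω2' : ℝ} (hω : ω1 ≠ 0) (hω' : ω1' ≠ 0)
    (h : Dep ![X1, X1', wpoint X' X1' X2' ω1' ω2', wpoint X X1 X2 ω1 ω2]) :
    ω2' = -(b1 * a2 / c1) * ω2 + (c2 * b1 / c1 - b2) := by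
  obtain ⟨r, s, t, k, hr, hne⟩ := not_li_four.1 h; rw [wpoint, wpoint, h1, h2] at hr
  obtain ⟨e1, e2, e3, e4⟩ := li_four.1 hli
    (s * c1 + t * (ω2' * c1 + ω1' * c2) + k * (ω1 * ω2)) (r + s * a1 + t * (ω2' * a1) + k * ω2)
    (t * (ω1' * a2) + k * ω1) (s * b1 + t * (ω1' * ω2' + ω2' * b1 + ω1' * b2)) (by
      linear_combination (norm := module) hr)
  by_cases ht : t = 0
  · subst ht; have hk : k = 0 := by simpa [hω] using e3
    subst hk; have hs : s = 0 := by simpa [hc1] using e1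
    subst hs; simp only [zero_mul, add_zero] at e2; simp [e2] at hne
  · have key : t * ω1' * (c1 * ω2' + b1 * a2 * ω2 + c1 * b2 - c2 * b1) = 0 := by
      linear_combination c1 * e4 - b1 * e1 + b1 * ω2 * e3
    have := (mul_eq_zero.1 key).resolve_left (mul_ne_zero ht hω')
    field_simp
    linear_combination this

lemma wpoint_swap (X X1 X2 : V) (ω1 ω2 : ℝ) : wpoint X X1 X2 ω1 ω2 = wpoint X X2 X1 ω2 ω1 := by
  rw [wpoint, wpoint]; module

lemma dep_four_smul {a b c d : V} {r s t k : ℝ} (hr : r ≠ 0) (hs : s ≠ 0) (ht : t ≠ 0) (hk : k ≠ 0)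
    (h : Dep ![r • a, s • b, t • c, k • d]) : Dep ![a, b, c, d] := by
  obtain ⟨x, y, z, w, e, hne⟩ := not_li_four.1 h
  exact not_li_four.2 ⟨x * r, y * s, z * t, w * k, by linear_combination (norm := module) e, by
    simpa [hr, hs, ht, hk] using hne⟩

lemma dep_meet' {T S T' S' : V →ₗ[ℝ] Hat} {P Q : V → ℝ} {c d : ℝ} {Y : Hat}
    (hT : ∀ z, T' z = c • T z + P z • Y) (hS : ∀ z, S' z = d • S z + Q z • Y) (z w w' : V) :
    Dep ![meet (T z) (S w), meet (T z) (S w'), meet (T' z) (S' w'), meet (T' z) (S' w)] := by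
  have h := dep_meet hS hT w w' z
  rw [meet_comm (S w), meet_comm (S w'), meet_comm (S' w), meet_comm (S' w')] at h
  obtain ⟨x, y, z, k, e, hne⟩ := not_li_four.1 h
  exact not_li_four.2 ⟨-x, -y, -z, -k, by linear_combination (norm := module) e, by simpa using hne⟩

/-- The maps that describe how the vertices of common fundamental transforms propagate along an edge. -/
structure EdgeMaps (X X1 X2 X' X1' X2' : V) (E1 E2 : ℝ ≃ᵃ[ℝ] ℝ) : Prop where
  left : ∀ ω1 ω2 ω1' ω2' : ℝ, ω2 ≠ 0 → ω2' ≠ 0 →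
    Dep ![X2, X2', wpoint X' X1' X2' ω1' ω2', wpoint X X1 X2 ω1 ω2] → ω1' = E1 ω1
  right : ∀ ω1 ω2 ω1' ω2' : ℝ, ω1 ≠ 0 → ω1' ≠ 0 →
    Dep ![X1, X1', wpoint X' X1' X2' ω1' ω2', wpoint X X1 X2 ω1 ω2] → ω2' = E2 ω2

lemma exists_edgeMaps {X X1 X2 X' X1' X2' : V} (hli : LI ![X, X1, X2, X'])
    (h1 : Quad X X' X1' X1) (h2 : Quad X X' X2' X2) : ∃ E1 E2, EdgeMaps X X1 X2 X' X1' X2' E1 E2 := by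
  obtain ⟨c1, b1, a1, hc1, hb1, ha1, e1⟩ := h1.exists_comb
  obtain ⟨c2, b2, a2, hc2, hb2, ha2, e2⟩ := h2.exists_comb; have hli' : LI ![X, X2, X1, X'] := by
    rw [li_four] at hli ⊢; intro r s t k hr
    have := hli r t s k (by linear_combination (norm := module) hr)
    tauto
  refine ⟨affine (-(b2 * a1 / c2)) (c1 * b2 / c2 - b1) (by simp [*]),
    affine (-(b1 * a2 / c1)) (c2 * b1 / c1 - b2) (by simp [*]),
    fun ω1 ω2 ω1' ω2' hω hω' h => ?_, fun ω1 ω2 ω1' ω2' hω hω' h => ?_⟩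
  · rw [affine_apply]; rw [wpoint_swap, wpoint_swap X] at h
    exact edge_relation hli' e2 e1 hc2 hω hω' h
  · rw [affine_apply]; exact edge_relation hli e1 e2 hc1 hω hω' h

/-! ### The vertices of the superpositions of two fundamental transformations of a patch -/

section Corner

variable (T S : V →ₗ[ℝ] Hat) (X1 X2 : Hat) (P1 P2 Q1 Q2 : V →ₗ[ℝ] ℝ)

/-- The dependence on the parameters of a vertex of the superpositions of two fundamental
transformations. -/
structure Corner (v w x x1 x2 : V) (κ a b a' b' : ℝ) : Prop where
  ne : κ ≠ 0
  ne1 : a ≠ 0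
  ne2 : a' ≠ 0
  left : ∃ r : ℝ, r ≠ 0 ∧ meet (shift T P1 X1 v) (shift S Q1 X1 w) = r • x1
  right : ∃ r : ℝ, r ≠ 0 ∧ meet (shift T P2 X2 v) (shift S Q2 X2 w) = r • x2
  meet_eq : ∀ n d n' d' : ℝ,
    meet (double T P1 P2 X1 X2 n d n' d' v) (double S Q1 Q2 X1 X2 n d n' d' w) =
      (κ * (d * d' - n * n')) • (((a * n + b * d) * (a' * n' + b' * d')) • x +
        (d * (a' * n' + b' * d')) • x1 + (d' * (a * n + b * d)) • x2)

variable {T S X1 X2 P1 P2 Q1 Q2} {v w x x1 x2 v' w' x' x1' x2' : V}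
  {κ a b a' b' κ' c d c' d' : ℝ} {E1 E2 : ℝ ≃ᵃ[ℝ] ℝ}

lemma Corner.swap (h : Corner T S X1 X2 P1 P2 Q1 Q2 v w x x1 x2 κ a b a' b') :
    Corner T S X2 X1 P2 P1 Q2 Q1 v w x x2 x1 κ a' b' a b :=
  ⟨h.ne, h.ne2, h.ne1, h.right, h.left, fun n d n' d' => by
    rw [double_swap, double_swap S, h.meet_eq]; module⟩

lemma EdgeMaps.swap {X X1 X2 X' X1' X2' : V} (h : EdgeMaps X X1 X2 X' X1' X2' E1 E2) :
    EdgeMaps X X2 X1 X' X2' X1' E2 E1 :=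
  ⟨fun ω1 ω2 ω1' ω2' h1 h2 h3 => h.right ω2 ω1 ω2' ω1' h1 h2 (by rwa [wpoint_swap, wpoint_swap X]),
    fun ω1 ω2 ω1' ω2' h1 h2 h3 => h.left ω2 ω1 ω2' ω1' h1 h2 (by rwa [wpoint_swap, wpoint_swap X])⟩

lemma Corner.edge_right (h : Corner T S X1 X2 P1 P2 Q1 Q2 v w x x1 x2 κ a b a' b')
    (h' : Corner T S X1 X2 P1 P2 Q1 Q2 v' w' x' x1' x2' κ' c d c' d')
    (hE : EdgeMaps x x1 x2 x' x1' x2' E1 E2) (hv : v = v' ∨ w = w') (n' : ℝ) :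
    c' * n' + d' = E2 (a' * n' + b') := by
  obtain ⟨n, hn⟩ := Infinite.exists_notMem_finset ({-b / a, -d / c, 1 / n'} : Finset ℝ)
  simp only [Finset.mem_insert, Finset.mem_singleton, not_or] at hn
  obtain ⟨hn1, hn2, hn3⟩ := hn
  have f1 : a * n + b ≠ 0 := fun h0 => hn1 ((eq_div_iff h.ne1).2 (by linarith))
  have f2 : c * n + d ≠ 0 := fun h0 => hn2 ((eq_div_iff h'.ne1).2 (by linarith))
  have f3 : 1 - n * n' ≠ 0 := fun h0 => by
    have h1 : n' ≠ 0 := by rintro rfl; norm_num at h0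
    exact hn3 ((eq_div_iff h1).2 (by linarith))
  refine hE.right (a * n + b) (a' * n' + b') (c * n + d) (c' * n' + d') f1 f2 ?_
  have key : Dep ![meet (shift T P1 X1 v) (shift S Q1 X1 w), meet (shift T P1 X1 v') (shift S Q1 X1 w'),
      meet (double T P1 P2 X1 X2 n 1 n' 1 v') (double S Q1 Q2 X1 X2 n 1 n' 1 w'),
      meet (double T P1 P2 X1 X2 n 1 n' 1 v) (double S Q1 Q2 X1 X2 n 1 n' 1 w)] := by
    rcases hv with rfl | rfl
    · exact dep_meet' (double_eq T P1 P2 X1 X2 n one_ne_zero n' 1)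
        (double_eq S Q1 Q2 X1 X2 n one_ne_zero n' 1) _ _ _
    · exact dep_meet (double_eq T P1 P2 X1 X2 n one_ne_zero n' 1)
        (double_eq S Q1 Q2 X1 X2 n one_ne_zero n' 1) _ _ _
  obtain ⟨r, hr, e⟩ := h.left; obtain ⟨r', hr', e'⟩ := h'.left
  rw [e, e', h.meet_eq, h'.meet_eq] at key; simp only [mul_one, one_mul] at key
  exact dep_four_smul hr hr' (mul_ne_zero h'.ne f3) (mul_ne_zero h.ne f3) key

lemma Corner.edge_left (h : Corner T S X1 X2 P1 P2 Q1 Q2 v w x x1 x2 κ a b a' b')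
    (h' : Corner T S X1 X2 P1 P2 Q1 Q2 v' w' x' x1' x2' κ' c d c' d')
    (hE : EdgeMaps x x1 x2 x' x1' x2' E1 E2) (hv : v = v' ∨ w = w') (n : ℝ) :
    c * n + d = E1 (a * n + b) := h.swap.edge_right h'.swap hE.swap hv n

end Corner

/-! ### Normal forms of nets and their fundamental transforms -/

/-- Homogeneous coordinates of the vertices of a net. -/
def pt (s : SCNet m) (z : Lattice m) : V := (s.vertex z).rep

/-- Linear maps that generate all patches of a net. -/
abbrev Maps (m : ℕ) (W : Type) [AddCommGroup W] [Module ℝ W] : Type :=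
  Fin m → Fin m → Lattice m → V →ₗ[ℝ] W

/-- Normal form of a net. -/
def NetBase (s : SCNet m) (T S : Maps m Hat) : Prop :=
  ∀ i j, i ≠ j → ∀ z, Base (s.patch i j z) (T i j z) (S i j z)

/-- Normal form of a fundamental transform. -/
def NetForm (s s1 : SCNet m) (T S : Maps m Hat) (X : Fin m → Fin m → Lattice m → Hat)
    (P Q : Maps m ℝ) : Prop :=
  ∀ i j, i ≠ j → ∀ z, PairForm (s.patch i j z) (s1.patch i j z) (T i j z) (S i j z) (X i j z)
    (P i j z) (Q i j z)

lemma exists_netBase {s s1 : SCNet m} (h : IsFTransform s s1) (hp : GeneralPair s s1) :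
    ∃ T S, NetBase s T S := by
  have L := h.layers hp
  have : ∀ (i j : Fin m) (z : Lattice m), ∃ T S, i ≠ j → Base (s.patch i j z) T S := by
    intro i j z; by_cases hij : i = j
    · exact ⟨0, 0, fun h => absurd hij h⟩
    · obtain ⟨T, S, hB⟩ := (s.isSCPatch i j hij z).exists_base (s1.isSCPatch i j hij z) (L.pair i j hij z)
        (L.pair_swap hij z) (L.cell hij z)
      exact ⟨T, S, fun _ => hB⟩
  choose T S hB using this
  exact ⟨T, S, fun i j hij z => hB i j z hij⟩

lemma NetBase.exists_form {s s1 : SCNet m} {T S : Maps m Hat} (hB : NetBase s T S)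
    (h : IsFTransform s s1) (hp : GeneralPair s s1) : ∃ X P Q, NetForm s s1 T S X P Q := by
  have L := h.layers hp; have : ∀ (i j : Fin m) (z : Lattice m), ∃ X P Q, i ≠ j →
      PairForm (s.patch i j z) (s1.patch i j z) (T i j z) (S i j z) X P Q := by
    intro i j z; by_cases hij : i = j
    · exact ⟨0, 0, 0, fun h => absurd hij h⟩
    · obtain ⟨X, P, Q, hX⟩ := (hB i j hij z).exists_pairForm _ (s1.isSCPatch i j hij z)
        (L.pair i j hij z) (L.pair_swap hij z) (L.cell hij z)
      exact ⟨X, P, Q, fun _ => hX⟩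
  choose X P Q hX using this
  exact ⟨X, P, Q, fun i j hij z => hX i j z hij⟩

lemma GeneralTriple.li {s s1 s2 : SCNet m} (h : GeneralTriple s s1 s2) (z : Lattice m) :
    LI ![s.pt z, s1.pt z, s2.pt z] := by
  have := h.plane z; rwa [vertexPlane, join3_eq (rep_spec _) (rep_spec _) (rep_spec _),
    ← li_iff_finrank] at this

lemma quad_pt {p q r s : RP3} (h : PlanarQuad p q r s) : Quad p.rep q.rep r.rep s.rep :=
  (planarQuad_iff (rep_spec _) (rep_spec _) (rep_spec _) (rep_spec _)).1 h

lemma GeneralTriple.exists_edgeMaps {s s1 s2 : SCNet m} (h : GeneralTriple s s1 s2)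
    (h1 : IsFTransform s s1) (h2 : IsFTransform s s2) (i : Fin m) (z : Lattice m) :
    ∃ E1 E2, EdgeMaps (s.pt z) (s1.pt z) (s2.pt z) (s.pt (z + e i)) (s1.pt (z + e i))
      (s2.pt (z + e i)) E1 E2 := by
  refine SCNet.exists_edgeMaps ?_ (quad_pt (h1.qnet i z)) (quad_pt (h2.qnet i z))
  have := h.next i z; rw [(rep_spec _).le_iff, vertexPlane,
    join3_eq (rep_spec _) (rep_spec _) (rep_spec _)] at this
  have h4 := linearIndependent_finCons.2 ⟨h.li z, this⟩; rw [li_four]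
  intro r r' t k hr; have := li_four.1 h4 k r r' t (by
    show k • s.pt (z + e i) + r • s.pt z + r' • s1.pt z + t • s2.pt z = 0
    linear_combination (norm := module) hr)
  tauto

/-! ### The vertices of common fundamental transforms -/

section Triple

variable {s s1 s2 : SCNet m} {T S : Maps m Hat} {X1 X2 : Fin m → Fin m → Lattice m → Hat}
  {P1 Q1 P2 Q2 : Maps m ℝ}

lemma exists_corner_at (h : GeneralTriple s s1 s2) (h1 : IsFTransform s s1) (h2 : IsFTransform s s2)
    (hB : NetBase s T S) (hX1 : NetForm s s1 T S X1 P1 Q1) (hX2 : NetForm s s2 T S X2 P2 Q2)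
    {i j : Fin m} (hij : i ≠ j) (z : Lattice m) {ε δ : ℝ} (hε : ε ∈ B01)
    (hδ : δ ∈ B01) {z' : Lattice m} (hz : Represents (s.vertex z') (s.patch i j z ε δ))
    (hz1 : Represents (s1.vertex z') (s1.patch i j z ε δ))
    (hz2 : Represents (s2.vertex z') (s2.patch i j z ε δ)) :
    ∃ κ a b a' b', Corner (T i j z) (S i j z) (X1 i j z) (X2 i j z) (P1 i j z) (P2 i j z) (Q1 i j z)
      (Q2 i j z) (s.patch i j z ε 0) (s.patch i j z 0 δ) (s.pt z') (s1.pt z') (s2.pt z') κ a b a' b' := by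
  have hli := h.li z'; have l1 : LI ![s.pt z', s1.pt z'] := by
    rw [li_two]; intro r t hr
    have := li_three.1 hli r t 0 (by linear_combination (norm := module) hr)
    tauto
  have l2 : LI ![s.pt z', s2.pt z'] := by
    rw [li_two]; intro r t hr
    have := li_three.1 hli r 0 t (by linear_combination (norm := module) hr)
    tauto
  obtain ⟨r, hr, e⟩ := (hB i j hij z).corner ε hε δ hδ
  obtain ⟨r1, hr1, e1⟩ := (hX1 i j hij z).corner_eq ((h1.layers h.pair₁).cell hij z) hε hδ
  obtain ⟨r2, hr2, e2⟩ := (hX2 i j hij z).corner_eq ((h2.layers h.pair₂).cell hij z) hε hδ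
  obtain ⟨μ, hμ, f⟩ := (rep_spec (s.vertex z')).exists_smul hz
  obtain ⟨μ1, hμ1, f1⟩ := (rep_spec (s1.vertex z')).exists_smul hz1
  obtain ⟨μ2, hμ2, f2⟩ := (rep_spec (s2.vertex z')).exists_smul hz2
  rw [f, smul_smul] at e; rw [f1, smul_smul] at e1; rw [f2, smul_smul] at e2
  obtain ⟨κ, a, b, a', b', hκ, ha, ha', key⟩ := exists_meet_double (mul_ne_zero hr hμ)
    (mul_ne_zero hr1 hμ1) (mul_ne_zero hr2 hμ2) e e1 e2 l1 l2
  exact ⟨κ, a, b, a', b', hκ, ha, ha', ⟨_, mul_ne_zero hr1 hμ1, e1⟩, ⟨_, mul_ne_zero hr2 hμ2, e2⟩, key⟩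

/-- The coordinates of the vertices of common fundamental transforms with respect to the
corresponding vertices of `s`, `s1`, `s2` in their dependence on the coordinates of the vertex at `z0`. -/
structure Weights (s s1 s2 : SCNet m) (z0 : Lattice m) (α1 β1 α2 β2 : Lattice m → ℝ) : Prop where
  ne1 : ∀ z, α1 z ≠ 0
  ne2 : ∀ z, α2 z ≠ 0
  init : α1 z0 = 1 ∧ β1 z0 = 0 ∧ α2 z0 = 1 ∧ β2 z0 = 0
  edge : ∀ i z, ∃ E1 E2, EdgeMaps (s.pt z) (s1.pt z) (s2.pt z) (s.pt (z + e i)) (s1.pt (z + e i))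
      (s2.pt (z + e i)) E1 E2 ∧ (∀ θ, E1 (α1 z * θ + β1 z) = α1 (z + e i) * θ + β1 (z + e i)) ∧
      ∀ θ, E2 (α2 z * θ + β2 z) = α2 (z + e i) * θ + β2 (z + e i)

lemma GeneralTriple.exists_weights (h : GeneralTriple s s1 s2) (h1 : IsFTransform s s1)
    (h2 : IsFTransform s s2) (z0 : Lattice m) : ∃ α1 β1 α2 β2, Weights s s1 s2 z0 α1 β1 α2 β2 := by
  obtain ⟨T, S, hB⟩ := exists_netBase h1 h.pair₁
  obtain ⟨X1, P1, Q1, hX1⟩ := hB.exists_form h1 h.pair₁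
  obtain ⟨X2, P2, Q2, hX2⟩ := hB.exists_form h2 h.pair₂
  choose E1 E2 hE using h.exists_edgeMaps h1 h2
  have flat : ∀ i j, i ≠ j → ∀ z, E1 j (z + e i) * E1 i z = E1 i (z + e j) * E1 j z ∧
      E2 j (z + e i) * E2 i z = E2 i (z + e j) * E2 j z := by
    intro i j hij z; obtain ⟨a1, a2, a3, a4⟩ := s.adapted i j hij z
    obtain ⟨b1, b2, b3, b4⟩ := s1.adapted i j hij z; obtain ⟨c1, c2, c3, c4⟩ := s2.adapted i j hij z
    obtain ⟨κ, a, b, a', b', k00⟩ := exists_corner_at h h1 h2 hB hX1 hX2 hij z (by simp) (by simp) a1 b1 c1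
    obtain ⟨_, _, _, _, _, k10⟩ := exists_corner_at h h1 h2 hB hX1 hX2 hij z (by simp) (by simp) a2 b2 c2
    obtain ⟨_, _, _, _, _, k01⟩ := exists_corner_at h h1 h2 hB hX1 hX2 hij z (by simp) (by simp) a3 b3 c3
    obtain ⟨_, _, _, _, _, k11⟩ := exists_corner_at h h1 h2 hB hX1 hX2 hij z (by simp) (by simp) a4 b4 c4
    have hE' := hE i (z + e j); rw [add_right_comm z (e j) (e i)] at hE'
    constructor <;> refine AffineEquiv.ext fun x => ?_
    · have hx : a * ((x - b) / a) + b = x := by field_simp [k00.ne1]; ring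
      have e1 := k00.edge_left k10 (hE i z) (Or.inr rfl) ((x - b) / a)
      have e2 := k10.edge_left k11 (hE j (z + e i)) (Or.inl rfl) ((x - b) / a)
      have e3 := k00.edge_left k01 (hE j z) (Or.inl rfl) ((x - b) / a)
      have e4 := k01.edge_left k11 hE' (Or.inr rfl) ((x - b) / a); rw [hx] at e1 e3
      show E1 j (z + e i) (E1 i z x) = E1 i (z + e j) (E1 j z x)
      rw [← e1, ← e2, ← e3, ← e4]
    · have hx : a' * ((x - b') / a') + b' = x := by field_simp [k00.ne2]; ring
      have e1 := k00.edge_right k10 (hE i z) (Or.inr rfl) ((x - b') / a')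
      have e2 := k10.edge_right k11 (hE j (z + e i)) (Or.inl rfl) ((x - b') / a')
      have e3 := k00.edge_right k01 (hE j z) (Or.inl rfl) ((x - b') / a')
      have e4 := k01.edge_right k11 hE' (Or.inr rfl) ((x - b') / a')
      rw [hx] at e1 e3
      show E2 j (z + e i) (E2 i z x) = E2 i (z + e j) (E2 j z x)
      rw [← e1, ← e2, ← e3, ← e4]
  obtain ⟨Φ1, i1, hΦ1⟩ := exists_parallel E1 (fun i j hij z => (flat i j hij z).1) z0
  obtain ⟨Φ2, i2, hΦ2⟩ := exists_parallel E2 (fun i j hij z => (flat i j hij z).2) z0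
  choose α1 β1 hα1 f1 using fun z => exists_affine (Φ1 z)
  choose α2 β2 hα2 f2 using fun z => exists_affine (Φ2 z)
  refine ⟨α1, β1, α2, β2, hα1, hα2, ?_, fun i z => ⟨_, _, hE i z, fun θ => ?_, fun θ => ?_⟩⟩
  · have e1 := f1 z0 0; have e2 := f1 z0 1; have e3 := f2 z0 0; have e4 := f2 z0 1
    rw [i1, AffineEquiv.coe_one, id] at e1 e2; rw [i2, AffineEquiv.coe_one, id] at e3 e4
    refine ⟨?_, ?_, ?_, ?_⟩ <;> linarith
  · rw [← f1, ← f1, hΦ1]; rfl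
  · rw [← f2, ← f2, hΦ2]; rfl

/-- Homogeneous coordinates of a vertex of a common fundamental transform. -/
def vtx (s s1 s2 : SCNet m) (α1 β1 α2 β2 : Lattice m → ℝ) (z : Lattice m) (t1 t2 : ℝ) : V :=
  ((α1 z + β1 z * t1) * (α2 z + β2 z * t2)) • s.pt z + (t1 * (α2 z + β2 z * t2)) • s1.pt z +
    (t2 * (α1 z + β1 z * t1)) • s2.pt z

variable {z0 : Lattice m} {α1 β1 α2 β2 : Lattice m → ℝ}

lemma Corner.meet_double_eq {T S : V →ₗ[ℝ] Hat} {X1 X2 : Hat} {P1 P2 Q1 Q2 : V →ₗ[ℝ] ℝ}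
    {v w : V} {κ a b a' b' c d c' d' : ℝ} {z : Lattice m}
    (h : Corner T S X1 X2 P1 P2 Q1 Q2 v w (s.pt z) (s1.pt z) (s2.pt z) κ c d c' d')
    {α β α' β' : ℝ} (ha : a ≠ 0) (ha' : a' ≠ 0)
    (h1 : ∀ n θ, a * n + b = α * θ + β → c * n + d = α1 z * θ + β1 z)
    (h2 : ∀ n θ, a' * n + b' = α' * θ + β' → c' * n + d' = α2 z * θ + β2 z) (t1 t2 : ℝ) :
    meet (double T P1 P2 X1 X2 (α / a + (β - b) / a * t1) t1 (α' / a' + (β' - b') / a' * t2) t2 v)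
      (double S Q1 Q2 X1 X2 (α / a + (β - b) / a * t1) t1 (α' / a' + (β' - b') / a' * t2) t2 w) =
      (κ * (t1 * t2 - (α / a + (β - b) / a * t1) * (α' / a' + (β' - b') / a' * t2))) •
        vtx s s1 s2 α1 β1 α2 β2 z t1 t2 := by
  have aux : ∀ {a b α β c d α1 β1 : ℝ}, a ≠ 0 → (∀ n θ, a * n + b = α * θ + β → c * n + d = α1 * θ + β1) →
      ∀ t, c * (α / a + (β - b) / a * t) + d * t = α1 + β1 * t := by
    intro a b α β c d α1 β1 ha h t; have e0 := h ((α * 0 + β - b) / a) 0 (by field_simp; ring)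
    have e1 := h ((α * 1 + β - b) / a) 1 (by field_simp; ring)
    have e2 : c * (α / a) = α1 := by
      have : α / a = (α * 1 + β - b) / a - (α * 0 + β - b) / a := by ring
      rw [this]; linarith
    have e3 : c * ((β - b) / a) + d = β1 := by
      have : (β - b) / a = (α * 0 + β - b) / a := by ring
      rw [this]; linarith
    linear_combination e2 + t * e3
  rw [h.meet_eq, aux ha h1, aux ha' h2, vtx]

/-- The vertex `z'` of the lattice belongs to the corner `(ε, δ)` of the cell at `z`. -/
inductive IsCorner (i j : Fin m) (z : Lattice m) : ℝ → ℝ → Lattice m → Prop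
  | zero : IsCorner i j z 0 0 z
  | left : IsCorner i j z 1 0 (z + e i)
  | right : IsCorner i j z 0 1 (z + e j)
  | both : IsCorner i j z 1 1 (z + e i + e j)

lemma Weights.exists_cell (hW : Weights s s1 s2 z0 α1 β1 α2 β2) (h : GeneralTriple s s1 s2)
    (h1 : IsFTransform s s1) (h2 : IsFTransform s s2)
    (hB : NetBase s T S) (hX1 : NetForm s s1 T S X1 P1 Q1) (hX2 : NetForm s s2 T S X2 P2 Q2)
    {i j : Fin m} (hij : i ≠ j) (z : Lattice m) :
    ∃ p q p' q' : ℝ, p ≠ 0 ∧ p' ≠ 0 ∧ ∀ ε δ z', IsCorner i j z ε δ z' → ∃ κ : ℝ, κ ≠ 0 ∧ ∀ t1 t2 : ℝ,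
      meet (double (T i j z) (P1 i j z) (P2 i j z) (X1 i j z) (X2 i j z) (p + q * t1) t1 (p' + q' * t2) t2
          (s.patch i j z ε 0))
        (double (S i j z) (Q1 i j z) (Q2 i j z) (X1 i j z) (X2 i j z) (p + q * t1) t1 (p' + q' * t2) t2
          (s.patch i j z 0 δ)) =
        (κ * (t1 * t2 - (p + q * t1) * (p' + q' * t2))) • vtx s s1 s2 α1 β1 α2 β2 z' t1 t2 := by
  obtain ⟨a1, a2, a3, a4⟩ := s.adapted i j hij z; obtain ⟨b1, b2, b3, b4⟩ := s1.adapted i j hij z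
  obtain ⟨c1, c2, c3, c4⟩ := s2.adapted i j hij z
  obtain ⟨κ, a, b, a', b', k00⟩ := exists_corner_at h h1 h2 hB hX1 hX2 hij z (by simp) (by simp) a1 b1 c1
  obtain ⟨κ1, _, _, _, _, k10⟩ := exists_corner_at h h1 h2 hB hX1 hX2 hij z (by simp) (by simp) a2 b2 c2
  obtain ⟨κ2, _, _, _, _, k01⟩ := exists_corner_at h h1 h2 hB hX1 hX2 hij z (by simp) (by simp) a3 b3 c3
  obtain ⟨κ3, _, _, _, _, k11⟩ := exists_corner_at h h1 h2 hB hX1 hX2 hij z (by simp) (by simp) a4 b4 c4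
  obtain ⟨_, _, hE, hE1, hE2⟩ := hW.edge i z; obtain ⟨_, _, hF, hF1, hF2⟩ := hW.edge j z
  obtain ⟨_, _, hG, hG1, hG2⟩ := hW.edge j (z + e i)
  have f10 := fun n θ hn => (k00.edge_left k10 hE (Or.inr rfl) n).trans ((congrArg _ hn).trans (hE1 θ))
  have g10 := fun n θ hn => (k00.edge_right k10 hE (Or.inr rfl) n).trans ((congrArg _ hn).trans (hE2 θ))
  have f01 := fun n θ hn => (k00.edge_left k01 hF (Or.inl rfl) n).trans ((congrArg _ hn).trans (hF1 θ))
  have g01 := fun n θ hn => (k00.edge_right k01 hF (Or.inl rfl) n).trans ((congrArg _ hn).trans (hF2 θ))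
  have f11 := fun n θ hn => (k10.edge_left k11 hG (Or.inl rfl) n).trans
    ((congrArg _ (f10 n θ hn)).trans (hG1 θ))
  have g11 := fun n θ hn => (k10.edge_right k11 hG (Or.inl rfl) n).trans
    ((congrArg _ (g10 n θ hn)).trans (hG2 θ))
  refine ⟨α1 z / a, (β1 z - b) / a, α2 z / a', (β2 z - b') / a', div_ne_zero (hW.ne1 z) k00.ne1,
    div_ne_zero (hW.ne2 z) k00.ne2, ?_⟩
  rintro _ _ _ (_ | _ | _ | _)
  · exact ⟨κ, k00.ne, k00.meet_double_eq k00.ne1 k00.ne2 (fun n θ hn => hn) (fun n θ hn => hn)⟩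
  · exact ⟨κ1, k10.ne, k10.meet_double_eq k00.ne1 k00.ne2 f10 g10⟩
  · exact ⟨κ2, k01.ne, k01.meet_double_eq k00.ne1 k00.ne2 f01 g01⟩
  · exact ⟨κ3, k11.ne, k11.meet_double_eq k00.ne1 k00.ne2 f11 g11⟩

end Triple

/-! ### Generic parameters -/

section Generic

variable {ι : Type} {W W' : Type*} [AddCommGroup W] [Module ℝ W] [AddCommGroup W'] [Module ℝ W']

/-- Polynomial functions. -/
def IsPoly (g : (ι → ℝ) → ℝ) : Prop := ∃ p : MvPolynomial ι ℝ, ∀ t, g t = MvPolynomial.eval t p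

/-- Polynomial maps to vector spaces. -/
def IsPolyV (f : (ι → ℝ) → W) : Prop := ∀ l : W →ₗ[ℝ] ℝ, IsPoly fun t => l (f t)

namespace IsPoly

variable {f g : (ι → ℝ) → ℝ}

lemma const (c : ℝ) : IsPoly fun _ : ι → ℝ => c := ⟨MvPolynomial.C c, fun t => by simp⟩

lemma coord (k : ι) : IsPoly fun t : ι → ℝ => t k := ⟨MvPolynomial.X k, fun t => by simp⟩

lemma add : IsPoly f → IsPoly g → IsPoly fun t => f t + g t
  | ⟨p, hp⟩, ⟨q, hq⟩ => ⟨p + q, fun t => by simp only [hp, hq, map_add]⟩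

lemma mul : IsPoly f → IsPoly g → IsPoly fun t => f t * g t
  | ⟨p, hp⟩, ⟨q, hq⟩ => ⟨p * q, fun t => by simp only [hp, hq, map_mul]⟩

lemma sub (hf : IsPoly f) (hg : IsPoly g) : IsPoly fun t => f t - g t := by
  simpa [sub_eq_add_neg] using hf.add ((const (-1)).mul hg)

lemma sum {κ : Type*} (s : Finset κ) {f : κ → (ι → ℝ) → ℝ} (h : ∀ k, IsPoly (f k)) :
    IsPoly fun t => ∑ k ∈ s, f k t := by
  choose p hp using h
  exact ⟨∑ k ∈ s, p k, fun t => by simp [hp]⟩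

lemma prod {κ : Type*} (s : Finset κ) {f : κ → (ι → ℝ) → ℝ} (h : ∀ k, IsPoly (f k)) :
    IsPoly fun t => ∏ k ∈ s, f k t := by
  choose p hp using h
  exact ⟨∏ k ∈ s, p k, fun t => by simp [hp]⟩

end IsPoly

namespace IsPolyV

variable {f g : (ι → ℝ) → W}

lemma const (c : W) : IsPolyV fun _ : ι → ℝ => c := fun l => IsPoly.const (l c)

lemma add (hf : IsPolyV f) (hg : IsPolyV g) : IsPolyV fun t => f t + g t := fun l => by
  simpa using (hf l).add (hg l)

lemma smul {r : (ι → ℝ) → ℝ} (hr : IsPoly r) (hf : IsPolyV f) : IsPolyV fun t => r t • f t :=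
  fun l => by simpa using hr.mul (hf l)

lemma map (hf : IsPolyV f) (L : W →ₗ[ℝ] W') : IsPolyV fun t => L (f t) := fun l => hf (l ∘ₗ L)

lemma meet {f g : (ι → ℝ) → Hat} (hf : IsPolyV f) (hg : IsPolyV g) :
    IsPolyV fun t => SCNet.meet (f t) (g t) := by
  simp only [meet_apply, sub_eq_add_neg, ← neg_smul]
  exact (smul (hf (LinearMap.snd ℝ V ℝ)) (hg.map (LinearMap.fst ℝ V ℝ))).add
    (smul (by simpa using (IsPoly.const (-1)).mul (hg (LinearMap.snd ℝ V ℝ)))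
      (hf.map (LinearMap.fst ℝ V ℝ)))

lemma pi {κ : Type*} [Fintype κ] [DecidableEq κ] {f : (ι → ℝ) → κ → ℝ} (h : ∀ k, IsPoly fun t => f t k) :
    IsPolyV f := by
  intro l; have : (fun t => l (f t)) = fun t => ∑ k, f t k * l (Pi.single k 1) := by
    ext t
    conv_lhs => rw [pi_eq_sum_univ' (f t), map_sum]
    simp
  rw [this]; exact IsPoly.sum _ fun k => (h k).mul (IsPoly.const _)

end IsPolyV

/-- `Q` holds outside the zero set of a polynomial that does not vanish at `t0`. -/
def Near (t0 : ι → ℝ) (Q : (ι → ℝ) → Prop) : Prop :=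
  ∃ g, IsPoly g ∧ g t0 ≠ 0 ∧ ∀ t, g t ≠ 0 → Q t

/-- `Q` holds outside the zero set of a nonzero polynomial. -/
def Gen (Q : (ι → ℝ) → Prop) : Prop := ∃ t0, Near t0 Q

variable {Q R : (ι → ℝ) → Prop} {t0 : ι → ℝ}

lemma Near.gen (h : Near t0 Q) : Gen Q := ⟨t0, h⟩

lemma Near.mono (h : Near t0 Q) (hR : ∀ t, Q t → R t) : Near t0 R := by
  obtain ⟨g, h1, h2, h3⟩ := h; exact ⟨g, h1, h2, fun t ht => hR t (h3 t ht)⟩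

lemma Near.and (hQ : Near t0 Q) (hR : Near t0 R) : Near t0 fun t => Q t ∧ R t := by
  obtain ⟨g, h1, h2, h3⟩ := hQ; obtain ⟨f, k1, k2, k3⟩ := hR
  exact ⟨_, h1.mul k1, mul_ne_zero h2 k2, fun t ht =>
    ⟨h3 t (left_ne_zero_of_mul ht), k3 t (right_ne_zero_of_mul ht)⟩⟩

lemma Gen.mono (h : Gen Q) (hR : ∀ t, Q t → R t) : Gen R := h.imp fun _ h => h.mono hR

lemma Gen.and (hQ : Gen Q) (hR : Gen R) : Gen fun t => Q t ∧ R t := by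
  obtain ⟨t0, g, ⟨p, hp⟩, h2, h3⟩ := hQ; obtain ⟨t1, f, ⟨q, hq⟩, k2, k3⟩ := hR
  have hpq : p * q ≠ 0 := by
    refine mul_ne_zero ?_ ?_ <;> rintro rfl
    · exact h2 (by rw [hp, map_zero])
    · exact k2 (by rw [hq, map_zero])
  obtain ⟨t, ht⟩ : ∃ t, MvPolynomial.eval t (p * q) ≠ 0 := by
    by_contra! hcon
    exact hpq (MvPolynomial.funext fun t => by rw [hcon, map_zero])
  refine ⟨t, fun t => MvPolynomial.eval t (p * q), ⟨_, fun t => rfl⟩, ht, fun t ht => ?_⟩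
  change MvPolynomial.eval t (p * q) ≠ 0 at ht
  rw [map_mul] at ht
  exact ⟨h3 t (by rw [hp]; exact left_ne_zero_of_mul ht), k3 t (by rw [hq]; exact right_ne_zero_of_mul ht)⟩

lemma IsPoly.near {g : (ι → ℝ) → ℝ} (hg : IsPoly g) (h : g t0 ≠ 0) : Near t0 fun t => g t ≠ 0 :=
  ⟨g, hg, h, fun _ ht => ht⟩

lemma near_li {n : ℕ} {v : Fin n → (ι → ℝ) → W} (hv : ∀ i, IsPolyV (v i))
    (h : LI fun i => v i t0) : Near t0 fun t => LI fun i => v i t := by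
  obtain ⟨L, hL⟩ := LinearMap.exists_leftInverse_of_injective
    (Finsupp.linearCombination ℝ fun i => v i t0) (LinearMap.ker_eq_bot.2 h)
  let M : (ι → ℝ) → Matrix (Fin n) (Fin n) ℝ := fun t => Matrix.of fun i j => L (v j t) i
  refine ⟨fun t => (M t).det, ?_, ?_, fun t ht => ?_⟩
  · simp only [Matrix.det_apply']; exact IsPoly.sum _ fun σ => (IsPoly.const _).mul
      (IsPoly.prod _ fun i => hv i (Finsupp.lapply (σ i) ∘ₗ L))
  · have : M t0 = 1 := by
      ext i j; have := congrArg (fun f => f (Finsupp.single j 1) i) hL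
      simp only [LinearMap.comp_apply, Finsupp.linearCombination_single, one_smul, LinearMap.id_apply] at this
      show L (v j t0) i = _
      rw [this, Matrix.one_apply, Finsupp.single_apply]; simp only [eq_comm]
    show (M t0).det ≠ 0
    rw [this, Matrix.det_one]; exact one_ne_zero
  · show LI fun i => v i t
    rw [Fintype.linearIndependent_iff]; intro c hc; have : (M t).mulVec c = 0 := by
      ext i; have := congrArg (fun x => L x i) hc
      simpa [Matrix.mulVec, dotProduct, M, mul_comm] using this
    exact congrFun (Matrix.eq_zero_of_mulVec_eq_zero ht this)

lemma near_li_three {a b c : (ι → ℝ) → W} (ha : IsPolyV a) (hb : IsPolyV b) (hc : IsPolyV c)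
    (h : LI ![a t0, b t0, c t0]) :
    Near t0 fun t => LI ![a t, b t, c t] := by
  have e : ∀ t, (fun i => (![a, b, c] i) t) = ![a t, b t, c t] :=
    fun t => funext fun i => by fin_cases i <;> rfl
  rw [← e] at h
  refine (near_li (v := ![a, b, c]) (by intro i; fin_cases i <;> assumption) h).mono fun t ht => ?_
  rwa [e] at ht

lemma near_li_four {a b c d : (ι → ℝ) → W} (ha : IsPolyV a) (hb : IsPolyV b) (hc : IsPolyV c)
    (hd : IsPolyV d) (h : LI ![a t0, b t0, c t0, d t0]) :
    Near t0 fun t => LI ![a t, b t, c t, d t] := by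
  have e : ∀ t, (fun i => (![a, b, c, d] i) t) = ![a t, b t, c t, d t] :=
    fun t => funext fun i => by fin_cases i <;> rfl
  rw [← e] at h
  refine (near_li (v := ![a, b, c, d]) (by intro i; fin_cases i <;> assumption) h).mono fun t ht => ?_
  rwa [e] at ht

lemma near_li_five {a b c d f : (ι → ℝ) → W} (ha : IsPolyV a) (hb : IsPolyV b) (hc : IsPolyV c)
    (hd : IsPolyV d) (hf : IsPolyV f) (h : LI ![a t0, b t0, c t0, d t0, f t0]) :
    Near t0 fun t => LI ![a t, b t, c t, d t, f t] := by
  have e : ∀ t, (fun i => (![a, b, c, d, f] i) t) = ![a t, b t, c t, d t, f t] :=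
    fun t => funext fun i => by fin_cases i <;> rfl
  rw [← e] at h
  refine (near_li (v := ![a, b, c, d, f]) (by intro i; fin_cases i <;> assumption) h).mono fun t ht => ?_
  rwa [e] at ht

lemma generically_of_gen {ι' : Type} {E : Set (ι' → ℝ)} {δ : MvPolynomial ι' ℝ}
    {t : (ι' → ℝ) → ι → ℝ} {r : ι → MvPolynomial ι' ℝ}
    (ht : ∀ w, MvPolynomial.eval w δ ≠ 0 → ∀ k, MvPolynomial.eval w δ * t w k = MvPolynomial.eval w (r k))
    (hE : ∀ t0, ∃ w ∈ E, MvPolynomial.eval w δ ≠ 0 ∧ t w = t0) {K : Type*} [Countable K]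
    {Q : K → (ι → ℝ) → Prop} (hQ : ∀ k, Gen (Q k)) {R : (ι' → ℝ) → Prop}
    (hR : ∀ w ∈ E, MvPolynomial.eval w δ ≠ 0 → (∀ k, Q k (t w)) → R w) : Generically E R := by
  have hom : ∀ p : MvPolynomial ι ℝ, ∃ (N : ℕ) (q : MvPolynomial ι' ℝ), ∀ w, MvPolynomial.eval w δ ≠ 0 →
      MvPolynomial.eval w q = MvPolynomial.eval w δ ^ N * MvPolynomial.eval (t w) p := by
    intro p
    induction p using MvPolynomial.induction_on with
    | C a => exact ⟨0, MvPolynomial.C a, fun w _ => by simp⟩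
    | add p p' hp hp' =>
      obtain ⟨N, q, h⟩ := hp; obtain ⟨N', q', h'⟩ := hp'
      exact ⟨N + N', δ ^ N' * q + δ ^ N * q', fun w hw => by simp [h w hw, h' w hw]; ring⟩
    | mul_X p k hp =>
      obtain ⟨N, q, h⟩ := hp
      exact ⟨N + 1, q * r k, fun w hw => by simp [h w hw, ← ht w hw k]; ring⟩
  choose t0 g hg hg0 hgQ using hQ
  choose p hp using hg
  choose N q hq using fun k => hom (p k)
  obtain ⟨f, hf⟩ := exists_surjective_nat (Option K)
  let P : Option K → MvPolynomial ι' ℝ := fun o => o.elim δ q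
  refine ⟨fun n => P (f n), fun n => ?_, fun w hw hn => ?_⟩
  · show ∃ w ∈ E, MvPolynomial.eval w (P (f n)) ≠ 0
    rcases f n with _ | k
    · obtain ⟨w, hw, h, -⟩ := hE 0; exact ⟨w, hw, h⟩
    · obtain ⟨w, hw, h, e⟩ := hE (t0 k); refine ⟨w, hw, ?_⟩
      show MvPolynomial.eval w (q k) ≠ 0
      rw [hq k w h, e, ← hp]; exact mul_ne_zero (pow_ne_zero _ h) (hg0 k)
  · obtain ⟨n, e⟩ := hf none; have hδ : MvPolynomial.eval w δ ≠ 0 := by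
      have : MvPolynomial.eval w (P (f n)) ≠ 0 := hn n; rwa [e] at this
    refine hR w hw hδ fun k => hgQ k _ ?_
    obtain ⟨n, e⟩ := hf (some k); have : MvPolynomial.eval w (P (f n)) ≠ 0 := hn n
    rw [e] at this; change MvPolynomial.eval w (q k) ≠ 0 at this; rw [hq k w hδ, ← hp] at this
    exact right_ne_zero_of_mul this

end Generic

/-! ### Nets in general position in homogeneous coordinates -/

/-- Homogeneous coordinates of the vertices of a net and of points of its tangents. -/
structure Points (σ : SCNet m) (x : Lattice m → V) (d : Fin m → Fin m → Lattice m → V) : Prop where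
  vertex : ∀ z, Represents (σ.vertex z) (x z)
  tangent : ∀ i j, i ≠ j → ∀ z, σ.tangent i j z = span ℝ {x z, d i j z}

/-- General position of two layers of vertices and tangents at a point of the lattice. -/
structure LayerPos (x : Lattice m → V) (d : Fin m → Fin m → Lattice m → V) (y : Lattice m → V)
    (d' : Fin m → Fin m → Lattice m → V) (i j k : Fin m) (z : Lattice m) : Prop where
  abc : LI ![x z, x (z + e k), y (z + e k)]
  abd : LI ![x z, x (z + e k), y z]
  acd : LI ![x z, y (z + e k), y z]
  bcd : LI ![x (z + e k), y (z + e k), y z]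
  cube : LI ![y z, x z, x (z + e i), x (z + e j)]
  left : LI ![d i j z, x z, x (z + e k), y z]
  left' : LI ![d i j (z + e k), x z, x (z + e k), y z]
  right : LI ![d' i j z, x z, x (z + e k), y z]
  right' : LI ![d' i j (z + e k), x z, x (z + e k), y z]
  skew : LI ![x z, d i j z, y (z + e k), d' i j (z + e k)]
  skew' : LI ![x (z + e k), d i j (z + e k), y z, d' i j z]

lemma Points.li {σ : SCNet m} {x : Lattice m → V} {d : Fin m → Fin m → Lattice m → V}
    (h : Points σ x d) {i j : Fin m} (hij : i ≠ j) (z : Lattice m) :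
    LI ![x z, d i j z] := by
  rw [li_iff_finrank, range_pair, ← h.tangent i j hij]
  have := (σ.isSCPatch i j hij z).li_du (j := 0) (by simp) zero_mem_Icc
  rwa [li_iff_finrank, range_pair] at this

lemma IsFTransform.symm {σ τ : SCNet m} (h : IsFTransform σ τ) : IsFTransform τ σ := by
  refine ⟨fun i z => ?_, fun i j hij z => (h.patch i j hij z).symm⟩
  have hq := quad_pt (h.qnet i z)
  refine (planarQuad_iff (rep_spec _) (rep_spec _) (rep_spec _) (rep_spec _)).2
    ⟨?_, ?_, ?_, ?_, ?_⟩
  · obtain ⟨r, s, t, k, e, hne⟩ := not_li_four.1 hq.dep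
    exact not_li_four.2 ⟨k, t, s, r, by linear_combination (norm := module) e, by tauto⟩
  · exact li_three_rotate (li_three_rotate (li_three_swap (li_three_rotate hq.bcd)))
  · exact li_three_rotate (li_three_rotate (li_three_swap (li_three_rotate hq.acd)))
  · exact li_three_rotate (li_three_rotate (li_three_swap (li_three_rotate hq.abd)))
  · exact li_three_rotate (li_three_rotate (li_three_swap (li_three_rotate hq.abc)))

lemma GeneralPair.symm {σ τ : SCNet m} (h : IsFTransform σ τ) (hp : GeneralPair σ τ) :
    GeneralPair τ σ := by
  have plane : ∀ k z, join3 (τ.vertex z) (τ.vertex (z + e k)) (σ.vertex z) =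
      join3 (σ.vertex z) (σ.vertex (z + e k)) (τ.vertex z) := by
    intro k z; have hq := quad_pt (h.qnet k z); rw [join3_eq (rep_spec _) (rep_spec _) (rep_spec _),
      join3_eq (rep_spec _) (rep_spec _) (rep_spec _)]
    obtain ⟨m1, m2, m3⟩ := mem_span_triple_left (σ.vertex z).rep (σ.vertex (z + e k)).rep (τ.vertex z).rep
    refine span_range_eq_of_mem
      (li_three_rotate (li_three_rotate (li_three_swap (li_three_rotate hq.acd))))
      (finrank_span_three hq.abd) ?_
    intro i; fin_cases i
    exacts [m3, hq.mem, m1]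
  refine ⟨fun i j hij z hle => ?_, fun i j k hij z t ht => ?_, fun i j k hij z => ?_⟩
  · have hc := hp.cube i j hij z
    rw [(rep_spec _).le_iff, join3_eq (rep_spec _) (rep_spec _) (rep_spec _)]
      at hc hle
    have hli := linearIndependent_finCons.2 ⟨(quad_pt (σ.planar i j hij z)).abd, hc⟩
    obtain ⟨a, b, c, -, hb, -, e1⟩ := (quad_pt (h.qnet i z)).exists_comb
    obtain ⟨a', b', c', -, hb', -, e2⟩ := (quad_pt (h.qnet j z)).exists_comb
    obtain ⟨r, s, t, e3⟩ := mem_span_triple.1 hle; rw [e1, e2] at e3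
    obtain ⟨h1, h2, h3, h4⟩ := li_four.1 hli (r + s * c + t * c') (s * a + t * a' - 1) (s * b) (t * b') (by
      linear_combination (norm := module) -e3)
    have hs := (mul_eq_zero.1 h3).resolve_right hb; have ht := (mul_eq_zero.1 h4).resolve_right hb'
    rw [hs, ht] at h2; norm_num at h2
  · rw [plane]; refine hp.tangent i j k hij z t ?_
    simp only [mem_insert_iff, mem_singleton_iff] at ht ⊢; tauto
  · obtain ⟨h1, h2⟩ := hp.skew i j k hij z
    exact ⟨by rw [inf_comm]; exact h2, by rw [inf_comm]; exact h1⟩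

section Layer

variable {σ τ : SCNet m} {x y : Lattice m → V} {d d' : Fin m → Fin m → Lattice m → V}

lemma layerPos_of (h : IsFTransform σ τ) (hp : GeneralPair σ τ) (hx : Points σ x d)
    (hy : Points τ y d') {i j : Fin m} (hij : i ≠ j) (k : Fin m) (z : Lattice m) :
    LayerPos x d y d' i j k z := by
  have hq := (planarQuad_iff (hx.vertex _) (hx.vertex _) (hy.vertex _) (hy.vertex _)).1 (h.qnet k z)
  have ht := hp.tangent i j k hij z; obtain ⟨k1, k2⟩ := hp.skew i j k hij z
  simp only [mem_insert_iff, mem_singleton_iff, forall_eq_or_imp, forall_eq, hx.tangent i j hij,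
    hy.tangent i j hij] at ht
  rw [hx.tangent i j hij, hy.tangent i j hij] at k1 k2; obtain ⟨t1, t2, t3, t4⟩ := ht
  obtain ⟨m1, m2, m3⟩ := mem_span_triple_left (x z) (x (z + e k)) (y z)
  refine ⟨hq.abc, hq.abd, hq.acd, hq.bcd, ?_,
    li_of_not_le (hx.vertex _) (hx.vertex _) (hy.vertex _) hq.abd m1 t1,
    li_of_not_le (hx.vertex _) (hx.vertex _) (hy.vertex _) hq.abd m2 t2,
    li_of_not_le (hx.vertex _) (hx.vertex _) (hy.vertex _) hq.abd m3 t3,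
    li_of_not_le (hx.vertex _) (hx.vertex _) (hy.vertex _) hq.abd hq.mem t4,
    li_pairs_inf.2 ⟨hx.li hij _, hy.li hij _, by rw [range_pair, range_pair]; exact k1⟩,
    li_pairs_inf.2 ⟨hx.li hij _, hy.li hij _, by rw [range_pair, range_pair]; exact k2⟩⟩
  have hc := hp.cube i j hij z
  rw [(hy.vertex _).le_iff, join3_eq (hx.vertex _) (hx.vertex _) (hx.vertex _)] at hc
  exact linearIndependent_finCons.2 ⟨((planarQuad_iff (hx.vertex _) (hx.vertex _) (hx.vertex _)
    (hx.vertex _)).1 (σ.planar i j hij z)).abd, hc⟩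

lemma genPos_of_layerPos (hx : Points σ x d) {p : Lattice m → RP3} (hp : ∀ z, Represents (p z) (y z))
    {t : Fin m → Fin m → Lattice m → Submodule ℝ V}
    (ht : ∀ i j, i ≠ j → ∀ z, t i j z = span ℝ {y z, d' i j z})
    (h : ∀ i j, i ≠ j → ∀ k z, LayerPos x d y d' i j k z) : GenPos σ.vertex σ.tangent p t := by
  refine ⟨fun i j hij z => ?_, fun i j k hij z => ?_, fun i j k hij z => ?_⟩
  · rw [(hp _).le_iff, join3_eq (hx.vertex _) (hx.vertex _) (hx.vertex _)]
    exact notMem_span_of_li (h i j hij i z).cube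
  · have key : ∀ {a b : V}, LI ![b, x z, x (z + e k), y z] →
        ¬ span ℝ {a, b} ≤ join3 (σ.vertex z) (σ.vertex (z + e k)) (p z) := fun hli hle => by
      rw [join3_eq (hx.vertex _) (hx.vertex _) (hp _)] at hle
      exact notMem_span_of_li hli (hle (subset_span (by right; rfl)))
    have hl := h i j hij k z
    simp only [mem_insert_iff, mem_singleton_iff, forall_eq_or_imp, forall_eq, hx.tangent i j hij,
      ht i j hij]
    exact ⟨key hl.left, key hl.left', key hl.right, key hl.right'⟩
  · have hl := h i j hij k z; rw [hx.tangent i j hij, ht i j hij, hx.tangent i j hij, ht i j hij]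
    have h1 := (li_pairs_inf.1 hl.skew).2.2; have h2 := (li_pairs_inf.1 hl.skew').2.2
    rw [range_pair, range_pair] at h1 h2; exact ⟨h1, h2⟩

end Layer

lemma trans_of_li {x1 x2 d1 d2 y : V} {p : RP3} (hp : Represents p y)
    (h1 : LI ![d1, x1, x2, y]) (h2 : LI ![d2, x1, x2, y]) :
    Trans (span ℝ {x1, d1}) (span ℝ {x2, d2}) p := by
  have key : ∀ a d : V, span ℝ {a, d} ⊔ p.submodule = span ℝ (range ![a, d, y]) := by
    intro a d; rw [show p.submodule = _ from hp, ← Submodule.span_union, range_triple]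
    congr 1
    ext x; simp; tauto
  have l1 : LI ![x1, d1, y] := li_three.2 fun r s t hr => by
    have := li_four.1 h1 s r 0 t (by linear_combination (norm := module) hr)
    tauto
  refine ⟨?_, ?_, fun he => ?_⟩
  · rw [key]; exact finrank_span_three l1
  · rw [key]; refine finrank_span_three (li_three.2 fun r s t hr => ?_)
    have := li_four.1 h2 s 0 r t (by linear_combination (norm := module) hr)
    tauto
  · rw [key, key] at he; have : x2 ∈ span ℝ (range ![x1, d1, y]) := by
      rw [he]; exact subset_span ⟨0, rfl⟩
    obtain ⟨r, s, t, e⟩ := mem_span_triple.1 this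
    have := li_four.1 h1 s r (-1) t (by rw [e]; module)
    norm_num at this

/-! ### Nets generated by linear maps -/

/-- The patches of `σ` are generated by the boundary curves of the patches of `s` by means of `T`, `S`. -/
structure Generates (s σ : SCNet m) (T S : Maps m Hat) : Prop where
  corner : ∀ i j, i ≠ j → ∀ z ε δ z', IsCorner i j z ε δ z' →
    Represents (σ.vertex z') (meet (T i j z (s.patch i j z ε 0)) (S i j z (s.patch i j z 0 δ)))
  patch : ∀ i j, i ≠ j → ∀ z, SamePatch (σ.patch i j z) (gen (s.patch i j z) (T i j z) (S i j z))

/-- Points of the tangents of a generated net. -/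
def dir (s : SCNet m) (T S : Maps m Hat) (i j : Fin m) (z : Lattice m) : V :=
  meet (T i j z ((s.patch i j z).du 0 0)) (S i j z (s.patch i j z 0 0))

lemma Generates.points {s σ : SCNet m} {T S : Maps m Hat} (h : Generates s σ T S) {x : Lattice m → V}
    (hx : ∀ z, Represents (σ.vertex z) (x z)) : Points σ x (dir s T S) := by
  refine ⟨hx, fun i j hij z => ?_⟩
  have hF : (s.patch i j z).Smooth := (s.isSCPatch i j hij z).smooth
  have hσ : (σ.patch i j z).Smooth := (σ.isSCPatch i j hij z).smooth
  have hg := smooth_gen hF (T i j z) (S i j z); have h0 := h.corner i j hij z 0 0 z .zero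
  obtain ⟨r, t, e1, e2⟩ := tangent_eq_of_dep (hg.left 0) (hσ.left 0)
    (fun u hu => dep_two_comm (h.patch i j hij z u hu 0 zero_mem_Icc)) zero_mem_Icc h0.ne_zero
  obtain ⟨k, hk, e3⟩ := h0.exists_smul (hx z)
  change deriv (fun u => σ.patch i j z u 0) 0 = t • _ + r • (gen _ _ _).du 0 0 at e2
  rw [du_gen hF] at e2; change σ.patch i j z 0 0 = r • meet _ _ at e1
  have hr : r ≠ 0 := by
    rintro rfl; refine (σ.isSCPatch i j hij z).ne_zero_left (j := 0) (by simp) zero_mem_Icc ?_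
    rw [e1, zero_smul]
  rw [tangent, Lift.vertexTangent, show (σ.patch i j z).du 0 0 = _ from e2, e1, e3]
  refine le_antisymm (span_le.2 ?_) (span_le.2 ?_)
  · rintro _ (rfl | rfl)
    · exact mem_span_pair.2 ⟨r * k⁻¹, 0, by
        rw [smul_smul, inv_mul_cancel_right₀ hk]; module⟩
    · refine mem_span_pair.2 ⟨t * k⁻¹, r, ?_⟩
      rw [smul_smul, inv_mul_cancel_right₀ hk]; rfl
  · rintro _ (rfl | rfl)
    · exact mem_span_pair.2 ⟨k * r⁻¹, 0, by
        rw [smul_smul, inv_mul_cancel_right₀ hr]; module⟩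
    · refine mem_span_pair.2 ⟨-(r⁻¹ * t * r⁻¹), r⁻¹, ?_⟩
      rw [smul_add, smul_smul, smul_smul r⁻¹ r, inv_mul_cancel₀ hr, smul_smul, neg_mul,
        inv_mul_cancel_right₀ hr]
      show _ + ((r⁻¹ * t) • meet _ _ + _) = _
      rw [one_smul, dir]; module

/-- The two families of linear maps define fundamental transforms. -/
def Related (T S T' S' : Maps m Hat) : Prop := ∀ i j, i ≠ j → ∀ z, ∃ (c d : ℝ) (P Q : V → ℝ) (Y : Hat),
  (∀ w, T' i j z w = c • T i j z w + P w • Y) ∧ ∀ w, S' i j z w = d • S i j z w + Q w • Y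

/-- The linear maps generate a net with the vertices `y`. -/
structure IsNetData (s : SCNet m) (T S : Maps m Hat) (y : Lattice m → V) : Prop where
  swap : ∀ i j, i ≠ j → ∀ z, gen (s.patch j i z) (T j i z) (S j i z) =
    (gen (s.patch i j z) (T i j z) (S i j z)).swap
  sc : ∀ i j, i ≠ j → ∀ z, IsSCPatch (gen (s.patch i j z) (T i j z) (S i j z))
  corner : ∀ i j, i ≠ j → ∀ z ε δ z', IsCorner i j z ε δ z' → ∃ r : ℝ, r ≠ 0 ∧
    meet (T i j z (s.patch i j z ε 0)) (S i j z (s.patch i j z 0 δ)) = r • y z'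
  abc : ∀ i j, i ≠ j → ∀ z, LI ![y z, y (z + e i), y (z + e i + e j)]
  abd : ∀ i j, i ≠ j → ∀ z, LI ![y z, y (z + e i), y (z + e j)]
  bcd : ∀ i j, i ≠ j → ∀ z, LI ![y (z + e i), y (z + e i + e j), y (z + e j)]

section Generated

variable {s σ σ1 σ2 : SCNet m} {T S T1 S1 T2 S2 : Maps m Hat} {x x1 x2 y : Lattice m → V}

lemma IsNetData.corner_represents (h : IsNetData s T S y) {p : Lattice m → RP3}
    (hp : ∀ z, Represents (p z) (y z)) {i j : Fin m} (hij : i ≠ j) {z : Lattice m} {ε δ : ℝ}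
    {z' : Lattice m} (hc : IsCorner i j z ε δ z') :
    Represents (p z') (meet (T i j z (s.patch i j z ε 0)) (S i j z (s.patch i j z 0 δ))) := by
  obtain ⟨r, hr, e⟩ := h.corner i j hij z ε δ z' hc; rw [e]; exact (hp z').smul hr

lemma IsNetData.planar (h : IsNetData s T S y) {i j : Fin m} (hij : i ≠ j) (z : Lattice m) :
    Quad (y z) (y (z + e i)) (y (z + e i + e j)) (y (z + e j)) := by
  refine ⟨?_, h.abc i j hij z, h.abd i j hij z, ?_, h.bcd i j hij z⟩
  · obtain ⟨r1, h1, e1⟩ := h.corner i j hij z _ _ _ .zero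
    obtain ⟨r2, h2, e2⟩ := h.corner i j hij z _ _ _ .left
    obtain ⟨r3, h3, e3⟩ := h.corner i j hij z _ _ _ .both
    obtain ⟨r4, h4, e4⟩ := h.corner i j hij z _ _ _ .right; refine dep_four_smul h1 h2 h3 h4 ?_
    rw [← e1, ← e2, ← e3, ← e4]
    have hm : ∀ k, ![T i j z (s.patch i j z 0 0), T i j z (s.patch i j z 1 0), S i j z (s.patch i j z 0 0),
        S i j z (s.patch i j z 0 1)] k ∈ span ℝ (range _) :=
      fun k => subset_span (mem_range_self k)
    exact not_li_meet_four (finrank_span_four_le _ _ _ _) (hm 0) (hm 1) (hm 1) (hm 0) (hm 2) (hm 2)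
      (hm 3) (hm 3)
  · have := h.abc j i hij.symm z; rw [add_right_comm] at this; exact li_three_swap this

lemma IsNetData.layer [Nontrivial (Fin m)] (h : IsNetData s T S y) {p : Lattice m → RP3}
    (hp : ∀ z, Represents (p z) (y z)) (hσ : Generates s σ T1 S1) (hR : Related T1 S1 T S)
    (hx : ∀ z, Represents (σ.vertex z) (x z))
    (hl : ∀ i j, i ≠ j → ∀ k z, LayerPos x (dir s T1 S1) y (dir s T S) i j k z) :
    (∀ i z, PlanarQuad (σ.vertex z) (σ.vertex (z + e i)) (p (z + e i)) (p z)) ∧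
    (∀ i j, i ≠ j → ∀ z, ClassicalFPair (σ.patch i j z) (gen (s.patch i j z) (T i j z) (S i j z))) ∧
    GenPos σ.vertex σ.tangent p
      fun i j z => (gen (s.patch i j z) (T i j z) (S i j z)).vertexTangent := by
  refine ⟨fun i z => ?_, fun i j hij z => ?_, ?_⟩
  · obtain ⟨j, hji⟩ := exists_ne i; have hij := hji.symm; have l := hl i j hij i z
    obtain ⟨c, d, P, Q, Y, hT, hS⟩ := hR i j hij z; have c0 := hσ.corner i j hij z _ _ _ .zero
    have c1 := hσ.corner i j hij z _ _ _ .left; have k0 := h.corner_represents hp hij (z := z) .zero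
    have k1 := h.corner_represents hp hij (z := z) .left
    refine (planarQuad_iff (hx _) (hx _) (hp _) (hp _)).2 ⟨?_, l.abc, l.abd, l.acd, l.bcd⟩
    obtain ⟨r1, h1, e1⟩ := (hx _).exists_smul c0; obtain ⟨r2, h2, e2⟩ := (hx _).exists_smul c1
    obtain ⟨r3, h3, e3⟩ := (hp _).exists_smul k1; obtain ⟨r4, h4, e4⟩ := (hp _).exists_smul k0
    refine dep_four_smul h1 h2 h3 h4 ?_
    rw [← e1, ← e2, ← e3, ← e4]; exact dep_meet hT hS _ _ _
  · obtain ⟨c, d, P, Q, Y, hT, hS⟩ := hR i j hij z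
    exact classicalFPair_of_gen (s.isSCPatch i j hij z) (σ.isSCPatch i j hij z).smooth
      (h.sc i j hij z).smooth hT hS (hσ.corner i j hij z _ _ _ .zero).ne_zero
      (h.corner_represents hp hij (z := z) .zero).ne_zero (hσ.patch i j hij z)
      fun u _ v _ => not_li_two.2 ⟨1, -1, by module, by simp⟩
  · refine genPos_of_layerPos (hσ.points hx) hp (fun i j hij z => ?_) hl
    have hF : (s.patch i j z).Smooth := (s.isSCPatch i j hij z).smooth
    obtain ⟨r, hr, e1⟩ := h.corner i j hij z _ _ _ .zero
    rw [Lift.vertexTangent, du_gen hF, show gen (s.patch i j z) (T i j z) (S i j z) 0 0 = r • y z from e1]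
    refine le_antisymm (span_le.2 ?_) (span_le.2 ?_)
    · rintro _ (rfl | rfl)
      exacts [mem_span_pair.2 ⟨r, 0, by module⟩, subset_span (by right; rfl)]
    · rintro _ (rfl | rfl)
      · exact mem_span_pair.2 ⟨r⁻¹, 0, by rw [smul_smul, inv_mul_cancel₀ hr]; module⟩
      · exact subset_span (by right; rfl)

lemma IsNetData.isFTransform [Nontrivial (Fin m)] (h : IsNetData s T S y) {τ : SCNet m}
    (hp : ∀ z, Represents (τ.vertex z) (y z))
    (hτ : τ.patch = fun i j z => gen (s.patch i j z) (T i j z) (S i j z)) (hσ : Generates s σ T1 S1)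
    (hR : Related T1 S1 T S) (hx : ∀ z, Represents (σ.vertex z) (x z))
    (hl : ∀ i j, i ≠ j → ∀ k z, LayerPos x (dir s T1 S1) y (dir s T S) i j k z) :
    IsFTransform σ τ ∧ GeneralPair σ τ := by
  obtain ⟨h1, h2, h3⟩ := h.layer hp hσ hR hx hl
  refine ⟨⟨h1, fun i j hij z => by rw [hτ]; exact h2 i j hij z⟩, generalPair_iff.2 ?_⟩
  have : τ.tangent = fun i j z => (gen (s.patch i j z) (T i j z) (S i j z)).vertexTangent := by
    ext1 i; ext1 j; ext1 z; rw [tangent, hτ]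
  rw [this]; exact h3

lemma IsNetData.exists_net [Nontrivial (Fin m)] (h : IsNetData s T S y) (hσ1 : Generates s σ1 T1 S1)
    (hσ2 : Generates s σ2 T2 S2) (hR1 : Related T1 S1 T S) (hR2 : Related T2 S2 T S)
    (hx1 : ∀ z, Represents (σ1.vertex z) (x1 z)) (hx2 : ∀ z, Represents (σ2.vertex z) (x2 z))
    (hl1 : ∀ i j, i ≠ j → ∀ k z, LayerPos x1 (dir s T1 S1) y (dir s T S) i j k z)
    (ht1 : ∀ i j, i ≠ j → ∀ z, LI ![dir s T1 S1 i j z, x1 z, x2 z, y z])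
    (ht2 : ∀ i j, i ≠ j → ∀ z, LI ![dir s T2 S2 i j z, x1 z, x2 z, y z]) :
    ∃ τ : SCNet m, (∀ z, Represents (τ.vertex z) (y z)) ∧
      τ.patch = fun i j z => gen (s.patch i j z) (T i j z) (S i j z) := by
  have hy : ∀ z, y z ≠ 0 := fun z => by
    obtain ⟨i, j, hij⟩ := exists_pair_ne (Fin m); exact (h.abc i j hij z).ne_zero 0
  choose p hp using fun z => exists_represents (hy z)
  obtain ⟨q, f, g⟩ := h.layer hp hσ1 hR1 hx1 hl1; have f2 : ∀ i j, i ≠ j → ∀ z,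
      ClassicalFPair (σ2.patch i j z) (gen (s.patch i j z) (T i j z) (S i j z)) := fun i j hij z => by
    obtain ⟨c, d, P, Q, Y, hT, hS⟩ := hR2 i j hij z
    exact classicalFPair_of_gen (s.isSCPatch i j hij z) (σ2.isSCPatch i j hij z).smooth
      (h.sc i j hij z).smooth hT hS (hσ2.corner i j hij z _ _ _ .zero).ne_zero
      (h.corner_represents hp hij (z := z) .zero).ne_zero (hσ2.patch i j hij z)
      fun u _ v _ => not_li_two.2 ⟨1, -1, by module, by simp⟩
  have hC : CommonTransform σ1 σ2 p fun i j z => gen (s.patch i j z) (T i j z) (S i j z) := by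
    refine ⟨h.sc, h.swap, fun i j hij z => ⟨?_, ?_, ?_, ?_⟩, fun i j hij z => ?_, q, f, f2,
      fun i j hij z => ?_, g⟩
    · exact h.corner_represents hp hij .zero
    · exact h.corner_represents hp hij .left
    · exact h.corner_represents hp hij .right
    · exact h.corner_represents hp hij .both
    · exact (planarQuad_iff (hp _) (hp _) (hp _) (hp _)).2 (h.planar hij z)
    · rw [(hσ1.points hx1).tangent i j hij, (hσ2.points hx2).tangent i j hij]
      exact trans_of_li (hp z) (ht1 i j hij z) (ht2 i j hij z)
  obtain ⟨τ, h1, h2⟩ := hC.exists_net; exact ⟨τ, fun z => by rw [h1]; exact hp z, h2⟩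

end Generated

/-! ### Symmetric choice of the linear maps -/

/-- The first linear map, with the cells parametrized in a symmetric way. -/
def symL (T S : Maps m Hat) : Maps m Hat := fun i j z => if i < j then T i j z else -S j i z

/-- The second linear map, with the cells parametrized in a symmetric way. -/
def symR (T S : Maps m Hat) : Maps m Hat := fun i j z => if i < j then S i j z else T j i z

lemma sym_cases {R : Fin m → Fin m → Lattice m → (V →ₗ[ℝ] Hat) → (V →ₗ[ℝ] Hat) → Prop}
    {T S : Maps m Hat} (h : ∀ i j, i ≠ j → ∀ z, R i j z (T i j z) (S i j z))
    (hsw : ∀ i j, i ≠ j → ∀ z, R i j z (T i j z) (S i j z) → R j i z (-S i j z) (T i j z)) {i j : Fin m}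
    (hij : i ≠ j) (z : Lattice m) : R i j z (symL T S i j z) (symR T S i j z) := by
  rw [symL, symR]; split_ifs with hlt
  · exact h i j hij z
  · exact hsw j i hij.symm z (h j i hij.symm z)

lemma gen_sym_swap (s : SCNet m) (T S : Maps m Hat) {i j : Fin m} (hij : i ≠ j) (z : Lattice m) :
    gen (s.patch j i z) (symL T S j i z) (symR T S j i z) =
      (gen (s.patch i j z) (symL T S i j z) (symR T S i j z)).swap := by
  rw [s.patch_swap i j hij, symL, symL, symR, symR]
  rcases lt_or_gt_of_ne hij with h | h
  · rw [if_neg h.asymm, if_neg h.asymm, if_pos h, if_pos h, swap_gen]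
  · rw [if_pos h, if_pos h, if_neg h.asymm, if_neg h.asymm, swap_gen]
    ext1 u; ext1 v
    simp only [gen, meetLift, LinearMap.neg_apply, map_neg, neg_neg]

lemma IsCorner.swap {i j : Fin m} {z z' : Lattice m} {ε δ : ℝ} (h : IsCorner i j z ε δ z') :
    IsCorner j i z δ ε z' := by
  rcases h with _ | _ | _ | _
  exacts [.zero, .right, .left, by rw [add_right_comm]; exact .both]

lemma meet_neg_comm (x y : Hat) : meet (-x) y = meet y x := by
  rw [map_neg, LinearMap.neg_apply, meet_comm, neg_neg]

lemma Generates.sym {s σ : SCNet m} {T S : Maps m Hat} (h : Generates s σ T S) :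
    Generates s σ (symL T S) (symR T S) where
  corner i j hij z := by
    refine sym_cases (R := fun i j z A B => ∀ ε δ z', IsCorner i j z ε δ z' →
      Represents (σ.vertex z') (meet (A (s.patch i j z ε 0)) (B (s.patch i j z 0 δ)))) h.corner
      (fun i j hij z hc ε δ z' hz => ?_) hij z
    rw [s.patch_swap i j hij, LinearMap.neg_apply, meet_neg_comm]
    exact hc _ _ _ hz.swap
  patch i j hij z := by
    refine sym_cases (R := fun i j z A B => SamePatch (σ.patch i j z) (gen (s.patch i j z) A B)) h.patch
      (fun i j hij z hc => ?_) hij z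
    rw [s.patch_swap i j hij, σ.patch_swap i j hij, ← swap_gen]; exact hc.swap

lemma Related.sym {T S T' S' : Maps m Hat} (h : Related T S T' S') :
    Related (symL T S) (symR T S) (symL T' S') (symR T' S') := by
  intro i j hij z; rw [symL, symL, symR, symR]; split_ifs with hlt
  · exact h i j hij z
  · obtain ⟨c, d, P, Q, Y, hT, hS⟩ := h j i hij.symm z
    exact ⟨d, c, fun w => -Q w, P, Y, fun w => by
      rw [LinearMap.neg_apply, LinearMap.neg_apply, hS]; module, hT⟩

lemma isNetData_sym {s : SCNet m} {T S : Maps m Hat} {y : Lattice m → V}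
    (sc : ∀ i j, i ≠ j → ∀ z, IsSCPatch (gen (s.patch i j z) (T i j z) (S i j z)))
    (corner : ∀ i j, i ≠ j → ∀ z ε δ z', IsCorner i j z ε δ z' → ∃ r : ℝ, r ≠ 0 ∧
      meet (T i j z (s.patch i j z ε 0)) (S i j z (s.patch i j z 0 δ)) = r • y z')
    (abc : ∀ i j, i ≠ j → ∀ z, LI ![y z, y (z + e i), y (z + e i + e j)])
    (abd : ∀ i j, i ≠ j → ∀ z, LI ![y z, y (z + e i), y (z + e j)])
    (bcd : ∀ i j, i ≠ j → ∀ z, LI ![y (z + e i), y (z + e i + e j), y (z + e j)]) :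
    IsNetData s (symL T S) (symR T S) y where
  swap i j hij z := gen_sym_swap s T S hij z
  sc i j hij z := by
    refine sym_cases (R := fun i j z A B => IsSCPatch (gen (s.patch i j z) A B)) sc
      (fun i j hij z hc => ?_) hij z
    rw [s.patch_swap i j hij, ← swap_gen]; exact hc.swap
  corner i j hij z := by
    refine sym_cases (R := fun i j z A B => ∀ ε δ z', IsCorner i j z ε δ z' → ∃ r : ℝ, r ≠ 0 ∧
      meet (A (s.patch i j z ε 0)) (B (s.patch i j z 0 δ)) = r • y z') corner
      (fun i j hij z hc ε δ z' hz => ?_) hij z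
    rw [s.patch_swap i j hij, LinearMap.neg_apply, meet_neg_comm]
    exact hc _ _ _ hz.swap
  abc := abc
  abd := abd
  bcd := bcd

/-! ### Polynomial families of nets -/

section Family

variable {ι : Type} {t0 : ι → ℝ}

lemma IsPoly.pow {g : (ι → ℝ) → ℝ} (hg : IsPoly g) (n : ℕ) : IsPoly fun t => g t ^ n := by
  obtain ⟨p, hp⟩ := hg; exact ⟨p ^ n, fun t => by simp [hp]⟩

lemma near_layerPos {x y : (ι → ℝ) → Lattice m → V} {d d' : (ι → ℝ) → Fin m → Fin m → Lattice m → V}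
    (hx : ∀ z, IsPolyV fun t => x t z) (hd : ∀ i j z, IsPolyV fun t => d t i j z)
    (hy : ∀ z, IsPolyV fun t => y t z) (hd' : ∀ i j z, IsPolyV fun t => d' t i j z) {i j k : Fin m}
    {z : Lattice m} (h : LayerPos (x t0) (d t0) (y t0) (d' t0) i j k z) :
    Near t0 fun t => LayerPos (x t) (d t) (y t) (d' t) i j k z :=
  ((((((((((near_li_three (hx _) (hx _) (hy _) h.abc).and (near_li_three (hx _) (hx _) (hy _) h.abd)).and
    (near_li_three (hx _) (hy _) (hy _) h.acd)).and (near_li_three (hx _) (hy _) (hy _) h.bcd)).and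
    (near_li_four (hy _) (hx _) (hx _) (hx _) h.cube)).and
    (near_li_four (hd _ _ _) (hx _) (hx _) (hy _) h.left)).and
    (near_li_four (hd _ _ _) (hx _) (hx _) (hy _) h.left')).and
    (near_li_four (hd' _ _ _) (hx _) (hx _) (hy _) h.right)).and
    (near_li_four (hd' _ _ _) (hx _) (hx _) (hy _) h.right')).and
    ((near_li_four (hx _) (hd _ _ _) (hy _) (hd' _ _ _) h.skew).and
    (near_li_four (hx _) (hd _ _ _) (hy _) (hd' _ _ _) h.skew'))).mono
    fun _ ⟨⟨⟨⟨⟨⟨⟨⟨⟨h1, h2⟩, h3⟩, h4⟩, h5⟩, h6⟩, h7⟩, h8⟩, h9⟩, h10, h11⟩ =>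
      ⟨h1, h2, h3, h4, h5, h6, h7, h8, h9, h10, h11⟩

lemma near_layerPos_const {x : Lattice m → V} {y : (ι → ℝ) → Lattice m → V}
    {d : Fin m → Fin m → Lattice m → V} {d' : (ι → ℝ) → Fin m → Fin m → Lattice m → V}
    (hy : ∀ z, IsPolyV fun t => y t z) (hd' : ∀ i j z, IsPolyV fun t => d' t i j z) {i j k : Fin m}
    {z : Lattice m} (h : LayerPos x d (y t0) (d' t0) i j k z) :
    Near t0 fun t => LayerPos x d (y t) (d' t) i j k z :=
  near_layerPos (x := fun _ => x) (d := fun _ => d) (fun _ => IsPolyV.const _)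
    (fun _ _ _ => IsPolyV.const _) hy hd' h

lemma near_transversal {A B : (ι → ℝ) → ℝ → Hat} (hA : ∀ u, IsPolyV fun t => A t u)
    (hB : ∀ u, IsPolyV fun t => B t u) (hB' : ∀ u, IsPolyV fun t => deriv (B t) u)
    (h : Transversal (A t0) (B t0)) : Near t0 fun t => Transversal (A t) (B t) := by
  have key : ∀ j ∈ B01, Near t0 fun t => (B t j).2 ≠ 0 ∧
      LI ![A t 0, A t (1 / 2), A t 1, B t j, deriv (B t) j] := fun j hj =>
    ((hB j (LinearMap.snd ℝ V ℝ)).near (h.ne j hj)).and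
      (near_li_five (hA _) (hA _) (hA _) (hB _) (hB' _) (h.li j hj))
  refine (((key 0 (by simp)).and (key 1 (by simp))).and
    (near_li_five (hA _) (hA _) (hA _) (hB _) (hB _) h.li_ends)).mono fun t ⟨⟨h0, h1⟩, h2⟩ => ⟨?_, ?_, h2⟩
  · rintro j (rfl | rfl); exacts [h0.1, h1.1]
  · rintro j (rfl | rfl); exacts [h0.2, h1.2]

lemma near_meetData {F : Lift} (hF : IsSCPatch F) {T S : (ι → ℝ) → V →ₗ[ℝ] Hat}
    (hT : ∀ v, IsPolyV fun t => T t v) (hS : ∀ v, IsPolyV fun t => S t v)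
    (h : MeetData (fun u => T t0 (F u 0)) fun v => S t0 (F 0 v)) :
    Near t0 fun t => MeetData (fun u => T t (F u 0)) fun v => S t (F 0 v) := by
  have hFs : F.Smooth := hF.smooth
  have conic : ∀ {G : Lift} {A : V →ₗ[ℝ] Hat} {b c : Hat}, IsSCPatch G →
      LI ![A (G 0 0), A (G (1 / 2) 0), A (G 1 0), b, c] →
      ∃ K β, ConicData (fun u => A (G u 0)) K β := by
    intro G A b c hG hli; obtain ⟨⟨B, hB⟩, -⟩ := hG.boundary (j := 0) (by simp)
    obtain ⟨B', hB'⟩ := hB.map A fun e he h0 => by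
      rw [← hB.span_three] at he; obtain ⟨r, s, t, rfl⟩ := mem_span_triple.1 he
      rw [map_add, map_add, map_smul, map_smul, map_smul] at h0
      obtain ⟨rfl, rfl, rfl, -⟩ := li_five.1 hli r s t 0 0 (by linear_combination (norm := module) h0)
      module
    exact ⟨_, _, hB'⟩
  obtain ⟨q, hq, hcub⟩ := h.cubic
  have hT' : ∀ u, IsPolyV fun t => deriv (fun u => T t (F u 0)) u := fun u => by
    simp only [deriv_linear_comp _ (hFs.left 0)]; exact hT _
  have hS' : ∀ u, IsPolyV fun t => deriv (fun v => S t (F 0 v)) u := fun u => by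
    simp only [deriv_linear_comp _ (hFs.right 0)]; exact hS _
  refine (((near_transversal (fun u => hT _) (fun u => hS _) hS' h.transversal).and
    (near_transversal (fun u => hS _) (fun u => hT _) hT' h.transversal')).and
    ((near_li_four ((hT _).meet (hT _)) ((hT _).meet (hT _)) ((hS _).meet (hS _))
      ((hS _).meet (hS _)) h.skew).and (near_li (fun k => IsPolyV.pi fun s => IsPoly.prod _ fun i =>
        (((hT _).meet (hS _)) (LinearMap.proj i)).pow _) hcub))).mono
    fun t ⟨⟨h1, h2⟩, h3, h4⟩ => ⟨?_, ?_, h1, h2, h3, q, hq, h4⟩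
  · exact conic hF (h1.li 0 (by simp))
  · exact conic hF.swap (h2.li 0 (by simp))

lemma isPolyV_sym {s : SCNet m} {T S : (ι → ℝ) → Maps m Hat}
    (hT : ∀ i j z v, IsPolyV fun t => T t i j z v) (hS : ∀ i j z v, IsPolyV fun t => S t i j z v)
    (i j : Fin m) (z : Lattice m) : IsPolyV fun t => dir s (symL (T t) (S t)) (symR (T t) (S t)) i j z := by
  simp only [dir, symL, symR]; split_ifs with hij
  · exact (hT _ _ _ _).meet (hS _ _ _ _)
  · simp only [LinearMap.neg_apply, meet_neg_comm]; exact (hT _ _ _ _).meet (hS _ _ _ _)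

lemma Gen.imp {p : Prop} {Q : (ι → ℝ) → Prop} (h : p → Gen Q) : Gen fun t => p → Q t := by
  by_cases hp : p
  · exact (h hp).mono fun t ht _ => ht
  · exact ⟨0, _, IsPoly.const 1, one_ne_zero, fun t _ h => absurd h hp⟩

end Family

/-! ### Superpositions of two fundamental transformations of a net -/

lemma IsCorner.mem {i j : Fin m} {z z' : Lattice m} {ε δ : ℝ} (h : IsCorner i j z ε δ z') :
    ε ∈ B01 ∧ δ ∈ B01 := by
  rcases h with _ | _ | _ | _ <;> simp

lemma IsCorner.represents (σ : SCNet m) {i j : Fin m} (hij : i ≠ j) {z z' : Lattice m} {ε δ : ℝ}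
    (h : IsCorner i j z ε δ z') : Represents (σ.vertex z') (σ.patch i j z ε δ) := by
  obtain ⟨a1, a2, a3, a4⟩ := σ.adapted i j hij z
  rcases h with _ | _ | _ | _ <;> assumption

/-- The linear maps of a fundamental transform. -/
def shiftMaps (T : Maps m Hat) (P : Maps m ℝ) (X : Fin m → Fin m → Lattice m → Hat) : Maps m Hat :=
  fun i j z => shift (T i j z) (P i j z) (X i j z)

lemma NetBase.generates {s : SCNet m} {T S : Maps m Hat} (h : NetBase s T S) : Generates s s T S := by
  refine ⟨fun i j hij z ε δ z' hz => ?_, fun i j hij z => (h i j hij z).dep⟩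
  obtain ⟨r, hr, e⟩ := (h i j hij z).corner ε hz.mem.1 δ hz.mem.2
  rw [e]; exact (hz.represents s hij).smul hr

lemma NetForm.generates {s s1 : SCNet m} {T S : Maps m Hat} {X : Fin m → Fin m → Lattice m → Hat}
    {P Q : Maps m ℝ} (h : NetForm s s1 T S X P Q) (h1 : IsFTransform s s1) (hp : GeneralPair s s1) :
    Generates s s1 (shiftMaps T P X) (shiftMaps S Q X) := by
  have L := h1.layers hp; refine ⟨fun i j hij z ε δ z' hz => ?_, fun i j hij z => ?_⟩
  · obtain ⟨r, hr, e⟩ := (h i j hij z).corner_eq (L.cell hij z) hz.mem.1 hz.mem.2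
    show Represents _ (meet (shift _ _ _ _) (shift _ _ _ _))
    rw [e]; exact (hz.represents s1 hij).smul hr
  · exact (h i j hij z).dep (s.isSCPatch i j hij z) (s1.isSCPatch i j hij z) (L.pair i j hij z)
      (L.pair_swap hij z) (L.cell hij z)

/-- Two fundamental transformations of a net with the data that describe their superpositions. -/
structure Superposition (s s1 s2 : SCNet m) (z0 : Lattice m) (T S : Maps m Hat)
    (X1 : Fin m → Fin m → Lattice m → Hat) (P1 Q1 : Maps m ℝ) (X2 : Fin m → Fin m → Lattice m → Hat)
    (P2 Q2 : Maps m ℝ) where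
  (α1 β1 α2 β2 : Lattice m → ℝ)
  (p q p' q' : Fin m → Fin m → Lattice m → ℝ)
  triple : GeneralTriple s s1 s2
  left1 : IsFTransform s s1
  left2 : IsFTransform s s2
  base : NetBase s T S
  form1 : NetForm s s1 T S X1 P1 Q1
  form2 : NetForm s s2 T S X2 P2 Q2
  weights : Weights s s1 s2 z0 α1 β1 α2 β2
  p_ne : ∀ i j, i ≠ j → ∀ z, p i j z ≠ 0
  p_ne' : ∀ i j, i ≠ j → ∀ z, p' i j z ≠ 0
  cell : ∀ i j, i ≠ j → ∀ z, ∀ ε δ z', IsCorner i j z ε δ z' → ∃ κ : ℝ, κ ≠ 0 ∧ ∀ t1 t2 : ℝ,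
    meet (double (T i j z) (P1 i j z) (P2 i j z) (X1 i j z) (X2 i j z) (p i j z + q i j z * t1) t1
        (p' i j z + q' i j z * t2) t2 (s.patch i j z ε 0))
      (double (S i j z) (Q1 i j z) (Q2 i j z) (X1 i j z) (X2 i j z) (p i j z + q i j z * t1) t1
        (p' i j z + q' i j z * t2) t2 (s.patch i j z 0 δ)) =
      (κ * (t1 * t2 - (p i j z + q i j z * t1) * (p' i j z + q' i j z * t2))) •
        vtx s s1 s2 α1 β1 α2 β2 z' t1 t2

lemma exists_superposition {s s1 s2 : SCNet m} {T S : Maps m Hat}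
    {X1 X2 : Fin m → Fin m → Lattice m → Hat} {P1 Q1 P2 Q2 : Maps m ℝ} (h : GeneralTriple s s1 s2)
    (h1 : IsFTransform s s1) (h2 : IsFTransform s s2) (hB : NetBase s T S)
    (hX1 : NetForm s s1 T S X1 P1 Q1) (hX2 : NetForm s s2 T S X2 P2 Q2) (z0 : Lattice m) :
    Nonempty (Superposition s s1 s2 z0 T S X1 P1 Q1 X2 P2 Q2) := by
  obtain ⟨α1, β1, α2, β2, hW⟩ := h.exists_weights h1 h2 z0
  choose! p q p' q' hp hp' hc using fun i j (hij : i ≠ j) z => hW.exists_cell h h1 h2 hB hX1 hX2 hij z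
  exact ⟨⟨α1, β1, α2, β2, p, q, p', q', h, h1, h2, hB, hX1, hX2, hW, hp, hp', hc⟩⟩

variable {s s1 s2 : SCNet m} {z0 : Lattice m} {T S : Maps m Hat}
  {X1 X2 : Fin m → Fin m → Lattice m → Hat} {P1 Q1 P2 Q2 : Maps m ℝ}

namespace Superposition

variable (D : Superposition s s1 s2 z0 T S X1 P1 Q1 X2 P2 Q2)

/-- The numerator of the first parameter. -/
def num (i j : Fin m) (z : Lattice m) (t : ℝ) : ℝ := D.p i j z + D.q i j z * t

/-- The numerator of the second parameter. -/
def num' (i j : Fin m) (z : Lattice m) (t : ℝ) : ℝ := D.p' i j z + D.q' i j z * t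

/-- The linear maps of the superpositions, normalized in such a way that `t1 = t2 = 0` belongs to `s`. -/
def maps (A : Maps m Hat) (B1 B2 : Maps m ℝ) (t1 t2 : ℝ) : Maps m Hat := fun i j z =>
  (-(D.p i j z * D.p' i j z))⁻¹ • double (A i j z) (B1 i j z) (B2 i j z) (X1 i j z) (X2 i j z)
    (D.num i j z t1) t1 (D.num' i j z t2) t2

/-- The vertices of the superpositions. -/
def point (z : Lattice m) (t1 t2 : ℝ) : V := vtx s s1 s2 D.α1 D.β1 D.α2 D.β2 z t1 t2

/-- The first linear maps of the patches of the superpositions. -/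
def symL (t1 t2 : ℝ) : Maps m Hat := SCNet.symL (D.maps T P1 P2 t1 t2) (D.maps S Q1 Q2 t1 t2)

/-- The second linear maps of the patches of the superpositions. -/
def symR (t1 t2 : ℝ) : Maps m Hat := SCNet.symR (D.maps T P1 P2 t1 t2) (D.maps S Q1 Q2 t1 t2)

/-- The patches of the superpositions. -/
def patch (t1 t2 : ℝ) : Fin m → Fin m → Lattice m → Lift :=
  fun i j z => gen (s.patch i j z) (D.symL t1 t2 i j z) (D.symR t1 t2 i j z)

/-- The parameters for which a superposition is in general position. -/
structure Good (i j k : Fin m) (z : Lattice m) (t1 t2 : ℝ) : Prop where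
  ne1 : t1 ≠ 0
  ne2 : t2 ≠ 0
  weight1 : D.α1 z + D.β1 z * t1 ≠ 0
  weight2 : D.α2 z + D.β2 z * t2 ≠ 0
  det : t1 * t2 - D.num i j z t1 * D.num' i j z t2 ≠ 0
  meetData : MeetData (fun u => D.maps T P1 P2 t1 t2 i j z (s.patch i j z u 0))
    fun v => D.maps S Q1 Q2 t1 t2 i j z (s.patch i j z 0 v)
  abc : LI ![D.point z t1 t2, D.point (z + e i) t1 t2, D.point (z + e i + e j) t1 t2]
  abd : LI ![D.point z t1 t2, D.point (z + e i) t1 t2, D.point (z + e j) t1 t2]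
  bcd : LI
    ![D.point (z + e i) t1 t2, D.point (z + e i + e j) t1 t2, D.point (z + e j) t1 t2]
  layer1 : LayerPos s1.pt (dir s (SCNet.symL (shiftMaps T P1 X1) (shiftMaps S Q1 X1))
    (SCNet.symR (shiftMaps T P1 X1) (shiftMaps S Q1 X1))) (fun z => D.point z t1 t2)
    (dir s (D.symL t1 t2) (D.symR t1 t2)) i j k z
  layer2 : LayerPos s2.pt (dir s (SCNet.symL (shiftMaps T P2 X2) (shiftMaps S Q2 X2))
    (SCNet.symR (shiftMaps T P2 X2) (shiftMaps S Q2 X2))) (fun z => D.point z t1 t2)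
    (dir s (D.symL t1 t2) (D.symR t1 t2)) i j k z

lemma maps_zero (A : Maps m Hat) (B1 B2 : Maps m ℝ) {i j : Fin m} (hij : i ≠ j) (z : Lattice m) :
    D.maps A B1 B2 0 0 i j z = A i j z := by
  have h := mul_ne_zero (D.p_ne i j hij z) (D.p_ne' i j hij z); refine LinearMap.ext fun v => ?_
  rw [maps, LinearMap.smul_apply, inv_smul_eq_iff₀ (neg_ne_zero.2 h), double_apply, num, num']
  module

lemma point_zero (z : Lattice m) : Represents (s.vertex z) (D.point z 0 0) := by
  have h := (rep_spec (s.vertex z)).smul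
    (mul_ne_zero (D.weights.ne1 z) (D.weights.ne2 z))
  rwa [show (D.α1 z * D.α2 z) • (s.vertex z).rep = D.point z 0 0 by
    rw [point, vtx, pt]; module] at h

lemma generates_zero : Generates s s (D.symL 0 0) (D.symR 0 0) := by
  refine Generates.sym ⟨fun i j hij z => ?_, fun i j hij z => ?_⟩ <;>
    rw [D.maps_zero _ _ _ hij, D.maps_zero _ _ _ hij]
  exacts [D.base.generates.corner i j hij z, D.base.generates.patch i j hij z]

section Poly

variable {ι : Type} {f g : (ι → ℝ) → ℝ}

lemma isPoly_num (hf : IsPoly f) (i j : Fin m) (z : Lattice m) : IsPoly fun t => D.num i j z (f t) :=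
  (IsPoly.const _).add ((IsPoly.const _).mul hf)

lemma isPoly_num' (hf : IsPoly f) (i j : Fin m) (z : Lattice m) : IsPoly fun t => D.num' i j z (f t) :=
  (IsPoly.const _).add ((IsPoly.const _).mul hf)

lemma isPoly_det (hf : IsPoly f) (hg : IsPoly g) (i j : Fin m) (z : Lattice m) :
    IsPoly fun t => f t * g t - D.num i j z (f t) * D.num' i j z (g t) :=
  (hf.mul hg).sub ((D.isPoly_num hf i j z).mul (D.isPoly_num' hg i j z))

lemma isPolyV_maps (hf : IsPoly f) (hg : IsPoly g) (A : Maps m Hat) (B1 B2 : Maps m ℝ) (i j : Fin m)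
    (z : Lattice m) (v : V) : IsPolyV fun t => D.maps A B1 B2 (f t) (g t) i j z v :=
  IsPolyV.smul (IsPoly.const _) (((IsPolyV.smul (D.isPoly_det hf hg i j z) (IsPolyV.const _)).add
    (IsPolyV.smul (IsPoly.const _) ((IsPolyV.smul (hf.mul hg) (IsPolyV.const _)).add
      (IsPolyV.smul ((D.isPoly_num hf i j z).mul hg) (IsPolyV.const _))))).add
    (IsPolyV.smul (IsPoly.const _) ((IsPolyV.smul ((D.isPoly_num' hg i j z).mul hf) (IsPolyV.const _)).add
      (IsPolyV.smul (hf.mul hg) (IsPolyV.const _)))))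

lemma isPolyV_point (hf : IsPoly f) (hg : IsPoly g) (z : Lattice m) :
    IsPolyV fun t => D.point z (f t) (g t) := by
  have h1 := (IsPoly.const (D.α1 z)).add ((IsPoly.const (D.β1 z)).mul hf)
  have h2 := (IsPoly.const (D.α2 z)).add ((IsPoly.const (D.β2 z)).mul hg)
  exact ((IsPolyV.smul (h1.mul h2) (IsPolyV.const _)).add (IsPolyV.smul (hf.mul h2) (IsPolyV.const _))).add
    (IsPolyV.smul (hg.mul h1) (IsPolyV.const _))

lemma isPolyV_dir (hf : IsPoly f) (hg : IsPoly g) (i j : Fin m) (z : Lattice m) :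
    IsPolyV fun t => dir s (D.symL (f t) (g t)) (D.symR (f t) (g t)) i j z :=
  isPolyV_sym (D.isPolyV_maps hf hg T P1 P2) (D.isPolyV_maps hf hg S Q1 Q2) i j z

end Poly

lemma gen_good {ι : Type} (a b : ι) (i j k : Fin m) (hij : i ≠ j) (z : Lattice m) :
    Gen fun t : ι → ℝ => D.Good i j k z (t a) (t b) := by
  have ha := IsPoly.coord a; have hb := IsPoly.coord b; have hM := D.isPolyV_maps ha hb
  have hV := D.isPolyV_point ha hb; have hdir := D.isPolyV_dir ha hb
  have q0 := (planarQuad_iff (D.point_zero _) (D.point_zero _) (D.point_zero _) (D.point_zero _)).1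
    (s.planar i j hij z)
  have hs := D.generates_zero.points D.point_zero
  have h1 : ∀ c : ι, Gen fun t : ι → ℝ => t c ≠ 0 := fun c =>
    (IsPoly.near (t0 := fun _ => 1) (IsPoly.coord c) one_ne_zero).gen
  have g1 : Gen fun t : ι → ℝ => D.α1 z + D.β1 z * t a ≠ 0 :=
    (IsPoly.near (t0 := 0) ((IsPoly.const _).add ((IsPoly.const _).mul ha)) (by
      simpa using D.weights.ne1 z)).gen
  have g2 : Gen fun t : ι → ℝ => D.α2 z + D.β2 z * t b ≠ 0 :=
    (IsPoly.near (t0 := 0) ((IsPoly.const _).add ((IsPoly.const _).mul hb)) (by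
      simpa using D.weights.ne2 z)).gen
  have g3 : Gen fun t : ι → ℝ => t a * t b - D.num i j z (t a) * D.num' i j z (t b) ≠ 0 :=
    (IsPoly.near (t0 := 0) (D.isPoly_det ha hb i j z) (by
      simpa [num, num'] using ⟨D.p_ne i j hij z, D.p_ne' i j hij z⟩)).gen
  have g4 := (near_meetData (t0 := (0 : ι → ℝ)) (s.isSCPatch i j hij z) (hM T P1 P2 i j z)
    (hM S Q1 Q2 i j z) (by
      simp only [Pi.zero_apply, D.maps_zero _ _ _ hij]; exact (D.base i j hij z).meetData)).gen
  have g5 := (near_li_three (t0 := (0 : ι → ℝ)) (hV z) (hV (z + e i)) (hV (z + e i + e j)) q0.abc).gen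
  have g6 := (near_li_three (t0 := (0 : ι → ℝ)) (hV z) (hV (z + e i)) (hV (z + e j)) q0.abd).gen
  have g7 := (near_li_three (t0 := (0 : ι → ℝ)) (hV (z + e i)) (hV (z + e i + e j)) (hV (z + e j))
    q0.bcd).gen
  have g8 := (near_layerPos_const (t0 := (0 : ι → ℝ)) hV hdir (layerPos_of D.left1.symm (D.triple.pair₁.symm D.left1)
      ((D.form1.generates D.left1 D.triple.pair₁).sym.points fun z => rep_spec (s1.vertex z)) hs
        hij k z)).gen
  have g9 := (near_layerPos_const (t0 := (0 : ι → ℝ)) hV hdir (layerPos_of D.left2.symm (D.triple.pair₂.symm D.left2)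
      ((D.form2.generates D.left2 D.triple.pair₂).sym.points fun z => rep_spec (s2.vertex z)) hs
        hij k z)).gen
  exact (((h1 a).and (h1 b)).and (((g1.and g2).and g3).and ((g4.and (g5.and (g6.and g7))).and
    (g8.and g9)))).mono fun t ⟨⟨h1, h2⟩, ⟨⟨h3, h4⟩, h5⟩, ⟨h6, h7, h8, h9⟩, h10, h11⟩ =>
      ⟨h1, h2, h3, h4, h5, h6, h7, h8, h9, h10, h11⟩

end Superposition

lemma li_tangent {p q r : RP3} {a b c d w y : V} (ha : Represents p a) (hb : Represents q b)
    (hc : Represents r c) (hli : LI ![a, b, c])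
    (hw : w ∈ span ℝ (range ![a, b, c])) (h : ¬ span ℝ {w, d} ≤ join3 p q r)
    {x s t : ℝ} (hx : x ≠ 0) (hy : y = x • a + s • b + t • c) : LI ![d, b, c, y] := by
  have h4 := li_of_not_le ha hb hc hli hw h; rw [li_four] at h4 ⊢
  intro i j k l e; rw [hy] at e
  obtain ⟨rfl, h1, h2, h3⟩ := h4 i (l * x) (j + l * s) (k + l * t) (by linear_combination (norm := module) e)
  have hl := (mul_eq_zero.1 h1).resolve_right hx; subst hl; simp only [zero_mul, add_zero] at h2 h3
  exact ⟨rfl, h2, h3, rfl⟩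

lemma li_quad {a b c : V} (h : LI ![a, b, c]) {x s t : ℝ} (hx : x ≠ 0) (hs : s ≠ 0)
    (ht : t ≠ 0) {y : V} (hy : y = x • a + s • b + t • c) : Quad a b y c := by
  subst hy; rw [li_three] at h
  refine ⟨not_li_four.2 ⟨x, s, -1, t, by module, by simp⟩, li_three.2 fun i j k e => ?_,
    li_three.2 h, li_three.2 fun i j k e => ?_, li_three.2 fun i j k e => ?_⟩
  · obtain ⟨h1, h2, h3⟩ := h (i + k * x) (j + k * s) (k * t) (by linear_combination (norm := module) e)
    have hk := (mul_eq_zero.1 h3).resolve_right ht; rw [hk, zero_mul, add_zero] at h1 h2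
    exact ⟨h1, h2, hk⟩
  · obtain ⟨h1, h2, h3⟩ := h (i + j * x) (j * s) (k + j * t) (by linear_combination (norm := module) e)
    have hj := (mul_eq_zero.1 h2).resolve_right hs; rw [hj, zero_mul, add_zero] at h1 h3
    exact ⟨h1, hj, h3⟩
  · obtain ⟨h1, h2, h3⟩ := h (j * x) (i + j * s) (k + j * t) (by linear_combination (norm := module) e)
    have hj := (mul_eq_zero.1 h1).resolve_right hx; rw [hj, zero_mul, add_zero] at h2 h3
    exact ⟨h2, hj, h3⟩

namespace Superposition

variable (D : Superposition s s1 s2 z0 T S X1 P1 Q1 X2 P2 Q2) {t1 t2 : ℝ}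

lemma related1 (h : t1 ≠ 0) : Related (SCNet.symL (shiftMaps T P1 X1) (shiftMaps S Q1 X1))
    (SCNet.symR (shiftMaps T P1 X1) (shiftMaps S Q1 X1)) (D.symL t1 t2) (D.symR t1 t2) := by
  have key : ∀ (A : Maps m Hat) (B1 B2 : Maps m ℝ) i j z w, D.maps A B1 B2 t1 t2 i j z w =
      ((-(D.p i j z * D.p' i j z))⁻¹ * (t1 * t2 - D.num i j z t1 * D.num' i j z t2)) •
        shiftMaps A B1 X1 i j z w + ((-(D.p i j z * D.p' i j z))⁻¹ *
        (D.num i j z t1 * t1⁻¹ * B1 i j z w + B2 i j z w)) •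
        ((D.num' i j z t2 * t1) • X1 i j z + (t1 * t2) • X2 i j z) := by
    intro A B1 B2 i j z w
    rw [maps, LinearMap.smul_apply, double_eq _ _ _ _ _ _ h, smul_add, smul_smul, smul_smul]; rfl
  exact Related.sym fun i j hij z => ⟨_, _, _, _, _, key T P1 P2 i j z, key S Q1 Q2 i j z⟩

lemma related2 (h : t2 ≠ 0) : Related (SCNet.symL (shiftMaps T P2 X2) (shiftMaps S Q2 X2))
    (SCNet.symR (shiftMaps T P2 X2) (shiftMaps S Q2 X2)) (D.symL t1 t2) (D.symR t1 t2) := by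
  have key : ∀ (A : Maps m Hat) (B1 B2 : Maps m ℝ) i j z w, D.maps A B1 B2 t1 t2 i j z w =
      ((-(D.p i j z * D.p' i j z))⁻¹ * (t2 * t1 - D.num' i j z t2 * D.num i j z t1)) •
        shiftMaps A B2 X2 i j z w + ((-(D.p i j z * D.p' i j z))⁻¹ *
        (D.num' i j z t2 * t2⁻¹ * B2 i j z w + B1 i j z w)) •
        ((D.num i j z t1 * t2) • X2 i j z + (t2 * t1) • X1 i j z) := by
    intro A B1 B2 i j z w
    rw [maps, LinearMap.smul_apply, double_swap, double_eq _ _ _ _ _ _ h, smul_add, smul_smul, smul_smul]; rfl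
  exact Related.sym fun i j hij z => ⟨_, _, _, _, _, key T P1 P2 i j z, key S Q1 Q2 i j z⟩

lemma quad (h : t1 ≠ 0) (h' : t2 ≠ 0) {z : Lattice m} (h1 : D.α1 z + D.β1 z * t1 ≠ 0)
    (h2 : D.α2 z + D.β2 z * t2 ≠ 0) : Quad (s.pt z) (s1.pt z) (D.point z t1 t2) (s2.pt z) :=
  li_quad (D.triple.li z) (mul_ne_zero h1 h2) (mul_ne_zero h h2) (mul_ne_zero h' h1) rfl

lemma corner_eq {i j : Fin m} (hij : i ≠ j) {z z' : Lattice m} {ε δ : ℝ} (hz : IsCorner i j z ε δ z')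
    (hdet : t1 * t2 - D.num i j z t1 * D.num' i j z t2 ≠ 0) : ∃ r : ℝ, r ≠ 0 ∧
      meet (D.maps T P1 P2 t1 t2 i j z (s.patch i j z ε 0))
        (D.maps S Q1 Q2 t1 t2 i j z (s.patch i j z 0 δ)) = r • D.point z' t1 t2 := by
  obtain ⟨κ, hκ, e⟩ := D.cell i j hij z ε δ z' hz
  have hp := inv_ne_zero (neg_ne_zero.2 (mul_ne_zero (D.p_ne i j hij z) (D.p_ne' i j hij z)))
  refine ⟨_, mul_ne_zero (mul_ne_zero hp hp) (mul_ne_zero hκ hdet), ?_⟩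
  rw [maps, maps, LinearMap.smul_apply, LinearMap.smul_apply, map_smul, map_smul, LinearMap.smul_apply,
    smul_smul, ← smul_smul (_ * _), num, num', e t1 t2]
  rfl

lemma isNetData (h : ∀ i j k, i ≠ j → ∀ z, D.Good i j k z t1 t2) :
    IsNetData s (D.symL t1 t2) (D.symR t1 t2) fun z => D.point z t1 t2 :=
  isNetData_sym (fun i j hij z => (h i j i hij z).meetData.isSCPatch)
    (fun i j hij z ε δ z' hz => D.corner_eq hij hz (h i j i hij z).det)
    (fun i j hij z => (h i j i hij z).abc) (fun i j hij z => (h i j i hij z).abd)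
    (fun i j hij z => (h i j i hij z).bcd)

lemma exists_net [Nontrivial (Fin m)] (h : ∀ i j k, i ≠ j → ∀ z, D.Good i j k z t1 t2) :
    ∃ τ : SCNet m, (∀ z, Represents (τ.vertex z) (D.point z t1 t2)) ∧ τ.patch = D.patch t1 t2 ∧
      IsCommonFTransform s s1 s2 τ ∧ GeneralPair s1 τ ∧ GeneralPair s2 τ := by
  obtain ⟨i0, j0, h0⟩ := exists_pair_ne (Fin m); have hN := D.isNetData h
  have g1 := (D.form1.generates D.left1 D.triple.pair₁).sym
  have g2 := (D.form2.generates D.left2 D.triple.pair₂).sym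
  have p1 := g1.points fun z => rep_spec (s1.vertex z)
  have p2 := g2.points fun z => rep_spec (s2.vertex z)
  have r1 := D.related1 (t2 := t2) (h i0 j0 i0 h0 z0).ne1
  have r2 := D.related2 (t1 := t1) (h i0 j0 i0 h0 z0).ne2
  have l1 := fun i j hij k z => (h i j k hij z).layer1
  have l2 := fun i j hij k z => (h i j k hij z).layer2
  have tan : ∀ i j, i ≠ j → ∀ z, _ ∧ _ := fun i j hij z => by
    have hg := h i j i hij z
    obtain ⟨-, m1, m2⟩ := mem_span_triple_left (s.pt z) (s1.pt z) (s2.pt z)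
    have ht1 := D.triple.tangent₁ i j hij z; have ht2 := D.triple.tangent₂ i j hij z
    rw [p1.tangent i j hij] at ht1; rw [p2.tangent i j hij] at ht2
    have hx := mul_ne_zero hg.weight1 hg.weight2
    exact And.intro (li_tangent (rep_spec _) (rep_spec _) (rep_spec _) (D.triple.li z) m1
      ht1 hx (rfl : D.point z t1 t2 = _)) (li_tangent (rep_spec _) (rep_spec _)
        (rep_spec _) (D.triple.li z) m2 ht2 hx (rfl : D.point z t1 t2 = _))
  obtain ⟨τ, h1, h2⟩ := hN.exists_net g1 g2 r1 r2 p1.vertex p2.vertex l1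
    (fun i j hij z => (tan i j hij z).1) (fun i j hij z => (tan i j hij z).2)
  obtain ⟨f1, q1⟩ := hN.isFTransform h1 h2 g1 r1 p1.vertex l1
  obtain ⟨f2, q2⟩ := hN.isFTransform h1 h2 g2 r2 p2.vertex l2
  refine ⟨τ, h1, h2, ⟨f1, f2, fun z => ?_⟩, q1, q2⟩
  have hg := h i0 j0 i0 h0 z; exact (planarQuad_iff (rep_spec _) (rep_spec _) (h1 z) (rep_spec _)).2
    (D.quad hg.ne1 hg.ne2 hg.weight1 hg.weight2)

end Superposition

/-! ### Uniqueness of common fundamental transforms -/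

lemma IsCommonFTransform.exists_wpoint {s s1 s2 τ : SCNet m} (h : IsCommonFTransform s s1 s2 τ)
    (z : Lattice m) : ∃ ω1 ω2 : ℝ, ω1 ≠ 0 ∧ ω2 ≠ 0 ∧
      Represents (τ.vertex z) (wpoint (s.pt z) (s1.pt z) (s2.pt z) ω1 ω2) := by
  obtain ⟨r, t, k, hr, ht, hk, e⟩ := (quad_pt (h.coplanar z)).exists_comb
  change _ = r • s.pt z + t • s1.pt z + k • s2.pt z at e
  refine ⟨r / t, r / k, div_ne_zero hr ht, div_ne_zero hr hk, ?_⟩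
  have := (rep_spec (τ.vertex z)).smul (div_ne_zero hr (mul_ne_zero ht hk))
  rw [e] at this; rw [wpoint]
  convert this using 1
  match_scalars <;> field_simp

lemma GeneralTriple.trans {s s1 s2 τ : SCNet m} (h : GeneralTriple s s1 s2)
    (hτ : IsCommonFTransform s s1 s2 τ) {i j : Fin m} (hij : i ≠ j) (z : Lattice m) :
    Trans (s1.tangent i j z) (s2.tangent i j z) (τ.vertex z) := by
  have hy := rep_spec (τ.vertex z); have a1 := (s1.adapted i j hij z).1
  have a2 := (s2.adapted i j hij z).1
  have hq := (planarQuad_iff (rep_spec _) a1 hy a2).1 (hτ.coplanar z)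
  obtain ⟨r, t, k, hr, -, -, e⟩ := hq.exists_comb
  obtain ⟨-, m1, m2⟩ := mem_span_triple_left (s.vertex z).rep (s1.patch i j z 0 0) (s2.patch i j z 0 0)
  exact trans_of_li hy (li_tangent (rep_spec _) a1 a2 hq.abd m1 (h.tangent₁ i j hij z) hr e)
    (li_tangent (rep_spec _) a1 a2 hq.abd m2 (h.tangent₂ i j hij z) hr e)

lemma GeneralTriple.same {s s1 s2 τ τ' : SCNet m} (h : GeneralTriple s s1 s2)
    (h1 : IsFTransform s s1) (h2 : IsFTransform s s2) (hτ : IsCommonFTransform s s1 s2 τ)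
    (hp : GeneralPair s1 τ) (hτ' : IsCommonFTransform s s1 s2 τ') {z0 : Lattice m}
    (hv : τ.vertex z0 = τ'.vertex z0) : Same τ τ' := by
  refine same_of_vertex hτ.left hτ.right hτ'.left hτ'.right hp (fun i j hij z => h.trans hτ hij z) ?_
  choose ω1 ω2 n1 n2 hω using hτ.exists_wpoint
  choose ω1' ω2' n1' n2' hω' using hτ'.exists_wpoint
  have key : ∀ z, τ.vertex z = τ'.vertex z ↔ ω1 z = ω1' z ∧ ω2 z = ω2' z := by
    refine fun z => ⟨fun he => ?_, fun ⟨e1, e2⟩ => ?_⟩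
    · obtain ⟨r, hr, e⟩ := (hω z).exists_smul (he ▸ hω' z); rw [wpoint, wpoint] at e
      obtain ⟨e1, e2, e3⟩ := li_three.1 (h.li z) (ω1' z * ω2' z - r * (ω1 z * ω2 z)) (ω2' z - r * ω2 z)
        (ω1' z - r * ω1 z) (by linear_combination (norm := module) e)
      have hr1 : r = 1 := by
        have : r * (ω1 z * ω2 z) * (r - 1) = 0 := by
          linear_combination e1 - ω1' z * e2 - r * ω2 z * e3
        have := (mul_eq_zero.1 this).resolve_left (mul_ne_zero hr (mul_ne_zero (n1 z) (n2 z)))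
        linarith
      rw [hr1] at e2 e3; constructor <;> linarith
    · have := hω' z; rw [← e1, ← e2] at this; exact (hω z).eq this
  refine lattice_induction hv fun i z => ?_
  obtain ⟨E1, E2, hE⟩ := h.exists_edgeMaps h1 h2 i z
  have a1 := hE.left _ _ _ _ (n2 z) (n2 (z + e i)) ((planarQuad_iff (rep_spec _) (rep_spec _)
    (hω _) (hω _)).1 (hτ.right.qnet i z)).dep
  have a2 := hE.right _ _ _ _ (n1 z) (n1 (z + e i)) ((planarQuad_iff (rep_spec _) (rep_spec _)
    (hω _) (hω _)).1 (hτ.left.qnet i z)).dep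
  have b1 := hE.left _ _ _ _ (n2' z) (n2' (z + e i)) ((planarQuad_iff (rep_spec _)
    (rep_spec _) (hω' _) (hω' _)).1 (hτ'.right.qnet i z)).dep
  have b2 := hE.right _ _ _ _ (n1' z) (n1' (z + e i)) ((planarQuad_iff (rep_spec _)
    (rep_spec _) (hω' _) (hω' _)).1 (hτ'.left.qnet i z)).dep
  rw [key, key, a1, a2, b1, b2, E1.injective.eq_iff, E2.injective.eq_iff]

/-! ### Generic points of planes -/

lemma exists_eval_eq {ι : Type} [Fintype ι] [DecidableEq ι] (l : (ι → ℝ) →ₗ[ℝ] ℝ) :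
    ∃ p : MvPolynomial ι ℝ, ∀ w, MvPolynomial.eval w p = l w := by
  refine ⟨∑ k, MvPolynomial.X k * MvPolynomial.C (l (Pi.single k 1)), fun w => ?_⟩
  conv_rhs => rw [pi_eq_sum_univ' w, map_sum]
  simp

lemma exists_plane_coordinates {a b c : V} (h : LI ![a, b, c]) :
    ∃ φ : Fin 3 → V →ₗ[ℝ] ℝ, (∀ w ∈ span ℝ (range ![a, b, c]),
      w = φ 0 w • a + φ 1 w • b + φ 2 w • c) ∧
      ∀ r s t : ℝ, φ 0 (r • a + s • b + t • c) = r ∧ φ 1 (r • a + s • b + t • c) = s ∧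
        φ 2 (r • a + s • b + t • c) = t := by
  obtain ⟨L, hL⟩ := LinearMap.exists_leftInverse_of_injective
    (Finsupp.linearCombination ℝ ![a, b, c]) (LinearMap.ker_eq_bot.2 h)
  have hv : ∀ i, L (![a, b, c] i) = Finsupp.single i 1 := fun i => by
    have := LinearMap.congr_fun hL (Finsupp.single i 1); simpa using this
  have ha := hv 0; have hb := hv 1; have hc := hv 2; simp only [Matrix.cons_val] at ha hb hc
  have key : ∀ r s t : ℝ, ∀ k, L (r • a + s • b + t • c) k = ![r, s, t] k := fun r s t k => by
    rw [map_add, map_add, map_smul, map_smul, map_smul, ha, hb, hc]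
    fin_cases k <;> simp
  refine ⟨fun k => Finsupp.lapply k ∘ₗ L, fun w hw => ?_, fun r s t =>
    ⟨key r s t 0, key r s t 1, key r s t 2⟩⟩
  obtain ⟨r, s, t, rfl⟩ := mem_span_triple.1 hw
  show _ = L _ 0 • a + L _ 1 • b + L _ 2 • c
  rw [key, key, key]; rfl

lemma Superposition.point_init {s s1 s2 : SCNet m} {z0 : Lattice m} {T S : Maps m Hat}
    {X1 X2 : Fin m → Fin m → Lattice m → Hat} {P1 Q1 P2 Q2 : Maps m ℝ}
    (D : Superposition s s1 s2 z0 T S X1 P1 Q1 X2 P2 Q2) (t1 t2 : ℝ) :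
    D.point z0 t1 t2 = s.pt z0 + t1 • s1.pt z0 + t2 • s2.pt z0 := by
  obtain ⟨a1, a2, a3, a4⟩ := D.weights.init; rw [point, vtx, a1, a2, a3, a4]; module

lemma GeneralTriple.generically [Nontrivial (Fin m)] {s s1 s2 : SCNet m} (h : GeneralTriple s s1 s2)
    (h1 : IsFTransform s s1) (h2 : IsFTransform s s2) (z0 : Lattice m) :
    Generically (vertexPlane s s1 s2 z0 : Set V) fun w => ∃ τ, IsCommonFTransform s s1 s2 τ ∧
      GeneralPair s1 τ ∧ GeneralPair s2 τ ∧ Represents (τ.vertex z0) w := by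
  obtain ⟨T, S, hB⟩ := exists_netBase h1 h.pair₁
  obtain ⟨X1, P1, Q1, hX1⟩ := hB.exists_form h1 h.pair₁
  obtain ⟨X2, P2, Q2, hX2⟩ := hB.exists_form h2 h.pair₂
  obtain ⟨D⟩ := exists_superposition h h1 h2 hB hX1 hX2 z0
  obtain ⟨φ, hφ, hφ'⟩ := exists_plane_coordinates (h.li z0)
  choose r hr using fun k => exists_eval_eq (φ k)
  have hE : vertexPlane s s1 s2 z0 = span ℝ (range ![s.pt z0, s1.pt z0, s2.pt z0]) :=
    join3_eq (rep_spec _) (rep_spec _) (rep_spec _)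
  refine generically_of_gen (K := Fin m × Fin m × Fin m × Lattice m) (δ := r 0)
    (t := fun w => ![φ 1 w / φ 0 w, φ 2 w / φ 0 w]) (r := ![r 1, r 2])
    (Q := fun κ t => κ.1 ≠ κ.2.1 → D.Good κ.1 κ.2.1 κ.2.2.1 κ.2.2.2 (t 0) (t 1)) (fun w hw k => ?_)
    (fun t => ⟨s.pt z0 + t 0 • s1.pt z0 + t 1 • s2.pt z0, ?_, ?_⟩)
    (fun κ => Gen.imp fun hκ => D.gen_good 0 1 _ _ _ hκ _) (fun w hw hδ hg => ?_)
  · rw [hr] at hw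
    fin_cases k <;> simp [hr, mul_div_cancel₀ _ hw]
  · rw [hE]; exact mem_span_triple.2 ⟨1, t 0, t 1, by module⟩
  · obtain ⟨e1, e2, e3⟩ := hφ' 1 (t 0) (t 1); rw [one_smul] at e1 e2 e3
    rw [hr, e1, e2, e3]; refine ⟨one_ne_zero, funext fun k => ?_⟩
    fin_cases k <;> simp
  · obtain ⟨τ, hτ, -, hc, g1, g2⟩ := D.exists_net fun i j k hij z => hg ⟨i, j, k, z⟩ hij
    refine ⟨τ, hc, g1, g2, ?_⟩
    rw [hr] at hδ; have hw' := hφ w (hE ▸ hw); have := (hτ z0).smul hδ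
    rw [D.point_init] at this
    convert this using 1
    conv_lhs => rw [hw']
    simp only [Matrix.cons_val]; match_scalars <;> field_simp

/-! ### Superposition of three fundamental transformations -/

lemma univ_eq_of_ne : ∀ {a b c : Fin 3}, a ≠ b → a ≠ c → b ≠ c →
    (Finset.univ : Finset (Fin 3)) = {a, b, c} := by decide

lemma sum_of_ne {W : Type*} [AddCommMonoid W] {a b c : Fin 3} (hab : a ≠ b) (hac : a ≠ c) (hbc : b ≠ c)
    (f : Fin 3 → W) : ∑ k, f k = f a + f b + f c := by
  rw [univ_eq_of_ne hab hac hbc, Finset.sum_insert (by simp [hab, hac]), Finset.sum_insert (by simp [hbc]),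
    Finset.sum_singleton, add_assoc]

section Algebra

variable (d n : Fin 3 → Fin 3 → ℝ) (T : V →ₗ[ℝ] Hat) (P : Fin 3 → V →ₗ[ℝ] ℝ) (X : Fin 3 → Hat)

/-- The matrix of the linear system for the directions of the superposition. -/
def tripleMatrix : Matrix (Fin 3) (Fin 3) ℝ :=
  Matrix.of fun a b => if a = b then d a (a + 1) * d a (a + 2) else -(n a b * d a (-a - b))

/-- The directions of the superposition. -/
def tripleDir (a : Fin 3) : Hat :=
  ∑ b, ((tripleMatrix d n).adjugate a b * tripleMatrix d n b b) • X b

/-- Superposition of the fundamental transformations with directions `X a`, depending on the parameters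
`n a b / d a b`. -/
def triple : V →ₗ[ℝ] Hat :=
  (tripleMatrix d n).det • T + ∑ a, (P a).smulRight (tripleDir d n X a)

variable {a b c : Fin 3} (hab : a ≠ b) (hac : a ≠ c) (hbc : b ≠ c)

include hab hac hbc

lemma tripleMatrix_self : tripleMatrix d n a a = d a b * d a c := by
  have : ∀ a b c : Fin 3, a ≠ b → a ≠ c → b ≠ c → b = a + 1 ∧ c = a + 2 ∨ c = a + 1 ∧ b = a + 2 := by decide
  rw [tripleMatrix, Matrix.of_apply, if_pos rfl]
  rcases this a b c hab hac hbc with ⟨h1, h2⟩ | ⟨h1, h2⟩ <;> rw [h1, h2]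
  exact mul_comm _ _

lemma tripleMatrix_ne : tripleMatrix d n a b = -(n a b * d a c) := by
  have : ∀ a b c : Fin 3, a ≠ b → a ≠ c → b ≠ c → -a - b = c := by decide
  rw [tripleMatrix, Matrix.of_apply, if_neg hab, this a b c hab hac hbc]

lemma tripleDir_rel : (d a b * d a c) • tripleDir d n X a = (n a b * d a c) • tripleDir d n X b +
    (n a c * d a b) • tripleDir d n X c + ((tripleMatrix d n).det * (d a b * d a c)) • X a := by
  have key : ∑ k, tripleMatrix d n a k • tripleDir d n X k =
      ((tripleMatrix d n).det * tripleMatrix d n a a) • X a := by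
    simp only [tripleDir, Finset.smul_sum, smul_smul]; rw [Finset.sum_comm]
    have h : ∀ l, ∑ k, (tripleMatrix d n a k * ((tripleMatrix d n).adjugate k l * tripleMatrix d n l l)) • X l
        = (((tripleMatrix d n).det • (1 : Matrix (Fin 3) (Fin 3) ℝ)) a l * tripleMatrix d n l l) • X l := by
      intro l; rw [← Matrix.mul_adjugate, Matrix.mul_apply, Finset.sum_mul, Finset.sum_smul]
      simp only [mul_assoc]
    simp only [h, Matrix.smul_apply, Matrix.one_apply, smul_eq_mul, mul_ite, mul_one, mul_zero, ite_mul,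
      zero_mul, ite_smul, zero_smul, Finset.sum_ite_eq, Finset.mem_univ, if_true]
  rw [sum_of_ne hab hac hbc, tripleMatrix_self d n hab hac hbc, tripleMatrix_ne d n hab hac hbc,
    tripleMatrix_ne d n hac hab hbc.symm] at key
  linear_combination (norm := module) key

lemma triple_apply (z : V) : triple d n T P X z = (tripleMatrix d n).det • T z +
    P a z • tripleDir d n X a + P b z • tripleDir d n X b + P c z • tripleDir d n X c := by
  rw [triple, LinearMap.add_apply, LinearMap.sum_apply, sum_of_ne hab hac hbc, add_assoc, add_assoc,
    add_assoc]
  rfl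

variable {d n} (h1 : d a b ≠ 0) (h2 : d a c ≠ 0)

include h1 h2

lemma tripleDir_eq : tripleDir d n X a = (n a b / d a b) • tripleDir d n X b +
    (n a c / d a c) • tripleDir d n X c + (tripleMatrix d n).det • X a := by
  have h := congrArg (fun v => (d a b * d a c)⁻¹ • v) (tripleDir_rel d n X hab hac hbc)
  simp only [smul_add, smul_smul] at h; rw [inv_mul_cancel₀ (mul_ne_zero h1 h2), one_smul] at h
  rw [h]; match_scalars <;> field_simp

variable {T P X}

lemma triple_mem {K : Submodule ℝ Hat} {z : V} (h : shift T (P a) (X a) z ∈ K)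
    (hb : tripleDir d n X b ∈ K) (hc : tripleDir d n X c ∈ K) : triple d n T P X z ∈ K := by
  have e := tripleDir_eq (n := n) X hab hac hbc h1 h2; rw [shift_apply] at h
  rw [triple_apply d n T P X hab hac hbc]
  convert K.add_mem (K.smul_mem (tripleMatrix d n).det h) (K.add_mem
    (K.smul_mem (n a b / d a b * P a z + P b z) hb) (K.smul_mem (n a c / d a c * P a z + P c z) hc)) using 1
  linear_combination (norm := module) P a z • e

variable (h3 : d b a ≠ 0) (h4 : d b c ≠ 0)

include h3 h4

lemma double_mem {K : Submodule ℝ Hat} {z : V} (hdet : (tripleMatrix d n).det ≠ 0)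
    (h : shift T (P a) (X a) z ∈ K) (hb : tripleDir d n X b ∈ K) (hc : tripleDir d n X c ∈ K) :
    double T (P a) (P b) (X a) (X b) (n a b) (d a b) (n b a) (d b a) z ∈ K := by
  have ea := tripleDir_eq (n := n) X hab hac hbc h1 h2
  have eb := tripleDir_eq (n := n) X hab.symm hbc hac h3 h4; rw [double_eq _ _ _ _ _ _ h1]
  refine K.add_mem (K.smul_mem _ h) (K.smul_mem _ ((K.smul_mem_iff hdet).1 ?_))
  have hβ : n b a = n b a / d b a * d b a := by field_simp
  convert K.smul_mem (d a b * d b a) (K.add_mem (K.smul_mem (1 - n b a / d b a * (n a b / d a b)) hb)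
    (K.smul_mem (-(n b a / d b a * (n a c / d a c) + n b c / d b c)) hc)) using 1
  generalize n b a / d b a = β at *
  rw [hβ]; linear_combination (norm := module) (-(d a b * d b a * β)) • ea - (d a b * d b a) • eb

lemma triple_eq (hΔ : d a b * d b a - n a b * n b a ≠ 0) : ∃ x y : ℝ, ∀ (T : V →ₗ[ℝ] Hat)
    (P : Fin 3 → V →ₗ[ℝ] ℝ) (z : V), triple d n T P X z =
      ((tripleMatrix d n).det / (d a b * d b a - n a b * n b a)) •
        double T (P a) (P b) (X a) (X b) (n a b) (d a b) (n b a) (d b a) z +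
      (P c z + x * P a z + y * P b z) • tripleDir d n X c := by
  have ea := tripleDir_eq (n := n) X hab hac hbc h1 h2
  have eb := tripleDir_eq (n := n) X hab.symm hbc hac h3 h4
  have hα : n a b = n a b / d a b * d a b := by field_simp
  have hβ : n b a = n b a / d b a * d b a := by field_simp
  generalize n a b / d a b = α at *
  generalize n b a / d b a = β at *
  rw [hα, hβ] at hΔ ⊢; have hw := inv_mul_cancel₀ hΔ; rw [div_eq_mul_inv]
  set w := (d a b * d b a - α * d a b * (β * d b a))⁻¹
  refine ⟨w * d a b * d b a * (n a c / d a c + α * (n b c / d b c)),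
    w * d a b * d b a * (β * (n a c / d a c) + n b c / d b c), fun T P z => ?_⟩
  rw [triple_apply d n T P X hab hac hbc, double_apply]
  linear_combination (norm := module) (w * d a b * d b a * (P a z + β * P b z)) • ea +
    (w * d a b * d b a * (α * P a z + P b z)) • eb - hw • ((tripleMatrix d n).det • T z +
      P a z • tripleDir d n X a + P b z • tripleDir d n X b)

end Algebra

/-! ### Exchanging two fundamental transforms -/

lemma vertexPlane_swap (s s1 s2 : SCNet m) (z : Lattice m) :
    vertexPlane s s2 s1 z = vertexPlane s s1 s2 z := sup_right_comm _ _ _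

lemma GeneralTriple.swap {s s1 s2 : SCNet m} (h : GeneralTriple s s1 s2) : GeneralTriple s s2 s1 where
  pair₁ := h.pair₂
  pair₂ := h.pair₁
  plane z := by rw [vertexPlane_swap]; exact h.plane z
  next i z := by rw [vertexPlane_swap]; exact h.next i z
  prev i z := by rw [vertexPlane_swap]; exact h.prev i z
  tangent₁ i j hij z := by rw [vertexPlane_swap]; exact h.tangent₂ i j hij z
  tangent₂ i j hij z := by rw [vertexPlane_swap]; exact h.tangent₁ i j hij z

lemma vtx_swap (s s1 s2 : SCNet m) (α1 β1 α2 β2 : Lattice m → ℝ) (z : Lattice m) (t1 t2 : ℝ) :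
    vtx s s2 s1 α2 β2 α1 β1 z t2 t1 = vtx s s1 s2 α1 β1 α2 β2 z t1 t2 := by
  rw [vtx, vtx]; module

namespace Superposition

/-- The two fundamental transforms exchanged. -/
def swap (D : Superposition s s1 s2 z0 T S X1 P1 Q1 X2 P2 Q2) :
    Superposition s s2 s1 z0 T S X2 P2 Q2 X1 P1 Q1 where
  α1 := D.α2
  β1 := D.β2
  α2 := D.α1
  β2 := D.β1
  p := D.p'
  q := D.q'
  p' := D.p
  q' := D.q
  triple := D.triple.swap
  left1 := D.left2
  left2 := D.left1
  base := D.base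
  form1 := D.form2
  form2 := D.form1
  weights :=
    { ne1 := D.weights.ne2
      ne2 := D.weights.ne1
      init := by obtain ⟨h1, h2, h3, h4⟩ := D.weights.init; exact ⟨h3, h4, h1, h2⟩
      edge := fun i z => by
        obtain ⟨E1, E2, hE, h1, h2⟩ := D.weights.edge i z; exact ⟨E2, E1, hE.swap, h2, h1⟩ }
  p_ne := D.p_ne'
  p_ne' := D.p_ne
  cell i j hij z ε δ z' hz := by
    obtain ⟨κ, hκ, e⟩ := D.cell i j hij z ε δ z' hz; refine ⟨κ, hκ, fun t1 t2 => ?_⟩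
    rw [double_swap, double_swap (S i j z), e t2 t1, vtx_swap, mul_comm t1, mul_comm (_ + _) (_ + _)]

end Superposition

lemma det_ne_zero_of_mulVec {M : Matrix (Fin 3) (Fin 3) ℝ} (h : ∀ v, M.mulVec v = 0 → v = 0) :
    M.det ≠ 0 := fun h0 => by
  obtain ⟨v, hv, e⟩ := Matrix.exists_mulVec_eq_zero_iff.2 h0; exact hv (h v e)

lemma isPoly_matrix_det {ι : Type} {n : ℕ} {M : (ι → ℝ) → Matrix (Fin n) (Fin n) ℝ}
    (h : ∀ a b, IsPoly fun t => M t a b) : IsPoly fun t => (M t).det := by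
  simp only [Matrix.det_apply']
  exact IsPoly.sum _ fun σ => (IsPoly.const _).mul (IsPoly.prod _ fun i => h _ _)

/-- The indices of the parameters. -/
abbrev Par : Type := {p : Fin 3 × Fin 3 // p.1 ≠ p.2}

/-- The parameters, with zero diagonal. -/
def par (t : Par → ℝ) (a b : Fin 3) : ℝ := if h : a ≠ b then t ⟨(a, b), h⟩ else 0

lemma par_eq {a b : Fin 3} (h : a ≠ b) (t : Par → ℝ) : par t a b = t ⟨(a, b), h⟩ := dif_pos h

lemma isPoly_par (a b : Fin 3) : IsPoly fun t => par t a b := by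
  by_cases h : a ≠ b
  · simp only [par_eq h]; exact IsPoly.coord _
  · simp only [par, dif_neg h]; exact IsPoly.const _

/-- The parameters that give the original net. -/
def cyclic : Par → ℝ := fun p => if p.1.2 = p.1.1 + 1 then 0 else 1

lemma Generates.smul {s σ : SCNet m} {T S T' S' : Maps m Hat} (h : Generates s σ T S)
    (hr : ∀ i j, i ≠ j → ∀ z, ∃ r : ℝ, r ≠ 0 ∧ T' i j z = r • T i j z ∧ S' i j z = r • S i j z) :
    Generates s σ T' S' := by
  refine ⟨fun i j hij z ε δ z' hz => ?_, fun i j hij z u hu v hv => ?_⟩ <;>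
    obtain ⟨r, h0, e1, e2⟩ := hr i j hij z <;> rw [e1, e2]
  · simp only [LinearMap.smul_apply, map_smul, smul_smul]
    exact (h.corner i j hij z ε δ z' hz).smul (mul_ne_zero h0 h0)
  · obtain ⟨x, y, e, hne⟩ := not_li_two.1 (h.patch i j hij z u hu v hv)
    refine not_li_two.2 ⟨r * r * x, y, ?_, by simpa [h0] using hne⟩
    have : gen (s.patch i j z) (r • T i j z) (r • S i j z) u v =
        (r * r) • gen (s.patch i j z) (T i j z) (S i j z) u v := by
      simp only [gen, meetLift, LinearMap.smul_apply, map_smul, smul_smul]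
    rw [this]; linear_combination (norm := module) (r * r) • e

/-- Three fundamental transformations of a net with the data that describe their superpositions. -/
structure TripleSuperposition (s : SCNet m) (σ : Fin 3 → SCNet m) (z0 : Lattice m) (T S : Maps m Hat)
    (X : Fin 3 → Fin m → Fin m → Lattice m → Hat) (P Q : Fin 3 → Maps m ℝ) where
  (i0 j0 : Fin m)
  ne : i0 ≠ j0
  pair : ∀ a b, a ≠ b → Superposition s (σ a) (σ b) z0 T S (X a) (P a) (Q a) (X b) (P b) (Q b)
  swap : ∀ a b, ∀ h : a ≠ b, pair b a h.symm = (pair a b h).swap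
  li : ∀ a b c, a ≠ b → a ≠ c → b ≠ c → ∀ z,
    LI ![s.pt z, (σ a).pt z, (σ b).pt z, (σ c).pt z]

variable {s : SCNet m} {σ : Fin 3 → SCNet m} {z0 : Lattice m} {T S : Maps m Hat}
  {X : Fin 3 → Fin m → Fin m → Lattice m → Hat} {P Q : Fin 3 → Maps m ℝ}

namespace TripleSuperposition

variable (D : TripleSuperposition s σ z0 T S X P Q)

/-- The numerators of the parameters in a cell. -/
def num (t : Par → ℝ) (i j : Fin m) (z : Lattice m) (a b : Fin 3) : ℝ :=
  if h : a ≠ b then (D.pair a b h).num i j z (par t a b) else 0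

/-- The determinant of the linear system for the directions in a cell. -/
def det (t : Par → ℝ) (i j : Fin m) (z : Lattice m) : ℝ := (tripleMatrix (par t) (D.num t i j z)).det

/-- The directions of the superposition in a cell. -/
def vec (t : Par → ℝ) (i j : Fin m) (z : Lattice m) (a : Fin 3) : Hat :=
  tripleDir (par t) (D.num t i j z) (fun a => X a i j z) a

/-- The linear maps of the superpositions. -/
def maps (A : Maps m Hat) (B : Fin 3 → Maps m ℝ) (t : Par → ℝ) : Maps m Hat := fun i j z =>
  (D.det cyclic i j z)⁻¹ •
    triple (par t) (D.num t i j z) (A i j z) (fun a => B a i j z) fun a => X a i j z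

/-- The first linear maps of the patches of the superpositions. -/
def symL (t : Par → ℝ) : Maps m Hat := SCNet.symL (D.maps T P t) (D.maps S Q t)

/-- The second linear maps of the patches of the superpositions. -/
def symR (t : Par → ℝ) : Maps m Hat := SCNet.symR (D.maps T P t) (D.maps S Q t)

/-- The vertices of the superpositions. -/
def point (t : Par → ℝ) (z : Lattice m) : V :=
  meet (D.maps T P t D.i0 D.j0 z (s.patch D.i0 D.j0 z 0 0))
    (D.maps S Q t D.i0 D.j0 z (s.patch D.i0 D.j0 z 0 0))

variable {a b c : Fin 3} (hab : a ≠ b) (hac : a ≠ c) (hbc : b ≠ c)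

/-- The vertices of the superposition of two of the transformations. -/
def pairPoint (t : Par → ℝ) (z : Lattice m) : V := (D.pair a b hab).point z (par t a b) (par t b a)

/-- Points of the tangents of the superposition of two of the transformations. -/
def pairDir (t : Par → ℝ) : Fin m → Fin m → Lattice m → V :=
  dir s ((D.pair a b hab).symL (par t a b) (par t b a)) ((D.pair a b hab).symR (par t a b) (par t b a))

lemma num_eq (t : Par → ℝ) (i j : Fin m) (z : Lattice m) :
    D.num t i j z a b = (D.pair a b hab).num i j z (par t a b) := dif_pos hab

lemma num_eq' (t : Par → ℝ) (i j : Fin m) (z : Lattice m) :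
    D.num t i j z b a = (D.pair a b hab).num' i j z (par t b a) := by
  rw [D.num_eq hab.symm, D.swap a b hab]; rfl

lemma pairPoint_swap (t : Par → ℝ) (z : Lattice m) : D.pairPoint hab.symm t z = D.pairPoint hab t z := by
  rw [pairPoint, D.swap a b hab]; exact vtx_swap s (σ a) (σ b) _ _ _ _ _ _ _

section Poly

lemma isPoly_num (i j : Fin m) (z : Lattice m) (a b : Fin 3) : IsPoly fun t => D.num t i j z a b := by
  by_cases h : a ≠ b
  · simp only [D.num_eq h]; exact (D.pair a b h).isPoly_num (isPoly_par _ _) _ _ _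
  · simp only [num, dif_neg h]; exact IsPoly.const _

lemma isPoly_matrix (i j : Fin m) (z : Lattice m) (a b : Fin 3) :
    IsPoly fun t => tripleMatrix (par t) (D.num t i j z) a b := by
  simp only [tripleMatrix, Matrix.of_apply]; split_ifs
  · exact (isPoly_par _ _).mul (isPoly_par _ _)
  · simpa using (IsPoly.const (-1)).mul ((D.isPoly_num i j z a b).mul (isPoly_par a (-a - b)))

lemma isPolyV_vec (i j : Fin m) (z : Lattice m) (a : Fin 3) : IsPolyV fun t => D.vec t i j z a := by
  have h : ∀ b, IsPolyV fun t => ((tripleMatrix (par t) (D.num t i j z)).adjugate a b *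
      tripleMatrix (par t) (D.num t i j z) b b) • X b i j z := fun b => by
    refine IsPolyV.smul (IsPoly.mul ?_ (D.isPoly_matrix i j z b b)) (IsPolyV.const _)
    simp only [Matrix.adjugate_apply]; refine isPoly_matrix_det fun k l => ?_
    simp only [Matrix.updateRow_apply]; split_ifs
    exacts [IsPoly.const _, D.isPoly_matrix _ _ _ _ _]
  simp only [vec, tripleDir, Fin.sum_univ_three]; exact ((h 0).add (h 1)).add (h 2)

lemma isPolyV_maps (A : Maps m Hat) (B : Fin 3 → Maps m ℝ) (i j : Fin m) (z : Lattice m) (v : V) :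
    IsPolyV fun t => D.maps A B t i j z v := by
  have h : ∀ a : Fin 3, IsPolyV fun t => B a i j z v • D.vec t i j z a := fun a =>
    IsPolyV.smul (IsPoly.const _) (D.isPolyV_vec i j z a)
  simp only [maps, LinearMap.smul_apply, triple_apply (a := 0) (b := 1) (c := 2) _ _ _ _ _ (by decide)
    (by decide) (by decide)]
  exact IsPolyV.smul (IsPoly.const _) ((((IsPolyV.smul (isPoly_matrix_det (D.isPoly_matrix i j z))
    (IsPolyV.const _)).add (h 0)).add (h 1)).add (h 2))

lemma isPolyV_point (z : Lattice m) : IsPolyV fun t => D.point t z :=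
  (D.isPolyV_maps _ _ _ _ _ _).meet (D.isPolyV_maps _ _ _ _ _ _)

lemma isPolyV_dir (i j : Fin m) (z : Lattice m) : IsPolyV fun t => dir s (D.symL t) (D.symR t) i j z :=
  isPolyV_sym (D.isPolyV_maps T P) (D.isPolyV_maps S Q) i j z

lemma isPolyV_pairPoint (z : Lattice m) : IsPolyV fun t => D.pairPoint hab t z :=
  (D.pair a b hab).isPolyV_point (isPoly_par _ _) (isPoly_par _ _) z

lemma isPolyV_pairDir (i j : Fin m) (z : Lattice m) : IsPolyV fun t => D.pairDir hab t i j z :=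
  (D.pair a b hab).isPolyV_dir (isPoly_par _ _) (isPoly_par _ _) i j z

end Poly

/-! ### Special parameters -/

section Special

variable {i j : Fin m} (hij : i ≠ j) (z : Lattice m)

include hij

lemma cyclic_cell : D.det cyclic i j z ≠ 0 ∧ ∀ a, D.vec cyclic i j z a = 0 := by
  have ne : ∀ a : Fin 3, a ≠ a + 1 ∧ a ≠ a + 2 ∧ a + 1 ≠ a + 2 := by decide
  have succ : ∀ a : Fin 3, a - 1 + 1 = a := by decide
  have c1 : ∀ a, par cyclic a (a + 1) = 0 := fun a => by rw [par_eq (ne a).1, cyclic, if_pos rfl]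
  have c2 : ∀ a, par cyclic a (a + 2) = 1 := fun a => by
    rw [par_eq (ne a).2.1, cyclic, if_neg (ne a).2.2.symm]
  have n1 : ∀ a, D.num cyclic i j z a (a + 1) ≠ 0 := fun a => by
    rw [D.num_eq (ne a).1, c1, Superposition.num, mul_zero, add_zero]
    exact Superposition.p_ne _ i j hij z
  constructor
  · refine det_ne_zero_of_mulVec fun v hv => funext fun k => ?_
    have h := congrFun hv (k - 1); obtain ⟨h1, h2, h3⟩ := ne (k - 1)
    rw [Matrix.mulVec, dotProduct, sum_of_ne h1 h2 h3, tripleMatrix_self _ _ h1 h2 h3,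
      tripleMatrix_ne _ _ h1 h2 h3, tripleMatrix_ne _ _ h2 h1 h3.symm, c1, c2] at h
    have h' := n1 (k - 1); rw [succ] at h h'; simpa [h'] using h
  · intro k; obtain ⟨h1, h2, h3⟩ := ne (k - 1)
    have h := tripleDir_rel (par cyclic) (D.num cyclic i j z) (fun a => X a i j z) h1 h2 h3
    rw [c1, c2] at h; have h' := n1 (k - 1); rw [succ] at h h'
    simp only [zero_mul, zero_smul, mul_zero, add_zero, mul_one] at h
    exact (smul_eq_zero.1 h.symm).resolve_left h'

lemma maps_cyclic (A : Maps m Hat) (B : Fin 3 → Maps m ℝ) : D.maps A B cyclic i j z = A i j z := by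
  obtain ⟨h, h0⟩ := D.cyclic_cell hij z; refine LinearMap.ext fun v => ?_
  rw [maps, LinearMap.smul_apply, inv_smul_eq_iff₀ h, triple_apply (a := 0) (b := 1) (c := 2) _ _ _ _ _
    (by decide) (by decide) (by decide)]
  have h0 : ∀ a, tripleDir _ _ _ a = 0 := h0; simp only [h0, smul_zero, add_zero]
  rfl

end Special

end TripleSuperposition

/-- The parameters of the pair `a`, `b` vanish, those of the other pairs do not. -/
structure Special (t : Par → ℝ) (a b c : Fin 3) : Prop where
  ab : par t a b = 0
  ba : par t b a = 0
  ac : par t a c ≠ 0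
  ca : par t c a ≠ 0
  bc : par t b c ≠ 0
  cb : par t c b ≠ 0

lemma Superposition.Good.li_dir {s s1 s2 : SCNet m} {z0 : Lattice m} {T S : Maps m Hat}
    {X1 X2 : Fin m → Fin m → Lattice m → Hat} {P1 Q1 P2 Q2 : Maps m ℝ}
    {D : Superposition s s1 s2 z0 T S X1 P1 Q1 X2 P2 Q2} {t1 t2 : ℝ} {i j k l : Fin m} {z : Lattice m}
    (h : D.Good i j k z t1 t2) (h' : D.Good j i l z t1 t2) (hij : i ≠ j) : LI
      ![dir s (D.symL t1 t2) (D.symR t1 t2) i j z, D.point z t1 t2, s.pt z, s2.pt z] := by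
  have g1 := (D.form1.generates D.left1 D.triple.pair₁).sym
  have p1 := g1.points fun z => rep_spec (s1.vertex z)
  have ht1 := D.triple.tangent₁ i j hij z; rw [p1.tangent i j hij] at ht1
  obtain ⟨-, m1, -⟩ := mem_span_triple_left (s.pt z) (s1.pt z) (s2.pt z)
  have l4 : LI ![_, s1.pt z, s2.pt z, D.point z t1 t2] := li_tangent (rep_spec _) (rep_spec _) (rep_spec _) (D.triple.li z) m1
    ht1 (mul_ne_zero h.weight1 h.weight2) (rfl : D.point z t1 t2 = _)
  obtain ⟨x, y, A, B, Y, hT, hS⟩ := D.related1 (t2 := t2) h.ne1 i j hij z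
  have dep := dep_meet hT hS (s.patch i j z 0 0) ((s.patch i j z).du 0 0) (s.patch i j z 0 0)
  obtain ⟨r1, n1, e1⟩ := (rep_spec (s1.vertex z)).exists_smul (g1.corner i j hij z 0 0 z .zero)
  obtain ⟨r2, n2, e2⟩ : ∃ r : ℝ, r ≠ 0 ∧ meet (D.symL t1 t2 i j z (s.patch i j z 0 0))
      (D.symR t1 t2 i j z (s.patch i j z 0 0)) = r • D.point z t1 t2 := by
    rw [symL, symR, SCNet.symL, SCNet.symR]; split_ifs
    · exact D.corner_eq hij .zero h.det
    · obtain ⟨r, hr, e⟩ := D.corner_eq hij.symm .zero h'.det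
      rw [LinearMap.neg_apply, meet_neg_comm, s.patch_swap j i hij.symm]
      exact ⟨r, hr, e⟩
  rw [e1, e2] at dep; obtain ⟨r, u, v, w, e, hne⟩ := not_li_four.1 dep
  change (r • r1 • s1.pt z + u • dir s _ _ i j z + v • dir s _ _ i j z + w • r2 • D.point z t1 t2 : V) = 0 at e
  have l3 : LI ![dir s (D.symL t1 t2) (D.symR t1 t2) i j z, s1.pt z, s1.pt (z + SCNet.e k),
    D.point z t1 t2] := h.layer1.right
  rw [li_four] at l3 l4 ⊢; have hu : u ≠ 0 := by
    rintro rfl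
    obtain ⟨h1, h2, -, h4⟩ := l3 v (r * r1) 0 (w * r2) (by linear_combination (norm := module) e)
    rcases hne with hn | hn | hn | hn
    exacts [hn ((mul_eq_zero.1 h2).resolve_right n1), hn rfl, hn h1, hn ((mul_eq_zero.1 h4).resolve_right n2)]
  have hv : v ≠ 0 := by
    rintro rfl; exact hu (l4 u (r * r1) 0 (w * r2) (by linear_combination (norm := module) e)).1
  have hx := mul_ne_zero h.weight1 h.weight2; have hy := mul_ne_zero h.ne1 h.weight2
  have hp : D.point z t1 t2 = _ • s.pt z + _ • s1.pt z + _ • s2.pt z := rfl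
  set x' := (D.α1 z + D.β1 z * t1) * (D.α2 z + D.β2 z * t2); set y' := t1 * (D.α2 z + D.β2 z * t2)
  set z' := t2 * (D.α1 z + D.β1 z * t1); intro α β γ δ h0
  obtain ⟨h1, h2, h3, h4⟩ := l4 (x' * α * u) (x' * α * (r * r1) + v * γ * y') (v * γ * z' - x' * v * δ)
    (x' * α * (w * r2) - x' * v * β - v * γ) (by
      linear_combination (norm := module) (x' * α) • e - (x' * v) • h0 - (v * γ) • hp)
  have a0 : α = 0 := by simpa [hx, hu] using h1
  subst a0; have c0 : γ = 0 := by simpa [hv, hy] using h2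
  subst c0; simpa [hx, hv] using And.intro h4 h3

namespace TripleSuperposition

variable (D : TripleSuperposition s σ z0 T S X P Q) {a b c : Fin 3} (hab : a ≠ b) (hac : a ≠ c) (hbc : b ≠ c)

section Special

variable {t : Par → ℝ} (ht : Special t a b c)

include hab hac hbc ht

lemma special_cell {i j : Fin m} (hij : i ≠ j) (z : Lattice m) : D.det t i j z ≠ 0 ∧
    D.vec t i j z a = 0 ∧ D.vec t i j z b = 0 ∧ D.vec t i j z c = D.det t i j z • X c i j z := by
  obtain ⟨h1, h2, h3, h4, h5, h6⟩ := ht; have n1 : D.num t i j z a b ≠ 0 := by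
    rw [D.num_eq hab, h1, Superposition.num, mul_zero, add_zero]
    exact Superposition.p_ne _ i j hij z
  have n2 : D.num t i j z b a ≠ 0 := by
    rw [D.num_eq hab.symm, h2, Superposition.num, mul_zero, add_zero]
    exact Superposition.p_ne _ i j hij z
  have r1 := tripleDir_rel (par t) (D.num t i j z) (fun a => X a i j z) hab hac hbc |>.symm
  have r2 := tripleDir_rel (par t) (D.num t i j z) (fun a => X a i j z) hab.symm hbc hac |>.symm
  have r3 := tripleDir_rel (par t) (D.num t i j z) (fun a => X a i j z) hac.symm hbc.symm hab
  rw [h1] at r1; rw [h2] at r2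
  simp only [zero_mul, mul_zero, zero_smul, add_zero, smul_eq_zero, mul_eq_zero, n1, h3, false_or,
    n2, h5] at r1 r2
  rw [r1, r2, smul_zero, smul_zero, zero_add, zero_add] at r3
  replace r3 : D.vec t i j z c = D.det t i j z • X c i j z :=
    smul_right_injective Hat (mul_ne_zero h4 h6) (r3.trans (by rw [mul_comm, mul_smul]; rfl))
  refine ⟨det_ne_zero_of_mulVec fun v hv => ?_, r2, r1, r3⟩
  have e1 := congrFun hv a; have e2 := congrFun hv b; have e3 := congrFun hv c
  rw [Matrix.mulVec, dotProduct, sum_of_ne hab hac hbc] at e1 e2 e3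
  rw [tripleMatrix_self _ _ hab hac hbc, tripleMatrix_ne _ _ hab hac hbc, h1,
    tripleMatrix_ne _ _ hac hab hbc.symm, h1] at e1
  rw [tripleMatrix_self _ _ hab.symm hbc hac, tripleMatrix_ne _ _ hab.symm hbc hac, h2,
    tripleMatrix_ne _ _ hbc hab.symm hac.symm, h2] at e2
  have v1 : v b = 0 := by simpa [n1, h3] using e1
  have v2 : v a = 0 := by simpa [n2, h5] using e2
  rw [v1, v2, tripleMatrix_self _ _ hac.symm hbc.symm hab] at e3
  have v3 : v c = 0 := by simpa [h4, h6] using e3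
  have hk : ∀ a b c : Fin 3, a ≠ b → a ≠ c → b ≠ c → ∀ k, k = a ∨ k = b ∨ k = c := by decide
  funext k
  rcases hk a b c hab hac hbc k with rfl | rfl | rfl <;> assumption

lemma special_maps (A : Maps m Hat) (B : Fin 3 → Maps m ℝ) {i j : Fin m} (hij : i ≠ j) (z : Lattice m) :
    D.maps A B t i j z =
      ((D.det cyclic i j z)⁻¹ * D.det t i j z) • shiftMaps A (B c) (X c) i j z := by
  obtain ⟨-, h1, h2, h3⟩ := D.special_cell hab hac hbc ht hij z
  rw [vec] at h1 h2 h3; refine LinearMap.ext fun v => ?_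
  rw [maps, LinearMap.smul_apply, triple_apply _ _ _ _ _ hab hac hbc, h1, h2, h3, LinearMap.smul_apply,
    shiftMaps, shift_apply, det, det]
  module

lemma special_generates : Generates s (σ c) (D.maps T P t) (D.maps S Q t) :=
  ((D.pair a c hac).form2.generates (D.pair a c hac).left2 (D.pair a c hac).triple.pair₂).smul
    fun _ _ hij z => ⟨_, mul_ne_zero (inv_ne_zero (D.cyclic_cell hij z).1)
      (D.special_cell hab hac hbc ht hij z).1, D.special_maps hab hac hbc ht T P hij z,
        D.special_maps hab hac hbc ht S Q hij z⟩

lemma special_point (z : Lattice m) : Represents ((σ c).vertex z) (D.point t z) :=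
  (D.special_generates hab hac hbc ht).corner _ _ D.ne z 0 0 z .zero

lemma special_pairPoint (z : Lattice m) : Represents (s.vertex z) (D.pairPoint hab t z) := by
  rw [pairPoint, ht.ab, ht.ba]; exact (D.pair a b hab).point_zero z

lemma special_layerPos {i j : Fin m} (hij : i ≠ j) (k : Fin m) (z : Lattice m) :
    LayerPos (D.pairPoint hab t) (D.pairDir hab t) (D.point t) (dir s (D.symL t) (D.symR t)) i j k z := by
  have h := (D.pair a b hab).generates_zero.points fun z => (D.pair a b hab).point_zero z
  have e : D.pairPoint hab t = fun z => (D.pair a b hab).point z 0 0 := by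
    funext z; rw [pairPoint, ht.ab, ht.ba]
  rw [pairDir, e, ht.ab, ht.ba]
  exact layerPos_of (D.pair a c hac).left2 (D.pair a c hac).triple.pair₂ h
    ((D.special_generates hab hac hbc ht).sym.points (D.special_point hab hac hbc ht)) hij k z

end Special

lemma gen_pair (i j k : Fin m) (hij : i ≠ j) (z : Lattice m) :
    Gen fun t : Par → ℝ => (D.pair a b hab).Good i j k z (par t a b) (par t b a) := by
  refine ((D.pair a b hab).gen_good (ι := Par) ⟨(a, b), hab⟩ ⟨(b, a), hab.symm⟩ i j k hij z).mono
    fun t ht => ?_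
  rwa [par_eq hab, par_eq hab.symm]

include hab in
lemma exists_special (i j k : Fin m) (hij : i ≠ j) (z : Lattice m) : ∃ t, Special t a b c ∧
    (D.pair a c hac).Good i j k z (par t a c) (par t c a) ∧
    (D.pair a c hac).Good j i k z (par t a c) (par t c a) ∧
    (D.pair b c hbc).Good i j k z (par t b c) (par t c b) := by
  obtain ⟨t, g, -, hg, h⟩ := ((D.gen_pair hac i j k hij z).and (D.gen_pair hac j i k hij.symm z)).and
    (D.gen_pair hbc i j k hij z)
  obtain ⟨⟨h1, h3⟩, h2⟩ := h t hg
  have key : ∃ t' : Par → ℝ, par t' a b = 0 ∧ par t' b a = 0 ∧ par t' a c = par t a c ∧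
      par t' c a = par t c a ∧ par t' b c = par t b c ∧ par t' c b = par t c b := by
    refine ⟨fun p => if p.1 = (a, b) ∨ p.1 = (b, a) then 0 else t p, ?_⟩
    simp [par_eq, hab, hac, hbc, hab.symm, hac.symm, hbc.symm]
  obtain ⟨t', e1, e2, e3, e4, e5, e6⟩ := key; refine ⟨t', ⟨e1, e2, ?_, ?_, ?_, ?_⟩, ?_, ?_, ?_⟩
  · rw [e3]; exact h1.ne1
  · rw [e4]; exact h1.ne2
  · rw [e5]; exact h2.ne1
  · rw [e6]; exact h2.ne2
  · rw [e3, e4]; exact h1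
  · rw [e3, e4]; exact h3
  · rw [e5, e6]; exact h2

end TripleSuperposition

lemma Transversal.meet_ne_zero {A B : ℝ → Hat} (h : Transversal A B) {ε δ : ℝ}
    (hε : ε ∈ B01) (hδ : δ ∈ B01) : meet (A ε) (B δ) ≠ 0 := fun h0 => by
  have e : (A ε).2 • B δ - (B δ).2 • A ε = 0 := by rw [← inl_meet, h0]; rfl
  have l := li_five.1 (h.li δ hδ)
  rcases hε with rfl | rfl
  · have := l (-(B δ).2) 0 0 (A 0).2 0 (by linear_combination (norm := module) e)
    exact h.ne δ hδ (neg_eq_zero.1 this.1)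
  · have := l 0 0 (-(B δ).2) (A 1).2 0 (by linear_combination (norm := module) e)
    exact h.ne δ hδ (neg_eq_zero.1 this.2.2.1)

namespace TripleSuperposition

variable (D : TripleSuperposition s σ z0 T S X P Q) {a b c : Fin 3} (hab : a ≠ b) (hac : a ≠ c) (hbc : b ≠ c)

/-- The parameters for which a superposition is in general position. -/
structure Good (i j k : Fin m) (z : Lattice m) (t : Par → ℝ) : Prop where
  pair : (D.pair a b hab).Good i j k z (par t a b) (par t b a)
  det : D.det t i j z ≠ 0
  meetData : MeetData (fun u => D.maps T P t i j z (s.patch i j z u 0))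
    fun v => D.maps S Q t i j z (s.patch i j z 0 v)
  abc : LI ![D.point t z, D.point t (z + e i), D.point t (z + e i + e j)]
  abd : LI ![D.point t z, D.point t (z + e i), D.point t (z + e j)]
  bcd : LI ![D.point t (z + e i), D.point t (z + e i + e j), D.point t (z + e j)]
  layer : LayerPos (D.pairPoint hab t) (D.pairDir hab t) (D.point t) (dir s (D.symL t) (D.symR t)) i j k z
  first : LI ![(σ a).pt z, D.pairPoint hab t z, D.point t z]
  trans : LI
    ![D.pairDir hac t i j z, D.pairPoint hac t z, D.pairPoint hab t z, D.point t z]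
  plane : LI ![(σ a).pt z, (σ b).pt z, D.pairPoint hab t z, D.pairPoint hbc t z]
  notMem : LI ![D.pairPoint hab t z, (σ c).pt z, D.pairPoint hac t z, D.pairPoint hbc t z]

lemma gen_good (i j k : Fin m) (hij : i ≠ j) (z : Lattice m) :
    Gen fun t => D.Good hab hac hbc i j k z t := by
  obtain ⟨t, ht, g1, g1', g2⟩ := D.exists_special hab hac hbc i j k hij z
  have hp := D.special_point hab hac hbc ht
  obtain ⟨r, hr, e1⟩ := (rep_spec _).exists_smul (D.special_pairPoint hab hac hbc ht z)
  obtain ⟨r', hr', e2⟩ := (rep_spec _).exists_smul (hp z); change _ = r • s.pt z at e1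
  change _ = r' • (σ c).pt z at e2
  have hL := li_four.1 (D.li a b c hab hac hbc z)
  have q := (planarQuad_iff (hp _) (hp _) (hp _) (hp _)).1 ((σ c).planar i j hij z)
  have l1 : LI ![(σ a).pt z, D.pairPoint hab t z, D.point t z] := by
    rw [e1, e2, li_three]; intro x y w h0
    have := hL (y * r) x 0 (w * r') (by linear_combination (norm := module) h0)
    simpa [hr, hr', and_comm, and_left_comm] using this
  have l2 : LI
      ![D.pairDir hac t i j z, D.pairPoint hac t z, D.pairPoint hab t z, D.point t z] := by
    have h := li_four.1 (show LI ![D.pairDir hac t i j z, D.pairPoint hac t z, s.pt z,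
      (σ c).pt z] from g1.li_dir g1' hij)
    rw [e1, e2, li_four]; intro x y w v h0
    have := h x y (w * r) (v * r') (by linear_combination (norm := module) h0)
    simpa [hr, hr'] using this
  obtain ⟨u1, v₁, w1, n1, f1⟩ : ∃ u v w : ℝ, v ≠ 0 ∧
      D.pairPoint hac t z = u • s.pt z + v • (σ a).pt z + w • (σ c).pt z :=
    ⟨_, _, _, mul_ne_zero g1.ne1 g1.weight2, rfl⟩
  obtain ⟨u2, v₂, w2, n2, n3, f2⟩ : ∃ u v w : ℝ, v ≠ 0 ∧ w ≠ 0 ∧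
      D.pairPoint hbc t z = u • s.pt z + v • (σ b).pt z + w • (σ c).pt z :=
    ⟨_, _, _, mul_ne_zero g2.ne1 g2.weight2, mul_ne_zero g2.ne2 g2.weight1, rfl⟩
  have l3 : LI ![(σ a).pt z, (σ b).pt z, D.pairPoint hab t z, D.pairPoint hbc t z] := by
    rw [e1, f2, li_four]; intro x y w v h0
    obtain ⟨h1, h2, h3, h4⟩ := hL (w * r + v * u2) x (y + v * v₂) (v * w2) (by
      linear_combination (norm := module) h0)
    have hv := (mul_eq_zero.1 h4).resolve_right n3; subst hv
    exact ⟨h2, by simpa using h3, by simpa [hr] using h1, rfl⟩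
  have l4 : LI
      ![D.pairPoint hab t z, (σ c).pt z, D.pairPoint hac t z, D.pairPoint hbc t z] := by
    rw [e1, f1, f2, li_four]; intro x y w v h0
    obtain ⟨h1, h2, h3, h4⟩ := hL (x * r + w * u1 + v * u2) (w * v₁) (v * v₂)
      (y + w * w1 + v * w2) (by linear_combination (norm := module) h0)
    have hw := (mul_eq_zero.1 h2).resolve_right n1; have hv := (mul_eq_zero.1 h3).resolve_right n2
    subst hw hv; exact ⟨by simpa [hr] using h1, by simpa using h4, rfl, rfl⟩
  have c1 := near_meetData (t0 := cyclic) (s.isSCPatch i j hij z) (D.isPolyV_maps T P i j z)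
    (D.isPolyV_maps S Q i j z) (by
      rw [D.maps_cyclic hij, D.maps_cyclic hij]; exact ((D.pair a b hab).base i j hij z).meetData)
  have hV := D.isPolyV_point; have v1 := D.isPolyV_pairPoint hab
  have v2 := D.isPolyV_pairPoint hac; have v3 := D.isPolyV_pairPoint hbc
  refine ((D.gen_pair hab i j k hij z).and (((((IsPoly.near (isPoly_matrix_det (D.isPoly_matrix i j z))
    (D.special_cell hab hac hbc ht hij z).1).and (near_li_three (hV _) (hV _) (hV _) q.abc)).and
    ((near_li_three (hV _) (hV _) (hV _) q.abd).and (near_li_three (hV _) (hV _) (hV _) q.bcd))).and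
    ((near_layerPos v1 (D.isPolyV_pairDir hab) hV D.isPolyV_dir
      (D.special_layerPos hab hac hbc ht hij k z)).and
    (near_li_three (IsPolyV.const _) (v1 _) (hV _) l1))).and
    ((near_li_four (D.isPolyV_pairDir hac _ _ _) (v2 _) (v1 _) (hV _) l2).and
    ((near_li_four (IsPolyV.const _) (IsPolyV.const _) (v1 _) (v3 _) l3).and
    (near_li_four (v1 _) (IsPolyV.const _) (v2 _) (v3 _) l4)))).gen).and c1.gen |>.mono ?_
  rintro t ⟨⟨h1, ⟨⟨⟨h2, h3⟩, h4, h5⟩, h6, h7⟩, h8, h9, h10⟩, h11⟩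
  exact ⟨h1, h2, h11, h3, h4, h5, h6, h7, h8, h9, h10⟩

section Cell

variable {t : Par → ℝ} {i j : Fin m} (hij : i ≠ j) {z : Lattice m}

include hab hac hbc hij

lemma corner_mem (g1 : ∀ {a b : Fin 3} (h : a ≠ b), (D.pair a b h).Good i j i z (par t a b) (par t b a))
    (hdet : D.det t i j z ≠ 0) {ε δ : ℝ} {z' : Lattice m} (hz : IsCorner i j z ε δ z')
    (hli : LI ![(σ a).pt z', D.pairPoint hab t z', D.pairPoint hac t z']) :
    meet (D.maps T P t i j z (s.patch i j z ε 0)) (D.maps S Q t i j z (s.patch i j z 0 δ)) ∈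
      span ℝ (range ![(σ a).pt z', D.pairPoint hab t z', D.pairPoint hac t z']) := by
  set U := s.patch i j z ε 0; set W := s.patch i j z 0 δ
  set K := span ℝ (range ![shift (T i j z) (P a i j z) (X a i j z) U,
    shift (S i j z) (Q a i j z) (X a i j z) W, D.vec t i j z b, D.vec t i j z c])
  have m0 : shift (T i j z) (P a i j z) (X a i j z) U ∈ K := subset_span ⟨0, rfl⟩
  have m1 : shift (S i j z) (Q a i j z) (X a i j z) W ∈ K := subset_span ⟨1, rfl⟩
  have m2 : D.vec t i j z b ∈ K := subset_span ⟨2, rfl⟩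
  have m3 : D.vec t i j z c ∈ K := subset_span ⟨3, rfl⟩; have n1 := (g1 hab).ne1
  have n2 := (g1 hac).ne1; have key : ∀ (A : Maps m Hat) (B : Fin 3 → Maps m ℝ) (w : V),
      shift (A i j z) (B a i j z) (X a i j z) w ∈ K → D.maps A B t i j z w ∈ K ∧
      (D.pair a b hab).maps A (B a) (B b) (par t a b) (par t b a) i j z w ∈ K ∧
      (D.pair a c hac).maps A (B a) (B c) (par t a c) (par t c a) i j z w ∈ K := fun A B w hw => by
    refine ⟨K.smul_mem _ (triple_mem hab hac hbc n1 n2 hw m2 m3), K.smul_mem _ ?_, K.smul_mem _ ?_⟩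
    · rw [← D.num_eq hab, ← D.num_eq' hab]
      exact double_mem (P := fun a => B a i j z) (X := fun a => X a i j z) hab hac hbc n1 n2
        (g1 hab).ne2 (g1 hbc).ne1 hdet hw m2 m3
    · rw [← D.num_eq hac, ← D.num_eq' hac]
      exact double_mem (P := fun a => B a i j z) (X := fun a => X a i j z) hac hab hbc.symm n2 n1
        (g1 hac).ne2 (g1 hbc).ne2 hdet hw m3 m2
  obtain ⟨k1, k2, k3⟩ := key T P U m0; obtain ⟨l1, l2, l3⟩ := key S Q W m1
  have dep := not_li_meet_four (finrank_span_four_le _ _ _ _) k1 m0 k2 k3 l1 m1 l2 l3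
  obtain ⟨r1, h1, e1⟩ := (rep_spec _).exists_smul (((D.pair a b hab).form1.generates
    (D.pair a b hab).left1 (D.pair a b hab).triple.pair₁).corner i j hij z ε δ z' hz)
  obtain ⟨r2, h2, e2⟩ := (D.pair a b hab).corner_eq hij hz (g1 hab).det
  obtain ⟨r3, h3, e3⟩ := (D.pair a c hac).corner_eq hij hz (g1 hac).det
  change meet (shift _ _ _ U) (shift _ _ _ W) = _ at e1
  rw [e1, e2, e3] at dep
  exact mem_span_of_not_li hli (dep_four_smul one_ne_zero h1 h2 h3 (by rw [one_smul]; exact dep))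

end Cell

end TripleSuperposition

lemma inf_eq_span_singleton {E F G : Submodule ℝ V} {x y : V} (hE : finrank ℝ E = 3)
    (hF : finrank ℝ F = 3) (hne : E ≠ F) (hli : LI ![x, y]) (hx : x ∈ E)
    (hx' : x ∈ F) (hy : y ∈ E) (hy' : y ∈ F) (hG : x ∉ G) (hyG : y ∈ G) :
    E ⊓ F ⊓ G = span ℝ {y} := by
  refine le_antisymm (fun v ⟨⟨h1, h2⟩, h3⟩ => ?_) ((Submodule.span_singleton_le_iff_mem _ _).2
    ⟨⟨hy, hy'⟩, hyG⟩)
  obtain ⟨p, q, rfl⟩ := exists_comb_of_mem_planes hE hF hne hli hx hx' hy hy' h1 h2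
  have hp : p = 0 := by
    by_contra hp; refine hG ((G.smul_mem_iff hp).1 ?_); simpa using G.sub_mem h3 (G.smul_mem q hyG)
  exact mem_span_singleton.2 ⟨q, by rw [hp]; module⟩

lemma Superposition.generates {s s1 s2 τ : SCNet m} {z0 : Lattice m} {T S : Maps m Hat}
    {X1 X2 : Fin m → Fin m → Lattice m → Hat} {P1 Q1 P2 Q2 : Maps m ℝ} [Nontrivial (Fin m)]
    (D : Superposition s s1 s2 z0 T S X1 P1 Q1 X2 P2 Q2) {t1 t2 : ℝ}
    (h : ∀ i j k, i ≠ j → ∀ z, D.Good i j k z t1 t2) (hτ : IsCommonFTransform s s1 s2 τ)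
    (h0 : Represents (τ.vertex z0) (D.point z0 t1 t2)) :
    (∀ z, Represents (τ.vertex z) (D.point z t1 t2)) ∧ Generates s τ (D.symL t1 t2) (D.symR t1 t2) := by
  obtain ⟨τ', h1, h2, h3, h4, -⟩ := D.exists_net h
  have hs := D.triple.same D.left1 D.left2 h3 h4 hτ ((h1 z0).eq h0)
  have hv : ∀ z, Represents (τ.vertex z) (D.point z t1 t2) := fun z => hs.vertex z ▸ h1 z
  refine ⟨hv, fun i j hij z ε δ z' hz => (D.isNetData h).corner_represents hv hij hz,
    fun i j hij z u hu v hv => ?_⟩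
  have := hs.patch i j hij z u hu v hv; rw [h2] at this; exact dep_two_comm this

namespace TripleSuperposition

variable (D : TripleSuperposition s σ z0 T S X P Q)

/-- All superpositions with the parameters `t` are in general position. -/
def InGeneralPosition (t : Par → ℝ) : Prop := ∀ {a b c : Fin 3} (hab : a ≠ b) (hac : a ≠ c) (hbc : b ≠ c)
  {i j : Fin m} (_ : i ≠ j) (k : Fin m) (z : Lattice m), D.Good hab hac hbc i j k z t

namespace InGeneralPosition

variable {D} {t : Par → ℝ} (h : D.InGeneralPosition t) {a b c : Fin 3} (hab : a ≠ b) (hac : a ≠ c)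
  (hbc : b ≠ c)

include h

lemma pair {a b : Fin 3} (hab : a ≠ b) {i j : Fin m} (hij : i ≠ j) (k : Fin m) (z : Lattice m) :
    (D.pair a b hab).Good i j k z (par t a b) (par t b a) := by
  obtain ⟨c, hc, hc'⟩ : ∃ c, a ≠ c ∧ b ≠ c := by revert a b; decide
  exact (h hab hc hc' hij k z).pair

include hab hac hbc

lemma quad (z : Lattice m) :
    Quad ((σ a).pt z) (D.pairPoint hab t z) (D.point t z) (D.pairPoint hac t z) := by
  have g := h hab hac hbc D.ne D.i0 z; have g' := h hac hab hbc.symm D.ne D.i0 z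
  have l := h hac.symm hbc.symm hab D.ne D.i0 z; have l2 := li_four.1 g.trans
  have l1 : LI ![(σ a).pt z, D.pairPoint hab t z, D.pairPoint hac t z] := by
    have l3 := li_four.1 l.plane; rw [D.pairPoint_swap hac] at l3
    exact li_three.2 fun x y w e => by
      have := l3 0 x w y (by linear_combination (norm := module) e)
      tauto
  have hm := D.corner_mem hab hac hbc D.ne (fun h' => h.pair h' D.ne _ _) g.det .zero l1
  refine ⟨fun hli => ?_, g.first, l1, li_three_swap g'.first, li_three.2 fun x y w e => ?_⟩
  · obtain ⟨x, y, w, e⟩ := mem_span_triple.1 hm; have := li_four.1 hli x y (-1) w (by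
      rw [show D.point t z = _ from e]; module)
    norm_num at this
  · have := l2 0 w x y (by linear_combination (norm := module) e)
    tauto

lemma corner_mem {i j : Fin m} (hij : i ≠ j) {z z' : Lattice m} {ε δ : ℝ} (hz : IsCorner i j z ε δ z') :
    meet (D.maps T P t i j z (s.patch i j z ε 0)) (D.maps S Q t i j z (s.patch i j z 0 δ)) ∈
      span ℝ (range ![(σ a).pt z', D.pairPoint hab t z', D.pairPoint hac t z']) :=
  D.corner_mem hab hac hbc hij (fun h' => h.pair h' hij _ _) (h hab hac hbc hij i z).det hz
    (h.quad hab hac hbc z').abd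

lemma planes_inf (z : Lattice m) :
    span ℝ (range ![(σ a).pt z, D.pairPoint hab t z, D.pairPoint hac t z]) ⊓
      span ℝ (range ![(σ b).pt z, D.pairPoint hab.symm t z, D.pairPoint hbc t z]) ⊓
      span ℝ (range ![(σ c).pt z, D.pairPoint hac.symm t z, D.pairPoint hbc.symm t z]) =
    span ℝ {D.point t z} := by
  have g := h hab hac hbc D.ne D.i0 z; have q1 := h.quad hab hac hbc z
  have q2 := h.quad hab.symm hbc hac z; have q3 := h.quad hac.symm hbc.symm hab z
  obtain ⟨m1, m2, -⟩ := mem_span_triple_left ((σ a).pt z) (D.pairPoint hab t z) (D.pairPoint hac t z)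
  obtain ⟨-, m3, -⟩ := mem_span_triple_left ((σ b).pt z) (D.pairPoint hab.symm t z) (D.pairPoint hbc t z)
  have mem : ∀ {a b c d : V}, Quad a b c d → c ∈ span ℝ (range ![a, b, d]) := fun {a b c d} q => by
    obtain ⟨x, y, w, -, -, -, e⟩ := q.exists_comb; exact mem_span_triple.2 ⟨x, y, w, e⟩
  refine inf_eq_span_singleton (finrank_span_three q1.abd) (finrank_span_three q2.abd) (fun he => ?_)
    (li_two.2 fun x y e => ?_) m2 (by rw [← D.pairPoint_swap hab]; exact m3) (mem q1) (mem q2) ?_ (mem q3)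
  · rw [he, D.pairPoint_swap hab] at m1; exact notMem_span_of_li g.plane m1
  · have := li_three.1 g.first 0 x y (by linear_combination (norm := module) e)
    exact this.2
  · rw [D.pairPoint_swap hac, D.pairPoint_swap hbc]; exact notMem_span_of_li g.notMem

lemma isNetData : IsNetData s (D.symL t) (D.symR t) (D.point t) := by
  have g := fun {i j : Fin m} (hij : i ≠ j) z => h hab hac hbc hij i z
  refine isNetData_sym (fun i j hij z => (g hij z).meetData.isSCPatch) (fun i j hij z ε δ z' hz => ?_)
    (fun i j hij z => (g hij z).abc) (fun i j hij z => (g hij z).abd) fun i j hij z => (g hij z).bcd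
  have hm := Submodule.mem_inf.2 ⟨Submodule.mem_inf.2 ⟨h.corner_mem hab hac hbc hij hz,
    h.corner_mem hab.symm hbc hac hij hz⟩, h.corner_mem hac.symm hbc.symm hab hij hz⟩
  rw [h.planes_inf hab hac hbc, mem_span_singleton] at hm; obtain ⟨r, e⟩ := hm
  refine ⟨r, ?_, e.symm⟩
  rintro rfl; rw [zero_smul] at e
  exact (g hij z).meetData.transversal.meet_ne_zero hz.mem.1 hz.mem.2 e.symm

lemma related : Related ((D.pair a b hab).symL (par t a b) (par t b a))
    ((D.pair a b hab).symR (par t a b) (par t b a)) (D.symL t) (D.symR t) := by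
  refine Related.sym fun i j hij z => ?_
  have g := h.pair hab hij i z; have hd := g.det; rw [← D.num_eq hab, ← D.num_eq' hab] at hd
  obtain ⟨x, y, e⟩ := triple_eq (X := fun a => X a i j z) hab hac hbc g.ne1 (h.pair hac hij i z).ne1 g.ne2
    (h.pair hbc hij i z).ne1 hd
  have hp := neg_ne_zero.2 (mul_ne_zero ((D.pair a b hab).p_ne i j hij z) ((D.pair a b hab).p_ne' i j hij z))
  have key : ∀ (A : Maps m Hat) (B : Fin 3 → Maps m ℝ) w, D.maps A B t i j z w =
      ((D.det cyclic i j z)⁻¹ * (D.det t i j z / (par t a b * par t b a - D.num t i j z a b *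
        D.num t i j z b a)) * -((D.pair a b hab).p i j z * (D.pair a b hab).p' i j z)) •
        (D.pair a b hab).maps A (B a) (B b) (par t a b) (par t b a) i j z w +
      ((D.det cyclic i j z)⁻¹ * (B c i j z w + x * B a i j z w + y * B b i j z w)) •
        D.vec t i j z c := fun A B w => by
    rw [maps, LinearMap.smul_apply, e, Superposition.maps, LinearMap.smul_apply, smul_smul,
      mul_inv_cancel_right₀ hp, smul_add, smul_smul, smul_smul, ← D.num_eq hab, ← D.num_eq' hab]
    rfl
  exact ⟨_, _, _, _, _, key T P, key S Q⟩

end InGeneralPosition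

end TripleSuperposition

lemma IsTripleFTransform.same_of_vertex {s1 s2 s3 s12 s13 s23 τ τ' : SCNet m}
    (h : IsTripleFTransform s1 s2 s3 s12 s13 s23 τ) (h' : IsTripleFTransform s1 s2 s3 s12 s13 s23 τ')
    (hp : GeneralPair s12 τ)
    (hT : ∀ i j, i ≠ j → ∀ z, Trans (s12.tangent i j z) (s13.tangent i j z) (τ.vertex z))
    (hv : ∀ z, (τ.vertex z).submodule = vertexPlane s1 s12 s13 z ⊓
      vertexPlane s2 s12 s23 z ⊓ vertexPlane s3 s13 s23 z) : Same τ τ' := by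
  refine SCNet.same_of_vertex h.ftransform₁₂ h.ftransform₁₃ h'.ftransform₁₂ h'.ftransform₁₃ hp hT fun z => ?_
  have mem : ∀ {p q r x : RP3}, PlanarQuad p q x r → x.rep ∈ join3 p q r := fun {p q r x} hq => by
    obtain ⟨a, b, c, -, -, -, e⟩ := (quad_pt hq).exists_comb
    rw [join3_eq (rep_spec p) (rep_spec q) (rep_spec r)]; exact mem_span_triple.2 ⟨a, b, c, e⟩
  have hm : (τ'.vertex z).rep ∈ (τ.vertex z).submodule := by
    rw [hv]; exact ⟨⟨mem (h'.coplanar₁ z), mem (h'.coplanar₂ z)⟩, mem (h'.coplanar₃ z)⟩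
  rw [show (τ.vertex z).submodule = _ from rep_spec _, mem_span_singleton] at hm
  obtain ⟨r, hr⟩ := hm; have hr0 : r ≠ 0 := by
    rintro rfl; exact (rep_spec (τ'.vertex z)).ne_zero (by rw [← hr, zero_smul])
  exact ((rep_spec (τ.vertex z)).smul hr0).eq (hr ▸ rep_spec (τ'.vertex z))

lemma TripleSuperposition.InGeneralPosition.exists_net [Nontrivial (Fin m)] {s : SCNet m}
    {σ : Fin 3 → SCNet m} {z0 : Lattice m} {T S : Maps m Hat}
    {X : Fin 3 → Fin m → Fin m → Lattice m → Hat} {P Q : Fin 3 → Maps m ℝ}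
    {D : TripleSuperposition s σ z0 T S X P Q} {t : Par → ℝ} (h : D.InGeneralPosition t)
    {s12 s13 s23 : SCNet m} (h12 : IsCommonFTransform s (σ 0) (σ 1) s12)
    (h13 : IsCommonFTransform s (σ 0) (σ 2) s13) (h23 : IsCommonFTransform s (σ 1) (σ 2) s23)
    (v12 : Represents (s12.vertex z0) (D.pairPoint (a := 0) (b := 1) (by decide) t z0))
    (v13 : Represents (s13.vertex z0) (D.pairPoint (a := 0) (b := 2) (by decide) t z0))
    (v23 : Represents (s23.vertex z0) (D.pairPoint (a := 1) (b := 2) (by decide) t z0)) :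
    ∃ τ, IsTripleFTransform (σ 0) (σ 1) (σ 2) s12 s13 s23 τ ∧
      (∀ z, (τ.vertex z).submodule = vertexPlane (σ 0) s12 s13 z ⊓
        vertexPlane (σ 1) s12 s23 z ⊓ vertexPlane (σ 2) s13 s23 z) ∧
      ∀ τ', IsTripleFTransform (σ 0) (σ 1) (σ 2) s12 s13 s23 τ' → Same τ τ' := by
  have n1 : (0 : Fin 3) ≠ 1 := by decide
  have n2 : (0 : Fin 3) ≠ 2 := by decide
  have n3 : (1 : Fin 3) ≠ 2 := by decide
  obtain ⟨w12, g12⟩ := (D.pair 0 1 n1).generates (fun i j k hij z => h.pair n1 hij k z) h12 v12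
  obtain ⟨w13, g13⟩ := (D.pair 0 2 n2).generates (fun i j k hij z => h.pair n2 hij k z) h13 v13
  obtain ⟨w23, g23⟩ := (D.pair 1 2 n3).generates (fun i j k hij z => h.pair n3 hij k z) h23 v23
  have hN := h.isNetData n1 n2 n3; have t1 : ∀ i j, i ≠ j → ∀ z, LI
      ![D.pairDir n1 t i j z, D.pairPoint n1 t z, D.pairPoint n2 t z, D.point t z] :=
    fun i j hij z => (h n2 n1 n3.symm hij i z).trans
  have t2 : ∀ i j, i ≠ j → ∀ z, LI
      ![D.pairDir n2 t i j z, D.pairPoint n1 t z, D.pairPoint n2 t z, D.point t z] := fun i j hij z => by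
    have := li_four.1 (h n1 n2 n3 hij i z).trans; refine li_four.2 fun x y w v e => ?_
    have := this x w y v (by linear_combination (norm := module) e)
    tauto
  have r12 := h.related n1 n2 n3; have r13 := h.related n2 n1 n3.symm
  obtain ⟨τ, hτ, hτ'⟩ := hN.exists_net g12 g13 r12 r13 w12 w13
    (fun i j hij k z => (h n1 n2 n3 hij k z).layer) t1 t2
  obtain ⟨f12, p12⟩ := hN.isFTransform hτ hτ' g12 r12 w12 fun i j hij k z => (h n1 n2 n3 hij k z).layer
  obtain ⟨f13, -⟩ := hN.isFTransform hτ hτ' g13 r13 w13 fun i j hij k z => (h n2 n1 n3.symm hij k z).layer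
  obtain ⟨f23, -⟩ := hN.isFTransform hτ hτ' g23 (h.related n3 n1.symm n2.symm) w23
    fun i j hij k z => (h n3 n1.symm n2.symm hij k z).layer
  have q2 := fun z => D.pairPoint_swap n1 t z ▸ h.quad n1.symm n3 n2 z
  have q3 := fun z => D.pairPoint_swap n2 t z ▸ D.pairPoint_swap n3 t z ▸ h.quad n2.symm n3.symm n1 z
  have hτ3 : IsTripleFTransform (σ 0) (σ 1) (σ 2) s12 s13 s23 τ := ⟨f12, f13, f23,
    fun z => (planarQuad_iff (rep_spec _) (w12 z) (hτ z) (w13 z)).2 (h.quad n1 n2 n3 z),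
    fun z => (planarQuad_iff (rep_spec _) (w12 z) (hτ z) (w23 z)).2 (q2 z),
    fun z => (planarQuad_iff (rep_spec _) (w13 z) (hτ z) (w23 z)).2 (q3 z)⟩
  have hv : ∀ z, (τ.vertex z).submodule = vertexPlane (σ 0) s12 s13 z ⊓
      vertexPlane (σ 1) s12 s23 z ⊓ vertexPlane (σ 2) s13 s23 z := fun z => by
    have := h.planes_inf n1 n2 n3 z
    rw [D.pairPoint_swap n1, D.pairPoint_swap n2, D.pairPoint_swap n3] at this
    rw [show (τ.vertex z).submodule = _ from hτ z, ← this]; simp only [vertexPlane]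
    rw [join3_eq (rep_spec _) (w12 z) (w13 z), join3_eq (rep_spec _) (w12 z) (w23 z),
      join3_eq (rep_spec _) (w13 z) (w23 z)]
    rfl
  refine ⟨τ, hτ3, hv, fun τ' h' => hτ3.same_of_vertex h' p12 (fun i j hij z => ?_) hv⟩
  rw [(g12.points w12).tangent i j hij, (g13.points w13).tangent i j hij]
  exact trans_of_li (hτ z) (t1 i j hij z) (t2 i j hij z)

lemma exists_tripleSuperposition [Nontrivial (Fin m)] {s : SCNet m} {σ : Fin 3 → SCNet m}
    (h : ∀ a, IsFTransform s (σ a)) (hT : ∀ a b, a ≠ b → GeneralTriple s (σ a) (σ b))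
    (hli : ∀ z, LI ![s.pt z, (σ 0).pt z, (σ 1).pt z, (σ 2).pt z]) (z0 : Lattice m) :
    ∃ T S X P Q, Nonempty (TripleSuperposition s σ z0 T S X P Q) := by
  have hp : ∀ a, GeneralPair s (σ a) := fun a =>
    (hT a (a + 1) ((by decide : ∀ a : Fin 3, a ≠ a + 1) a)).pair₁
  obtain ⟨T, S, hB⟩ := exists_netBase (h 0) (hp 0)
  choose X P Q hX using fun a => hB.exists_form (h a) (hp a)
  have E := fun a b (hab : a ≠ b) =>
    (exists_superposition (hT a b hab) (h a) (h b) hB (hX a) (hX b) z0).some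
  obtain ⟨i0, j0, hne⟩ := exists_pair_ne (Fin m)
  refine ⟨T, S, X, P, Q, ⟨⟨i0, j0, hne, fun a b hab => if a < b then E a b hab else (E b a hab.symm).swap,
    fun a b hab => ?_, fun a b c hab hac hbc z => ?_⟩⟩⟩
  · rcases lt_or_gt_of_ne hab with hlt | hlt
    · rw [if_neg hlt.asymm, if_pos hlt]
    · rw [if_pos hlt, if_neg hlt.asymm]; rfl
  · have key : ∀ a b c : Fin 3, a ≠ b → a ≠ c → b ≠ c →
        Function.Injective ![0, a.succ, b.succ, c.succ] := by decide
    convert (hli z).comp _ (key a b c hab hac hbc) using 1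
    have hs : ∀ a : Fin 3, (![s.pt z, (σ 0).pt z, (σ 1).pt z, (σ 2).pt z] : Fin 4 → V) a.succ =
      (σ a).pt z := fun a => by fin_cases a <;> rfl
    funext k
    fin_cases k
    exacts [rfl, (hs a).symm, (hs b).symm, (hs c).symm]

lemma generically_exists_triple [Nontrivial (Fin m)] {s : SCNet m} {σ : Fin 3 → SCNet m}
    (h : ∀ a, IsFTransform s (σ a)) (hT : ∀ a b, a ≠ b → GeneralTriple s (σ a) (σ b))
    (hli : ∀ z, LI ![s.pt z, (σ 0).pt z, (σ 1).pt z, (σ 2).pt z]) (z0 : Lattice m) :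
    Generically
      {w : Fin 3 × Fin 4 → ℝ | (fun a => w (0, a)) ∈ vertexPlane s (σ 0) (σ 1) z0 ∧
        (fun a => w (1, a)) ∈ vertexPlane s (σ 0) (σ 2) z0 ∧
        (fun a => w (2, a)) ∈ vertexPlane s (σ 1) (σ 2) z0}
      fun w => ∀ s12 s13 s23 : SCNet m, IsCommonFTransform s (σ 0) (σ 1) s12 →
        IsCommonFTransform s (σ 0) (σ 2) s13 → IsCommonFTransform s (σ 1) (σ 2) s23 →
        Represents (s12.vertex z0) (fun a => w (0, a)) → Represents (s13.vertex z0) (fun a => w (1, a)) →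
        Represents (s23.vertex z0) (fun a => w (2, a)) →
        ∃ τ, IsTripleFTransform (σ 0) (σ 1) (σ 2) s12 s13 s23 τ ∧
          (∀ z, (τ.vertex z).submodule = vertexPlane (σ 0) s12 s13 z ⊓
            vertexPlane (σ 1) s12 s23 z ⊓ vertexPlane (σ 2) s13 s23 z) ∧
          ∀ τ', IsTripleFTransform (σ 0) (σ 1) (σ 2) s12 s13 s23 τ' → Same τ τ' := by
  obtain ⟨T, S, X, P, Q, ⟨D⟩⟩ := exists_tripleSuperposition h hT hli z0
  let b := basisOfLinearIndependentOfCardEqFinrank (hli z0) (by simp)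
  have e0 : ∀ l, b.coord l (s.pt z0) = if 0 = l then 1 else 0 := fun l => by
    rw [show s.pt z0 = b 0 by rw [coe_basisOfLinearIndependentOfCardEqFinrank]; rfl, Module.Basis.coord_apply,
      Module.Basis.repr_self, Finsupp.single_apply]
  have e1 : ∀ l a, b.coord l ((σ a).pt z0) = if a.succ = l then 1 else 0 := fun l a => by
    rw [show (σ a).pt z0 = b a.succ by
      rw [coe_basisOfLinearIndependentOfCardEqFinrank]; fin_cases a <;> rfl, Module.Basis.coord_apply,
      Module.Basis.repr_self, Finsupp.single_apply]
  have hE : ∀ a c, vertexPlane s (σ a) (σ c) z0 =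
      span ℝ (range ![s.pt z0, (σ a).pt z0, (σ c).pt z0]) := fun a c =>
    join3_eq (rep_spec _) (rep_spec _) (rep_spec _)
  let R : Fin 3 → (Fin 3 × Fin 4 → ℝ) →ₗ[ℝ] V := fun k => LinearMap.funLeft ℝ ℝ fun a => (k, a)
  choose p hp using fun q : Fin 4 × Fin 3 => exists_eval_eq (b.coord q.1 ∘ₗ R q.2)
  have hp : ∀ l k w, MvPolynomial.eval w (p (l, k)) = b.coord l (R k w) := fun l k w => hp (l, k) w
  let row : Fin 3 → Fin 3 → Fin 3 := fun a c => a + c - 1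
  let t : (Fin 3 × Fin 4 → ℝ) → Par → ℝ := fun w q =>
    b.coord q.1.1.succ (R (row q.1.1 q.1.2) w) / b.coord 0 (R (row q.1.1 q.1.2) w)
  refine generically_of_gen (K := {κ : (Fin 3 × Fin 3 × Fin 3) × (Fin m × Fin m × Fin m) × Lattice m //
      κ.1.1 ≠ κ.1.2.1 ∧ κ.1.1 ≠ κ.1.2.2 ∧ κ.1.2.1 ≠ κ.1.2.2 ∧ κ.2.1.1 ≠ κ.2.1.2.1})
    (δ := ∏ k, p (0, k)) (t := t)
    (r := fun q => p (q.1.1.succ, row q.1.1 q.1.2) * ∏ k ∈ Finset.univ.erase (row q.1.1 q.1.2), p (0, k))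
    (Q := fun κ => D.Good κ.2.1 κ.2.2.1 κ.2.2.2.1 κ.1.2.1.1 κ.1.2.1.2.1 κ.1.2.1.2.2 κ.1.2.2)
    (fun w hw q => ?_) (fun t0 => ?_) (fun κ => D.gen_good _ _ _ _ _ _ κ.2.2.2.2 _) (fun w hw hδ hg => ?_)
  · rw [← Finset.mul_prod_erase _ _ (Finset.mem_univ (row q.1.1 q.1.2)), map_mul] at hw ⊢
    have h0 := left_ne_zero_of_mul hw; rw [map_mul, hp, hp]; rw [hp] at h0
    show _ * (_ / _) = _
    field_simp
  · let lo : Fin 3 → Fin 3 := ![0, 0, 1]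
    let hi : Fin 3 → Fin 3 := ![1, 2, 2]
    let x : Fin 3 → V := fun k => s.pt z0 + par t0 (lo k) (hi k) • (σ (lo k)).pt z0 +
      par t0 (hi k) (lo k) • (σ (hi k)).pt z0
    have hx : ∀ k, x k ∈ vertexPlane s (σ (lo k)) (σ (hi k)) z0 := fun k => by
      rw [hE]; exact mem_span_triple.2 ⟨1, _, _, by rw [one_smul]⟩
    have h0 : ∀ k, b.coord 0 (x k) = 1 := fun k => by
      simp only [x, map_add, map_smul, e0, e1, Fin.succ_ne_zero, if_true, if_false, smul_zero, add_zero]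
    refine ⟨fun q => x q.1 q.2, ⟨hx 0, hx 1, hx 2⟩, ?_, funext fun q => ?_⟩
    · rw [map_prod]; refine Finset.prod_ne_zero_iff.2 fun k _ => ?_
      rw [hp]; exact ne_of_eq_of_ne (h0 k) one_ne_zero
    · obtain ⟨⟨a, c⟩, hac⟩ := q; change a ≠ c at hac
      show b.coord a.succ (x (row a c)) / b.coord 0 (x (row a c)) = _
      rw [h0, div_one]
      have key : ∀ a c : Fin 3, a ≠ c → (![0, 0, 1] (a + c - 1) = a ∧ ![1, 2, 2] (a + c - 1) = c) ∨
        (![0, 0, 1] (a + c - 1) = c ∧ ![1, 2, 2] (a + c - 1) = a) := by decide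
      simp only [x, map_add, map_smul, e0, e1, (Fin.succ_ne_zero _).symm, if_false, Fin.succ_inj]
      rcases key a c hac with ⟨h1, h2⟩ | ⟨h1, h2⟩
      · rw [show lo (row a c) = a from h1, show hi (row a c) = c from h2, if_pos rfl, if_neg hac.symm,
          par_eq hac]
        simp
      · rw [show lo (row a c) = c from h1, show hi (row a c) = a from h2, if_pos rfl, if_neg hac.symm,
          par_eq hac]
        simp
  · intro s12 s13 s23 c1 c2 c3 v₁ v₂ v3
    have hD : D.InGeneralPosition (t w) := fun {a b c} hab hac hbc {i j} hij k z =>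
      hg ⟨((a, b, c), (i, j, k), z), hab, hac, hbc, hij⟩
    have key : ∀ {a c : Fin 3} (hac : a ≠ c), R (row a c) w ∈ vertexPlane s (σ a) (σ c) z0 →
        ∃ r : ℝ, r ≠ 0 ∧ D.pairPoint hac (t w) z0 = r • R (row a c) w := fun {a c} hac hm => by
      rw [map_prod, Finset.prod_ne_zero_iff] at hδ; have h0 := hδ (row a c) (Finset.mem_univ _)
      rw [hp] at h0; refine ⟨_, inv_ne_zero h0, (eq_inv_smul_iff₀ h0).2 ?_⟩
      rw [TripleSuperposition.pairPoint, Superposition.point_init, par_eq hac, par_eq hac.symm]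
      show _ • (_ + (b.coord a.succ (R (row a c) w) / _) • _ +
        (b.coord c.succ (R (row c a) w) / b.coord 0 (R (row c a) w)) • _) = _
      rw [show row c a = row a c from congrArg (· - 1) (add_comm c a)]
      rw [hE] at hm; obtain ⟨u, v, y, e⟩ := mem_span_triple.1 hm
      have e' : b.coord 0 (R (row a c) w) = u ∧ b.coord a.succ (R (row a c) w) = v ∧
          b.coord c.succ (R (row a c) w) = y := by
        rw [e]
        simp only [map_add, map_smul, e0, e1, Fin.succ_ne_zero, (Fin.succ_ne_zero _).symm, if_true,
          if_false, Fin.succ_inj, hac, hac.symm]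
        simp
      obtain ⟨f1, f2, f3⟩ := e'; rw [f1, f2, f3, e]; rw [f1] at h0; match_scalars <;> field_simp
    have rep : ∀ {a c : Fin 3} (hac : a ≠ c) {q : RP3}, R (row a c) w ∈ vertexPlane s (σ a) (σ c) z0 →
        Represents q (R (row a c) w) → Represents q (D.pairPoint hac (t w) z0) :=
      fun {a c} hac {q} hm hq => by
        obtain ⟨r, hr, e⟩ := key hac hm; rw [e]; exact hq.smul hr
    exact hD.exists_net c1 c2 c3 (rep _ hw.1 v₁) (rep _ hw.2.1 v₂) (rep _ hw.2.2 v3)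

namespace GeneralQuadruple

variable {s s1 s2 s3 : SCNet m}
lemma triple (h : GeneralQuadruple s s1 s2 s3) {a b : Fin 3} (hab : a ≠ b) :
    GeneralTriple s (![s1, s2, s3] a) (![s1, s2, s3] b) := by
  fin_cases a <;> fin_cases b
  exacts [absurd rfl hab, h.triple₁₂, h.triple₁₃, h.triple₁₂.swap, absurd rfl hab, h.triple₂₃,
    h.triple₁₃.swap, h.triple₂₃.swap, absurd rfl hab]

lemma li (h : GeneralQuadruple s s1 s2 s3) (z : Lattice m) : LI ![s.pt z, s1.pt z, s2.pt z, s3.pt z] := by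
  have := h.span z
  rw [vertexPlane, join3_eq (rep_spec _) (rep_spec _) (rep_spec _),
    show (s3.vertex z).submodule = _ from rep_spec _, ← Submodule.span_union] at this
  refine linearIndependent_of_top_le_span_of_card_eq_finrank (this.ge.trans (span_mono ?_)) (by simp)
  rintro x (⟨k, rfl⟩ | rfl)
  · fin_cases k
    exacts [⟨0, rfl⟩, ⟨1, rfl⟩, ⟨2, rfl⟩]
  · exact ⟨3, rfl⟩

end GeneralQuadruple

end SCNet

end

theorem mainTheorem8 (m : ℕ) (hm : 2 ≤ m) :
    -- Part (i)
    (∀ s s₁ s₂ : SCNet m, SCNet.IsFTransform s s₁ → SCNet.IsFTransform s s₂ →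
      SCNet.GeneralTriple s s₁ s₂ →
      -- the 2-parameter family: any vertex of the common F-transform can be prescribed generically
      (∀ z₀, SCNet.Generically (SCNet.vertexPlane s s₁ s₂ z₀ : Set SCNet.V) fun w =>
        ∃ s₁₂, SCNet.IsCommonFTransform s s₁ s₂ s₁₂ ∧
          SCNet.GeneralPair s₁ s₁₂ ∧ SCNet.GeneralPair s₂ s₁₂ ∧
          SCNet.Represents (s₁₂.vertex z₀) w) ∧
      -- a net of this family is determined by any one of its vertices
      (∀ s₁₂ s₁₂' : SCNet m,
        SCNet.IsCommonFTransform s s₁ s₂ s₁₂ →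
        SCNet.GeneralPair s₁ s₁₂ → SCNet.GeneralPair s₂ s₁₂ →
        SCNet.IsCommonFTransform s s₁ s₂ s₁₂' →
        ∀ z, s₁₂.vertex z = s₁₂'.vertex z → SCNet.Same s₁₂ s₁₂')) ∧
    -- Part (ii)
    (∀ s s₁ s₂ s₃ : SCNet m, SCNet.IsFTransform s s₁ → SCNet.IsFTransform s s₂ →
      SCNet.IsFTransform s s₃ → SCNet.GeneralQuadruple s s₁ s₂ s₃ →
      ∀ z₀, SCNet.Generically
        {w : Fin 3 × Fin 4 → ℝ | (fun a => w (0, a)) ∈ SCNet.vertexPlane s s₁ s₂ z₀ ∧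
          (fun a => w (1, a)) ∈ SCNet.vertexPlane s s₁ s₃ z₀ ∧
          (fun a => w (2, a)) ∈ SCNet.vertexPlane s s₂ s₃ z₀}
        fun w => ∀ s₁₂ s₁₃ s₂₃ : SCNet m,
          SCNet.IsCommonFTransform s s₁ s₂ s₁₂ →
          SCNet.IsCommonFTransform s s₁ s₃ s₁₃ →
          SCNet.IsCommonFTransform s s₂ s₃ s₂₃ →
          SCNet.Represents (s₁₂.vertex z₀) (fun a => w (0, a)) →
          SCNet.Represents (s₁₃.vertex z₀) (fun a => w (1, a)) →
          SCNet.Represents (s₂₃.vertex z₀) (fun a => w (2, a)) →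
          ∃ s₁₂₃, SCNet.IsTripleFTransform s₁ s₂ s₃ s₁₂ s₁₃ s₂₃ s₁₂₃ ∧
            -- the vertices are fixed by the coplanarity conditions
            (∀ z, (s₁₂₃.vertex z).submodule = SCNet.vertexPlane s₁ s₁₂ s₁₃ z ⊓
              SCNet.vertexPlane s₂ s₁₂ s₂₃ z ⊓ SCNet.vertexPlane s₃ s₁₃ s₂₃ z) ∧
            ∀ s₁₂₃', SCNet.IsTripleFTransform s₁ s₂ s₃ s₁₂ s₁₃ s₂₃ s₁₂₃' →
              SCNet.Same s₁₂₃ s₁₂₃') := by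
  have : Nontrivial (Fin m) := Fin.nontrivial_iff_two_le.2 hm
  refine ⟨fun s s₁ s₂ h₁ h₂ h => ⟨h.generically h₁ h₂, fun τ τ' hτ hp _ hτ' z hv =>
    h.same h₁ h₂ hτ hp hτ' hv⟩, fun s s₁ s₂ s₃ h₁ h₂ h₃ h z₀ =>
    SCNet.generically_exists_triple (σ := ![s₁, s₂, s₃]) (fun a => ?_) (fun _ _ => h.triple) h.li z₀⟩
  fin_cases a
  exacts [h₁, h₂, h₃]
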